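/- Work over $\mathbb{C}$. Let $\mathcal{B}\subset\mathbb{P}^4$ be Bring's curve $\sum_i x_i=\sum_i x_i^2=\sum_i x_i^3=0$, on which $S_5$ acts by permuting the coordinates $x_1,\dots,x_5$. Let $\mathcal{C}_2$ be the smooth projective model of $$y^2=108\,(4+12x+95x^2+170x^3+155x^4+72x^5+16x^6)$$ (the curve $y^2=F(s,t)$ in $\mathbb{P}(1,1,3)$, $F$ the homogenized sextic, $x=t/s$), and let $$\mathcal{E}_4:\ y^2=432\,(x^3+80x^2+125x+50),\qquad \mathcal{E}_1:\ y^2=x^3-5x^2-40x-80 .$$ Let $j$ be the modular $j$-function and let $\tau_0$ be a point of the upper half-plane with $\operatorname{Re}\tau_0=-\tfrac12$, $|\operatorname{Im}\tau_0-0.186676|<10^{-6}$, $j(\tau_0)=-\frac{5\cdot 29^3}{2^5}$ and $j(5\tau_0)=-\frac{25}{2}$. Then: 1. $\mathcal{C}_2$ is a smooth curve of genus $2$, and there is an isomorphism $\mathcal{B}/\langle(345)\rangle\cong\mathcal{C}_2$ under which $(12)$ induces the automorphism $\sigma:[s:t:y]\mapsto[-s-t:t:y]$ and $(34)$ induces the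 hyperelliptic involution $\iota:[s:t:y]\mapsto[s:t:-y]$. The automorphisms $\sigma,\iota$ generate a Klein four-group $V_4$. (In the coordinates $x=-2/(1+x')$, $y=y'/(1+x')^3$ they are $x'\mapsto-x'$ and $y'\mapsto-y'$.) Moreover $\mathcal{C}_2/\langle\sigma\rangle\cong\mathcal{E}_4$ and $\mathcal{C}_2/\langle\sigma\iota\rangle\cong\mathcal{E}_1$. 2. $\mathcal{B}/\langle(12),(345)\rangle\cong\mathcal{E}_4$, which is an elliptic curve with $j$-invariant $-\frac{5^2\cdot 241^3}{2^3}$. 3. $\mathcal{B}/\langle(12)(34),(345)\rangle\cong\mathcal{B}/\langle(12)(34),(13)(24)\rangle\cong\mathcal{E}_1$, which is an elliptic curve with $j$-invariant $-\frac{5\cdot 29^3}{2^5}$. 4. A point $\tau_0$ as above exists, and for every such point $j_{\mathcal{E}_1}=j(\tau_0)$ and $j_{\mathcal{E}_4}=j(15\tau_0)$. -/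

import Mathlib

open scoped LinearAlgebra.Projectivization Topology UpperHalfPlane

/-- A space with functions over `ℂ` (the classical language of varieties): a topological space with
a sheaf of `ℂ`-valued functions. The sheaf is recorded through the relation `RegAt p f`, meaning
that the function `f` is regular on some neighbourhood of the point `p`. -/
structure FunSpace where
  carrier : Type
  top : TopologicalSpace carrier
  RegAt : carrier → (carrier → ℂ) → Prop
  regAt_const : ∀ p c, RegAt p (fun _ => c)
  regAt_add : ∀ p f g, RegAt p f → RegAt p g → RegAt p (f + g)
  regAt_mul : ∀ p f g, RegAt p f → RegAt p g → RegAt p (f * g)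
  regAt_inv : ∀ p f, RegAt p f → f p ≠ 0 → RegAt p (fun q => (f q)⁻¹)
  regAt_congr : ∀ p f g, (∀ᶠ q in @nhds _ top p, f q = g q) → RegAt p f → RegAt p g
  eventually_regAt : ∀ p f, RegAt p f → ∀ᶠ q in @nhds _ top p, RegAt q f
  eventually_ne : ∀ p f, RegAt p f → f p ≠ 0 → ∀ᶠ q in @nhds _ top p, f q ≠ 0

namespace FunSpace

instance : CoeSort FunSpace Type := ⟨FunSpace.carrier⟩

instance (X : FunSpace) : TopologicalSpace X.carrier := X.top

/-- A bijection is an isomorphism if it is a homeomorphism that identifies the regular functions. -/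
def IsIso {X Y : FunSpace} (e : X.carrier ≃ Y.carrier) : Prop :=
  Continuous e ∧ Continuous e.symm ∧
    ∀ (p : X.carrier) (f : Y.carrier → ℂ), Y.RegAt (e p) f ↔ X.RegAt p (f ∘ e)

def Isomorphic (X Y : FunSpace) : Prop := ∃ e : X.carrier ≃ Y.carrier, IsIso e

/-- The orbit space `X / G` with the quotient topology; a function on an open set of `X / G` is
regular if and only if its pullback to `X` is regular. -/
def quotient (X : FunSpace) (G : Type) [Group G] [MulAction G X.carrier] : FunSpace where
  carrier := MulAction.orbitRel.Quotient G X.carrier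
  top := inferInstanceAs (TopologicalSpace (Quotient (MulAction.orbitRel G X.carrier)))
  RegAt x f := ∀ᶠ y in @nhds (Quotient (MulAction.orbitRel G X.carrier)) _ x,
    ∀ q : X.carrier, Quotient.mk (MulAction.orbitRel G X.carrier) q = y →
      X.RegAt q (fun r => f (Quotient.mk (MulAction.orbitRel G X.carrier) r))
  regAt_const _ c := Filter.Eventually.of_forall fun _ q _ => X.regAt_const q c
  regAt_add _ _ _ hf hg := by
    filter_upwards [hf, hg] with y h1 h2 q hq
    exact X.regAt_add _ _ _ (h1 q hq) (h2 q hq)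
  regAt_mul _ _ _ hf hg := by
    filter_upwards [hf, hg] with y h1 h2 q hq
    exact X.regAt_mul _ _ _ (h1 q hq) (h2 q hq)
  regAt_inv x f hf hx := by
    have hne : ∀ᶠ y in @nhds (Quotient (MulAction.orbitRel G X.carrier)) _ x, f y ≠ 0 := by
      obtain ⟨U, hU, hUo, hxU⟩ := eventually_nhds_iff.1 hf
      refine eventually_nhds_iff.2 ⟨{y | y ∈ U ∧ f y ≠ 0}, fun y hy => hy.2, ?_, hxU, hx⟩
      refine isOpen_coinduced.2 (isOpen_iff_eventually.2 fun q hq => ?_)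
      have h1 := X.eventually_ne q _ (hU _ hq.1 q rfl) hq.2
      have h2 := (isOpen_coinduced.1 hUo).eventually_mem (x := q) hq.1
      filter_upwards [h1, h2] with r hr1 hr2 using ⟨hr2, hr1⟩
    filter_upwards [hf, hne] with y h1 h2 q hq
    exact X.regAt_inv _ _ (h1 q hq) (by rw [hq]; exact h2)
  regAt_congr x f g hfg hf := by
    filter_upwards [hf, eventually_eventually_nhds.2 hfg] with y h1 h2 q hq
    subst hq
    exact X.regAt_congr _ _ _ ((continuous_quotient_mk'.tendsto q).eventually h2) (h1 q rfl)
  eventually_regAt _ _ hf := eventually_eventually_nhds.2 hf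
  eventually_ne x f hf hx := by
    obtain ⟨U, hU, hUo, hxU⟩ := eventually_nhds_iff.1 hf
    refine eventually_nhds_iff.2 ⟨{y | y ∈ U ∧ f y ≠ 0}, fun y hy => hy.2, ?_, hxU, hx⟩
    refine isOpen_coinduced.2 (isOpen_iff_eventually.2 fun q hq => ?_)
    have h1 := X.eventually_ne q _ (hU _ hq.1 q rfl) hq.2
    have h2 := (isOpen_coinduced.1 hUo).eventually_mem (x := q) hq.1
    filter_upwards [h1, h2] with r hr1 hr2 using ⟨hr2, hr1⟩

/-- The projection `X → X / G`. -/
def toQuotient (X : FunSpace) (G : Type) [Group G] [MulAction G X.carrier] (p : X.carrier) :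
    (X.quotient G).carrier :=
  Quotient.mk (MulAction.orbitRel G X.carrier) p

/-- The ring of functions that are regular near `p`. It maps onto the local ring of germs at `p`;
functions that agree near `p` have the same class in the cotangent space defined below. -/
def localRing (X : FunSpace) (p : X.carrier) : Subalgebra ℂ (X.carrier → ℂ) where
  carrier := {f | X.RegAt p f}
  mul_mem' hf hg := X.regAt_mul _ _ _ hf hg
  add_mem' hf hg := X.regAt_add _ _ _ hf hg
  algebraMap_mem' c := X.regAt_const p c

/-- The ideal `𝔪_p` of functions vanishing at `p`. -/
def maxIdeal (X : FunSpace) (p : X.carrier) : Ideal (X.localRing p) :=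
  RingHom.ker ((Pi.evalRingHom (fun _ : X.carrier => ℂ) p).comp (X.localRing p).val.toRingHom)

/-- The cotangent space `𝔪_p / 𝔪_p²`. -/
abbrev CotangentSpace (X : FunSpace) (p : X.carrier) : Type := (X.maxIdeal p).Cotangent

/-- The differential `d_p f`, the class of `f - f(p)` in `𝔪_p / 𝔪_p²`. -/
noncomputable def diff (X : FunSpace) (p : X.carrier) (f : X.carrier → ℂ) (hf : X.RegAt p f) :
    X.CotangentSpace p :=
  (X.maxIdeal p).toCotangent
    ⟨⟨f, hf⟩ - algebraMap ℂ (X.localRing p) (f p), by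
      change f p - f p = 0
      exact sub_self _⟩

/-- A family of cotangent vectors is a regular differential form if it is locally of the form
`∑ aᵢ dbᵢ` with regular functions `aᵢ`, `bᵢ`. -/
def IsRegularForm (X : FunSpace) (ω : ∀ p : X.carrier, X.CotangentSpace p) : Prop :=
  ∀ p : X.carrier, ∃ U : Set X.carrier, IsOpen U ∧ p ∈ U ∧
    ∃ (n : ℕ) (a b : Fin n → X.carrier → ℂ),
      (∀ i, ∀ q ∈ U, X.RegAt q (a i)) ∧ ∃ hb : ∀ i, ∀ q ∈ U, X.RegAt q (b i),
        ∀ q (hq : q ∈ U), ω q = ∑ i, a i q • X.diff q (b i) (hb i q hq)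

/-- The complex vector space of regular differential forms on `X`. -/
def forms (X : FunSpace) : Submodule ℂ (∀ p : X.carrier, X.CotangentSpace p) where
  carrier := {ω | X.IsRegularForm ω}
  zero_mem' p := ⟨Set.univ, isOpen_univ, trivial, 0, Fin.elim0, Fin.elim0, fun i => i.elim0,
    fun i => i.elim0, fun q _ => by simp⟩
  add_mem' {ω η} hω hη p := by
    obtain ⟨U, hU, hp, n, a, b, ha, hb, h⟩ := hω p
    obtain ⟨V, hV, hp', m, c, e, hc, he, h'⟩ := hη p
    refine ⟨U ∩ V, hU.inter hV, ⟨hp, hp'⟩, n + m, Fin.append a c, Fin.append b e, ?_, ?_, ?_⟩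
    · intro i q hq
      induction i using Fin.addCases with
      | left i => simpa using ha i q hq.1
      | right i => simpa using hc i q hq.2
    · intro i q hq
      induction i using Fin.addCases with
      | left i => simpa using hb i q hq.1
      | right i => simpa using he i q hq.2
    · intro q hq
      simp [Fin.sum_univ_add, h q hq.1, h' q hq.2]
  smul_mem' c ω hω p := by
    obtain ⟨U, hU, hp, n, a, b, ha, hb, h⟩ := hω p
    refine ⟨U, hU, hp, n, fun i q => c * a i q, b, fun i q hq =>
      X.regAt_mul _ _ _ (X.regAt_const q c) (ha i q hq), hb, fun q hq => ?_⟩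
    simp [h q hq, Finset.smul_sum, mul_smul]

/-- An irreducible nonsingular curve whose space of regular differential forms has dimension `g`
(for a projective curve this dimension is the genus). -/
def IsSmoothCurveOfGenus (X : FunSpace) (g : ℕ) : Prop :=
  IrreducibleSpace X.carrier ∧
  (∀ p : X.carrier, Module.finrank ℂ (X.CotangentSpace p) = 1) ∧
  Module.rank ℂ X.forms = g

end FunSpace

/-- The Zariski topology on `ℙⁿ⁻¹(ℂ)`, generated by the sets `{P ≠ 0}`, `P` homogeneous. -/
abbrev zariskiTopology (n : ℕ) : TopologicalSpace (ℙ ℂ (Fin n → ℂ)) :=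
  TopologicalSpace.generateFrom
    {U | ∃ (d : ℕ) (P : MvPolynomial (Fin n) ℂ), P.IsHomogeneous d ∧
      U = {p | MvPolynomial.eval p.rep P ≠ 0}}

/-- A subset of projective space with the induced Zariski topology. -/
abbrev zariskiInduced {n : ℕ} (S : Set (ℙ ℂ (Fin n → ℂ))) : TopologicalSpace S :=
  TopologicalSpace.induced Subtype.val (zariskiTopology n)

theorem zariskiInduced_eventually_ne {n : ℕ} (S : Set (ℙ ℂ (Fin n → ℂ))) (p : S) (d : ℕ)
    (P : MvPolynomial (Fin n) ℂ) (hP : P.IsHomogeneous d)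
    (hp : MvPolynomial.eval p.val.rep P ≠ 0) :
    ∀ᶠ q in @nhds _ (zariskiInduced S) p, MvPolynomial.eval q.val.rep P ≠ 0 := by
  let _ := zariskiInduced S
  refine IsOpen.eventually_mem (s := {q : S | MvPolynomial.eval q.val.rep P ≠ 0}) ?_ hp
  exact @isOpen_induced _ _ (zariskiTopology n) _ _
    (TopologicalSpace.isOpen_generateFrom_of_mem ⟨d, P, hP, rfl⟩)

/-- A subset of projective space as a space with functions: it carries the Zariski topology, and a
function is regular near `p` if near `p` it is a quotient `P / Q` of homogeneous polynomials of the
same degree with `Q(p) ≠ 0`. -/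
def projectiveSubspace {n : ℕ} (S : Set (ℙ ℂ (Fin n → ℂ))) : FunSpace where
  carrier := S
  top := zariskiInduced S
  RegAt p f := ∃ (d : ℕ) (P Q : MvPolynomial (Fin n) ℂ), P.IsHomogeneous d ∧ Q.IsHomogeneous d ∧
    MvPolynomial.eval p.val.rep Q ≠ 0 ∧
    ∀ᶠ q in @nhds _ (zariskiInduced S) p,
      f q = MvPolynomial.eval q.val.rep P / MvPolynomial.eval q.val.rep Q
  regAt_const p c := ⟨0, MvPolynomial.C c, 1, MvPolynomial.isHomogeneous_C _ _,
    MvPolynomial.isHomogeneous_one _ _, by simp, by simp⟩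
  regAt_add p f g := by
    rintro ⟨d, P, Q, hP, hQ, hQp, hf⟩ ⟨e, R, T, hR, hT, hTp, hg⟩
    refine ⟨d + e, P * T + Q * R, Q * T, (hP.mul hT).add (hQ.mul hR), hQ.mul hT, ?_, ?_⟩
    · simpa using ⟨hQp, hTp⟩
    · filter_upwards [hf, hg, zariskiInduced_eventually_ne S p d Q hQ hQp,
        zariskiInduced_eventually_ne S p e T hT hTp] with q h1 h2 h3 h4
      simp only [Pi.add_apply, h1, h2, map_add, map_mul]
      field_simp
  regAt_mul p f g := by
    rintro ⟨d, P, Q, hP, hQ, hQp, hf⟩ ⟨e, R, T, hR, hT, hTp, hg⟩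
    refine ⟨d + e, P * R, Q * T, hP.mul hR, hQ.mul hT, ?_, ?_⟩
    · simpa using ⟨hQp, hTp⟩
    · filter_upwards [hf, hg] with q h1 h2
      simp only [Pi.mul_apply, h1, h2, map_mul]
      rw [div_mul_div_comm]
  regAt_inv p f := by
    rintro ⟨d, P, Q, hP, hQ, hQp, hf⟩ hp
    refine ⟨d, Q, P, hQ, hP, ?_, ?_⟩
    · intro h
      apply hp
      rw [@Filter.Eventually.self_of_nhds _ (zariskiInduced S) _ _ hf, h, zero_div]
    · filter_upwards [hf] with q h1
      rw [h1, inv_div]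
  regAt_congr p f g hfg := by
    rintro ⟨d, P, Q, hP, hQ, hQp, hf⟩
    refine ⟨d, P, Q, hP, hQ, hQp, ?_⟩
    filter_upwards [hf, hfg] with q h1 h2
    rw [← h2, h1]
  eventually_regAt p f := by
    rintro ⟨d, P, Q, hP, hQ, hQp, hf⟩
    filter_upwards [(@eventually_eventually_nhds _ (zariskiInduced S) _ _).2 hf,
      zariskiInduced_eventually_ne S p d Q hQ hQp] with q h1 h2
    exact ⟨d, P, Q, hP, hQ, h2, h1⟩
  eventually_ne p f := by
    rintro ⟨d, P, Q, hP, hQ, hQp, hf⟩ hp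
    have hPp : MvPolynomial.eval p.val.rep P ≠ 0 := by
      intro h
      apply hp
      rw [@Filter.Eventually.self_of_nhds _ (zariskiInduced S) _ _ hf, h, zero_div]
    filter_upwards [hf, zariskiInduced_eventually_ne S p d Q hQ hQp,
      zariskiInduced_eventually_ne S p d P hP hPp] with q h1 h2 h3
    rw [h1]
    exact div_ne_zero h3 h2

/-- The common zeros in projective space of a set of homogeneous polynomials. -/
def zeroLocus {n : ℕ} (F : Set (MvPolynomial (Fin n) ℂ)) : Set (ℙ ℂ (Fin n → ℂ)) :=
  {p | ∀ P ∈ F, MvPolynomial.eval p.rep P = 0}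

/-- Bring's curve in `ℙ⁴`: `∑ xᵢ = ∑ xᵢ² = ∑ xᵢ³ = 0`. -/
noncomputable def bringCurve : FunSpace :=
  projectiveSubspace (zeroLocus
    {MvPolynomial.psum (Fin 5) ℂ 1, MvPolynomial.psum (Fin 5) ℂ 2, MvPolynomial.psum (Fin 5) ℂ 3})

/-- The permutation of homogeneous coordinates: `(σ x)ᵢ = x_{σ⁻¹ i}`. -/
noncomputable def permPoint (σ : Equiv.Perm (Fin 5)) (p : ℙ ℂ (Fin 5 → ℂ)) :
    ℙ ℂ (Fin 5 → ℂ) :=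
  p.map (LinearEquiv.funCongrLeft ℂ ℂ σ⁻¹).toLinearMap (LinearEquiv.injective _)

theorem permPoint_mem (σ : Equiv.Perm (Fin 5)) (p : ℙ ℂ (Fin 5 → ℂ))
    (hp : p ∈ zeroLocus {MvPolynomial.psum (Fin 5) ℂ 1, MvPolynomial.psum (Fin 5) ℂ 2,
      MvPolynomial.psum (Fin 5) ℂ 3}) :
    permPoint σ p ∈ zeroLocus {MvPolynomial.psum (Fin 5) ℂ 1, MvPolynomial.psum (Fin 5) ℂ 2,
      MvPolynomial.psum (Fin 5) ℂ 3} := by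
  have key : ∀ k, MvPolynomial.eval p.rep (MvPolynomial.psum (Fin 5) ℂ k) = 0 →
      MvPolynomial.eval (permPoint σ p).rep (MvPolynomial.psum (Fin 5) ℂ k) = 0 := by
    intro k hk
    have h1 : permPoint σ p = Projectivization.mk ℂ (fun i => p.rep (σ⁻¹ i))
        (fun h => p.rep_nonzero (funext fun i => by simpa using congrFun h (σ i))) := by
      conv_lhs => rw [← p.mk_rep]
      rfl
    obtain ⟨a, ha⟩ := Projectivization.exists_smul_eq_mk_rep ℂ (fun i => p.rep (σ⁻¹ i))
        (fun h => p.rep_nonzero (funext fun i => by simpa using congrFun h (σ i)))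
    rw [h1, ← ha]
    simp only [MvPolynomial.psum, map_sum, map_pow, MvPolynomial.eval_X, Pi.smul_apply,
      Units.smul_def, smul_eq_mul, mul_pow] at hk ⊢
    rw [← Finset.mul_sum, Equiv.sum_comp σ⁻¹ (fun i => p.rep i ^ k), hk, mul_zero]
  rintro P (rfl | rfl | rfl)
  · exact key 1 (hp _ (by simp))
  · exact key 2 (hp _ (by simp))
  · exact key 3 (hp _ (by simp))

/-- The symmetric group `S₅` acts on Bring's curve by permuting the homogeneous coordinates. -/
noncomputable instance : MulAction (Equiv.Perm (Fin 5)) bringCurve.carrier where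
  smul σ p := ⟨permPoint σ p.val, permPoint_mem σ p.val p.property⟩
  one_smul p := Subtype.ext (by
    change permPoint 1 p.val = p.val
    obtain ⟨p, hp⟩ := p
    induction p using Projectivization.ind with
    | h v hv => rfl)
  mul_smul σ τ p := Subtype.ext (by
    change permPoint (σ * τ) p.val = permPoint σ (permPoint τ p.val)
    obtain ⟨p, hp⟩ := p
    induction p using Projectivization.ind with
    | h v hv => rfl)

/-- The form `∑ fₖ s^(6-k) t^k` attached to a polynomial `f = ∑ fₖ x^k` of degree at most `6`. -/
noncomputable def sexticForm (f : Polynomial ℂ) (s t : ℂ) : ℂ :=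
  ∑ k ∈ Finset.range 7, f.coeff k * s ^ (6 - k) * t ^ k

theorem sextic_ne_zero (s t y : ℂ) (hst : s ≠ 0 ∨ t ≠ 0) :
    ![s ^ 3, s ^ 2 * t, s * t ^ 2, t ^ 3, y] ≠ 0 := by
  intro h
  rcases hst with hs | ht
  · exact hs (by simpa using congrFun h 0)
  · exact ht (by simpa using congrFun h 3)

/-- The projective model of the curve `y² = f(x)`, `deg f ≤ 6`: the curve `y² = ∑ fₖ s^(6-k) t^k`
in the weighted projective plane `ℙ(1, 1, 3)`, embedded in `ℙ⁴` by
`[s : t : y] ↦ [s³ : s²t : st² : t³ : y]`. The affine point `(x, y)` is `[1 : x : x² : x³ : y]`. The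
model is nonsingular when `f` is separable of degree `5` or `6`. -/
noncomputable def sexticCurve (f : Polynomial ℂ) : FunSpace :=
  projectiveSubspace {p | ∃ (s t y : ℂ) (h : s ≠ 0 ∨ t ≠ 0), y ^ 2 = sexticForm f s t ∧
    p = Projectivization.mk ℂ ![s ^ 3, s ^ 2 * t, s * t ^ 2, t ^ 3, y] (sextic_ne_zero s t y h)}

/-- The point `[s : t : y]` of the projective model of `y² = f(x)`. -/
noncomputable def sexticPoint (f : Polynomial ℂ) (s t y : ℂ) (h : s ≠ 0 ∨ t ≠ 0)
    (hy : y ^ 2 = sexticForm f s t) : (sexticCurve f).carrier :=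
  ⟨Projectivization.mk ℂ ![s ^ 3, s ^ 2 * t, s * t ^ 2, t ^ 3, y] (sextic_ne_zero s t y h),
    s, t, y, h, hy, rfl⟩

/-- The sextic `108 (4 + 12 x + 95 x² + 170 x³ + 155 x⁴ + 72 x⁵ + 16 x⁶)`. -/
noncomputable def polyC2 : Polynomial ℂ :=
  108 * (4 + 12 * .X + 95 * .X ^ 2 + 170 * .X ^ 3 + 155 * .X ^ 4 + 72 * .X ^ 5 + 16 * .X ^ 6)

/-- The curve `𝓒₂ : y² = 108 (4 + 12 x + 95 x² + 170 x³ + 155 x⁴ + 72 x⁵ + 16 x⁶)`. -/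
noncomputable def curveC2 : FunSpace := sexticCurve polyC2

/-- The plane projective curve of a Weierstrass equation. -/
noncomputable def weierstrassPlaneCurve (W : WeierstrassCurve ℂ) : FunSpace :=
  projectiveSubspace (zeroLocus {W.toProjective.polynomial})

/-- `X` is isomorphic to an elliptic curve in Weierstrass form whose `j`-invariant is `j`. -/
def HasJInvariant (X : FunSpace) (j : ℂ) : Prop :=
  ∃ (W : WeierstrassCurve ℂ) (_ : W.IsElliptic), X.Isomorphic (weierstrassPlaneCurve W) ∧ W.j = j

/-- The curve `𝓔₁ : y² = x³ - 5 x² - 40 x - 80`. -/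
noncomputable def curveE1 : FunSpace := weierstrassPlaneCurve ⟨0, -5, 0, -40, -80⟩

/-- The curve `𝓔₄ : y² = 432 (x³ + 80 x² + 125 x + 50)`, as a plane cubic in `[x : y : z]`. -/
noncomputable def curveE4 : FunSpace :=
  projectiveSubspace (zeroLocus
    {(.X 1 ^ 2 * .X 2 - 432 * (.X 0 ^ 3 + 80 * .X 0 ^ 2 * .X 2 + 125 * .X 0 * .X 2 ^ 2
      + 50 * .X 2 ^ 3) : MvPolynomial (Fin 3) ℂ)})

/-- The modular `j`-function `j = E₄³ / Δ` on the upper half-plane. -/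
noncomputable def modularJ (τ : ℍ) : ℂ := ModularForm.E₄ τ ^ 3 / ModularForm.discriminant τ

/-- The point `n τ` of the upper half-plane, for a positive integer `n`. -/
def scaledPoint (n : ℕ) (hn : 0 < n) (τ : ℍ) : ℍ :=
  ⟨n * (τ : ℂ), by simpa using mul_pos (Nat.cast_pos.2 hn) τ.im_pos⟩

/-- The defining conditions of `τ₀ = -1/2 + 0.186676… i`. -/
def IsTauZero (τ : ℍ) : Prop :=
  τ.re = -1 / 2 ∧ |τ.im - 0.186676| < 10 ^ (-6 : ℤ) ∧
    modularJ τ = -(5 * 29 ^ 3) / 2 ^ 5 ∧ modularJ (scaledPoint 5 (by norm_num) τ) = -25 / 2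

/-- The permutations of `{1, …, 5}`, written here on `{0, …, 4}`: `(12)`, `(34)`, `(345)`,
`(13)(24)`. -/
def perm12 : Equiv.Perm (Fin 5) := Equiv.swap 0 1

def perm34 : Equiv.Perm (Fin 5) := Equiv.swap 2 3

def perm345 : Equiv.Perm (Fin 5) := Equiv.swap 2 3 * Equiv.swap 3 4

def perm13_24 : Equiv.Perm (Fin 5) := Equiv.swap 0 2 * Equiv.swap 1 3

/-- The quotient of Bring's curve by the group generated by a set of permutations. -/
noncomputable def bringQuotient (S : Set (Equiv.Perm (Fin 5))) : FunSpace :=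
  bringCurve.quotient (Subgroup.closure S)

/-- The projection of Bring's curve to its quotient. -/
noncomputable def toBringQuotient (S : Set (Equiv.Perm (Fin 5))) (p : bringCurve.carrier) :
    (bringQuotient S).carrier :=
  bringCurve.toQuotient (Subgroup.closure S) p

/-! Everything rests on explicit equations. A Bring vector is one whose first three elementary
symmetric functions vanish, so the elementary symmetric functions of `x₃, x₄, x₅` are, up to sign,
the complete homogeneous ones of `x₁, x₂`. Hence `x₁, x₂` determine the unordered triple `x₃, x₄,
x₅`, and its alternating product, whose square is a discriminant, determines it up to rotation. This
presents `𝓑/⟨(345)⟩` as a double cover of the line, namely `𝓒₂`. In the coordinate `z = (2s + t)/t`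
the sextic is even; the invariants `z², y` of `σ` and `1/z², y/z³` of `σι` yield the cubics `𝓔₄` and
`𝓔₁`. On the other hand `(12)(34)` and `(13)(24)` change signs of three linear forms `a, b, c` with
`a² + b² + c² = -5w²` and `abc = -5w³`, `w = x₅`, and the squares of these satisfy the equation of
`𝓔₁` again.

To make these maps into quotients of spaces with functions, three facts are used. The topologies are
cofinite (`IsCurve`); for Bring's curve this comes from a norm out of a biquadratic extension of the
polynomials in one variable, and images inherit it. A surjective morphism onto a nonsingular curve
is a quotient map as soon as rational functions descend (`IsCurve.isQuot`), where nonsingularity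
means that rational functions have orders (`exists_orders`). Rational functions descend because the
function field upstairs is spanned by eigenfunctions of the group (`isRational_of_comp`): a Lagrange
resolvent for `(345)`, the function `z` for the involutions, the forms `a/w, b/w, c/w` for the
four-group. Two quotient maps with the same fibres have isomorphic targets (`IsQuot.exists_isIso`).

For the genus, `dx/y` trivializes the differentials on each of the two charts of `𝓒₂`, with
transition factor `-x`. A regular form is `(A(x) + B(x) y) dx/y`, and regularity at infinity leaves
`B = 0` and `deg A ≤ 1`.

The modular part uses the Hauptmoduln `(η(τ)/η(5τ))⁶` and `(η(τ)/η(3τ))¹²`. The formulas expressing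
`j` through them (`levelFive_eq_zero`, `levelThree_eq_zero`) are proved by multiplying the
conjugates of the difference of both sides over the cosets of `Γ₀(p)`: the product is a modular form
of level one and weight zero that vanishes at the cusp. The level-five Hauptmodul takes the value
`-10` at some negative real nome, found by the intermediate value theorem between truncated Euler
products, and there `j(τ)` and `j(5τ)` have the prescribed values. For any `τ₀` as in the statement,
`j(5τ₀)` gives a quartic for the level-three Hauptmodul at `5τ₀`, a size estimate selects the root
`-729/2`, and this determines `j(15τ₀)`. -/

namespace FunSpace

/-! ### Spaces with functions whose topology is cofinite, and quotient maps between them -/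

open Filter

/-- The underlying space has the topology of an irreducible curve: it is infinite and its proper
closed subsets are the finite ones. -/
structure IsCurve (X : FunSpace) : Prop where
  infinite : Infinite X.carrier
  isOpen_iff : ∀ s : Set X.carrier, IsOpen s ↔ s = ∅ ∨ sᶜ.Finite

/-- Rational functions: functions that are regular at almost all points. -/
def IsRational (X : FunSpace) (f : X.carrier → ℂ) : Prop :=
  ∀ᶠ p in cofinite, X.RegAt p f

variable {X Y Z : FunSpace}

theorem regAt_sub {p : X.carrier} {f g : X.carrier → ℂ} (hf : X.RegAt p f) (hg : X.RegAt p g) :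
    X.RegAt p (f - g) := by
  have := X.regAt_add _ _ _ hf (X.regAt_mul _ _ _ (X.regAt_const p (-1)) hg)
  convert this using 1
  ext q
  simp [sub_eq_add_neg]

theorem regAt_pow {p : X.carrier} {f : X.carrier → ℂ} (hf : X.RegAt p f) (n : ℕ) :
    X.RegAt p (f ^ n) := by
  induction n with
  | zero => simpa using! X.regAt_const p 1
  | succ n ih => rw [pow_succ]; exact X.regAt_mul _ _ _ ih hf

theorem regAt_const_mul {p : X.carrier} {f : X.carrier → ℂ} (c : ℂ) (hf : X.RegAt p f) :
    X.RegAt p (fun q => c * f q) :=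
  X.regAt_mul _ _ _ (X.regAt_const p c) hf

namespace IsCurve

variable (hX : X.IsCurve)
include hX

/-- Nonempty open sets are cofinite, so a neighbourhood statement splits into its value at the point
and an almost-everywhere statement. Later local arguments are reduced to the `cofinite` filter in
this way. -/
theorem eventually_nhds {p : X.carrier} {P : X.carrier → Prop} :
    (∀ᶠ q in 𝓝 p, P q) ↔ P p ∧ ∀ᶠ q in cofinite, P q := by
  constructor
  · intro h
    refine ⟨h.self_of_nhds, ?_⟩
    obtain ⟨U, hU, hUo, hp⟩ := eventually_nhds_iff.1 h
    rcases (hX.isOpen_iff U).1 hUo with rfl | hf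
    · exact absurd hp (Set.notMem_empty _)
    · exact hf.subset fun q hq hqU => hq (hU q hqU)
  · rintro ⟨hp, h⟩
    exact eventually_nhds_iff.2 ⟨{q | P q}, fun q hq => hq, (hX.isOpen_iff _).2 (.inr h), hp⟩

theorem isRational_of_regAt {p : X.carrier} {f : X.carrier → ℂ} (h : X.RegAt p f) :
    X.IsRational f :=
  (hX.eventually_nhds.1 (X.eventually_regAt p f h)).2

theorem regAt_congr {p : X.carrier} {f g : X.carrier → ℂ} (hf : X.RegAt p f)
    (h : f =ᶠ[cofinite] g) (hp : f p = g p) : X.RegAt p g :=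
  X.regAt_congr p f g (hX.eventually_nhds.2 ⟨hp, h⟩) hf

theorem eventually_exists {P : X.carrier → Prop} (h : ∀ᶠ p in cofinite, P p) : ∃ p, P p :=
  have := hX.infinite
  h.exists

theorem isRational_congr {f g : X.carrier → ℂ} (hf : X.IsRational f)
    (h : f =ᶠ[cofinite] g) : X.IsRational g := by
  obtain ⟨p, hp, hp'⟩ := hX.eventually_exists (hf.and h)
  exact hX.isRational_of_regAt (hX.regAt_congr hp h hp')

theorem eventually_ne {f : X.carrier → ℂ} {p : X.carrier} (hf : X.RegAt p f) (hp : f p ≠ 0) :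
    ∀ᶠ q in cofinite, f q ≠ 0 :=
  (hX.eventually_nhds.1 (X.eventually_ne p f hf hp)).2

/-- Nonvanishing at one regular point spreads to almost all points. Modulo almost-everywhere
equality the rational functions thus form a field. -/
theorem eq_zero_or_ne {f : X.carrier → ℂ} (hf : X.IsRational f) :
    f =ᶠ[cofinite] 0 ∨ ∀ᶠ q in cofinite, f q ≠ 0 := by
  by_cases h : ∃ p, X.RegAt p f ∧ f p ≠ 0
  · obtain ⟨p, hp, hp'⟩ := h
    exact .inr (hX.eventually_ne hp hp')
  · push Not at h
    exact .inl (hf.mono fun p hp => h p hp)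

/-- The identity principle: a difference that is nonzero at `p` would be nonzero almost everywhere.
-/
theorem eq_of_eventuallyEq {f g : X.carrier → ℂ} {p : X.carrier} (hf : X.RegAt p f)
    (hg : X.RegAt p g) (h : f =ᶠ[cofinite] g) : f p = g p := by
  by_contra hne
  have h1 := hX.eventually_ne (regAt_sub hf hg) (sub_ne_zero.2 hne)
  obtain ⟨q, hq, hq'⟩ := hX.eventually_exists (h1.and h)
  exact hq (sub_eq_zero.2 hq')

omit hX in
theorem isRational_const (c : ℂ) : X.IsRational fun _ => c :=
  Eventually.of_forall fun p => X.regAt_const p c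

omit hX in
theorem isRational_add {f g : X.carrier → ℂ} (hf : X.IsRational f) (hg : X.IsRational g) :
    X.IsRational (f + g) := by
  filter_upwards [hf, hg] with p h1 h2 using X.regAt_add _ _ _ h1 h2

omit hX in
theorem isRational_mul {f g : X.carrier → ℂ} (hf : X.IsRational f) (hg : X.IsRational g) :
    X.IsRational (f * g) := by
  filter_upwards [hf, hg] with p h1 h2 using X.regAt_mul _ _ _ h1 h2

theorem isRational_inv {f : X.carrier → ℂ} (hf : X.IsRational f) : X.IsRational f⁻¹ := by
  rcases hX.eq_zero_or_ne hf with h | h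
  · exact hX.isRational_congr hf (h.trans (h.mono fun p hp => by simp [hp]))
  · filter_upwards [hf, h] with p h1 h2 using X.regAt_inv _ _ h1 h2

theorem isRational_div {f g : X.carrier → ℂ} (hf : X.IsRational f) (hg : X.IsRational g) :
    X.IsRational (f / g) := by
  rw [div_eq_mul_inv]
  exact isRational_mul hf (hX.isRational_inv hg)

theorem irreducibleSpace : IrreducibleSpace X.carrier := by
  have := hX.infinite
  refine { isPreirreducible_univ := ?_, toNonempty := inferInstance }
  rintro u v hu hv ⟨a, -, ha⟩ ⟨b, -, hb⟩
  rcases (hX.isOpen_iff u).1 hu with rfl | hu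
  · exact absurd ha (Set.notMem_empty _)
  rcases (hX.isOpen_iff v).1 hv with rfl | hv
  · exact absurd hb (Set.notMem_empty _)
  have h1 : ∀ᶠ q in cofinite, q ∈ u := hu
  have h2 : ∀ᶠ q in cofinite, q ∈ v := hv
  obtain ⟨q, h⟩ := (h1.and h2).exists
  exact ⟨q, trivial, h⟩

end IsCurve

/-- A map is a quotient map of spaces with functions. -/
structure IsQuot (φ : X.carrier → Y.carrier) : Prop where
  surjective : Function.Surjective φ
  isOpen_iff : ∀ s : Set Y.carrier, IsOpen s ↔ IsOpen (φ ⁻¹' s)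
  regAt_iff : ∀ (y : Y.carrier) (f : Y.carrier → ℂ),
    Y.RegAt y f ↔ ∀ᶠ y' in 𝓝 y, ∀ x, φ x = y' → X.RegAt x (f ∘ φ)

theorem isQuot_toQuotient (X : FunSpace) (G : Type) [Group G] [MulAction G X.carrier] :
    IsQuot (Y := X.quotient G) (X.toQuotient G) where
  surjective := Quotient.mk_surjective
  isOpen_iff _ := isOpen_coinduced
  regAt_iff _ _ := Iff.rfl

theorem IsQuot.continuous {φ : X.carrier → Y.carrier} (hφ : IsQuot φ) : Continuous φ :=
  ⟨fun s hs => (hφ.isOpen_iff s).1 hs⟩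

theorem IsQuot.regAt_comp {φ : X.carrier → Y.carrier} (hφ : IsQuot φ) {x : X.carrier}
    {f : Y.carrier → ℂ} (h : Y.RegAt (φ x) f) : X.RegAt x (f ∘ φ) :=
  ((hφ.regAt_iff _ _).1 h).self_of_nhds x rfl

theorem IsQuot.comp {ψ : Y.carrier → Z.carrier} {φ : X.carrier → Y.carrier} (hψ : IsQuot ψ)
    (hφ : IsQuot φ) : IsQuot (ψ ∘ φ) where
  surjective := hψ.surjective.comp hφ.surjective
  isOpen_iff s := by rw [hψ.isOpen_iff, hφ.isOpen_iff]; rfl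
  regAt_iff z f := by
    rw [hψ.regAt_iff]
    constructor
    · intro h
      filter_upwards [h] with z' hz' x hx
      exact hφ.regAt_comp (hz' (φ x) hx)
    · intro h
      filter_upwards [eventually_eventually_nhds.2 h] with z' hz' y hy
      subst hy
      rw [hφ.regAt_iff]
      filter_upwards [hψ.continuous.tendsto y hz'] with y' hy' x hx
      exact hy' x (by simp [hx])

/-- Two quotient maps with the same fibres have isomorphic targets. -/
theorem IsQuot.exists_isIso {φ : X.carrier → Y.carrier} {ψ : X.carrier → Z.carrier}
    (hφ : IsQuot φ) (hψ : IsQuot ψ) (h : ∀ x x', φ x = φ x' ↔ ψ x = ψ x') :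
    ∃ e : Y.carrier ≃ Z.carrier, IsIso e ∧ ∀ x, e (φ x) = ψ x := by
  have h1 : ∀ x, ψ (Function.surjInv hφ.surjective (φ x)) = ψ x := fun x =>
    (h _ _).1 (Function.surjInv_eq hφ.surjective _)
  have h2 : ∀ x, φ (Function.surjInv hψ.surjective (ψ x)) = φ x := fun x =>
    (h _ _).2 (Function.surjInv_eq hψ.surjective _)
  let e : Y.carrier ≃ Z.carrier :=
    { toFun := fun y => ψ (Function.surjInv hφ.surjective y)
      invFun := fun z => φ (Function.surjInv hψ.surjective z)
      left_inv := fun y => by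
        obtain ⟨x, rfl⟩ := hφ.surjective y
        simp only [h1, h2]
      right_inv := fun z => by
        obtain ⟨x, rfl⟩ := hψ.surjective z
        simp only [h1, h2] }
  have he : ∀ x, e (φ x) = ψ x := h1
  have he' : ∀ x, e.symm (ψ x) = φ x := h2
  have hc : Continuous e := ⟨fun s hs => by
    rw [hφ.isOpen_iff]
    rw [hψ.isOpen_iff] at hs
    convert hs using 1
    ext x
    simp [he]⟩
  have hc' : Continuous e.symm := ⟨fun s hs => by
    rw [hψ.isOpen_iff]
    rw [hφ.isOpen_iff] at hs
    convert hs using 1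
    ext x
    simp [he']⟩
  refine ⟨e, ⟨hc, hc', fun y f => ?_⟩, he⟩
  rw [hψ.regAt_iff, hφ.regAt_iff]
  have hcomp : (f ∘ e) ∘ φ = f ∘ ψ := funext fun x => congrArg f (he x)
  rw [hcomp]
  constructor
  · intro H
    filter_upwards [hc.tendsto y H] with y' hy' x hx
    exact hy' x (by rw [← hx, he])
  · intro H
    have := hc'.tendsto (e y)
    rw [e.symm_apply_apply] at this
    filter_upwards [this H] with z hz x hx
    exact hz x (by rw [← hx, he'])

theorem IsIso.symm {e : X.carrier ≃ Y.carrier} (he : IsIso e) : IsIso e.symm := by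
  refine ⟨he.2.1, he.1, fun y f => ?_⟩
  have := he.2.2 (e.symm y) (f ∘ e.symm)
  rw [e.apply_symm_apply, Function.comp_assoc, e.symm_comp_self, Function.comp_id] at this
  exact this.symm

theorem Isomorphic.symm (h : Isomorphic X Y) : Isomorphic Y X :=
  h.imp' Equiv.symm fun _ he => IsIso.symm he

theorem Isomorphic.trans (h : Isomorphic X Y) (h' : Isomorphic Y Z) : Isomorphic X Z := by
  obtain ⟨e, h1, h2, h3⟩ := h
  obtain ⟨e', h4, h5, h6⟩ := h'
  exact ⟨e.trans e', h4.comp h1, h2.comp h5, fun p f => (h6 _ _).trans (h3 _ _)⟩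

theorem isIso_refl (X : FunSpace) : IsIso (Equiv.refl X.carrier) :=
  ⟨continuous_id, continuous_id, fun _ _ => Iff.rfl⟩

/-- A quotient map whose fibres are the orbits of `G` identifies its target with `X / G`. -/
theorem IsQuot.exists_isIso_quotient {φ : X.carrier → Y.carrier} (hφ : IsQuot φ) (G : Type)
    [Group G] [MulAction G X.carrier] (hinv : ∀ (g : G) (x : X.carrier), φ (g • x) = φ x)
    (horb : ∀ x x' : X.carrier, φ x = φ x' → ∃ g : G, g • x' = x) :
    ∃ e : (X.quotient G).carrier ≃ Y.carrier, IsIso e ∧ ∀ x, e (X.toQuotient G x) = φ x := by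
  refine (isQuot_toQuotient X G).exists_isIso hφ fun x x' => ?_
  refine Quotient.eq.trans ?_
  change x ∈ MulAction.orbit G x' ↔ _
  constructor
  · rintro ⟨g, rfl⟩
    exact hinv g x'
  · exact fun h => horb x x' h

/-- Every nonzero rational function has an order at every point. -/
def HasOrders (Y : FunSpace) : Prop :=
  ∀ q : Y.carrier, ∃ u : Y.carrier → ℂ, Y.RegAt q u ∧ u q = 0 ∧
    ∀ h, Y.IsRational h → h =ᶠ[cofinite] 0 ∨
      ∃ (n : ℕ) (v : Y.carrier → ℂ), Y.RegAt q v ∧ v q ≠ 0 ∧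
        (h =ᶠ[cofinite] u ^ n * v ∨ h * u ^ n =ᶠ[cofinite] v)

/-- A continuous surjection from a curve onto a space with closed points. -/
theorem IsCurve.of_surjective (hX : X.IsCurve) {φ : X.carrier → Y.carrier} (hφ : Continuous φ)
    (hs : Function.Surjective φ) (h1 : ∀ y : Y.carrier, IsClosed {y}) (hY : Infinite Y.carrier) :
    Y.IsCurve := by
  refine ⟨hY, fun s => ⟨fun h => ?_, fun h => ?_⟩⟩
  · rcases (hX.isOpen_iff _).1 (h.preimage hφ) with h | h
    · left
      rwa [Set.preimage_eq_empty_iff, hs.range_eq, Set.disjoint_univ] at h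
    · right
      rw [← Set.preimage_compl] at h
      rw [← Set.image_preimage_eq sᶜ hs]
      exact h.image φ
  · rcases h with rfl | h
    · exact isOpen_empty
    · rw [← isClosed_compl_iff, ← Set.biUnion_of_singleton sᶜ]
      exact h.isClosed_biUnion fun y _ => h1 y

/-- Fibres are finite: the preimage of the complement of a point is open and, by surjectivity,
nonempty. -/
theorem IsCurve.tendsto_cofinite (hX : X.IsCurve) (hY : Y.IsCurve) {φ : X.carrier → Y.carrier}
    (hφ : Continuous φ) (hs : Function.Surjective φ) : Tendsto φ cofinite cofinite := by
  refine Tendsto.cofinite_of_finite_preimage_singleton fun y => ?_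
  have hc : IsOpen ({y}ᶜ : Set Y.carrier) := (hY.isOpen_iff _).2 (.inr (by simp))
  rcases (hX.isOpen_iff _).1 (hc.preimage hφ) with h | h
  · have := hY.infinite
    obtain ⟨y', hy'⟩ := exists_ne y
    obtain ⟨x, rfl⟩ := hs y'
    exact absurd (show x ∈ φ ⁻¹' {y}ᶜ from hy') (by rw [h]; exact Set.notMem_empty _)
  · rw [Set.preimage_compl, compl_compl] at h
    exact h.to_subtype

/-- Descent of almost everywhere statements along a surjection. -/
theorem eventually_of_comp {φ : X.carrier → Y.carrier} (hs : Function.Surjective φ)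
    {P : Y.carrier → Prop} (h : ∀ᶠ x in cofinite, P (φ x)) : ∀ᶠ y in cofinite, P y := by
  have h' : {x | ¬ P (φ x)}.Finite := h
  refine (h'.image φ).subset fun y hy => ?_
  obtain ⟨x, rfl⟩ := hs y
  exact ⟨x, hy, rfl⟩

/-- A surjective morphism of curves is a quotient map if the target is nonsingular and every
function whose pullback is rational is itself rational. -/
theorem IsCurve.isQuot (hX : X.IsCurve) (hY : Y.IsCurve) (hd : Y.HasOrders)
    {φ : X.carrier → Y.carrier} (hφ : Continuous φ) (hs : Function.Surjective φ)
    (hreg : ∀ x f, Y.RegAt (φ x) f → X.RegAt x (f ∘ φ))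
    (hdesc : ∀ f, X.IsRational (f ∘ φ) → Y.IsRational f) : IsQuot φ where
  surjective := hs
  isOpen_iff s := by
    refine ⟨fun h => h.preimage hφ, fun h => (hY.isOpen_iff s).2 ?_⟩
    rcases (hX.isOpen_iff _).1 h with h | h
    · left
      rwa [Set.preimage_eq_empty_iff, hs.range_eq, Set.disjoint_univ] at h
    · right
      rw [← Set.preimage_compl] at h
      rw [← Set.image_preimage_eq sᶜ hs]
      exact h.image φ
  regAt_iff y f := by
    have ht := hX.tendsto_cofinite hY hφ hs
    constructor
    · intro h
      filter_upwards [Y.eventually_regAt _ _ h] with y' hy' x hx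
      exact hreg x f (by rwa [hx])
    · intro h
      obtain ⟨x, rfl⟩ := hs y
      have hx : X.RegAt x (f ∘ φ) := h.self_of_nhds x rfl
      -- `f` is rational on `Y`, so it has an order at `φ x`; the regularity of `f ∘ φ` at `x` rules
      -- out a pole there.
      have hf := hdesc f (hX.isRational_of_regAt hx)
      obtain ⟨u, hu, hu0, hord⟩ := hd (φ x)
      rcases hord f hf with h0 | ⟨n, v, hv, hv0, h1 | h1⟩
      · have := hX.eq_of_eventuallyEq hx (X.regAt_const x 0) (ht.eventually h0)
        exact hY.regAt_congr (Y.regAt_const _ 0) h0.symm this.symm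
      · have hr := Y.regAt_mul _ _ _ (regAt_pow hu n) hv
        have := hX.eq_of_eventuallyEq hx (hreg x _ hr) (ht.eventually h1)
        exact hY.regAt_congr hr h1.symm this.symm
      · have h2 := hX.eq_of_eventuallyEq (X.regAt_mul _ _ _ hx (hreg x _ (regAt_pow hu n)))
          (hreg x _ hv) (ht.eventually h1)
        rcases Nat.eq_zero_or_pos n with rfl | hn
        · exact hY.regAt_congr hv (h1.symm.trans (by simp)) (by simpa using h2.symm)
        -- A pole of order `n > 0`: evaluating `(f ∘ φ) (u ∘ φ)^n = v ∘ φ` at `x` shows that `v`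
        -- vanishes at `φ x`.
        · exfalso
          apply hv0
          rw [← Function.comp_apply (f := v), ← h2]
          simp [hu0, hn.ne']

end FunSpace


/-! ### Descent of rational functions along automorphisms -/

namespace FunSpace

open Filter

variable {X Y : FunSpace}

section Span

variable {I : Type} [Fintype I]

/-- Functions on `X` that are combinations of the functions `m i` with coefficients pulled back from
rational functions on `Y`. -/
def InSpan (φ : X.carrier → Y.carrier) (m : I → X.carrier → ℂ) (h : X.carrier → ℂ) : Prop :=
  ∃ c : I → Y.carrier → ℂ, (∀ i, Y.IsRational (c i)) ∧
    ∀ᶠ x in cofinite, h x = ∑ i, c i (φ x) * m i x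

variable {φ : X.carrier → Y.carrier} {m : I → X.carrier → ℂ}

theorem InSpan.congr {h h' : X.carrier → ℂ} (hh : InSpan φ m h) (e : h =ᶠ[cofinite] h') :
    InSpan φ m h' := by
  obtain ⟨c, hc, hh⟩ := hh
  exact ⟨c, hc, by filter_upwards [hh, e] with x h1 h2; rw [← h2, h1]⟩

theorem InSpan.add {h h' : X.carrier → ℂ} (hh : InSpan φ m h) (hh' : InSpan φ m h') :
    InSpan φ m (h + h') := by
  obtain ⟨c, hc, hh⟩ := hh
  obtain ⟨c', hc', hh'⟩ := hh'
  refine ⟨c + c', fun i => IsCurve.isRational_add (hc i) (hc' i), ?_⟩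
  filter_upwards [hh, hh'] with x h1 h2
  simp [h1, h2, add_mul, Finset.sum_add_distrib]

theorem inSpan_zero : InSpan φ m 0 :=
  ⟨0, fun _ => IsCurve.isRational_const 0, by simp⟩

theorem InSpan.sum {J : Type} (s : Finset J) {h : J → X.carrier → ℂ}
    (hh : ∀ j ∈ s, InSpan φ m (h j)) : InSpan φ m (∑ j ∈ s, h j) := by
  classical
  induction s using Finset.induction_on with
  | empty => exact inSpan_zero
  | insert j s hj ih =>
    rw [Finset.sum_insert hj]
    exact (hh j (by simp)).add (ih fun i hi => hh i (by simp [hi]))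

theorem InSpan.smul {h : X.carrier → ℂ} {c : Y.carrier → ℂ} (hc : Y.IsRational c)
    (hh : InSpan φ m h) : InSpan φ m (fun x => c (φ x) * h x) := by
  obtain ⟨d, hd, hh⟩ := hh
  refine ⟨fun i => c * d i, fun i => IsCurve.isRational_mul hc (hd i), ?_⟩
  filter_upwards [hh] with x h1
  simp [h1, Finset.mul_sum, mul_assoc]

theorem inSpan_self (i : I) : InSpan φ m (m i) := by
  classical
  exact ⟨fun j => fun _ => if j = i then 1 else 0, fun j => IsCurve.isRational_const _, by simp⟩

theorem inSpan_smul_self (i : I) {c : Y.carrier → ℂ} (hc : Y.IsRational c) :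
    InSpan φ m (fun x => c (φ x) * m i x) :=
  (inSpan_self i).smul hc

theorem InSpan.mul (hm : ∀ i j, InSpan φ m (m i * m j)) {h h' : X.carrier → ℂ}
    (hh : InSpan φ m h) (hh' : InSpan φ m h') : InSpan φ m (h * h') := by
  obtain ⟨c, hc, hh⟩ := hh
  obtain ⟨d, hd, hh'⟩ := hh'
  refine (InSpan.sum Finset.univ fun i _ => InSpan.sum Finset.univ fun j _ =>
    (hm i j).smul (IsCurve.isRational_mul (hc i) (hd j))).congr ?_
  filter_upwards [hh, hh'] with x h1 h2
  simp only [Finset.sum_apply, Pi.mul_apply, h1, h2, Finset.sum_mul_sum]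
  refine Finset.sum_congr rfl fun i _ => Finset.sum_congr rfl fun j _ => by ring

theorem InSpan.eval (hm : ∀ i j, InSpan φ m (m i * m j)) (h1 : InSpan φ m 1) {n : ℕ}
    {ψ : X.carrier → Fin n → ℂ} (hψ : ∀ k, InSpan φ m (fun x => ψ x k))
    (P : MvPolynomial (Fin n) ℂ) : InSpan φ m (fun x => MvPolynomial.eval (ψ x) P) := by
  induction P using MvPolynomial.induction_on with
  | C a =>
    refine (h1.smul (IsCurve.isRational_const a)).congr (Eventually.of_forall fun x => ?_)
    simp
  | add p q hp hq => simpa using! hp.add hq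
  | mul_X p k hp => simpa using! hp.mul hm (hψ k)

/-- Descent of rational functions: if the function field of `X` is generated over that of `Y` by
eigenfunctions `m i` of automorphisms `a k` over `Y` whose characters are separated by weights `w`,
then a function on `Y` with rational pullback is rational. -/
theorem isRational_of_comp [DecidableEq I] (hX : X.IsCurve) (hY : Y.IsCurve) (hφ : Continuous φ)
    (hs : Function.Surjective φ) {K : Type} [Fintype K] (a : K → X.carrier → X.carrier)
    (ha : ∀ k, Function.Injective (a k)) (hφa : ∀ k x, φ (a k x) = φ x) (χ : K → I → ℂ)
    (hχ : ∀ k i x, m i (a k x) = χ k i * m i x) (w : I → K → ℂ)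
    (hw : ∀ i j, ∑ k, w i k * χ k j = Pi.single (M := fun _ => ℂ) i 1 j)
    (hm0 : ∀ i, ∀ᶠ x in cofinite, m i x ≠ 0)
    (hgen : ∀ h, X.IsRational h → ∃ P Q, InSpan φ m P ∧ InSpan φ m Q ∧
      (∀ᶠ x in cofinite, Q x ≠ 0) ∧ h * Q =ᶠ[cofinite] P)
    (f : Y.carrier → ℂ) (hf : X.IsRational (f ∘ φ)) : Y.IsRational f := by
  classical
  obtain ⟨P, Q, ⟨d, hd, hP⟩, ⟨c, hc, hQ⟩, hQ0, hPQ⟩ := hgen _ hf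
  have ht := hX.tendsto_cofinite hY hφ hs
  -- Applying `a k` multiplies the `j`-th term on both sides by `χ k j`; the coefficients, pulled
  -- back from `Y`, do not change.
  have key : ∀ᶠ x in cofinite, ∀ k,
      f (φ x) * ∑ j, c j (φ x) * (χ k j * m j x) = ∑ j, d j (φ x) * (χ k j * m j x) := by
    refine eventually_all.2 fun k => ?_
    have h1 : ∀ᶠ x in cofinite, f (φ x) * ∑ j, c j (φ x) * m j x = ∑ j, d j (φ x) * m j x := by
      filter_upwards [hP, hQ, hPQ] with x h1 h2 h3
      rw [← h1, ← h2, ← h3]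
      rfl
    filter_upwards [(ha k).tendsto_cofinite.eventually h1] with x hx
    simpa only [hφa, hχ] using hx
  -- The weights `w i` project onto the `i`-th eigencomponent, so the relation holds component by
  -- component.
  have key2 : ∀ᶠ x in cofinite, ∀ i, f (φ x) * c i (φ x) * m i x = d i (φ x) * m i x := by
    filter_upwards [key] with x hx i
    have hsum : ∀ e : I → ℂ, ∑ k, w i k * ∑ j, e j * (χ k j * m j x) = e i * m i x := by
      intro e
      simp only [Finset.mul_sum]
      rw [Finset.sum_comm]
      have : ∀ j, ∑ k, w i k * (e j * (χ k j * m j x)) =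
          Pi.single (M := fun _ => ℂ) i 1 j * (e j * m j x) := by
        intro j
        rw [← hw, Finset.sum_mul]
        exact Finset.sum_congr rfl fun k _ => by ring
      simp only [this]
      rw [Finset.sum_eq_single i (fun j _ hj => by rw [Pi.single_eq_of_ne hj, zero_mul]) (by simp)]
      simp
    rw [← hsum fun j => d j (φ x), mul_assoc, ← hsum fun j => c j (φ x), Finset.mul_sum]
    refine Finset.sum_congr rfl fun k _ => ?_
    rw [← hx k]
    ring
  -- Not all `c i` vanish, since `Q` is nonzero; a nonvanishing one exhibits `f` as `d i / c i`.
  have hex : ∃ i, ∀ᶠ y in cofinite, c i y ≠ 0 := by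
    by_contra hne
    push Not at hne
    have h0 : ∀ᶠ x in cofinite, ∀ i, c i (φ x) = 0 := eventually_all.2 fun i =>
      ht.eventually ((hY.eq_zero_or_ne (hc i)).resolve_right (hne i))
    obtain ⟨x, h1, h2, h3⟩ := hX.eventually_exists (h0.and (hQ.and hQ0))
    exact h3 (by rw [h2]; simp [h1])
  obtain ⟨i, hi⟩ := hex
  refine hY.isRational_congr (hY.isRational_div (hd i) (hc i))
    (eventually_of_comp (φ := φ) hs ?_)
  filter_upwards [key2, ht.eventually hi, hm0 i] with x h1 h2 h3
  rw [Pi.div_apply, div_eq_iff h2]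
  exact (mul_right_cancel₀ h3 (h1 i)).symm

end Span

/-! ### Orders of rational functions on a curve `y² = f(x)` -/

section Hyperelliptic

open Polynomial

/-- Functions that agree almost everywhere with `A(x) + B(x) y` for polynomials `A`, `B`. -/
def InAB (x y h : Y.carrier → ℂ) : Prop :=
  ∃ A B : ℂ[X], ∀ᶠ p in cofinite, h p = A.eval (x p) + B.eval (x p) * y p

variable {x y : Y.carrier → ℂ} {f : ℂ[X]}

theorem InAB.add {h h' : Y.carrier → ℂ} (hh : InAB x y h) (hh' : InAB x y h') :
    InAB x y (h + h') := by
  obtain ⟨A, B, e⟩ := hh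
  obtain ⟨A', B', e'⟩ := hh'
  refine ⟨A + A', B + B', ?_⟩
  filter_upwards [e, e'] with p h1 h2
  simp only [Pi.add_apply, h1, h2, eval_add]
  ring

theorem InAB.mul (hxy : ∀ᶠ p in cofinite, y p ^ 2 = f.eval (x p)) {h h' : Y.carrier → ℂ}
    (hh : InAB x y h) (hh' : InAB x y h') : InAB x y (h * h') := by
  obtain ⟨A, B, e⟩ := hh
  obtain ⟨A', B', e'⟩ := hh'
  refine ⟨A * A' + B * B' * f, A * B' + B * A', ?_⟩
  filter_upwards [e, e', hxy] with p h1 h2 h3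
  simp only [Pi.mul_apply, h1, h2, eval_add, eval_mul, ← h3]
  ring

theorem inAB_poly (A : ℂ[X]) : InAB x y (fun p => A.eval (x p)) :=
  ⟨A, 0, by simp⟩

theorem inAB_poly_mul (B : ℂ[X]) : InAB x y (fun p => B.eval (x p) * y p) :=
  ⟨0, B, by simp⟩

theorem InAB.eval (hxy : ∀ᶠ p in cofinite, y p ^ 2 = f.eval (x p)) {n : ℕ}
    {ψ : Y.carrier → Fin n → ℂ} (hψ : ∀ k, InAB x y (fun p => ψ p k))
    (P : MvPolynomial (Fin n) ℂ) : InAB x y (fun p => MvPolynomial.eval (ψ p) P) := by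
  induction P using MvPolynomial.induction_on with
  | C a => simpa using inAB_poly (x := x) (y := y) (C a)
  | add p q hp hq => simpa using! hp.add hq
  | mul_X p k hp => simpa using! hp.mul hxy (hψ k)

/-- `h` is a power of `u` times a unit at `q`. -/
def HasOrd (q : Y.carrier) (u h : Y.carrier → ℂ) : Prop :=
  ∃ (a b : ℕ) (v : Y.carrier → ℂ), Y.RegAt q v ∧ v q ≠ 0 ∧ h * u ^ a =ᶠ[cofinite] u ^ b * v

variable {q : Y.carrier} {u : Y.carrier → ℂ}

theorem HasOrd.congr {h h' : Y.carrier → ℂ} (hh : HasOrd q u h) (e : h =ᶠ[cofinite] h') :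
    HasOrd q u h' := by
  obtain ⟨a, b, v, hv, hv0, e'⟩ := hh
  exact ⟨a, b, v, hv, hv0, (e.symm.mul .rfl).trans e'⟩

theorem HasOrd.mul {h h' : Y.carrier → ℂ} (hh : HasOrd q u h) (hh' : HasOrd q u h') :
    HasOrd q u (h * h') := by
  obtain ⟨a, b, v, hv, hv0, e⟩ := hh
  obtain ⟨a', b', v', hv', hv0', e'⟩ := hh'
  refine ⟨a + a', b + b', v * v', Y.regAt_mul _ _ _ hv hv', mul_ne_zero hv0 hv0', ?_⟩
  filter_upwards [e, e'] with p h1 h2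
  simp only [Pi.mul_apply, Pi.pow_apply] at h1 h2 ⊢
  rw [pow_add, pow_add, mul_mul_mul_comm, h1, h2]
  ring

theorem HasOrd.inv (hY : Y.IsCurve) (hu : ∀ᶠ p in cofinite, u p ≠ 0) {h : Y.carrier → ℂ}
    (hh : HasOrd q u h) : HasOrd q u h⁻¹ := by
  obtain ⟨a, b, v, hv, hv0, e⟩ := hh
  refine ⟨b, a, v⁻¹, Y.regAt_inv _ _ hv hv0, inv_ne_zero hv0, ?_⟩
  filter_upwards [e, hu, hY.eventually_ne hv hv0] with p h1 h2 h3
  simp only [Pi.mul_apply, Pi.pow_apply, Pi.inv_apply] at h1 ⊢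
  have h4 : h p ≠ 0 := by
    intro h4
    rw [h4, zero_mul] at h1
    exact mul_ne_zero (pow_ne_zero _ h2) h3 h1.symm
  field_simp
  exact h1.symm

theorem hasOrd_unit {v : Y.carrier → ℂ} (hv : Y.RegAt q v) (hv0 : v q ≠ 0) : HasOrd q u v :=
  ⟨0, 0, v, hv, hv0, by simp⟩

theorem hasOrd_self : HasOrd q u u :=
  ⟨0, 1, fun _ => 1, Y.regAt_const _ _, one_ne_zero, by
    refine Eventually.of_forall fun p => by simp⟩

theorem HasOrd.pow {h : Y.carrier → ℂ} (hh : HasOrd q u h) (n : ℕ) : HasOrd q u (h ^ n) := by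
  induction n with
  | zero => simpa using! hasOrd_unit (u := u) (Y.regAt_const q 1) one_ne_zero
  | succ n ih => rw [pow_succ]; exact ih.mul hh

theorem regAt_eval {x : Y.carrier → ℂ} (hx : Y.RegAt q x) (A : ℂ[X]) :
    Y.RegAt q (fun p => A.eval (x p)) := by
  induction A using Polynomial.induction_on' with
  | add p r hp hr => simpa using! Y.regAt_add _ _ _ hp hr
  | monomial n a =>
    simpa using! regAt_const_mul a (regAt_pow hx n)

theorem eventually_eval_ne_zero (hx : ∀ α, ∀ᶠ p in cofinite, x p ≠ α) {A : ℂ[X]} (hA : A ≠ 0) :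
    ∀ᶠ p in cofinite, A.eval (x p) ≠ 0 := by
  have : ∀ᶠ p in cofinite, ∀ α ∈ A.roots.toFinset, x p ≠ α :=
    (Finset.eventually_all _).2 fun α _ => hx α
  filter_upwards [this] with p hp h0
  exact hp (x p) (by simp [hA, h0]) rfl

/-- This is the norm of `A + B y`. At a simple root `γ` of `f`, an equation `A² = B² f` forces `X -
γ` to divide `A` and then `B`, against coprimality. -/
theorem sq_sub_mul_sq_ne_zero (hf : f.Separable) (hdeg : f.degree ≠ 0) {A B : ℂ[X]}
    (hAB : IsCoprime A B) : A ^ 2 - B ^ 2 * f ≠ 0 := by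
  intro h
  obtain ⟨γ, hγ⟩ := IsAlgClosed.exists_root f hdeg
  obtain ⟨g, hg⟩ := dvd_iff_isRoot.2 hγ
  have hgγ : g.eval γ ≠ 0 := by
    intro h0
    obtain ⟨a, b, hab⟩ := hf
    have := congrArg (eval γ) hab
    rw [hg] at this
    simp [h0] at this
  have hA : A.eval γ = 0 := by
    have := congrArg (eval γ) h
    rw [hg] at this
    simpa using this
  obtain ⟨A1, hA1⟩ := dvd_iff_isRoot.2 hA
  have h2 : (X - C γ) * ((X - C γ) * A1 ^ 2 - B ^ 2 * g) = 0 := by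
    rw [← h, hA1, hg]
    ring
  have h3 := (mul_eq_zero.1 h2).resolve_left (X_sub_C_ne_zero γ)
  have hB : B.eval γ = 0 := by
    have := congrArg (eval γ) h3
    simpa [hgγ] using this
  obtain ⟨a, b, hab⟩ := hAB
  have := congrArg (eval γ) hab
  simp [hA, hB] at this

/-- A curve that near `q` is the affine curve `y² = f(x)`, `f` separable, is nonsingular there. -/
theorem exists_hasOrd (hY : Y.IsCurve) (hxq : Y.RegAt q x) (hyq : Y.RegAt q y)
    (hxy : ∀ᶠ p in cofinite, y p ^ 2 = f.eval (x p)) (hf : f.Separable) (hdeg : f.degree ≠ 0)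
    (hx : ∀ α, ∀ᶠ p in cofinite, x p ≠ α) :
    ∃ u : Y.carrier → ℂ, (u = (fun p => x p - x q) ∧ y q ≠ 0 ∨ u = y ∧ y q = 0) ∧
      Y.RegAt q u ∧ u q = 0 ∧ (∀ᶠ p in cofinite, u p ≠ 0) ∧
      ∀ A B : ℂ[X], ¬ (A = 0 ∧ B = 0) → HasOrd q u (fun p => A.eval (x p) + B.eval (x p) * y p) := by
  have hf0 : f ≠ 0 := hf.ne_zero
  have hyne : ∀ᶠ p in cofinite, y p ≠ 0 := by
    filter_upwards [hxy, eventually_eval_ne_zero hx hf0] with p h1 h2 h3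
    rw [← h1, h3] at h2
    simp at h2
  have hq : y q ^ 2 = f.eval (x q) :=
    hY.eq_of_eventuallyEq (regAt_pow hyq 2) (regAt_eval hxq f) hxy
  have hxr : Y.RegAt q (fun p => x p - x q) := regAt_sub hxq (Y.regAt_const q (x q))
  -- The uniformizer is `x - x q` away from the branch points and `y` at them, where `x - x q = y² /
  -- g(x)` with `f = (X - x q) g`.
  obtain ⟨u, hu, hur, hu0, hune, hux⟩ : ∃ u : Y.carrier → ℂ,
      (u = (fun p => x p - x q) ∧ y q ≠ 0 ∨ u = y ∧ y q = 0) ∧ Y.RegAt q u ∧ u q = 0 ∧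
      (∀ᶠ p in cofinite, u p ≠ 0) ∧ HasOrd q u (fun p => x p - x q) := by
    by_cases hyq0 : y q = 0
    · refine ⟨y, .inr ⟨rfl, hyq0⟩, hyq, hyq0, hyne, ?_⟩
      have hroot : f.IsRoot (x q) := by rw [IsRoot.def, ← hq, hyq0]; simp
      obtain ⟨g, hg⟩ := dvd_iff_isRoot.2 hroot
      have hgq : g.eval (x q) ≠ 0 := by
        intro h0
        obtain ⟨a, b, hab⟩ := hf
        have := congrArg (eval (x q)) hab
        rw [hg] at this
        simp [h0] at this
      have hgr := regAt_eval hxq g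
      refine ⟨0, 2, fun p => (g.eval (x p))⁻¹, Y.regAt_inv _ _ hgr hgq, inv_ne_zero hgq, ?_⟩
      filter_upwards [hxy, hY.eventually_ne hgr hgq] with p h1 h2
      simp only [Pi.mul_apply, Pi.pow_apply, Pi.one_apply, pow_zero, mul_one]
      rw [h1, hg]
      simp [h2]
    · exact ⟨_, .inl ⟨rfl, hyq0⟩, hxr, sub_self _, (hx (x q)).mono fun p hp => sub_ne_zero.2 hp,
        hasOrd_self⟩
  refine ⟨u, hu, hur, hu0, hune, fun A B hAB => ?_⟩
  have hpoly : ∀ A : ℂ[X], A ≠ 0 → HasOrd q u (fun p => A.eval (x p)) := by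
    intro A hA
    obtain ⟨g, hg, hg'⟩ := exists_eq_pow_rootMultiplicity_mul_and_not_dvd A hA (x q)
    have hgq : g.eval (x q) ≠ 0 := fun h0 => hg' (dvd_iff_isRoot.2 h0)
    refine ((hux.pow (A.rootMultiplicity (x q))).mul
      (hasOrd_unit (regAt_eval hxq g) hgq)).congr (Eventually.of_forall fun p => ?_)
    conv_rhs => rw [hg]
    simp
  have hcop : ∀ A B : ℂ[X], IsCoprime A B →
      HasOrd q u (fun p => A.eval (x p) + B.eval (x p) * y p) := by
    intro A B hAB
    have hreg : ∀ A B : ℂ[X], Y.RegAt q (fun p => A.eval (x p) + B.eval (x p) * y p) :=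
      fun A B => Y.regAt_add _ _ _ (regAt_eval hxq A) (Y.regAt_mul _ _ _ (regAt_eval hxq B) hyq)
    by_cases h0 : A.eval (x q) + B.eval (x q) * y q = 0
    swap
    · exact hasOrd_unit (hreg A B) h0
    have hne : ¬ (A.eval (x q) = 0 ∧ B.eval (x q) = 0) := by
      rintro ⟨h1, h2⟩
      obtain ⟨a, b, hab⟩ := hAB
      have := congrArg (eval (x q)) hab
      simp [h1, h2] at this
    have hN := hpoly _ (sq_sub_mul_sq_ne_zero hf hdeg hAB)
    rcases hu with ⟨-, hyq0⟩ | ⟨rfl, hyq0⟩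
    -- `A + B y` and its conjugate cannot both vanish at `q`, for then `A` and `B` would; so the
    -- conjugate is a unit and `A + B y` has the order of the norm.
    · have h1 : A.eval (x q) + (-B).eval (x q) * y q ≠ 0 := by
        intro h1
        rw [eval_neg] at h1
        have h2 : A.eval (x q) = 0 := by linear_combination (h0 + h1) / 2
        rw [h2, zero_add] at h0
        exact hne ⟨h2, (mul_eq_zero.1 h0).resolve_right hyq0⟩
      refine (hN.mul ((hasOrd_unit (hreg A (-B)) h1).inv hY hune)).congr ?_
      filter_upwards [hxy, hY.eventually_ne (hreg A (-B)) h1] with p h2 h3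
      simp only [Pi.mul_apply, Pi.inv_apply]
      rw [← div_eq_mul_inv, div_eq_iff h3]
      simp only [eval_sub, eval_mul, eval_pow, eval_neg, ← h2]
      ring
    -- At a branch point `A` vanishes and `B` does not; writing `A = (X - x q) A₁` and `x - x q = y²
    -- / g(x)` leaves `y` times a unit.
    · rw [hyq0, mul_zero, add_zero] at h0
      have hB : B.eval (x q) ≠ 0 := fun h => hne ⟨h0, h⟩
      obtain ⟨A1, hA1⟩ := dvd_iff_isRoot.2 h0
      have hroot : f.IsRoot (x q) := by rw [IsRoot.def, ← hq, hyq0]; simp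
      obtain ⟨g, hg⟩ := dvd_iff_isRoot.2 hroot
      have hgq : g.eval (x q) ≠ 0 := by
        intro h0
        obtain ⟨a, b, hab⟩ := hf
        have := congrArg (eval (x q)) hab
        rw [hg] at this
        simp [h0] at this
      have hgr := regAt_eval hxq g
      have hv : Y.RegAt q (fun p => B.eval (x p) + A1.eval (x p) * u p * (g.eval (x p))⁻¹) :=
        Y.regAt_add _ _ _ (regAt_eval hxq B) (Y.regAt_mul _ _ _
          (Y.regAt_mul _ _ _ (regAt_eval hxq A1) hyq) (Y.regAt_inv _ _ hgr hgq))
      refine ⟨0, 1, _, hv, by simpa [hyq0] using hB, ?_⟩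
      filter_upwards [hxy, hY.eventually_ne hgr hgq] with p h1 h2
      simp only [Pi.mul_apply, Pi.one_apply, pow_zero, mul_one, pow_one]
      have h3 : (x p - x q) * g.eval (x p) = u p ^ 2 := by rw [h1, hg]; simp
      rw [hA1]
      simp only [eval_mul, eval_sub, eval_X, eval_C]
      field_simp
      linear_combination A1.eval (x p) * h3
  -- The general case follows by splitting off the greatest common divisor, a polynomial in `x`.
  set d := EuclideanDomain.gcd A B
  have hd : d ≠ 0 := fun h => hAB (EuclideanDomain.gcd_eq_zero_iff.1 h)
  obtain ⟨A', hA'⟩ := EuclideanDomain.gcd_dvd_left A B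
  obtain ⟨B', hB'⟩ := EuclideanDomain.gcd_dvd_right A B
  have hc : IsCoprime A' B' := by
    refine ⟨EuclideanDomain.gcdA A B, EuclideanDomain.gcdB A B, mul_left_cancel₀ hd ?_⟩
    have := EuclideanDomain.gcd_eq_gcd_ab A B
    calc d * _ = d * A' * EuclideanDomain.gcdA A B + d * B' * EuclideanDomain.gcdB A B := by ring
      _ = d * 1 := by rw [← hA', ← hB', ← this, mul_one]
  refine ((hpoly d hd).mul (hcop A' B' hc)).congr (Eventually.of_forall fun p => ?_)
  have e1 : A.eval (x p) = d.eval (x p) * A'.eval (x p) := by rw [← eval_mul, ← hA']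
  have e2 : B.eval (x p) = d.eval (x p) * B'.eval (x p) := by rw [← eval_mul, ← hB']
  simp only [Pi.mul_apply, e1, e2]
  ring

/-- A rational function is a quotient of two elements `A(x) + B(x) y`, so its order is a difference
of two orders; its sign decides between the two alternatives. -/
theorem exists_orders (hY : Y.IsCurve) (hxq : Y.RegAt q x) (hyq : Y.RegAt q y)
    (hxy : ∀ᶠ p in cofinite, y p ^ 2 = f.eval (x p)) (hf : f.Separable) (hdeg : f.degree ≠ 0)
    (hx : ∀ α, ∀ᶠ p in cofinite, x p ≠ α)
    (hgen : ∀ h, Y.IsRational h → ∃ P Q, InAB x y P ∧ InAB x y Q ∧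
      (∀ᶠ x in cofinite, Q x ≠ 0) ∧ h * Q =ᶠ[cofinite] P) :
    ∃ u : Y.carrier → ℂ, (u = (fun p => x p - x q) ∧ y q ≠ 0 ∨ u = y ∧ y q = 0) ∧
      Y.RegAt q u ∧ u q = 0 ∧
      ∀ h, Y.IsRational h → h =ᶠ[cofinite] 0 ∨
      ∃ (n : ℕ) (v : Y.carrier → ℂ), Y.RegAt q v ∧ v q ≠ 0 ∧
        (h =ᶠ[cofinite] u ^ n * v ∨ h * u ^ n =ᶠ[cofinite] v) := by
  obtain ⟨u, hu, hur, hu0, hune, hord⟩ := exists_hasOrd hY hxq hyq hxy hf hdeg hx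
  refine ⟨u, hu, hur, hu0, fun h hh => ?_⟩
  obtain ⟨P, Q, ⟨A, B, hP⟩, ⟨A', B', hQ⟩, hQ0, hPQ⟩ := hgen h hh
  by_cases h0 : A = 0 ∧ B = 0
  · left
    filter_upwards [hP, hQ0, hPQ] with p h1 h2 h3
    simp only [Pi.mul_apply, h1, h0.1, h0.2, eval_zero, zero_mul, add_zero, mul_eq_zero] at h3
    exact h3.resolve_right h2
  right
  have h0' : ¬ (A' = 0 ∧ B' = 0) := by
    rintro ⟨rfl, rfl⟩
    obtain ⟨p, h1, h2⟩ := hY.eventually_exists (hQ.and hQ0)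
    exact h2 (by simpa using h1)
  have h3 : HasOrd q u h := by
    refine ((hord A B h0).mul ((hord A' B' h0').inv hY hune)).congr ?_
    filter_upwards [hP, hQ, hQ0, hPQ] with p h1 h2 h3 h4
    simp only [Pi.mul_apply, Pi.inv_apply] at h4 ⊢
    rw [← h1, ← h2, ← h4, mul_inv_cancel_right₀ h3]
  obtain ⟨a, b, v, hv, hv0, e⟩ := h3
  rcases le_total a b with hab | hab
  · refine ⟨b - a, v, hv, hv0, .inl ?_⟩
    filter_upwards [e, hune] with p h1 h2
    refine mul_right_cancel₀ (pow_ne_zero a h2) (h1.trans ?_)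
    simp only [Pi.mul_apply, Pi.pow_apply]
    rw [← Nat.sub_add_cancel hab, pow_add, Nat.add_sub_cancel]
    ring
  · refine ⟨a - b, v, hv, hv0, .inr ?_⟩
    filter_upwards [e, hune] with p h1 h2
    refine mul_right_cancel₀ (pow_ne_zero b h2) ?_
    simp only [Pi.mul_apply, Pi.pow_apply] at h1 ⊢
    rw [mul_assoc, ← pow_add, Nat.sub_add_cancel hab, h1]
    ring

end Hyperelliptic

end FunSpace


/-! ### Homogeneous polynomials and subsets of projective space -/

open MvPolynomial in
theorem MvPolynomial.IsHomogeneous.eval_smul_eq {σ : Type*} [Fintype σ] {P : MvPolynomial σ ℂ}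
    {d : ℕ} (hP : P.IsHomogeneous d) (c : ℂ) (v : σ → ℂ) :
    eval (c • v) P = c ^ d * eval v P := by
  simp only [eval_eq', Finset.mul_sum]
  refine Finset.sum_congr rfl fun e he => ?_
  have hd : ∑ i, e i = d := by
    have := hP (mem_support_iff.1 he)
    rw [Finsupp.weight_apply, Finsupp.sum_fintype _ _ (by simp)] at this
    simpa using this
  simp only [Pi.smul_apply, smul_eq_mul, mul_pow, Finset.prod_mul_distrib]
  rw [Finset.prod_pow_eq_pow_sum, hd]
  ring

theorem Projectivization.exists_rep_eq {n : ℕ} {p : ℙ ℂ (Fin n → ℂ)} {v : Fin n → ℂ} {hv : v ≠ 0}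
    (h : p = Projectivization.mk ℂ v hv) : ∃ a : ℂ, a ≠ 0 ∧ p.rep = a • v := by
  obtain ⟨a, ha⟩ := Projectivization.exists_smul_eq_mk_rep ℂ v hv
  exact ⟨a, a.ne_zero, by rw [h, ← ha]; rfl⟩

namespace FunSpace

open Filter MvPolynomial

variable {n m : ℕ} {S : Set (ℙ ℂ (Fin n → ℂ))} {T : Set (ℙ ℂ (Fin m → ℂ))}

theorem isOpen_eval_ne_zero (S : Set (ℙ ℂ (Fin n → ℂ))) {d : ℕ} {P : MvPolynomial (Fin n) ℂ}
    (hP : P.IsHomogeneous d) :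
    IsOpen {p : (projectiveSubspace S).carrier | eval p.val.rep P ≠ 0} :=
  @isOpen_induced _ _ (zariskiTopology n) Subtype.val _
    (TopologicalSpace.isOpen_generateFrom_of_mem ⟨d, P, hP, rfl⟩)

theorem regAt_eval_div {p : (projectiveSubspace S).carrier} {d : ℕ} {P Q : MvPolynomial (Fin n) ℂ}
    (hP : P.IsHomogeneous d) (hQ : Q.IsHomogeneous d) (h : eval p.val.rep Q ≠ 0) :
    (projectiveSubspace S).RegAt p (fun q => eval q.val.rep P / eval q.val.rep Q) :=
  ⟨d, P, Q, hP, hQ, h, Eventually.of_forall fun _ => rfl⟩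

/-- A map given by homogeneous polynomials of the same degree is a morphism. -/
theorem continuous_and_regAt_comp_of_polynomial
    {φ : (projectiveSubspace S).carrier → (projectiveSubspace T).carrier} {e : ℕ}
    (ψ : Fin m → MvPolynomial (Fin n) ℂ) (hψ : ∀ i, (ψ i).IsHomogeneous e)
    (h : ∀ p, ∃ hne, (φ p).val = Projectivization.mk ℂ (fun i => eval p.val.rep (ψ i)) hne) :
    Continuous φ ∧ ∀ p f, (projectiveSubspace T).RegAt (φ p) f →
      (projectiveSubspace S).RegAt p (f ∘ φ) := by
  -- `rep` is an arbitrary representative, so the coordinates of `φ p` agree with the polynomials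
  -- only up to a scalar `a`; homogeneity turns it into `a ^ d`, which cancels in quotients.
  have key : ∀ p, ∃ a : ℂ, a ≠ 0 ∧ ∀ (d : ℕ) (P : MvPolynomial (Fin m) ℂ), P.IsHomogeneous d →
      eval (φ p).val.rep P = a ^ d * eval p.val.rep (aeval ψ P) := by
    intro p
    obtain ⟨hne, hp⟩ := h p
    obtain ⟨a, ha, hrep⟩ := Projectivization.exists_rep_eq hp
    refine ⟨a, ha, fun d P hP => ?_⟩
    rw [hrep, hP.eval_smul_eq]
    congr 1
    have : (eval p.val.rep).comp (aeval ψ : MvPolynomial (Fin m) ℂ →ₐ[ℂ] _).toRingHom =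
        eval (fun i => eval p.val.rep (ψ i)) := by
      apply MvPolynomial.ringHom_ext <;> simp
    exact (RingHom.congr_fun this P).symm
  have hc : Continuous φ := by
    refine continuous_induced_rng.2 (continuous_generateFrom_iff.2 ?_)
    rintro _ ⟨d, P, hP, rfl⟩
    convert isOpen_eval_ne_zero S (hP.aeval ψ hψ) using 1
    ext p
    obtain ⟨a, ha, hk⟩ := key p
    change eval (φ p).val.rep P ≠ 0 ↔ eval p.val.rep (aeval ψ P) ≠ 0
    rw [hk d P hP, mul_ne_zero_iff, and_iff_right (pow_ne_zero _ ha)]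
  refine ⟨hc, ?_⟩
  rintro p f ⟨d, P, Q, hP, hQ, hQp, hf⟩
  refine ⟨e * d, aeval ψ P, aeval ψ Q, hP.aeval ψ hψ, hQ.aeval ψ hψ, ?_, ?_⟩
  · obtain ⟨a, ha, hk⟩ := key p
    rw [hk d Q hQ] at hQp
    exact right_ne_zero_of_mul hQp
  · have := hc.tendsto p hf
    filter_upwards [this] with q hq
    obtain ⟨a, ha, hk⟩ := key q
    change f (φ q) = _
    rw [hq, hk d P hP, hk d Q hQ, mul_div_mul_left _ _ (pow_ne_zero _ ha)]

/-- A linear form that vanishes at `p` but not at `q`. -/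
theorem exists_linear_form {p q : ℙ ℂ (Fin n → ℂ)} (h : p ≠ q) :
    ∃ P : MvPolynomial (Fin n) ℂ, P.IsHomogeneous 1 ∧ eval p.rep P = 0 ∧ eval q.rep P ≠ 0 := by
  by_contra! hne
  apply h
  -- The `2 × 2` minors with `p` are linear forms vanishing at `p`; if all of them vanish at `q`,
  -- the two vectors are proportional.
  have hij : ∀ i j, p.rep i * q.rep j = p.rep j * q.rep i := by
    intro i j
    have h1 := hne (C (p.rep i) * X j - C (p.rep j) * X i)
      (((isHomogeneous_X ℂ j).C_mul _).sub ((isHomogeneous_X ℂ i).C_mul _)) (by simp; ring)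
    simpa [sub_eq_zero] using h1
  obtain ⟨i, hi⟩ := Function.ne_iff.1 p.rep_nonzero
  rw [← p.mk_rep, ← q.mk_rep, Projectivization.mk_eq_mk_iff']
  have hqi : q.rep i ≠ 0 := by
    intro h0
    apply q.rep_nonzero
    ext j
    have := hij i j
    rw [h0, mul_zero] at this
    exact (mul_eq_zero.1 this).resolve_left hi
  refine ⟨p.rep i / q.rep i, ?_⟩
  ext j
  simp only [Pi.smul_apply, smul_eq_mul]
  rw [div_mul_eq_mul_div, div_eq_iff hqi, hij]

theorem isClosed_singleton_projectiveSubspace (p : (projectiveSubspace S).carrier) :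
    IsClosed {p} := by
  rw [← isOpen_compl_iff, isOpen_iff_mem_nhds]
  intro q hq
  obtain ⟨P, hP, hp, hq'⟩ := exists_linear_form (p := p.val) (q := q.val)
    fun h => hq (Subtype.ext h.symm)
  refine mem_nhds_iff.2 ⟨_, fun r hr => ?_, isOpen_eval_ne_zero S hP, hq'⟩
  rintro rfl
  exact hr hp

/-- It is enough to look at the basic open sets: being empty or cofinite passes to finite
intersections and to unions. Conversely finite sets are closed because linear forms separate points.
-/
theorem isCurve_projectiveSubspace [Infinite S]
    (h : ∀ (d : ℕ) (P : MvPolynomial (Fin n) ℂ), P.IsHomogeneous d →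
      (∃ p ∈ S, eval p.rep P ≠ 0) → {p : S | eval p.val.rep P = 0}.Finite) :
    (projectiveSubspace S).IsCurve := by
  have hbasic : ∀ t, TopologicalSpace.GenerateOpen {U | ∃ (d : ℕ) (P : MvPolynomial (Fin n) ℂ),
      P.IsHomogeneous d ∧ U = {p | MvPolynomial.eval p.rep P ≠ 0}} t →
      (∀ p : S, p.val ∉ t) ∨ {p : S | p.val ∉ t}.Finite := by
    intro t ht
    induction ht with
    | basic t ht =>
      obtain ⟨d, P, hP, rfl⟩ := ht
      by_cases hne : ∃ p ∈ S, eval p.rep P ≠ 0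
      · exact .inr ((h d P hP hne).subset fun p hp => by simpa using hp)
      · push Not at hne
        exact .inl fun p => by simpa using hne p.val p.property
    | univ => right; simp
    | inter s t _ _ hs ht =>
      rcases hs with hs | hs
      · exact .inl fun p hp => hs p hp.1
      rcases ht with ht | ht
      · exact .inl fun p hp => ht p hp.2
      · refine .inr ((hs.union ht).subset fun p hp => ?_)
        by_contra hne
        simp only [Set.mem_union, Set.mem_ofPred_eq, not_or, not_not] at hne
        exact hp hne
    | sUnion U _ ih =>
      by_cases hU : ∃ s ∈ U, ∃ p : S, p.val ∈ s
      · obtain ⟨s, hs, p, hp⟩ := hU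
        exact .inr (((ih s hs).resolve_left fun h => h p hp).subset
          fun q hq hqs => hq ⟨s, hs, hqs⟩)
      · push Not at hU
        refine .inl fun p hp => ?_
        obtain ⟨s, hs, hp⟩ := hp
        exact hU s hs p hp
  refine ⟨inferInstanceAs (Infinite S), fun s => ⟨?_, ?_⟩⟩
  · rintro ⟨t, ht, rfl⟩
    refine (hbasic t ht).imp (fun h => Set.eq_empty_of_forall_notMem h) fun h => h
  rintro (rfl | hs)
  · exact isOpen_empty
  · rw [← isClosed_compl_iff, ← Set.biUnion_of_singleton sᶜ]
    exact hs.isClosed_biUnion fun p _ => isClosed_singleton_projectiveSubspace p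

theorem IsRational.exists_eval_div (hS : (projectiveSubspace S).IsCurve)
    {h : (projectiveSubspace S).carrier → ℂ} (hh : (projectiveSubspace S).IsRational h) :
    ∃ (d : ℕ) (P Q : MvPolynomial (Fin n) ℂ), P.IsHomogeneous d ∧ Q.IsHomogeneous d ∧
      (∀ᶠ p : (projectiveSubspace S).carrier in cofinite, eval p.val.rep Q ≠ 0) ∧
      ∀ᶠ p : (projectiveSubspace S).carrier in cofinite, h p = eval p.val.rep P / eval p.val.rep Q := by
  obtain ⟨p, d, P, Q, hP, hQ, hQp, hf⟩ := hS.eventually_exists hh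
  exact ⟨d, P, Q, hP, hQ,
    (hS.eventually_nhds.1 (zariskiInduced_eventually_ne S p d Q hQ hQp)).2,
    (hS.eventually_nhds.1 hf).2⟩

/-- Rational functions in terms of a parametrization of the homogeneous coordinates. -/
theorem IsRational.exists_eval (hS : (projectiveSubspace S).IsCurve)
    {h : (projectiveSubspace S).carrier → ℂ} (hh : (projectiveSubspace S).IsRational h)
    (ψ : (projectiveSubspace S).carrier → Fin n → ℂ)
    (hψ : ∀ᶠ p : (projectiveSubspace S).carrier in cofinite, ∃ a : ℂ, a ≠ 0 ∧ p.val.rep = a • ψ p) :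
    ∃ P Q : MvPolynomial (Fin n) ℂ, (∀ᶠ p in cofinite, eval (ψ p) Q ≠ 0) ∧
      h * (fun p => eval (ψ p) Q) =ᶠ[cofinite] fun p => eval (ψ p) P := by
  obtain ⟨d, P, Q, hP, hQ, hQ0, e⟩ := hh.exists_eval_div hS
  refine ⟨P, Q, ?_, ?_⟩
  · filter_upwards [hQ0, hψ] with p h1 ⟨a, ha, h2⟩ h3
    rw [h2, hQ.eval_smul_eq, h3, mul_zero] at h1
    exact h1 rfl
  · filter_upwards [hQ0, hψ, e] with p h1 ⟨a, ha, h2⟩ h3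
    have h4 : eval (ψ p) Q ≠ 0 := by
      intro h4
      rw [h2, hQ.eval_smul_eq, h4, mul_zero] at h1
      exact h1 rfl
    simp only [Pi.mul_apply]
    rw [h3, h2, hP.eval_smul_eq, hQ.eval_smul_eq, mul_div_mul_left _ _ (pow_ne_zero _ ha),
      div_mul_cancel₀ _ h4]

end FunSpace


/-! ### Bring's curve has the cofinite topology -/

/-- The vectors satisfying the equations of Bring's curve. -/
def IsBring (v : Fin 5 → ℂ) : Prop :=
  ∑ i, v i = 0 ∧ ∑ i, v i ^ 2 = 0 ∧ ∑ i, v i ^ 3 = 0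

/-- The point set of Bring's curve. -/
abbrev bringSet : Set (ℙ ℂ (Fin 5 → ℂ)) :=
  zeroLocus {MvPolynomial.psum (Fin 5) ℂ 1, MvPolynomial.psum (Fin 5) ℂ 2,
    MvPolynomial.psum (Fin 5) ℂ 3}

theorem mem_bringSet {p : ℙ ℂ (Fin 5 → ℂ)} : p ∈ bringSet ↔ IsBring p.rep := by
  simp [zeroLocus, IsBring, MvPolynomial.psum]

theorem IsBring.smul {v : Fin 5 → ℂ} (h : IsBring v) (c : ℂ) : IsBring (c • v) := by
  obtain ⟨h1, h2, h3⟩ := h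
  refine ⟨?_, ?_, ?_⟩ <;>
    simp only [Pi.smul_apply, smul_eq_mul, mul_pow, ← Finset.mul_sum, h1, h2, h3, mul_zero]

theorem mk_mem_bringSet {v : Fin 5 → ℂ} (hv : v ≠ 0) :
    Projectivization.mk ℂ v hv ∈ bringSet ↔ IsBring v := by
  obtain ⟨a, ha, h⟩ := Projectivization.exists_rep_eq (p := Projectivization.mk ℂ v hv) rfl
  rw [mem_bringSet, h]
  refine ⟨fun h => ?_, fun h => h.smul a⟩
  simpa [smul_smul, inv_mul_cancel₀ ha] using h.smul a⁻¹

namespace IsBring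

open MvPolynomial

theorem esymm_isHomogeneous (k : ℕ) : (esymm (Fin 5) ℂ k).IsHomogeneous k := by
  rw [esymm]
  refine IsHomogeneous.sum _ _ _ fun s hs => ?_
  have := IsHomogeneous.prod s (fun i => (X i : MvPolynomial (Fin 5) ℂ)) (fun _ => 1)
    fun i _ => isHomogeneous_X ℂ i
  rwa [Finset.sum_const, smul_eq_mul, mul_one, (Finset.mem_powersetCard.1 hs).2] at this

/-- By Newton's identities the power sums and the elementary symmetric functions up to degree three
vanish together; `of_eval_esymm` is the converse. -/
theorem eval_esymm {v : Fin 5 → ℂ} (h : IsBring v) :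
    eval v (esymm (Fin 5) ℂ 1) = 0 ∧ eval v (esymm (Fin 5) ℂ 2) = 0 ∧
      eval v (esymm (Fin 5) ℂ 3) = 0 := by
  obtain ⟨h1, h2, h3⟩ := h
  have e1 : eval v (esymm (Fin 5) ℂ 1) = 0 := by
    simpa [esymm_one] using h1
  have e2 : eval v (esymm (Fin 5) ℂ 2) = 0 := by
    have := congrArg (eval v) (mul_esymm_eq_sum (Fin 5) ℂ 2)
    simpa [Finset.sum_filter, Finset.Nat.sum_antidiagonal_eq_sum_range_succ_mk,
      Finset.sum_range_succ, psum, -esymm_one, h1, h2, e1] using this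
  refine ⟨e1, e2, ?_⟩
  have := congrArg (eval v) (mul_esymm_eq_sum (Fin 5) ℂ 3)
  simpa [Finset.sum_filter, Finset.Nat.sum_antidiagonal_eq_sum_range_succ_mk,
      Finset.sum_range_succ, psum, -esymm_one, h1, h2, h3, e1, e2] using this

theorem of_eval_esymm {v : Fin 5 → ℂ} (h1 : eval v (esymm (Fin 5) ℂ 1) = 0)
    (h2 : eval v (esymm (Fin 5) ℂ 2) = 0) (h3 : eval v (esymm (Fin 5) ℂ 3) = 0) : IsBring v := by
  have p1 : eval v (psum (Fin 5) ℂ 1) = 0 := by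
    rw [psum_one, ← esymm_one, h1]
  have p2 : eval v (psum (Fin 5) ℂ 2) = 0 := by
    rw [psum_eq_mul_esymm_sub_sum _ _ 2 (by norm_num)]
    simp [Finset.sum_filter, Finset.Nat.sum_antidiagonal_eq_sum_range_succ_mk,
      Finset.sum_range_succ, -esymm_one, h1, h2]
  have p3 : eval v (psum (Fin 5) ℂ 3) = 0 := by
    rw [psum_eq_mul_esymm_sub_sum _ _ 3 (by norm_num)]
    simp [Finset.sum_filter, Finset.Nat.sum_antidiagonal_eq_sum_range_succ_mk,
      Finset.sum_range_succ, -esymm_one, h1, h2, h3]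
  exact ⟨by simpa [psum] using p1, by simpa [psum] using p2, by simpa [psum] using p3⟩

/-- Every pair is the pair of fourth and fifth elementary symmetric functions of a Bring vector. -/
theorem exists_eval_esymm (a b : ℂ) : ∃ v : Fin 5 → ℂ, IsBring v ∧
    eval v (esymm (Fin 5) ℂ 4) = a ∧ eval v (esymm (Fin 5) ℂ 5) = b := by
  -- The coordinates are the roots of `X⁵ + aX - b`; its missing terms are the three vanishing
  -- symmetric functions.
  set P : Polynomial ℂ := .X ^ 5 + (.C a * .X - .C b) with hP
  have hd : (.C a * .X - .C b : Polynomial ℂ).degree < ((5 : ℕ) : WithBot ℕ) := by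
    refine lt_of_le_of_lt (b := ((1 : ℕ) : WithBot ℕ)) ?_ (by norm_num)
    compute_degree
    norm_num
  have hmon : P.Monic := Polynomial.monic_X_pow_add hd
  have hdeg : P.natDegree = 5 := by
    rw [hP, Polynomial.natDegree_add_eq_left_of_degree_lt (by rwa [Polynomial.degree_X_pow]),
      Polynomial.natDegree_X_pow]
  have hcard : Multiset.card P.roots = P.natDegree :=
    Polynomial.splits_iff_card_roots.1 (IsAlgClosed.splits P)
  obtain ⟨v, hv⟩ : ∃ v : Fin 5 → ℂ, Finset.univ.val.map v = P.roots := by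
    have hl : P.roots.toList.length = 5 := by rw [Multiset.length_toList, hcard, hdeg]
    refine ⟨fun i => P.roots.toList[i], ?_⟩
    conv_rhs => rw [← P.roots.coe_toList]
    rw [Fin.univ_val_map]
    congr 1
    refine List.ext_getElem (by simp [hl]) fun i h1 h2 => by rw [List.getElem_ofFn]; rfl
  have hco : ∀ k, k ≤ 5 → P.coeff k = (-1) ^ (5 - k) * eval v (esymm (Fin 5) ℂ (5 - k)) := by
    intro k hk
    rw [Polynomial.coeff_eq_esymm_roots_of_card hcard (hk.trans_eq hdeg.symm), hmon.leadingCoeff,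
      one_mul, hdeg, ← hv, ← aeval_esymm_eq_multiset_esymm (Fin 5) ℂ (5 - k) v]
    rfl
  have c0 := hco 0 (by norm_num)
  have c1 := hco 1 (by norm_num)
  have c2 := hco 2 (by norm_num)
  have c3 := hco 3 (by norm_num)
  have c4 := hco 4 (by norm_num)
  simp only [hP, Polynomial.coeff_add, Polynomial.coeff_sub, Polynomial.coeff_C_mul,
    Polynomial.coeff_X_pow, Polynomial.coeff_X, Polynomial.coeff_C] at c0 c1 c2 c3 c4
  norm_num [-esymm_one] at c0 c1 c2 c3 c4
  exact ⟨v, of_eval_esymm (by simpa using c4) c3.symm (by simpa using c2), c1.symm, c0.symm⟩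

/-- All five elementary symmetric functions vanish, so `∏ (z + v i) = z ^ 5`; now put `z = -v i`. -/
theorem eq_zero {v : Fin 5 → ℂ} (h : IsBring v) (h4 : eval v (esymm (Fin 5) ℂ 4) = 0)
    (h5 : eval v (esymm (Fin 5) ℂ 5) = 0) : v = 0 := by
  obtain ⟨h1, h2, h3⟩ := h.eval_esymm
  have key : ∀ z : ℂ, ∏ i, (z + v i) = z ^ 5 := by
    intro z
    have h6 := congrArg (Polynomial.eval z)
      (congrArg (Polynomial.map (eval v)) (prod_C_add_X_eq_sum_esymm ℂ (Fin 5)))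
    simpa [Finset.sum_range_succ, Polynomial.eval_prod, Polynomial.map_prod, -esymm_one, h1, h2, h3, h4,
      h5] using h6
  ext i
  have := key (-v i)
  rw [Finset.prod_eq_zero (Finset.mem_univ i) (by ring)] at this
  simpa using this.symm

/-- A homogeneous polynomial that vanishes at almost all points of Bring's curve vanishes on it. -/
theorem eval_eq_zero_of_finite {d : ℕ} {P : MvPolynomial (Fin 5) ℂ} (hP : P.IsHomogeneous d)
    (hfin : {p : bringSet | eval p.val.rep P ≠ 0}.Finite) {v : Fin 5 → ℂ} (hv : IsBring v) :
    eval v P = 0 := by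
  classical
  by_contra hne
  -- The constant makes the factor `σ = 1` of `N` vanish at `v`, while `N = 1` at every Bring vector
  -- all of whose permutations are zeros of `P`.
  set c : ℂ := -(eval v P)⁻¹ with hc
  set N : MvPolynomial (Fin 5) ℂ := ∏ σ : Equiv.Perm (Fin 5), (1 + C c * rename σ P) with hN
  have hsymm : N.IsSymmetric := by
    intro τ
    rw [hN, map_prod]
    refine Fintype.prod_equiv (Equiv.mulLeft τ) _ _ fun σ => ?_
    simp [rename_rename]
  obtain ⟨Q, hQ⟩ := esymmAlgHom_surjective (σ := Fin 5) ℂ (n := 5) (by simp) ⟨N, hsymm⟩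
  have hQ' : aeval (fun i : Fin 5 => esymm (Fin 5) ℂ (i + 1)) Q = N := by
    rw [← esymmAlgHom_apply, hQ]
  -- On Bring vectors the symmetric polynomial `N` depends only on the last two elementary symmetric
  -- functions, and does so polynomially.
  have hev : ∀ x : Fin 5 → ℂ, IsBring x → eval x N =
      eval ![0, 0, 0, eval x (esymm (Fin 5) ℂ 4), eval x (esymm (Fin 5) ℂ 5)] Q := by
    intro x hx
    obtain ⟨h1, h2, h3⟩ := hx.eval_esymm
    rw [← hQ']
    have h6 : (eval x).comp (aeval (fun i : Fin 5 => esymm (Fin 5) ℂ (i + 1)) :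
        MvPolynomial (Fin 5) ℂ →ₐ[ℂ] _).toRingHom =
        eval (fun i : Fin 5 => eval x (esymm (Fin 5) ℂ (i + 1))) := by
      apply MvPolynomial.ringHom_ext <;> simp
    refine (RingHom.congr_fun h6 Q).trans ?_
    congr 2
    ext i
    fin_cases i <;> simp [-esymm_one, h1, h2, h3]
  have hrep : ∀ p : bringSet, IsBring p.val.rep := fun p => mem_bringSet.1 p.property
  set Z := hfin.toFinset
  let e4 : (Fin 5 → ℂ) → ℂ := fun x => eval x (esymm (Fin 5) ℂ 4)
  let e5 : (Fin 5 → ℂ) → ℂ := fun x => eval x (esymm (Fin 5) ℂ 5)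
  -- The factor for `z` vanishes at `(e₄, e₅)` of every multiple of `z`, both terms having degree
  -- 20; the factor `X 0` keeps away from the zero vector. Off these curves `N = 1`, so `R` vanishes
  -- on the whole plane, and therefore `N = 1` on all Bring vectors, in contradiction to its value
  -- at `v`.
  set R : MvPolynomial (Fin 2) ℂ := (bind₁ ![0, 0, 0, X 0, X 1] Q - 1) * X 0 *
    ∏ z ∈ Z, (C (e5 z.val.rep ^ 4) * X 0 ^ 5 - C (e4 z.val.rep ^ 5) * X 1 ^ 4) with hR
  have hbind : ∀ a : Fin 2 → ℂ, eval a (bind₁ ![0, 0, 0, X 0, X 1] Q) =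
      eval ![0, 0, 0, a 0, a 1] Q := by
    intro a
    have h6 : (eval a).comp (bind₁ ![0, 0, 0, X 0, X 1] :
        MvPolynomial (Fin 5) ℂ →ₐ[ℂ] MvPolynomial (Fin 2) ℂ).toRingHom =
        eval ![0, 0, 0, a 0, a 1] := by
      apply MvPolynomial.ringHom_ext
      · simp
      · intro i
        fin_cases i <;> simp
    exact RingHom.congr_fun h6 Q
  have hR0 : R = 0 := by
    refine MvPolynomial.funext fun a => ?_
    obtain ⟨x, hx, hx4, hx5⟩ := exists_eval_esymm (a 0) (a 1)
    rw [hR, map_mul, map_mul, map_sub, hbind, map_one, map_zero, mul_eq_zero,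
      or_iff_not_imp_right, mul_eq_zero, or_iff_not_imp_right, eval_X]
    intro hprod ha0
    rw [map_prod, Finset.prod_eq_zero_iff] at hprod
    push Not at hprod
    have h7 := hev x hx
    rw [hx4, hx5] at h7
    rw [← h7, hN, map_prod, sub_eq_zero]
    refine Finset.prod_eq_one fun σ _ => ?_
    simp only [map_add, map_one, map_mul, eval_C, eval_rename]
    by_contra hne2
    have hPne : eval (x ∘ σ) P ≠ 0 := fun h => hne2 (by rw [h]; simp)
    have hxσ : IsBring (x ∘ σ) := by
      obtain ⟨h1, h2, h3⟩ := hx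
      exact ⟨(Equiv.sum_comp σ x).trans h1, (Equiv.sum_comp σ fun i => x i ^ 2).trans h2,
        (Equiv.sum_comp σ fun i => x i ^ 3).trans h3⟩
    have hσ0 : x ∘ σ ≠ 0 := by
      intro h0
      have hx0 : x = 0 := funext fun i => by simpa using congrFun h0 (σ.symm i)
      apply ha0
      rw [← hx4, hx0, ← zero_smul ℂ (0 : Fin 5 → ℂ), (esymm_isHomogeneous 4).eval_smul_eq]
      simp
    obtain ⟨l, hl, hrepl⟩ := Projectivization.exists_rep_eq
      (p := Projectivization.mk ℂ (x ∘ σ) hσ0) rfl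
    have hz : (⟨Projectivization.mk ℂ (x ∘ σ) hσ0, (mk_mem_bringSet hσ0).2 hxσ⟩ : bringSet) ∈ Z := by
      simp only [Z, Set.Finite.mem_toFinset, Set.mem_ofPred_eq]
      rw [hrepl, hP.eval_smul_eq]
      exact mul_ne_zero (pow_ne_zero _ hl) hPne
    apply hprod _ hz
    have hs4 : eval (x ∘ σ) (esymm (Fin 5) ℂ 4) = a 0 := by
      rw [← hx4, ← eval_rename, rename_esymm]
    have hs5 : eval (x ∘ σ) (esymm (Fin 5) ℂ 5) = a 1 := by
      rw [← hx5, ← eval_rename, rename_esymm]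
    simp only [e4, e5, hrepl, (esymm_isHomogeneous 4).eval_smul_eq,
      (esymm_isHomogeneous 5).eval_smul_eq, hs4, hs5, map_sub, map_mul, map_pow, eval_C, eval_X]
    ring
  rw [hR, mul_eq_zero, mul_eq_zero] at hR0
  rcases hR0 with (h | h) | h
  · have h7 := hev v hv
    have h8 := hbind ![e4 v, e5 v]
    rw [sub_eq_zero.1 h, map_one] at h8
    have h9 : eval v N = 1 := h7.trans h8.symm
    rw [hN, map_prod, Finset.prod_eq_zero (Finset.mem_univ (1 : Equiv.Perm (Fin 5)))] at h9
    · exact zero_ne_one h9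
    · simp [hc, hne]
  · exact X_ne_zero _ h
  · rw [Finset.prod_eq_zero_iff] at h
    obtain ⟨z, -, h⟩ := h
    have h5 := congrArg (eval ![1, 0]) h
    have h4 := congrArg (eval ![0, 1]) h
    simp at h4 h5
    exact z.val.rep_nonzero ((hrep z).eq_zero h4 h5)

end IsBring


namespace IsBring

section Biquadratic

open Polynomial

/-- The polynomial `2 X³ - 5 X² - 25`. -/
noncomputable def cubicPlus : ℂ[X] := 2 * X ^ 3 - 5 * X ^ 2 - 25

/-- The polynomial `-2 X³ - 5 X² - 25`. -/
noncomputable def cubicMinus : ℂ[X] := -2 * X ^ 3 - 5 * X ^ 2 - 25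

theorem cubicPlus_separable : cubicPlus.Separable := by
  -- The witnesses here and in the later separability proofs are Bézout coefficients for the
  -- polynomial and its derivative.
  refine ⟨C (9 / 25 / 576) * (6 * X - 64),
    C (1 / 576) - C (9 / 25 / 576) * (6 * X - 64) * (C (1 / 3) * X - C (5 / 18)), ?_⟩
  refine Polynomial.funext fun r => ?_
  simp [cubicPlus]
  ring

theorem cubicMinus_separable : cubicMinus.Separable := by
  refine ⟨C (9 / 25 / 576) * (-6 * X - 64),
    -(C (1 / 576) - C (9 / 25 / 576) * (-6 * X - 64) * (-C (1 / 3) * X - C (5 / 18))), ?_⟩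
  refine Polynomial.funext fun r => ?_
  simp [cubicMinus]
  ring

theorem cubicPlus_degree : cubicPlus.degree ≠ 0 := by
  have : cubicPlus.degree = 3 := by
    rw [cubicPlus]
    compute_degree!
  rw [this]
  decide

theorem cubicMinus_degree : cubicMinus.degree ≠ 0 := by
  have : cubicMinus.degree = 3 := by
    rw [cubicMinus]
    compute_degree!
  rw [this]
  decide

/-- Common factors `X - r` are removed until some member of the family is nonzero at `r`; valuation
arguments at `r` then need no coprimality. -/
theorem exists_factor_at {ι : Type} (f : ι → ℂ[X]) (r : ℂ) (hf : ∃ i, f i ≠ 0) :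
    ∃ (d : ℂ[X]) (f' : ι → ℂ[X]), d ≠ 0 ∧ (∀ i, f i = d * f' i) ∧ ∃ i, (f' i).eval r ≠ 0 := by
  obtain ⟨i, hi⟩ := hf
  induction hn : (f i).natDegree using Nat.strong_induction_on generalizing f with
  | _ n ih =>
    by_cases h : ∃ i, (f i).eval r ≠ 0
    · exact ⟨1, f, one_ne_zero, fun i => (one_mul _).symm, h⟩
    push Not at h
    choose g hg using fun i => dvd_iff_isRoot.2 (h i)
    have hgi : g i ≠ 0 := by
      intro h0
      exact hi (by rw [hg, h0, mul_zero])
    have hdeg : (g i).natDegree < n := by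
      rw [← hn, hg i, natDegree_mul (X_sub_C_ne_zero r) hgi, natDegree_X_sub_C]
      omega
    obtain ⟨d, f', hd, hf', hj⟩ := ih _ hdeg g hgi rfl
    exact ⟨(X - C r) * d, f', mul_ne_zero (X_sub_C_ne_zero r) hd,
      fun i => by rw [hg, hf', mul_assoc], hj⟩

theorem eval_ne_zero_of_separable {f g : ℂ[X]} {r : ℂ} (hf : f.Separable) (h : f = (X - C r) * g) :
    g.eval r ≠ 0 := by
  intro h0
  obtain ⟨a, b, hab⟩ := hf
  have := congrArg (eval r) hab
  rw [h] at this
  simp [h0] at this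

/-- At a simple root of `f` the left side has even valuation and the right side odd valuation. -/
theorem sq_ne_mul_sq {f A B : ℂ[X]} (hf : f.Separable) (hdeg : f.degree ≠ 0)
    (h : A ^ 2 = B ^ 2 * f) : A = 0 ∧ B = 0 := by
  by_contra hne
  obtain ⟨r, hr⟩ := IsAlgClosed.exists_root f hdeg
  obtain ⟨g, hg⟩ := dvd_iff_isRoot.2 hr
  have hgr := eval_ne_zero_of_separable hf hg
  obtain ⟨d, F, hd, hF, i, hi⟩ := exists_factor_at ![A, B] r (by
    by_contra! h0
    exact hne ⟨h0 0, h0 1⟩)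
  have h0 : A = d * F 0 := hF 0
  have h1 : B = d * F 1 := hF 1
  have e : F 0 ^ 2 = F 1 ^ 2 * ((X - C r) * g) := by
    refine mul_left_cancel₀ (pow_ne_zero 2 hd) ?_
    rw [← hg, ← mul_pow, ← h0, h, h1]
    ring
  have h2 : (F 0).eval r = 0 := by simpa using congrArg (eval r) e
  obtain ⟨A1, hA1⟩ := dvd_iff_isRoot.2 h2
  have e' : (X - C r) * A1 ^ 2 = F 1 ^ 2 * g := by
    refine mul_left_cancel₀ (X_sub_C_ne_zero r) ?_
    rw [hA1] at e
    linear_combination e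
  have h3 : (F 1).eval r = 0 := by simpa [hgr] using congrArg (eval r) e'
  fin_cases i
  · exact hi h2
  · exact hi h3

/-- The norm of `α + β a + γ b + δ a b` to the polynomials in `T`, where `a² = cubicPlus(T)` and
`b² = cubicMinus(T)`, is nonzero. -/
theorem exists_norm {α β γ δ : ℂ[X]} (h : ¬ (α = 0 ∧ β = 0 ∧ γ = 0 ∧ δ = 0)) :
    ∃ N : ℂ[X], N ≠ 0 ∧ ∀ T a b : ℂ, a ^ 2 = cubicPlus.eval T → b ^ 2 = cubicMinus.eval T →
      α.eval T + β.eval T * a + γ.eval T * b + δ.eval T * (a * b) = 0 → N.eval T = 0 := by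
  -- `A + B a` is the norm of the element under `b ↦ -b`, and `A² - B² cubicPlus` is the norm of
  -- that under `a ↦ -a`.
  set A := α ^ 2 + β ^ 2 * cubicPlus - γ ^ 2 * cubicMinus - δ ^ 2 * cubicPlus * cubicMinus with hA
  set B := 2 * (α * β - γ * δ * cubicMinus) with hB
  refine ⟨A ^ 2 - B ^ 2 * cubicPlus, fun h0 => ?_, fun T a b ha hb hf => ?_⟩
  · obtain ⟨hA0, hB0⟩ := sq_ne_mul_sq cubicPlus_separable cubicPlus_degree (sub_eq_zero.1 h0)
    -- If the norm were zero, then `A = B = 0`. The root `r` of `cubicMinus` is simple and not a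
    -- root of `cubicPlus`, the two polynomials differing by `4X³`. There `A = B = 0` forces all
    -- four coefficients, even after removal of common powers of `X - r`, to vanish.
    obtain ⟨r, hr⟩ := IsAlgClosed.exists_root cubicMinus cubicMinus_degree
    obtain ⟨g, hg⟩ := dvd_iff_isRoot.2 hr
    have hgr := eval_ne_zero_of_separable cubicMinus_separable hg
    have hpr : cubicPlus.eval r ≠ 0 := by
      intro h1
      have h2 : cubicMinus.eval r = 0 := hr
      simp only [cubicPlus, cubicMinus, eval_sub, eval_mul, eval_pow, eval_X, eval_neg,
        eval_ofNat] at h1 h2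
      have h3 : r = 0 := by
        have : r ^ 3 = 0 := by linear_combination (h1 - h2) / 4
        simpa using this
      rw [h3] at h1
      norm_num at h1
    obtain ⟨d, F, hd, hF, i, hi⟩ := exists_factor_at ![α, β, γ, δ] r (by
      by_contra! h1
      exact h ⟨h1 0, h1 1, h1 2, h1 3⟩)
    have f0 : α = d * F 0 := hF 0
    have f1 : β = d * F 1 := hF 1
    have f2 : γ = d * F 2 := hF 2
    have f3 : δ = d * F 3 := hF 3
    have e1 : F 0 * F 1 = F 2 * F 3 * ((X - C r) * g) := by
      refine mul_left_cancel₀ (mul_ne_zero two_ne_zero (pow_ne_zero 2 hd)) ?_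
      rw [f0, f1, f2, f3, hg] at hB
      linear_combination hB0 - hB
    have e2 : F 0 ^ 2 + F 1 ^ 2 * cubicPlus = (F 2 ^ 2 + F 3 ^ 2 * cubicPlus) * ((X - C r) * g) := by
      refine mul_left_cancel₀ (pow_ne_zero 2 hd) ?_
      rw [f0, f1, f2, f3, hg] at hA
      linear_combination hA0 - hA
    have key : ∀ x y : ℂ, x * y = 0 → x ^ 2 + y ^ 2 * cubicPlus.eval r = 0 → x = 0 ∧ y = 0 := by
      intro x y h1 h2
      rcases mul_eq_zero.1 h1 with rfl | rfl
      · simpa [hpr] using h2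
      · simpa using h2
    obtain ⟨k0, k1⟩ := key ((F 0).eval r) ((F 1).eval r)
      (by simpa using congrArg (eval r) e1) (by simpa using congrArg (eval r) e2)
    obtain ⟨A0, hA0'⟩ := dvd_iff_isRoot.2 k0
    obtain ⟨A1, hA1'⟩ := dvd_iff_isRoot.2 k1
    have e3 : (X - C r) * (A0 * A1) = F 2 * F 3 * g := by
      refine mul_left_cancel₀ (X_sub_C_ne_zero r) ?_
      rw [hA0', hA1'] at e1
      linear_combination e1
    have e4 : (X - C r) * (A0 ^ 2 + A1 ^ 2 * cubicPlus) =
        (F 2 ^ 2 + F 3 ^ 2 * cubicPlus) * g := by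
      refine mul_left_cancel₀ (X_sub_C_ne_zero r) ?_
      rw [hA0', hA1'] at e2
      linear_combination e2
    obtain ⟨k2, k3⟩ := key ((F 2).eval r) ((F 3).eval r)
      (by simpa [hgr] using congrArg (eval r) e3) (by simpa [hgr] using congrArg (eval r) e4)
    fin_cases i
    · exact hi k0
    · exact hi k1
    · exact hi k2
    · exact hi k3
  · have h1 : A.eval T + B.eval T * a = 0 := by
      simp only [hA, hB, eval_add, eval_sub, eval_mul, eval_pow, eval_ofNat, ← ha, ← hb]
      linear_combination hf * (α.eval T + β.eval T * a - γ.eval T * b - δ.eval T * (a * b))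
    simp only [eval_sub, eval_pow, eval_mul, ← ha]
    linear_combination h1 * (A.eval T - B.eval T * a)

/-- The homogeneous coordinates of Bring's curve in terms of `T`, `a`, `b`. -/
def param (T a b : ℂ) : Fin 5 → ℂ :=
  ![-T + a - 5, -T + b + 5, -T - b + 5, -T - a - 5, 4 * T]

/-- Reduction modulo the two quadratic relations to `1, a, b, ab` over the polynomials in `T`. -/
theorem exists_eval_param (P : MvPolynomial (Fin 5) ℂ) : ∃ α β γ δ : ℂ[X], ∀ T a b : ℂ,
    a ^ 2 = cubicPlus.eval T → b ^ 2 = cubicMinus.eval T →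
    MvPolynomial.eval (param T a b) P =
      α.eval T + β.eval T * a + γ.eval T * b + δ.eval T * (a * b) := by
  induction P using MvPolynomial.induction_on with
  | C c => exact ⟨C c, 0, 0, 0, fun T a b _ _ => by simp⟩
  | add p q hp hq =>
    obtain ⟨α, β, γ, δ, hp⟩ := hp
    obtain ⟨α', β', γ', δ', hq⟩ := hq
    refine ⟨α + α', β + β', γ + γ', δ + δ', fun T a b ha hb => ?_⟩
    rw [map_add, hp T a b ha hb, hq T a b ha hb]
    simp only [eval_add]
    ring
  | mul_X p k hp =>
    obtain ⟨α, β, γ, δ, hp⟩ := hp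
    obtain ⟨c, e, e', hk⟩ : ∃ (c : ℂ[X]) (e e' : ℂ), ∀ T a b : ℂ,
        param T a b k = c.eval T + e * a + e' * b := by
      fin_cases k
      · exact ⟨-X - 5, 1, 0, fun T a b => by simp [param]; ring⟩
      · exact ⟨-X + 5, 0, 1, fun T a b => by simp [param]; ring⟩
      · exact ⟨-X + 5, 0, -1, fun T a b => by simp [param]; ring⟩
      · exact ⟨-X - 5, -1, 0, fun T a b => by simp [param]; ring⟩
      · exact ⟨4 * X, 0, 0, fun T a b => by simp [param]⟩
    refine ⟨α * c + C e * β * cubicPlus + C e' * γ * cubicMinus,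
      β * c + C e * α + C e' * δ * cubicMinus, γ * c + C e' * α + C e * δ * cubicPlus,
      δ * c + C e' * β + C e * γ, fun T a b ha hb => ?_⟩
    rw [map_mul, hp T a b ha hb, MvPolynomial.eval_X, hk]
    simp only [eval_add, eval_mul, eval_C, ← ha, ← hb]
    ring

end Biquadratic

/-- On the three linear forms the Klein four-group of `{0, 1, 2, 3}` acts through its nontrivial
characters. Together with the sum of these four coordinates, which is `-v 4`, they diagonalize the
sum of squares. -/
theorem sum_sq_eq {v : Fin 5 → ℂ} (h : IsBring v) :
    (v 0 + v 1 - v 2 - v 3) ^ 2 + (v 0 - v 1 + v 2 - v 3) ^ 2 + (v 0 - v 1 - v 2 + v 3) ^ 2 =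
      -5 * v 4 ^ 2 := by
  obtain ⟨h1, h2, -⟩ := h
  simp only [Fin.sum_univ_five] at h1 h2
  linear_combination 4 * h2 + (v 4 - v 0 - v 1 - v 2 - v 3) * h1

theorem prod_eq {v : Fin 5 → ℂ} (h : IsBring v) :
    (v 0 + v 1 - v 2 - v 3) * (v 0 - v 1 + v 2 - v 3) * (v 0 - v 1 - v 2 + v 3) =
      -5 * v 4 ^ 3 := by
  obtain ⟨h1, h2, h3⟩ := h
  simp only [Fin.sum_univ_five] at h1 h2 h3
  have hv : v 4 = -(v 0 + v 1 + v 2 + v 3) := by linear_combination h1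
  rw [hv] at h2 h3 ⊢
  linear_combination (-2 * (v 0 + v 1 + v 2 + v 3)) * h2 + (8 / 3) * h3

/-- With `U = u₁/v₄` and `V = u₂/v₄` the parameters are `T = UV`, `a = (U + V) T`, `b = (U - V) T`.
The product relation makes the third form `-5/T` times `v₄`, and the sum of squares turns into `(U ±
V)² T² = ±2T³ - 5T² - 25`. -/
theorem exists_param {v : Fin 5 → ℂ} (h : IsBring v) (h4 : v 4 ≠ 0) :
    ∃ T a b : ℂ, T ≠ 0 ∧ a ^ 2 = cubicPlus.eval T ∧ b ^ 2 = cubicMinus.eval T ∧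
      v = (v 4 / (4 * T)) • param T a b := by
  have hs := h.sum_sq_eq
  have hp := h.prod_eq
  have hl : v 0 + v 1 + v 2 + v 3 + v 4 = 0 := by
    simpa [Fin.sum_univ_five] using h.1
  set u1 := v 0 + v 1 - v 2 - v 3 with hu1
  set u2 := v 0 - v 1 + v 2 - v 3 with hu2
  set u3 := v 0 - v 1 - v 2 + v 3 with hu3
  have hu12 : u1 * u2 ≠ 0 := by
    intro h0
    rw [h0, zero_mul] at hp
    exact mul_ne_zero (by norm_num) (pow_ne_zero 3 h4) hp.symm
  refine ⟨u1 * u2 / v 4 ^ 2, (u1 + u2) * (u1 * u2) / v 4 ^ 3, (u1 - u2) * (u1 * u2) / v 4 ^ 3,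
    div_ne_zero hu12 (pow_ne_zero 2 h4), ?_, ?_, ?_⟩
  · simp only [cubicPlus, Polynomial.eval_sub, Polynomial.eval_mul, Polynomial.eval_pow,
      Polynomial.eval_X, Polynomial.eval_ofNat]
    field_simp
    linear_combination (u1 ^ 2 * u2 ^ 2) * hs - (u1 * u2 * u3 - 5 * v 4 ^ 3) * hp
  · simp only [cubicMinus, Polynomial.eval_sub, Polynomial.eval_mul, Polynomial.eval_pow,
      Polynomial.eval_X, Polynomial.eval_ofNat, Polynomial.eval_neg]
    field_simp
    linear_combination (u1 ^ 2 * u2 ^ 2) * hs - (u1 * u2 * u3 - 5 * v 4 ^ 3) * hp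
  · have e3 : u3 / v 4 = -5 * v 4 ^ 2 / (u1 * u2) := by
      rw [div_eq_div_iff h4 hu12]
      linear_combination hp
    have e0 : v 0 = (-v 4 + u1 + u2 + u3) / 4 := by linear_combination hl / 4
    have e1 : v 1 = (-v 4 + u1 - u2 - u3) / 4 := by linear_combination hl / 4
    have e2 : v 2 = (-v 4 - u1 + u2 - u3) / 4 := by linear_combination hl / 4
    have e3' : v 3 = (-v 4 - u1 - u2 + u3) / 4 := by linear_combination hl / 4
    have hne1 := left_ne_zero_of_mul hu12
    have hne2 := right_ne_zero_of_mul hu12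
    have e4 : u3 = -5 * v 4 ^ 3 / (u1 * u2) := by
      rw [eq_div_iff hu12]
      linear_combination hp
    clear_value u1 u2 u3
    ext i
    fin_cases i
    · simp [param]
      rw [e0, e4]
      field_simp
      ring
    · simp [param]
      rw [e1, e4]
      field_simp
      ring
    · simp [param]
      rw [e2, e4]
      field_simp
      ring
    · simp [param]
      rw [e3', e4]
      field_simp
      ring
    · simp [param]
      field_simp

theorem isBring_param {T a b : ℂ} (ha : a ^ 2 = cubicPlus.eval T)
    (hb : b ^ 2 = cubicMinus.eval T) : IsBring (param T a b) := by
  simp only [cubicPlus, cubicMinus, Polynomial.eval_sub, Polynomial.eval_mul, Polynomial.eval_pow,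
      Polynomial.eval_X, Polynomial.eval_ofNat, Polynomial.eval_neg] at ha hb
  refine ⟨?_, ?_, ?_⟩ <;> simp only [Fin.sum_univ_five] <;> simp [param]
  · ring
  · linear_combination 2 * ha + 2 * hb
  · linear_combination (-6 * T - 30) * ha + (-6 * T + 30) * hb

end IsBring

section Finiteness

/-- A point is recovered from its normalized representative, so it suffices that there are finitely
many of these. -/
theorem finite_of_normalized {n : ℕ} {A : Set (ℙ ℂ (Fin n → ℂ))} (L : (Fin n → ℂ) → ℂ)
    {F : Set (Fin n → ℂ)} (hF : F.Finite)
    (h : ∀ p ∈ A, L p.rep ≠ 0 ∧ (L p.rep)⁻¹ • p.rep ∈ F) : A.Finite := by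
  refine Set.Finite.of_finite_image (f := fun p => (L p.rep)⁻¹ • p.rep)
    (hF.subset (by rintro _ ⟨p, hp, rfl⟩; exact (h p hp).2)) ?_
  intro p hp q hq hpq
  dsimp only at hpq
  rw [← p.mk_rep, ← q.mk_rep, Projectivization.mk_eq_mk_iff']
  refine ⟨L p.rep * (L q.rep)⁻¹, ?_⟩
  rw [mul_smul, ← hpq, smul_smul, mul_inv_cancel₀ (h p hp).1, one_smul]

theorem finite_pow_eq (n : ℕ) (hn : 0 < n) (c : ℂ) : {z : ℂ | z ^ n = c}.Finite := by
  refine ((Polynomial.X ^ n - Polynomial.C c).roots.toFinset.finite_toSet).subset fun z hz => ?_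
  have : (Polynomial.X ^ n - Polynomial.C c : Polynomial ℂ) ≠ 0 :=
    (Polynomial.monic_X_pow_sub_C c hn.ne').ne_zero
  simp only [Finset.mem_coe, Multiset.mem_toFinset, Polynomial.mem_roots this]
  simpa [sub_eq_zero] using hz

end Finiteness

/-- When the last coordinate is zero, the first three elementary symmetric functions of the other
four vanish, so these are the roots of some `X⁴ = c`; normalizing the first to `1` leaves fourth
roots of unity. -/
theorem bring_finite_infinity : {p : ℙ ℂ (Fin 5 → ℂ) | p ∈ bringSet ∧ p.rep 4 = 0}.Finite := by
  have hF : (Set.pi Set.univ fun _ : Fin 5 => insert (0 : ℂ) {z : ℂ | z ^ 4 = 1}).Finite :=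
    Set.Finite.pi fun _ => (finite_pow_eq 4 (by norm_num) 1).insert 0
  refine finite_of_normalized (fun v => v 0) hF ?_
  rintro p ⟨hp, h4⟩
  obtain ⟨h1, h2, h3⟩ := mem_bringSet.1 hp
  simp only [Fin.sum_univ_five, h4] at h1 h2 h3
  set v := p.rep with hv
  have key : ∀ i : Fin 5, i ≠ 4 → v i ^ 4 = v 0 ^ 4 := by
    have hx : v 3 = -(v 0 + v 1 + v 2) := by linear_combination h1
    rw [hx] at h2 h3
    have h5 : v 0 ^ 2 + v 1 ^ 2 + v 2 ^ 2 + v 0 * v 1 + v 0 * v 2 + v 1 * v 2 = 0 := by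
      linear_combination h2 / 2
    have h6 : (v 0 + v 1) * (v 0 + v 2) * (v 1 + v 2) = 0 := by
      linear_combination -h3 / 3
    have q1 : v 1 ^ 4 = v 0 ^ 4 := by
      linear_combination (v 1 - v 0) * (v 0 + v 1) * h5 - (v 1 - v 0) * h6
    have q2 : v 2 ^ 4 = v 0 ^ 4 := by
      linear_combination (v 2 - v 0) * (v 0 + v 2) * h5 - (v 2 - v 0) * h6
    have q3 : v 3 ^ 4 = v 0 ^ 4 := by
      rw [hx]
      linear_combination (v 1 + v 2) * (2 * v 0 + v 1 + v 2) * h5 + (2 * v 0 + v 1 + v 2) * h6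
    intro i hi
    fin_cases i
    · rfl
    · exact q1
    · exact q2
    · exact q3
    · exact absurd rfl hi
  have h0 : v 0 ≠ 0 := by
    intro h0
    apply p.rep_nonzero
    ext i
    by_cases hi : i = 4
    · rw [hi]; exact h4
    · have := key i hi
      rw [h0] at this
      simpa using this
  refine ⟨h0, fun i _ => ?_⟩
  simp only [Pi.smul_apply, smul_eq_mul]
  by_cases hi : i = 4
  · left
    rw [hi, h4, mul_zero]
  · right
    change _ = _
    rw [mul_pow, key i hi, ← mul_pow, inv_mul_cancel₀ h0, one_pow]

-- On the affine part `P` becomes `α + βa + γb + δab`. If this is not formally zero, the roots of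
-- its norm bound the possible `T`, and each `T` carries finitely many `a, b`. If it is formally
-- zero, `P` vanishes off the hyperplane at infinity, and `IsBring.eval_eq_zero_of_finite` shows
-- that the finitely many points at infinity are no exception.
open MvPolynomial in
theorem bring_finite_zeros {d : ℕ} {P : MvPolynomial (Fin 5) ℂ} (hP : P.IsHomogeneous d)
    (hne : ∃ p ∈ bringSet, eval p.rep P ≠ 0) : {p : bringSet | eval p.val.rep P = 0}.Finite := by
  obtain ⟨α, β, γ, δ, hev⟩ := IsBring.exists_eval_param P
  have heq : ∀ p ∈ bringSet, p.rep 4 ≠ 0 → ∃ T a b : ℂ, T ≠ 0 ∧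
      a ^ 2 = IsBring.cubicPlus.eval T ∧ b ^ 2 = IsBring.cubicMinus.eval T ∧
      p.rep = (p.rep 4 / (4 * T)) • IsBring.param T a b ∧
      (eval p.rep P = 0 ↔
        α.eval T + β.eval T * a + γ.eval T * b + δ.eval T * (a * b) = 0) := by
    intro p hp h4
    obtain ⟨T, a, b, hT, ha, hb, hrep⟩ := (mem_bringSet.1 hp).exists_param h4
    refine ⟨T, a, b, hT, ha, hb, hrep, ?_⟩
    rw [← hev T a b ha hb]
    conv_lhs => rw [hrep]
    rw [hP.eval_smul_eq, mul_eq_zero, or_iff_right]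
    exact pow_ne_zero _ (div_ne_zero h4 (by simpa using hT))
  refine Set.Finite.of_finite_image (f := Subtype.val) ?_ Subtype.val_injective.injOn
  by_cases h0 : α = 0 ∧ β = 0 ∧ γ = 0 ∧ δ = 0
  · exfalso
    obtain ⟨p, hp, hpP⟩ := hne
    refine hpP (IsBring.eval_eq_zero_of_finite hP ?_ (mem_bringSet.1 hp))
    refine Set.Finite.of_finite_image (f := Subtype.val) (bring_finite_infinity.subset ?_)
      Subtype.val_injective.injOn
    rintro _ ⟨q, hq, rfl⟩
    refine ⟨q.property, ?_⟩
    by_contra h4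
    obtain ⟨T, a, b, -, -, -, -, h⟩ := heq q.val q.property h4
    exact hq (h.2 (by simp [h0.1, h0.2.1, h0.2.2.1, h0.2.2.2]))
  obtain ⟨N, hN, hNz⟩ := IsBring.exists_norm h0
  have hfin : {p : ℙ ℂ (Fin 5 → ℂ) | p ∈ bringSet ∧ p.rep 4 ≠ 0 ∧ eval p.rep P = 0}.Finite := by
    have hF : ((fun x : ℂ × ℂ × ℂ => (4 * x.1)⁻¹ • IsBring.param x.1 x.2.1 x.2.2) ''
        ⋃ T ∈ {T | N.IsRoot T}, {T} ×ˢ ({a : ℂ | a ^ 2 = IsBring.cubicPlus.eval T} ×ˢ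
          {b : ℂ | b ^ 2 = IsBring.cubicMinus.eval T})).Finite := by
      refine Set.Finite.image _ (Set.Finite.biUnion (Polynomial.finite_setOfPred_isRoot hN)
        fun T _ => (Set.finite_singleton T).prod ((finite_pow_eq 2 (by norm_num) _).prod
          (finite_pow_eq 2 (by norm_num) _)))
    refine finite_of_normalized (fun v => v 4) hF ?_
    rintro p ⟨hp, h4, hpP⟩
    refine ⟨h4, ?_⟩
    obtain ⟨T, a, b, hT, ha, hb, hrep, h⟩ := heq p hp h4
    refine ⟨(T, a, b), Set.mem_biUnion (x := T) (hNz T a b ha hb (h.1 hpP)) ⟨rfl, ha, hb⟩, ?_⟩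
    dsimp only
    conv_rhs => rw [hrep]
    rw [smul_smul]
    congr 1
    have : (p.rep 4 / (4 * T)) * (4 * T) = p.rep 4 := by field_simp
    simp [IsBring.param]
    field_simp
  refine (bring_finite_infinity.union hfin).subset ?_
  rintro _ ⟨q, hq, rfl⟩
  by_cases h4 : q.val.rep 4 = 0
  · exact .inl ⟨q.property, h4⟩
  · exact .inr ⟨q.property, h4, hq⟩

instance : Infinite bringSet := by
  have hex : ∀ T : ℂ, T ≠ 0 → ∃ p : bringSet, ∃ a b l : ℂ, l ≠ 0 ∧
      p.val.rep = l • IsBring.param T a b := by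
    intro T hT
    obtain ⟨a, ha⟩ := IsAlgClosed.exists_pow_nat_eq (IsBring.cubicPlus.eval T) (n := 2) two_pos
    obtain ⟨b, hb⟩ := IsAlgClosed.exists_pow_nat_eq (IsBring.cubicMinus.eval T) (n := 2) two_pos
    have hne : IsBring.param T a b ≠ 0 := fun h => hT (by
      simpa [IsBring.param] using congrFun h 4)
    obtain ⟨l, hl, h⟩ := Projectivization.exists_rep_eq
      (p := Projectivization.mk ℂ (IsBring.param T a b) hne) rfl
    exact ⟨⟨_, (mk_mem_bringSet hne).2 (IsBring.isBring_param ha hb)⟩, a, b, l, hl, h⟩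
  choose p a b l hl hp using fun n : ℕ => hex (n + 1) (Nat.cast_add_one_ne_zero n)
  refine Infinite.of_injective p fun m n hmn => ?_
  have h1 := hp m
  rw [hmn, hp n] at h1
  have e0 := congrFun h1 0
  have e3 := congrFun h1 3
  have e4 := congrFun h1 4
  simp [IsBring.param] at e0 e3 e4
  have h5 : l n = l m := by linear_combination (-(1 : ℂ) / 10) * (e0 + e3) - e4 / 20
  rw [h5] at e4
  have := mul_left_cancel₀ (hl m) e4
  have h6 : (n : ℂ) = m := by linear_combination this / 4
  exact_mod_cast h6.symm

theorem isCurve_bringCurve : bringCurve.IsCurve :=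
  FunSpace.isCurve_projectiveSubspace (S := bringSet) fun _ _ hP hne => bring_finite_zeros hP hne


/-! ### The projective model of `𝓒₂` and its two charts -/

section SexticCurve

open Filter Polynomial FunSpace

/-- The reciprocal polynomial of `polyC2`. -/
noncomputable def polyC2Rev : ℂ[X] :=
  108 * (16 + 72 * X + 155 * X ^ 2 + 170 * X ^ 3 + 95 * X ^ 4 + 12 * X ^ 5 + 4 * X ^ 6)

theorem polyC2_separable : polyC2.Separable := by
  refine ⟨C (1 / 108) * (C (413/2000) + C (-4843/4000) * X + C (-7343/2000) * X ^ 2 +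
    C (-3783/1000) * X ^ 3 + C (-309/250) * X ^ 4),
    C (1 / 108) * (C (29/2000) + C (-13/400) * X + C (1117/1600) * X ^ 2 + C (1873/1600) * X ^ 3 +
    C (157/200) * X ^ 4 + C (103/500) * X ^ 5), ?_⟩
  refine funext fun z => ?_
  simp [polyC2]
  ring

theorem polyC2Rev_separable : polyC2Rev.Separable := by
  refine ⟨C (1 / 108) * (C (-119081/4000) + C (-245219/2000) * X + C (-263207/2000) * X ^ 2 +
    C (-4497/250) * X ^ 3 + C (-4497/500) * X ^ 4),
    C (1 / 108) * (C (13259/2000) + C (45557/1600) * X + C (74227/1600) * X ^ 2 +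
    C (26741/800) * X ^ 3 + C (1499/400) * X ^ 4 + C (1499/1000) * X ^ 5), ?_⟩
  refine funext fun z => ?_
  simp [polyC2Rev]
  ring

theorem polyC2_eval (z : ℂ) : polyC2.eval z =
    108 * (4 + 12 * z + 95 * z ^ 2 + 170 * z ^ 3 + 155 * z ^ 4 + 72 * z ^ 5 + 16 * z ^ 6) := by
  simp [polyC2]

theorem polyC2Rev_eval (z : ℂ) : polyC2Rev.eval z =
    108 * (16 + 72 * z + 155 * z ^ 2 + 170 * z ^ 3 + 95 * z ^ 4 + 12 * z ^ 5 + 4 * z ^ 6) := by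
  simp [polyC2Rev]

theorem degree_ne_zero_of_eval_ne {f : ℂ[X]} (a b : ℂ) (h : f.eval a ≠ f.eval b) :
    f.degree ≠ 0 := by
  intro hd
  rw [eq_C_of_degree_eq_zero hd] at h
  simp at h

theorem polyC2_degree_ne_zero : polyC2.degree ≠ 0 :=
  degree_ne_zero_of_eval_ne 0 1 (by norm_num [polyC2_eval])

theorem polyC2Rev_degree_ne_zero : polyC2Rev.degree ≠ 0 :=
  degree_ne_zero_of_eval_ne 0 1 (by norm_num [polyC2Rev_eval])

theorem sexticForm_polyC2 (s t : ℂ) : sexticForm polyC2 s t =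
    108 * (4 * s ^ 6 + 12 * s ^ 5 * t + 95 * s ^ 4 * t ^ 2 + 170 * s ^ 3 * t ^ 3 +
      155 * s ^ 2 * t ^ 4 + 72 * s * t ^ 5 + 16 * t ^ 6) := by
  have h : polyC2 = C 432 + C 1296 * X + C 10260 * X ^ 2 + C 18360 * X ^ 3 + C 16740 * X ^ 4 +
      C 7776 * X ^ 5 + C 1728 * X ^ 6 := by
    refine funext fun z => ?_
    simp [polyC2]
    ring
  have hc : ∀ k, polyC2.coeff k = ![432, 1296, 10260, 18360, 16740, 7776, 1728, 0]
      ⟨min k 7, by omega⟩ := by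
    intro k
    rw [h]
    simp only [coeff_add, coeff_C_mul, coeff_X_pow, coeff_X, coeff_C]
    rcases le_or_gt k 6 with hk | hk
    · interval_cases k <;> simp
    · have : ∀ j, j ≤ 6 → k ≠ j := fun j hj => by omega
      have hmin : min k 7 = 7 := by omega
      simp [this, hmin, (show (1 : ℕ) ≠ k by omega)]
  rw [sexticForm]
  simp only [Finset.sum_range_succ, Finset.sum_range_zero, hc]
  simp
  ring

theorem exists_eq_sexticPoint {f : ℂ[X]} (p : (sexticCurve f).carrier) :
    ∃ s t y h hy, p = sexticPoint f s t y h hy := by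
  obtain ⟨s, t, y, h, hy, hp⟩ := p.property
  exact ⟨s, t, y, h, hy, Subtype.ext hp⟩

theorem sexticPoint_rep {f : ℂ[X]} {s t y : ℂ} {h : s ≠ 0 ∨ t ≠ 0} {hy} :
    ∃ a : ℂ, a ≠ 0 ∧
      (sexticPoint f s t y h hy).val.rep = a • ![s ^ 3, s ^ 2 * t, s * t ^ 2, t ^ 3, y] :=
  Projectivization.exists_rep_eq rfl

theorem sexticPoint_eq_of_smul {f : ℂ[X]} {s t y s' t' y' : ℂ} {h : s ≠ 0 ∨ t ≠ 0} {hy}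
    {h' : s' ≠ 0 ∨ t' ≠ 0} {hy'} (c : ℂ) (hs : s = c * s') (ht : t = c * t')
    (hyy : y = c ^ 3 * y') : sexticPoint f s t y h hy = sexticPoint f s' t' y' h' hy' := by
  refine Subtype.ext ((Projectivization.mk_eq_mk_iff' _ _ _ _ _).2 ⟨c ^ 3, ?_⟩)
  subst hs ht hyy
  ext i
  fin_cases i <;> simp <;> ring

/-- The twisted cubic determines `[s : t]`, and the scalar relating the vectors in `ℙ⁴` is the cube
of the scalar relating the pairs; so points of the model are points of `ℙ(1, 1, 3)`. -/
theorem exists_smul_of_sexticPoint_eq {f : ℂ[X]} {s t y s' t' y' : ℂ} {h : s ≠ 0 ∨ t ≠ 0} {hy}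
    {h' : s' ≠ 0 ∨ t' ≠ 0} {hy'}
    (he : sexticPoint f s t y h hy = sexticPoint f s' t' y' h' hy') :
    ∃ c : ℂ, c ≠ 0 ∧ s = c * s' ∧ t = c * t' ∧ y = c ^ 3 * y' := by
  obtain ⟨μ, hμ⟩ := (Projectivization.mk_eq_mk_iff' _ _ _ _ _).1 (congrArg Subtype.val he)
  have e0 : μ * s' ^ 3 = s ^ 3 := by simpa using congrFun hμ 0
  have e1 : μ * (s' ^ 2 * t') = s ^ 2 * t := by simpa using congrFun hμ 1
  have e2 : μ * (s' * t' ^ 2) = s * t ^ 2 := by simpa using congrFun hμ 2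
  have e3 : μ * t' ^ 3 = t ^ 3 := by simpa using congrFun hμ 3
  have e4 : μ * y' = y := by simpa using congrFun hμ 4
  have hs0 : s' = 0 → s = 0 := fun h0 => by
    rw [h0] at e0
    simpa using e0.symm
  have ht0 : t' = 0 → t = 0 := fun h0 => by
    rw [h0] at e3
    simpa using e3.symm
  by_cases hs' : s' = 0
  · have ht' : t' ≠ 0 := h'.resolve_left (not_not.2 hs')
    have hs := hs0 hs'
    have ht : t ≠ 0 := h.resolve_left (not_not.2 hs)
    refine ⟨t / t', div_ne_zero ht ht', by simp [hs, hs'], by field_simp, ?_⟩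
    have : μ = (t / t') ^ 3 := by
      field_simp
      exact e3
    rw [← this, e4]
  · have hμ0 : μ ≠ 0 := by
      rintro rfl
      simp only [zero_mul] at e0 e3
      rcases h with h | h
      · exact h (by simpa using e0.symm)
      · exact h (by simpa using e3.symm)
    have hs : s ≠ 0 := by
      rintro rfl
      simp only [ne_eq, OfNat.ofNat_ne_zero, not_false_eq_true, zero_pow, mul_eq_zero,
        pow_eq_zero_iff] at e0
      exact e0.elim hμ0 hs'
    have hμ' : μ = (s / s') ^ 3 := by
      field_simp
      exact e0
    refine ⟨s / s', div_ne_zero hs hs', by field_simp, ?_, by rw [← hμ', e4]⟩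
    have : s ^ 2 * t = s ^ 2 * (s / s' * t') := by
      rw [← e1, hμ']
      field_simp
    exact mul_left_cancel₀ (pow_ne_zero 2 hs) this

theorem exists_sexticPoint (f : ℂ[X]) (s t : ℂ) (h : s ≠ 0 ∨ t ≠ 0) :
    ∃ y hy, sexticPoint f s t y h hy = sexticPoint f s t y h hy ∧ y ^ 2 = sexticForm f s t := by
  obtain ⟨y, hy⟩ := IsAlgClosed.exists_pow_nat_eq (sexticForm f s t) (n := 2) two_pos
  exact ⟨y, hy, rfl, hy⟩

instance (f : ℂ[X]) : Infinite (sexticCurve f).carrier := by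
  have h : ∀ t : ℂ, ∃ p : (sexticCurve f).carrier, p.val.rep 0 ≠ 0 ∧
      p.val.rep 1 / p.val.rep 0 = t := by
    intro t
    obtain ⟨y, hy, -, -⟩ := exists_sexticPoint f 1 t (.inl one_ne_zero)
    obtain ⟨a, ha, hr⟩ := sexticPoint_rep (f := f) (h := .inl one_ne_zero) (hy := hy)
    refine ⟨sexticPoint f 1 t y (.inl one_ne_zero) hy, ?_, ?_⟩ <;> rw [hr] <;> simp [ha]
  choose p hp hpt using h
  refine Infinite.of_injective p fun t t' htt => ?_
  rw [← hpt t, ← hpt t', htt]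

end SexticCurve

namespace CurveC2

open Filter Polynomial FunSpace

/-- The affine coordinates on the chart `s ≠ 0`. -/
noncomputable def x (p : curveC2.carrier) : ℂ := p.val.rep 1 / p.val.rep 0

noncomputable def y (p : curveC2.carrier) : ℂ := p.val.rep 4 / p.val.rep 0

/-- The affine coordinates on the chart `t ≠ 0`. -/
noncomputable def x' (p : curveC2.carrier) : ℂ := p.val.rep 2 / p.val.rep 3

noncomputable def y' (p : curveC2.carrier) : ℂ := p.val.rep 4 / p.val.rep 3

variable {s t w : ℂ} {h : s ≠ 0 ∨ t ≠ 0} {hw : w ^ 2 = sexticForm polyC2 s t}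

theorem x_sexticPoint : x (sexticPoint polyC2 s t w h hw) = t / s := by
  obtain ⟨a, ha, hr⟩ := sexticPoint_rep (f := polyC2) (h := h) (hy := hw)
  change (sexticPoint polyC2 s t w h hw).val.rep 1 /
    (sexticPoint polyC2 s t w h hw).val.rep 0 = _
  rw [hr]
  -- At `s = 0` both sides are `0`, division by zero having the value zero.
  rcases eq_or_ne s 0 with rfl | hs
  · simp
  · simp
    field_simp

theorem y_sexticPoint : y (sexticPoint polyC2 s t w h hw) = w / s ^ 3 := by
  obtain ⟨a, ha, hr⟩ := sexticPoint_rep (f := polyC2) (h := h) (hy := hw)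
  change (sexticPoint polyC2 s t w h hw).val.rep 4 /
    (sexticPoint polyC2 s t w h hw).val.rep 0 = _
  rw [hr]
  simp [mul_div_mul_left _ _ ha]

theorem x'_sexticPoint : x' (sexticPoint polyC2 s t w h hw) = s / t := by
  obtain ⟨a, ha, hr⟩ := sexticPoint_rep (f := polyC2) (h := h) (hy := hw)
  change (sexticPoint polyC2 s t w h hw).val.rep 2 /
    (sexticPoint polyC2 s t w h hw).val.rep 3 = _
  rw [hr]
  rcases eq_or_ne t 0 with rfl | hs
  · simp
  · simp
    field_simp

theorem y'_sexticPoint : y' (sexticPoint polyC2 s t w h hw) = w / t ^ 3 := by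
  obtain ⟨a, ha, hr⟩ := sexticPoint_rep (f := polyC2) (h := h) (hy := hw)
  change (sexticPoint polyC2 s t w h hw).val.rep 4 /
    (sexticPoint polyC2 s t w h hw).val.rep 3 = _
  rw [hr]
  simp [mul_div_mul_left _ _ ha]

theorem rep_zero_ne_zero_iff : (sexticPoint polyC2 s t w h hw).val.rep 0 ≠ 0 ↔ s ≠ 0 := by
  obtain ⟨a, ha, hr⟩ := sexticPoint_rep (f := polyC2) (h := h) (hy := hw)
  rw [hr]
  simp [ha]

theorem rep_three_ne_zero_iff : (sexticPoint polyC2 s t w h hw).val.rep 3 ≠ 0 ↔ t ≠ 0 := by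
  obtain ⟨a, ha, hr⟩ := sexticPoint_rep (f := polyC2) (h := h) (hy := hw)
  rw [hr]
  simp [ha]

theorem rep_zero_or_three (p : curveC2.carrier) : p.val.rep 0 ≠ 0 ∨ p.val.rep 3 ≠ 0 := by
  obtain ⟨s, t, w, h, hw, rfl⟩ := exists_eq_sexticPoint p
  rw [rep_zero_ne_zero_iff, rep_three_ne_zero_iff]
  exact h

theorem regAt_rep_div {p : curveC2.carrier} (i j : Fin 5) (h : p.val.rep j ≠ 0) :
    curveC2.RegAt p (fun q => q.val.rep i / q.val.rep j) := by
  have := FunSpace.regAt_eval_div (p := p) (MvPolynomial.isHomogeneous_X ℂ i)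
    (MvPolynomial.isHomogeneous_X ℂ j) (by simpa using h)
  simp only [MvPolynomial.eval_X] at this
  exact this

theorem regAt_x {p : curveC2.carrier} (h : p.val.rep 0 ≠ 0) : curveC2.RegAt p x :=
  regAt_rep_div _ _ h

theorem regAt_y {p : curveC2.carrier} (h : p.val.rep 0 ≠ 0) : curveC2.RegAt p y :=
  regAt_rep_div _ _ h

theorem regAt_x' {p : curveC2.carrier} (h : p.val.rep 3 ≠ 0) : curveC2.RegAt p x' :=
  regAt_rep_div _ _ h

theorem regAt_y' {p : curveC2.carrier} (h : p.val.rep 3 ≠ 0) : curveC2.RegAt p y' :=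
  regAt_rep_div _ _ h

theorem y_sq {p : curveC2.carrier} (h0 : p.val.rep 0 ≠ 0) : y p ^ 2 = polyC2.eval (x p) := by
  obtain ⟨s, t, w, h, hw, rfl⟩ := exists_eq_sexticPoint p
  have hs : s ≠ 0 := rep_zero_ne_zero_iff.1 h0
  rw [x_sexticPoint, y_sexticPoint, div_pow, hw, polyC2_eval, sexticForm_polyC2]
  field_simp

theorem y'_sq {p : curveC2.carrier} (h0 : p.val.rep 3 ≠ 0) :
    y' p ^ 2 = polyC2Rev.eval (x' p) := by
  obtain ⟨s, t, w, h, hw, rfl⟩ := exists_eq_sexticPoint p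
  have hs : t ≠ 0 := rep_three_ne_zero_iff.1 h0
  rw [x'_sexticPoint, y'_sexticPoint, div_pow, hw, polyC2Rev_eval, sexticForm_polyC2]
  field_simp
  ring

theorem rep_eq {p : curveC2.carrier} (h0 : p.val.rep 0 ≠ 0) :
    p.val.rep = p.val.rep 0 • ![1, x p, x p ^ 2, x p ^ 3, y p] := by
  obtain ⟨s, t, w, h, hw, rfl⟩ := exists_eq_sexticPoint p
  have hs : s ≠ 0 := rep_zero_ne_zero_iff.1 h0
  obtain ⟨a, ha, hr⟩ := sexticPoint_rep (f := polyC2) (h := h) (hy := hw)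
  rw [x_sexticPoint, y_sexticPoint, hr]
  ext i
  fin_cases i <;> simp <;> field_simp

theorem rep_eq' {p : curveC2.carrier} (h0 : p.val.rep 3 ≠ 0) :
    p.val.rep = p.val.rep 3 • ![x' p ^ 3, x' p ^ 2, x' p, 1, y' p] := by
  obtain ⟨s, t, w, h, hw, rfl⟩ := exists_eq_sexticPoint p
  have hs : t ≠ 0 := rep_three_ne_zero_iff.1 h0
  obtain ⟨a, ha, hr⟩ := sexticPoint_rep (f := polyC2) (h := h) (hy := hw)
  rw [x'_sexticPoint, y'_sexticPoint, hr]
  ext i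
  fin_cases i <;> simp <;> field_simp

theorem exists_x_eq (α : ℂ) : ∃ p : curveC2.carrier, p.val.rep 0 ≠ 0 ∧ x p = α := by
  obtain ⟨y, hy, -, -⟩ := exists_sexticPoint polyC2 1 α (.inl one_ne_zero)
  exact ⟨sexticPoint polyC2 1 α y (.inl one_ne_zero) hy, rep_zero_ne_zero_iff.2 one_ne_zero,
    by rw [x_sexticPoint, div_one]⟩

theorem exists_x'_eq (α : ℂ) : ∃ p : curveC2.carrier, p.val.rep 3 ≠ 0 ∧ x' p = α := by
  obtain ⟨y, hy, -, -⟩ := exists_sexticPoint polyC2 α 1 (.inr one_ne_zero)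
  exact ⟨sexticPoint polyC2 α 1 y (.inr one_ne_zero) hy, rep_three_ne_zero_iff.2 one_ne_zero,
    by rw [x'_sexticPoint, div_one]⟩

section Orders

variable (hc : curveC2.IsCurve)
include hc

/-- `x - α` is regular and nonzero at a point with `x = α + 1`. -/
theorem eventually_x_ne (α : ℂ) : ∀ᶠ p in cofinite, x p ≠ α := by
  obtain ⟨p, hp, hx⟩ := exists_x_eq (α + 1)
  filter_upwards [hc.eventually_ne (regAt_sub (regAt_x hp) (curveC2.regAt_const p α))
    (by simp [hx])] with q hq h
  exact hq (by simp [h])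

theorem eventually_x'_ne (α : ℂ) : ∀ᶠ p in cofinite, x' p ≠ α := by
  obtain ⟨p, hp, hx⟩ := exists_x'_eq (α + 1)
  filter_upwards [hc.eventually_ne (regAt_sub (regAt_x' hp) (curveC2.regAt_const p α))
    (by simp [hx])] with q hq h
  exact hq (by simp [h])

/-- Where the coordinate vanishes, `x` is a division by zero and hence `0`; it therefore suffices
that `x ≠ 0` almost everywhere. -/
theorem eventually_rep_zero : ∀ᶠ p : curveC2.carrier in cofinite, p.val.rep 0 ≠ 0 := by
  filter_upwards [eventually_x_ne hc 0] with p hp h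
  exact hp (by simp [x, h])

theorem eventually_rep_three : ∀ᶠ p : curveC2.carrier in cofinite, p.val.rep 3 ≠ 0 := by
  filter_upwards [eventually_x'_ne hc 0] with p hp h
  exact hp (by simp [x', h])

theorem eventually_y_sq : ∀ᶠ p in cofinite, y p ^ 2 = polyC2.eval (x p) :=
  (eventually_rep_zero hc).mono fun _ => y_sq

theorem eventually_y'_sq : ∀ᶠ p in cofinite, y' p ^ 2 = polyC2Rev.eval (x' p) :=
  (eventually_rep_three hc).mono fun _ => y'_sq

theorem exists_inAB {h : curveC2.carrier → ℂ} (hh : curveC2.IsRational h) :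
    ∃ P Q, InAB x y P ∧ InAB x y Q ∧ (∀ᶠ x in cofinite, Q x ≠ 0) ∧ h * Q =ᶠ[cofinite] P := by
  obtain ⟨P, Q, h1, h2⟩ := hh.exists_eval hc (fun p => ![1, x p, x p ^ 2, x p ^ 3, y p])
    ((eventually_rep_zero hc).mono fun p hp => ⟨_, hp, rep_eq hp⟩)
  refine ⟨_, _, InAB.eval (eventually_y_sq hc) (fun k => ?_) P,
    InAB.eval (eventually_y_sq hc) (fun k => ?_) Q, h1, h2⟩ <;>
  · fin_cases k
    · simpa using inAB_poly (x := x) (y := y) 1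
    · simpa using inAB_poly (x := x) (y := y) X
    · exact ⟨X ^ 2, 0, by simp⟩
    · exact ⟨X ^ 3, 0, by simp⟩
    · simpa using inAB_poly_mul (x := x) (y := y) 1

theorem exists_inAB' {h : curveC2.carrier → ℂ} (hh : curveC2.IsRational h) :
    ∃ P Q, InAB x' y' P ∧ InAB x' y' Q ∧ (∀ᶠ x in cofinite, Q x ≠ 0) ∧
      h * Q =ᶠ[cofinite] P := by
  obtain ⟨P, Q, h1, h2⟩ := hh.exists_eval hc (fun p => ![x' p ^ 3, x' p ^ 2, x' p, 1, y' p])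
    ((eventually_rep_three hc).mono fun p hp => ⟨_, hp, rep_eq' hp⟩)
  refine ⟨_, _, InAB.eval (eventually_y'_sq hc) (fun k => ?_) P,
    InAB.eval (eventually_y'_sq hc) (fun k => ?_) Q, h1, h2⟩ <;>
  · fin_cases k
    · exact ⟨X ^ 3, 0, by simp⟩
    · exact ⟨X ^ 2, 0, by simp⟩
    · simpa using inAB_poly (x := x') (y := y') X
    · simpa using inAB_poly (x := x') (y := y') 1
    · simpa using inAB_poly_mul (x := x') (y := y') 1

/-- A uniformizer at a point of the chart `s ≠ 0`. -/
theorem exists_uniformizer {q : curveC2.carrier} (hq : q.val.rep 0 ≠ 0) :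
    ∃ u : curveC2.carrier → ℂ, (u = (fun p => x p - x q) ∧ y q ≠ 0 ∨ u = y ∧ y q = 0) ∧
      curveC2.RegAt q u ∧ u q = 0 ∧
      ∀ h, curveC2.IsRational h → h =ᶠ[cofinite] 0 ∨
      ∃ (n : ℕ) (v : curveC2.carrier → ℂ), curveC2.RegAt q v ∧ v q ≠ 0 ∧
        (h =ᶠ[cofinite] u ^ n * v ∨ h * u ^ n =ᶠ[cofinite] v) :=
  exists_orders hc (regAt_x hq) (regAt_y hq) (eventually_y_sq hc) polyC2_separable
    polyC2_degree_ne_zero (eventually_x_ne hc) fun _ hh => exists_inAB hc hh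

/-- A uniformizer at a point of the chart `t ≠ 0`. -/
theorem exists_uniformizer' {q : curveC2.carrier} (hq : q.val.rep 3 ≠ 0) :
    ∃ u : curveC2.carrier → ℂ, (u = (fun p => x' p - x' q) ∧ y' q ≠ 0 ∨ u = y' ∧ y' q = 0) ∧
      curveC2.RegAt q u ∧ u q = 0 ∧
      ∀ h, curveC2.IsRational h → h =ᶠ[cofinite] 0 ∨
      ∃ (n : ℕ) (v : curveC2.carrier → ℂ), curveC2.RegAt q v ∧ v q ≠ 0 ∧
        (h =ᶠ[cofinite] u ^ n * v ∨ h * u ^ n =ᶠ[cofinite] v) :=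
  exists_orders hc (regAt_x' hq) (regAt_y' hq) (eventually_y'_sq hc) polyC2Rev_separable
    polyC2Rev_degree_ne_zero (eventually_x'_ne hc) fun _ hh => exists_inAB' hc hh

theorem hasOrders : curveC2.HasOrders := by
  intro q
  rcases rep_zero_or_three q with hq | hq
  · obtain ⟨u, -, h⟩ := exists_uniformizer hc hq
    exact ⟨u, h⟩
  · obtain ⟨u, -, h⟩ := exists_uniformizer' hc hq
    exact ⟨u, h⟩

end Orders

end CurveC2


/-! ### The map `𝓑 → 𝓒₂` and its fibres -/

namespace IsBring

/-- Modulo `X⁴` the product of the five factors `1 + v i X` is `1`, so the elementary symmetric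
functions of the last three coordinates are, up to sign, the complete homogeneous ones of the first
two. -/
theorem esymm_three {v : Fin 5 → ℂ} (h : IsBring v) : v 2 + v 3 + v 4 = -(v 0 + v 1) ∧
    v 2 * v 3 + v 3 * v 4 + v 4 * v 2 = v 0 ^ 2 + v 0 * v 1 + v 1 ^ 2 ∧
    v 2 * v 3 * v 4 = -(v 0 ^ 3 + v 0 ^ 2 * v 1 + v 0 * v 1 ^ 2 + v 1 ^ 3) := by
  obtain ⟨h1, h2, h3⟩ := h
  simp only [Fin.sum_univ_five] at h1 h2 h3
  have h4 : v 4 = -(v 0 + v 1 + v 2 + v 3) := by linear_combination h1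
  rw [h4] at h2 h3 ⊢
  refine ⟨by ring, by linear_combination -h2 / 2, ?_⟩
  linear_combination h3 / 3 + (v 0 + v 1) / 2 * h2

theorem of_esymm_three {v : Fin 5 → ℂ} (h1 : v 2 + v 3 + v 4 = -(v 0 + v 1))
    (h2 : v 2 * v 3 + v 3 * v 4 + v 4 * v 2 = v 0 ^ 2 + v 0 * v 1 + v 1 ^ 2)
    (h3 : v 2 * v 3 * v 4 = -(v 0 ^ 3 + v 0 ^ 2 * v 1 + v 0 * v 1 ^ 2 + v 1 ^ 3)) :
    IsBring v := by
  have h4 : v 4 = -(v 0 + v 1 + v 2 + v 3) := by linear_combination h1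
  rw [h4] at h2 h3
  refine ⟨?_, ?_, ?_⟩ <;> simp only [Fin.sum_univ_five] <;> rw [h4]
  · ring
  · linear_combination -2 * h2
  · linear_combination 3 * (v 0 + v 1) * h2 + 3 * h3

end IsBring

/-- A primitive third root of unity. -/
noncomputable def zetaThree : ℂ := (-1 + Real.sqrt 3 * Complex.I) / 2

theorem zetaThree_eq : zetaThree ^ 2 = -1 - zetaThree := by
  have h : ((Real.sqrt 3 : ℝ) : ℂ) ^ 2 = 3 := by
    rw [← Complex.ofReal_pow, Real.sq_sqrt (by norm_num)]
    norm_num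
  rw [zetaThree]
  linear_combination (Real.sqrt 3 : ℂ) ^ 2 / 4 * Complex.I_sq - h / 4

theorem zetaThree_cube : zetaThree ^ 3 = 1 := by
  linear_combination (zetaThree - 1) * zetaThree_eq

/-- The alternating product of the last three coordinates. -/
def alternating (v : Fin 5 → ℂ) : ℂ := (v 2 - v 3) * (v 3 - v 4) * (v 4 - v 2)

/-- The square of the alternating product is the discriminant of the cubic with roots `v 2, v 3, v
4`, a form of degree six in `v 0, v 1`. The constant has square `-108`, and with `s = v 0`, `t = -v
0 - v 1` the exchange of `v 0` and `v 1` becomes `s ↦ -s - t`. -/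
theorem IsBring.sq_eq_sexticForm {v : Fin 5 → ℂ} (h : IsBring v) :
    (6 * (zetaThree - zetaThree ^ 2) * alternating v) ^ 2 =
      sexticForm polyC2 (v 0) (-v 0 - v 1) := by
  obtain ⟨h1, h2, h3⟩ := h.esymm_three
  have hd : alternating v ^ 2 = (v 2 + v 3 + v 4) ^ 2 * (v 2 * v 3 + v 3 * v 4 + v 4 * v 2) ^ 2 -
      4 * (v 2 * v 3 + v 3 * v 4 + v 4 * v 2) ^ 3 - 4 * (v 2 + v 3 + v 4) ^ 3 * (v 2 * v 3 * v 4) +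
      18 * (v 2 + v 3 + v 4) * (v 2 * v 3 + v 3 * v 4 + v 4 * v 2) * (v 2 * v 3 * v 4) -
      27 * (v 2 * v 3 * v 4) ^ 2 := by
    rw [alternating]
    ring
  rw [h1, h2, h3] at hd
  rw [mul_pow, hd, sexticForm_polyC2]
  have hz : (6 * (zetaThree - zetaThree ^ 2)) ^ 2 = -108 := by
    rw [zetaThree_eq]
    linear_combination 144 * zetaThree_eq
  rw [hz]
  ring

theorem IsBring.ne_zero_or {v : Fin 5 → ℂ} (h : IsBring v) (hv : v ≠ 0) :
    v 0 ≠ 0 ∨ -v 0 - v 1 ≠ 0 := by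
  by_contra! h0
  obtain ⟨h1, h2, h3⟩ := h.esymm_three
  have h01 : v 1 = 0 := by linear_combination -h0.1 - h0.2
  rw [h0.1, h01] at h1 h2 h3
  have key : ∀ z, (z - v 2) * (z - v 3) * (z - v 4) = z ^ 3 := fun z => by
    linear_combination -z ^ 2 * h1 + z * h2 - h3
  apply hv
  ext i
  fin_cases i
  · exact h0.1
  · exact h01
  all_goals
    refine pow_eq_zero_iff (n := 3) (by norm_num) |>.1 ?_
    refine (key _).symm.trans ?_
    simp

theorem Projectivization.mk_eq_mk_of_smul {n : ℕ} {v w : Fin n → ℂ} {hv : v ≠ 0} {hw : w ≠ 0}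
    (a : ℂ) (h : v = a • w) : Projectivization.mk ℂ v hv = Projectivization.mk ℂ w hw :=
  (Projectivization.mk_eq_mk_iff' _ _ _ _ _).2 ⟨a, h.symm⟩

namespace bringCurve

open FunSpace Filter

theorem isBring_rep (p : bringCurve.carrier) : IsBring p.val.rep := mem_bringSet.1 p.property

theorem exists_rep_smul (σ : Equiv.Perm (Fin 5)) (p : bringCurve.carrier) :
    ∃ a : ℂ, a ≠ 0 ∧ (σ • p).val.rep = a • fun i => p.val.rep (σ⁻¹ i) := by
  have h1 : (σ • p).val = Projectivization.mk ℂ (fun i => p.val.rep (σ⁻¹ i))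
      (fun h => p.val.rep_nonzero (funext fun i => by simpa using congrFun h (σ i))) := by
    change permPoint σ p.val = _
    conv_lhs => rw [← p.val.mk_rep]
    rfl
  exact Projectivization.exists_rep_eq h1

theorem eq_smul_of_rep {σ : Equiv.Perm (Fin 5)} {p q : bringCurve.carrier} (c : ℂ)
    (h : ∀ i, q.val.rep i = c * p.val.rep (σ⁻¹ i)) : σ • p = q := by
  obtain ⟨a, ha, hr⟩ := exists_rep_smul σ p
  refine Subtype.ext ?_
  rw [← (σ • p).val.mk_rep, ← q.val.mk_rep]
  refine ((Projectivization.mk_eq_mk_iff' _ _ _ _ _).2 ⟨c * a⁻¹, ?_⟩).symm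
  ext i
  rw [hr, h]
  simp
  field_simp

/-- The map `𝓑 → 𝓒₂`. -/
noncomputable def toC2 (p : bringCurve.carrier) : curveC2.carrier :=
  sexticPoint polyC2 (p.val.rep 0) (-p.val.rep 0 - p.val.rep 1)
    (6 * (zetaThree - zetaThree ^ 2) * alternating p.val.rep)
    ((isBring_rep p).ne_zero_or p.val.rep_nonzero) (isBring_rep p).sq_eq_sexticForm

theorem toC2_eq_sexticPoint {p : bringCurve.carrier} {v : Fin 5 → ℂ} {a : ℂ}
    (hr : p.val.rep = a • v) (h : v 0 ≠ 0 ∨ -v 0 - v 1 ≠ 0)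
    (hy : (6 * (zetaThree - zetaThree ^ 2) * alternating v) ^ 2 =
      sexticForm polyC2 (v 0) (-v 0 - v 1)) :
    toC2 p = sexticPoint polyC2 (v 0) (-v 0 - v 1)
      (6 * (zetaThree - zetaThree ^ 2) * alternating v) h hy := by
  refine sexticPoint_eq_of_smul a ?_ ?_ ?_ <;> rw [hr] <;> simp [alternating] <;> ring

theorem toC2_smul (σ : Equiv.Perm (Fin 5)) (p : bringCurve.carrier) :
    ∃ h hy, toC2 (σ • p) = sexticPoint polyC2 (p.val.rep (σ⁻¹ 0))
      (-p.val.rep (σ⁻¹ 0) - p.val.rep (σ⁻¹ 1))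
      (6 * (zetaThree - zetaThree ^ 2) * alternating fun i => p.val.rep (σ⁻¹ i)) h hy := by
  obtain ⟨a, ha, hr⟩ := exists_rep_smul σ p
  have hb : IsBring fun i => p.val.rep (σ⁻¹ i) := by
    have := (isBring_rep (σ • p)).smul a⁻¹
    rwa [hr, smul_smul, inv_mul_cancel₀ ha, one_smul] at this
  have hne : (fun i => p.val.rep (σ⁻¹ i)) ≠ 0 := fun h0 => by
    rw [h0, smul_zero] at hr
    exact (σ • p).val.rep_nonzero hr
  exact ⟨hb.ne_zero_or hne, hb.sq_eq_sexticForm, toC2_eq_sexticPoint hr _ _⟩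

theorem toC2_perm345_smul (p : bringCurve.carrier) : toC2 (perm345 • p) = toC2 p := by
  obtain ⟨h, hy, e⟩ := toC2_smul perm345 p
  rw [e]
  have h0 : perm345⁻¹ 0 = 0 := by decide
  have h1 : perm345⁻¹ 1 = 1 := by decide
  have h2 : perm345⁻¹ 2 = 4 := by decide
  have h3 : perm345⁻¹ 3 = 2 := by decide
  have h4 : perm345⁻¹ 4 = 3 := by decide
  refine sexticPoint_eq_of_smul 1 ?_ ?_ ?_ <;> simp only [alternating, h0, h1, h2, h3, h4] <;> ring

theorem toC2_pow_smul (p : bringCurve.carrier) (n : ℕ) : toC2 (perm345 ^ n • p) = toC2 p := by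
  induction n with
  | zero => simp
  | succ n ih => rw [pow_succ', mul_smul, toC2_perm345_smul, ih]

theorem toC2_smul_of_mem {g : Equiv.Perm (Fin 5)} (hg : g ∈ Subgroup.closure {perm345})
    (p : bringCurve.carrier) : toC2 (g • p) = toC2 p := by
  induction hg using Subgroup.closure_induction generalizing p with
  | mem g hg => rw [Set.mem_singleton_iff.1 hg, toC2_perm345_smul]
  | one => rw [one_smul]
  | mul g g' _ _ h h' => rw [mul_smul, h, h']
  | inv g _ h => rw [← h (g⁻¹ • p), smul_inv_smul]

/-- Triples with the same elementary symmetric functions and the same alternating product differ by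
a cyclic permutation. -/
theorem cyclic_of_esymm {a b c a' b' c' : ℂ} (h1 : a' + b' + c' = a + b + c)
    (h2 : a' * b' + b' * c' + c' * a' = a * b + b * c + c * a) (h3 : a' * b' * c' = a * b * c)
    (h4 : (a' - b') * (b' - c') * (c' - a') = (a - b) * (b - c) * (c - a)) :
    (a' = a ∧ b' = b ∧ c' = c) ∨ (a' = b ∧ b' = c ∧ c' = a) ∨ (a' = c ∧ b' = a ∧ c' = b) := by
  have key : ∀ x y z x' y' z' : ℂ, x' + y' + z' = x + y + z →
      x' * y' + y' * z' + z' * x' = x * y + y * z + z * x → x' = x →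
      (y' = y ∧ z' = z) ∨ (y' = z ∧ z' = y) := by
    rintro x y z x' y' z' e1 e2 rfl
    have e3 : z' = y + z - y' := by linear_combination e1
    have e4 : (y' - y) * (y' - z) = 0 := by
      rw [e3] at e2
      linear_combination -e2
    rcases mul_eq_zero.1 e4 with h | h
    · have := sub_eq_zero.1 h
      exact .inl ⟨this, by rw [e3, this]; ring⟩
    · have := sub_eq_zero.1 h
      exact .inr ⟨this, by rw [e3, this]; ring⟩
  -- An odd rearrangement with the same alternating product forces two entries to coincide, and then
  -- it is also a cyclic one.
  have swap : ∀ x y z : ℂ, (x - z) * (z - y) * (y - x) = (x - y) * (y - z) * (z - x) →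
      x = y ∨ y = z ∨ z = x := by
    intro x y z e
    have : (x - y) * (y - z) * (z - x) = 0 := by linear_combination -e / 2
    rcases mul_eq_zero.1 this with h | h
    · rcases mul_eq_zero.1 h with h | h
      · exact .inl (sub_eq_zero.1 h)
      · exact .inr (.inl (sub_eq_zero.1 h))
    · exact .inr (.inr (sub_eq_zero.1 h))
  have h5 : (a' - a) * (a' - b) * (a' - c) = 0 := by
    linear_combination a' ^ 2 * h1 - a' * h2 + h3
  rcases mul_eq_zero.1 h5 with h6 | h6
  · rcases mul_eq_zero.1 h6 with h7 | h7
    · rcases key a b c a' b' c' h1 h2 (sub_eq_zero.1 h7) with ⟨rfl, rfl⟩ | ⟨rfl, rfl⟩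
      · exact .inl ⟨sub_eq_zero.1 h7, rfl, rfl⟩
      · rw [sub_eq_zero.1 h7] at h4 ⊢
        rcases swap _ _ _ h4 with rfl | rfl | rfl <;> simp
    · rcases key b c a a' b' c' (by linear_combination h1) (by linear_combination h2)
        (sub_eq_zero.1 h7) with ⟨rfl, rfl⟩ | ⟨rfl, rfl⟩
      · exact .inr (.inl ⟨sub_eq_zero.1 h7, rfl, rfl⟩)
      · rw [sub_eq_zero.1 h7] at h4 ⊢
        rcases swap b c' b' (by linear_combination h4) with rfl | rfl | rfl <;> simp
  · rcases key c a b a' b' c' (by linear_combination h1) (by linear_combination h2)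
      (sub_eq_zero.1 h6) with ⟨rfl, rfl⟩ | ⟨rfl, rfl⟩
    · exact .inr (.inr ⟨sub_eq_zero.1 h6, rfl, rfl⟩)
    · rw [sub_eq_zero.1 h6] at h4 ⊢
      rcases swap c c' b' (by linear_combination h4) with rfl | rfl | rfl <;> simp

theorem zetaThree_sub_ne_zero : 6 * (zetaThree - zetaThree ^ 2) ≠ 0 := by
  intro h
  rw [zetaThree_eq] at h
  have : zetaThree = -1 / 2 := by linear_combination h / 12
  have h2 := zetaThree_eq
  rw [this] at h2
  norm_num at h2

/-- Equal images fix, up to a scalar, the first two coordinates and the alternating product of the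
others, hence also the elementary symmetric functions of these. -/
theorem exists_pow_smul_of_toC2_eq {p q : bringCurve.carrier} (h : toC2 p = toC2 q) :
    ∃ n : ℕ, perm345 ^ n • q = p := by
  obtain ⟨c, hc, hs, ht, hy⟩ := exists_smul_of_sexticPoint_eq h
  set v := p.val.rep with hv
  set w := q.val.rep with hw
  have h1 : v 1 = c * w 1 := by linear_combination -ht - hs
  have hV : alternating v = c ^ 3 * alternating w := by
    refine mul_left_cancel₀ zetaThree_sub_ne_zero ?_
    rw [hy]
    ring
  obtain ⟨e1, e2, e3⟩ := (isBring_rep p).esymm_three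
  obtain ⟨f1, f2, f3⟩ := (isBring_rep q).esymm_three
  rw [← hv, hs, h1] at e1 e2 e3
  rw [← hw] at f1 f2 f3
  rcases cyclic_of_esymm (a := c * w 2) (b := c * w 3) (c := c * w 4) (a' := v 2) (b' := v 3)
    (c' := v 4) (by linear_combination e1 - c * f1) (by linear_combination e2 - c ^ 2 * f2)
    (by linear_combination e3 - c ^ 3 * f3) (by
      rw [alternating, alternating] at hV
      linear_combination hV) with ⟨g2, g3, g4⟩ | ⟨g2, g3, g4⟩ | ⟨g2, g3, g4⟩
  · refine ⟨0, eq_smul_of_rep c fun i => ?_⟩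
    fin_cases i
    exacts [hs, h1, g2, g3, g4]
  · refine ⟨2, eq_smul_of_rep c fun i => ?_⟩
    fin_cases i
    exacts [hs, h1, g2, g3, g4]
  · refine ⟨1, eq_smul_of_rep c fun i => ?_⟩
    fin_cases i
    exacts [hs, h1, g2, g3, g4]

theorem exists_esymm_three (a b c : ℂ) : ∃ x y z : ℂ, x + y + z = a ∧ x * y + y * z + z * x = b ∧
    x * y * z = c := by
  set f : Polynomial ℂ := .X ^ 3 + (-.C a * .X ^ 2 + .C b * .X - .C c) with hf
  have hd : f.degree ≠ 0 := by
    have : f.degree = 3 := by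
      rw [hf]
      compute_degree!
    rw [this]
    norm_num
  obtain ⟨x, hx⟩ := IsAlgClosed.exists_root f hd
  have hx' : x ^ 3 + (-a * x ^ 2 + b * x - c) = 0 := by simpa [hf, Polynomial.IsRoot] using hx
  obtain ⟨r, hr⟩ := IsAlgClosed.exists_pow_nat_eq ((a - x) ^ 2 - 4 * (b - x * (a - x)))
    (n := 2) two_pos
  refine ⟨x, (a - x + r) / 2, (a - x - r) / 2, by ring, by linear_combination -hr / 4, ?_⟩
  linear_combination -x * hr / 4 + hx'

theorem exists_toC2_eq {v : Fin 5 → ℂ} (h : IsBring v) (hne : v ≠ 0) :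
    ∃ p, toC2 p = sexticPoint polyC2 (v 0) (-v 0 - v 1)
      (6 * (zetaThree - zetaThree ^ 2) * alternating v) (h.ne_zero_or hne) h.sq_eq_sexticForm := by
  obtain ⟨a, ha, hr⟩ := Projectivization.exists_rep_eq (v := v) (hv := hne) rfl
  exact ⟨⟨Projectivization.mk ℂ v hne, (mk_mem_bringSet hne).2 h⟩, toC2_eq_sexticPoint hr _ _⟩

/-- The last three coordinates are the roots of a cubic determined by `s, t`. Up to the fixed
constant their alternating product is `±y`, and exchanging two roots corrects the sign. -/
theorem toC2_surjective : Function.Surjective toC2 := by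
  intro q
  obtain ⟨s, t, y, h, hy, rfl⟩ := exists_eq_sexticPoint q
  obtain ⟨a, b, c, h1, h2, h3⟩ := exists_esymm_three (-(s + (-s - t)))
    (s ^ 2 + s * (-s - t) + (-s - t) ^ 2)
    (-(s ^ 3 + s ^ 2 * (-s - t) + s * (-s - t) ^ 2 + (-s - t) ^ 3))
  have hb : IsBring ![s, -s - t, a, b, c] :=
    IsBring.of_esymm_three (by simpa using h1) (by simpa using h2) (by simpa using h3)
  have hb' : IsBring ![s, -s - t, b, a, c] :=
    IsBring.of_esymm_three (by simpa using (by linear_combination h1 : b + a + c = _))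
      (by simpa using (by linear_combination h2 : b * a + a * c + c * b = _))
      (by simpa using (by linear_combination h3 : b * a * c = _))
  have hne : ∀ d e f : ℂ, ![s, -s - t, d, e, f] ≠ 0 := by
    intro d e f h0
    have hs : s = 0 := congrFun h0 0
    have ht : -s - t = 0 := congrFun h0 1
    rw [hs] at ht
    exact h.elim (fun h => h hs) fun h => h (by linear_combination -ht)
  have hsq := hb.sq_eq_sexticForm
  simp only [Matrix.cons_val_zero, Matrix.cons_val_one] at hsq
  have ht : -s - (-s - t) = t := by ring
  rw [ht, ← hy] at hsq
  rcases sq_eq_sq_iff_eq_or_eq_neg.1 hsq with h4 | h4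
  · obtain ⟨p, hp⟩ := exists_toC2_eq hb (hne _ _ _)
    exact ⟨p, hp.trans (sexticPoint_eq_of_smul 1 (by simp) (by simp) (by rw [h4]; ring))⟩
  · obtain ⟨p, hp⟩ := exists_toC2_eq hb' (hne _ _ _)
    refine ⟨p, hp.trans (sexticPoint_eq_of_smul 1 (by simp) (by simp) ?_)⟩
    have : alternating ![s, -s - t, b, a, c] = -alternating ![s, -s - t, a, b, c] := by
      simp [alternating]
      ring
    rw [this]
    linear_combination -h4

open MvPolynomial in
theorem toC2_continuous_and_regAt : Continuous toC2 ∧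
    ∀ p f, curveC2.RegAt (toC2 p) f → bringCurve.RegAt p (f ∘ toC2) := by
  refine continuous_and_regAt_comp_of_polynomial (e := 3)
    ![X 0 ^ 3, X 0 ^ 2 * (-X 0 - X 1), X 0 * (-X 0 - X 1) ^ 2, (-X 0 - X 1) ^ 3,
      C (6 * (zetaThree - zetaThree ^ 2)) * ((X 2 - X 3) * (X 3 - X 4) * (X 4 - X 2))] ?_ ?_
  · have hX : ∀ i : Fin 5, (X i : MvPolynomial (Fin 5) ℂ).IsHomogeneous 1 := isHomogeneous_X ℂ
    have ht : (-X 0 - X 1 : MvPolynomial (Fin 5) ℂ).IsHomogeneous 1 := (hX 0).neg.sub (hX 1)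
    intro i
    fin_cases i
    · exact (hX 0).pow 3
    · exact ((hX 0).pow 2).mul ht
    · exact (hX 0).mul (ht.pow 2)
    · exact ht.pow 3
    · exact ((((hX 2).sub (hX 3)).mul ((hX 3).sub (hX 4))).mul ((hX 4).sub (hX 2))).C_mul _
  · intro p
    have e : (fun i => eval p.val.rep ((![X 0 ^ 3, X 0 ^ 2 * (-X 0 - X 1),
        X 0 * (-X 0 - X 1) ^ 2, (-X 0 - X 1) ^ 3, C (6 * (zetaThree - zetaThree ^ 2)) *
        ((X 2 - X 3) * (X 3 - X 4) * (X 4 - X 2))] : Fin 5 → MvPolynomial (Fin 5) ℂ) i)) =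
        ![p.val.rep 0 ^ 3, p.val.rep 0 ^ 2 * (-p.val.rep 0 - p.val.rep 1),
          p.val.rep 0 * (-p.val.rep 0 - p.val.rep 1) ^ 2, (-p.val.rep 0 - p.val.rep 1) ^ 3,
          6 * (zetaThree - zetaThree ^ 2) * alternating p.val.rep] := by
      ext i
      fin_cases i <;> simp [alternating]
    simp only [e]
    exact ⟨sextic_ne_zero _ _ _ ((isBring_rep p).ne_zero_or p.val.rep_nonzero), rfl⟩

end bringCurve

/-- The curve property is inherited through the surjection from Bring's curve, so the sextic needs
no finiteness argument of its own. -/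
theorem isCurve_curveC2 : curveC2.IsCurve :=
  isCurve_bringCurve.of_surjective bringCurve.toC2_continuous_and_regAt.1
    bringCurve.toC2_surjective FunSpace.isClosed_singleton_projectiveSubspace
    (inferInstanceAs (Infinite (sexticCurve polyC2).carrier))


/-! ### The function field of `𝓑` as a Kummer extension of that of `𝓒₂` -/

namespace bringCurve

open FunSpace Filter

/-- The Lagrange resolvent of the last three coordinates, for the cube root of unity `z`. -/
noncomputable def resolvent (z : ℂ) (p : bringCurve.carrier) : ℂ :=
  (p.val.rep 2 + z * p.val.rep 3 + z ^ 2 * p.val.rep 4) / p.val.rep 0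

theorem x_toC2 (p : bringCurve.carrier) :
    CurveC2.x (toC2 p) = (-p.val.rep 0 - p.val.rep 1) / p.val.rep 0 :=
  CurveC2.x_sexticPoint

theorem y_toC2 (p : bringCurve.carrier) : CurveC2.y (toC2 p) =
    6 * (zetaThree - zetaThree ^ 2) * alternating p.val.rep / p.val.rep 0 ^ 3 :=
  CurveC2.y_sexticPoint

theorem resolvent_smul (p : bringCurve.carrier) :
    resolvent zetaThree (perm345 • p) = zetaThree * resolvent zetaThree p := by
  obtain ⟨a, ha, hr⟩ := exists_rep_smul perm345 p
  have h0 : perm345⁻¹ 0 = 0 := by decide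
  have h2 : perm345⁻¹ 2 = 4 := by decide
  have h3 : perm345⁻¹ 3 = 2 := by decide
  have h4 : perm345⁻¹ 4 = 3 := by decide
  simp only [resolvent, hr, Pi.smul_apply, smul_eq_mul, h0, h2, h3, h4]
  rw [← mul_div_assoc, ← mul_div_mul_left (zetaThree * _) _ ha]
  congr 1
  linear_combination -a * p.val.rep 4 * zetaThree_cube

theorem resolvent_pow_smul (p : bringCurve.carrier) (n : ℕ) :
    resolvent zetaThree (perm345 ^ n • p) = zetaThree ^ n * resolvent zetaThree p := by
  induction n with
  | zero => simp
  | succ n ih => rw [pow_succ', mul_smul, resolvent_smul, ih, pow_succ']; ring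

theorem zetaThree_sq_sq : (zetaThree ^ 2) ^ 2 = zetaThree := by
  linear_combination zetaThree * zetaThree_cube

/-- `(r + ζs + ζ²t)(r + ζ²s + ζt) = e₁² - 3e₂`, a symmetric function of the triple. -/
theorem resolvent_mul {p : bringCurve.carrier} (h : p.val.rep 0 ≠ 0) :
    resolvent zetaThree p * resolvent (zetaThree ^ 2) p =
      -(3 + 3 * CurveC2.x (toC2 p) + 2 * CurveC2.x (toC2 p) ^ 2) := by
  obtain ⟨h1, h2, -⟩ := (isBring_rep p).esymm_three
  have key : ∀ r s t : ℂ, (r + zetaThree * s + zetaThree ^ 2 * t) *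
      (r + zetaThree ^ 2 * s + zetaThree * t) = (r + s + t) ^ 2 - 3 * (r * s + s * t + t * r) := by
    have := zetaThree_eq
    intro r s t
    grind
  rw [x_toC2, resolvent, resolvent, zetaThree_sq_sq, div_mul_div_comm, key, h1, h2]
  field_simp
  ring

/-- Lagrange's formula: the cube is a symmetric function plus a multiple of the alternating product,
hence a function on `𝓒₂`. The resolvent is thus a Kummer generator. -/
theorem resolvent_cube {p : bringCurve.carrier} (h : p.val.rep 0 ≠ 0) :
    resolvent zetaThree p ^ 3 = (20 * CurveC2.x (toC2 p) ^ 3 + 45 * CurveC2.x (toC2 p) ^ 2 +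
      45 * CurveC2.x (toC2 p)) / 2 - CurveC2.y (toC2 p) / 4 := by
  obtain ⟨h1, h2, h3⟩ := (isBring_rep p).esymm_three
  have key : ∀ r s t : ℂ, (r + zetaThree * s + zetaThree ^ 2 * t) ^ 3 =
      (2 * (r + s + t) ^ 3 - 9 * (r + s + t) * (r * s + s * t + t * r) + 27 * (r * s * t)) / 2 -
      3 / 2 * (zetaThree - zetaThree ^ 2) * ((r - s) * (s - t) * (t - r)) := by
    have := zetaThree_eq
    intro r s t
    grind
  rw [x_toC2, y_toC2, resolvent, div_pow, key, h1, h2, h3, alternating]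
  field_simp
  ring

theorem sum_eq {p : bringCurve.carrier} (h : p.val.rep 0 ≠ 0) :
    p.val.rep 2 + p.val.rep 3 + p.val.rep 4 = CurveC2.x (toC2 p) * p.val.rep 0 := by
  rw [(isBring_rep p).esymm_three.1, x_toC2]
  field_simp
  ring

theorem tendsto_toC2 : Tendsto toC2 cofinite cofinite :=
  isCurve_bringCurve.tendsto_cofinite isCurve_curveC2 toC2_continuous_and_regAt.1 toC2_surjective

theorem eventually_rep_zero : ∀ᶠ p : bringCurve.carrier in cofinite, p.val.rep 0 ≠ 0 :=
  (tendsto_toC2.eventually (CurveC2.eventually_rep_zero isCurve_curveC2)).mono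
    fun _ h => CurveC2.rep_zero_ne_zero_iff.1 h

open Polynomial in
theorem eventually_resolvent_ne_zero : ∀ᶠ p in cofinite, resolvent zetaThree p ≠ 0 := by
  have h0 : (3 + 3 * X + 2 * X ^ 2 : ℂ[X]) ≠ 0 := fun h => by
    have := congrArg (eval 0) h
    norm_num at this
  filter_upwards [eventually_rep_zero, tendsto_toC2.eventually
    (eventually_eval_ne_zero (CurveC2.eventually_x_ne isCurve_curveC2) h0)] with p h1 h2 h3
  have := resolvent_mul h1
  rw [h3, zero_mul] at this
  apply h2
  simp
  linear_combination this

theorem inSpan_resolvent : InSpan (I := Fin 3) toC2 (fun i p => resolvent zetaThree p ^ (i : ℕ))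
    (resolvent zetaThree) :=
  (inSpan_self 1).congr (Eventually.of_forall fun p => by simp)

theorem isRational_x : curveC2.IsRational CurveC2.x :=
  (CurveC2.eventually_rep_zero isCurve_curveC2).mono fun _ => CurveC2.regAt_x

theorem isRational_cube : curveC2.IsRational fun q => (20 * CurveC2.x q ^ 3 +
    45 * CurveC2.x q ^ 2 + 45 * CurveC2.x q) / 2 - CurveC2.y q / 4 := by
  filter_upwards [CurveC2.eventually_rep_zero isCurve_curveC2] with q hq
  have h1 := regAt_sub (regAt_eval (CurveC2.regAt_x hq)
    (.C 10 * .X ^ 3 + .C (45 / 2) * .X ^ 2 + .C (45 / 2) * .X))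
    (regAt_const_mul (1 / 4) (CurveC2.regAt_y hq))
  convert h1 using 1
  ext r
  simp
  ring

theorem inSpan_one : InSpan (I := Fin 3) toC2 (fun i p => resolvent zetaThree p ^ (i : ℕ)) 1 :=
  (inSpan_self 0).congr (Eventually.of_forall fun p => by simp)

/-- The second resolvent is `(ρρ')ρ²/ρ³`, where `ρρ'` and `ρ³` come from `𝓒₂`. -/
theorem inSpan_resolvent_sq : InSpan (I := Fin 3) toC2
    (fun i p => resolvent zetaThree p ^ (i : ℕ)) (resolvent (zetaThree ^ 2)) := by
  have hE : curveC2.IsRational fun q => -(3 + 3 * CurveC2.x q + 2 * CurveC2.x q ^ 2) := by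
    filter_upwards [CurveC2.eventually_rep_zero isCurve_curveC2] with q hq
    convert regAt_eval (CurveC2.regAt_x hq) (-(3 + 3 * .X + 2 * .X ^ 2)) using 2
    simp
  refine (inSpan_smul_self 2 (isCurve_curveC2.isRational_div hE isRational_cube)).congr ?_
  filter_upwards [eventually_rep_zero, eventually_resolvent_ne_zero] with p h1 h2
  simp only [Pi.div_apply, ← resolvent_cube h1, ← resolvent_mul h1]
  simp
  field_simp

theorem inSpan_mul (i j : Fin 3) : InSpan (I := Fin 3) toC2
    (fun i p => resolvent zetaThree p ^ (i : ℕ))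
    ((fun p => resolvent zetaThree p ^ (i : ℕ)) * fun p => resolvent zetaThree p ^ (j : ℕ)) := by
  by_cases h : (i : ℕ) + j < 3
  · exact (inSpan_self ⟨i + j, h⟩).congr (Eventually.of_forall fun p => by simp [pow_add])
  · refine (inSpan_smul_self ⟨i + j - 3, by omega⟩ isRational_cube).congr ?_
    filter_upwards [eventually_rep_zero] with p hp
    simp only [← resolvent_cube hp, Pi.mul_apply, ← pow_add]
    congr 1
    omega

/-- The last three coordinates are recovered from their sum and the two resolvents by the inverse
Fourier transform on `ℤ/3`. -/
theorem inSpan_rep (i : Fin 5) : InSpan (I := Fin 3) toC2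
    (fun i p => resolvent zetaThree p ^ (i : ℕ)) (fun p => p.val.rep i / p.val.rep 0) := by
  have hx : InSpan (I := Fin 3) toC2 (fun i p => resolvent zetaThree p ^ (i : ℕ))
      (fun p => CurveC2.x (toC2 p) * 1) := inSpan_one.smul isRational_x
  have hc : ∀ (c : ℂ) {h}, InSpan (I := Fin 3) toC2
      (fun i p => resolvent zetaThree p ^ (i : ℕ)) h → InSpan (I := Fin 3) toC2
      (fun i p => resolvent zetaThree p ^ (i : ℕ)) (fun p => c * h p) := fun c _ hh =>
    hh.smul (IsCurve.isRational_const c)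
  have hz := zetaThree_eq
  fin_cases i
  · refine inSpan_one.congr (eventually_rep_zero.mono fun p hp => ?_)
    simp [hp]
  · refine ((hc (-1) inSpan_one).add (hc (-1) hx)).congr (eventually_rep_zero.mono fun p hp => ?_)
    simp [x_toC2]
    field_simp
    ring
  · refine (hc (1 / 3) ((hx.add inSpan_resolvent).add inSpan_resolvent_sq)).congr
      (eventually_rep_zero.mono fun p hp => ?_)
    have := sum_eq hp
    simp only [Pi.add_apply, resolvent, zetaThree_sq_sq]
    field_simp
    grind
  · refine (hc (1 / 3) ((hx.add (hc (zetaThree ^ 2) inSpan_resolvent)).add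
      (hc zetaThree inSpan_resolvent_sq))).congr (eventually_rep_zero.mono fun p hp => ?_)
    have := sum_eq hp
    simp only [Pi.add_apply, resolvent, zetaThree_sq_sq]
    field_simp
    grind
  · refine (hc (1 / 3) ((hx.add (hc zetaThree inSpan_resolvent)).add
      (hc (zetaThree ^ 2) inSpan_resolvent_sq))).congr (eventually_rep_zero.mono fun p hp => ?_)
    have := sum_eq hp
    simp only [Pi.add_apply, resolvent, zetaThree_sq_sq]
    field_simp
    grind

theorem rep_eq_smul_div {p : bringCurve.carrier} {j : Fin 5} (hp : p.val.rep j ≠ 0) :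
    p.val.rep = p.val.rep j • fun i => p.val.rep i / p.val.rep j := by
  ext i
  simp
  field_simp

theorem isRational_of_toC2 (f : curveC2.carrier → ℂ) (hf : bringCurve.IsRational (f ∘ toC2)) :
    curveC2.IsRational f := by
  have hz := zetaThree_eq
  refine isRational_of_comp (I := Fin 3) (K := Fin 3)
    (m := fun i p => resolvent zetaThree p ^ (i : ℕ)) isCurve_bringCurve isCurve_curveC2
    toC2_continuous_and_regAt.1 toC2_surjective (fun k p => perm345 ^ (k : ℕ) • p)
    (fun k => MulAction.injective _) (fun k p => toC2_pow_smul p k)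
    (fun k i => (zetaThree ^ (k : ℕ)) ^ (i : ℕ)) (fun k i p => ?_)
    -- Orthogonality of characters: the weights are `ζ^(-ik)/3`.
    (fun i k => ((zetaThree ^ 2) ^ (k : ℕ)) ^ (i : ℕ) / 3) (fun i j => ?_) (fun i => ?_)
    (fun h hh => ?_) f hf
  · rw [resolvent_pow_smul, mul_pow]
  · fin_cases i <;> fin_cases j <;> simp [Fin.sum_univ_three] <;> grind
  · exact eventually_resolvent_ne_zero.mono fun p hp => pow_ne_zero _ hp
  · obtain ⟨P, Q, h1, h2⟩ := hh.exists_eval isCurve_bringCurve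
      (fun p i => p.val.rep i / p.val.rep 0)
      (eventually_rep_zero.mono fun p hp => ⟨_, hp, rep_eq_smul_div hp⟩)
    exact ⟨_, _, InSpan.eval inSpan_mul inSpan_one inSpan_rep P,
      InSpan.eval inSpan_mul inSpan_one inSpan_rep Q, h1, h2⟩

theorem isQuot_toC2 : IsQuot toC2 :=
  isCurve_bringCurve.isQuot isCurve_curveC2 (CurveC2.hasOrders isCurve_curveC2)
    toC2_continuous_and_regAt.1 toC2_surjective toC2_continuous_and_regAt.2 isRational_of_toC2

end bringCurve

/-! ### The involutions of `𝓒₂` -/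

section KleinFour

variable {G : Type*} [Group G] {a b : G}

theorem Subgroup.mem_closure_pair_of_mul_self (ha : a * a = 1) (hb : b * b = 1)
    (hab : a * b = b * a) (g : G) :
    g ∈ Subgroup.closure {a, b} ↔ g = 1 ∨ g = a ∨ g = b ∨ g = a * b := by
  have ha' : a⁻¹ = a := inv_eq_of_mul_eq_one_left ha
  have hb' : b⁻¹ = b := inv_eq_of_mul_eq_one_left hb
  have haa : ∀ c, a * (a * c) = c := fun c => by rw [← mul_assoc, ha, one_mul]
  have hba : ∀ c, b * (a * c) = a * (b * c) := fun c => by rw [← mul_assoc, ← hab, mul_assoc]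
  constructor
  · intro hg
    induction hg using Subgroup.closure_induction with
    | mem g hg =>
      rcases hg with rfl | rfl
      · exact .inr (.inl rfl)
      · exact .inr (.inr (.inl rfl))
    | one => exact .inl rfl
    | mul g g' _ _ h h' =>
      rcases h with rfl | rfl | rfl | rfl <;> rcases h' with rfl | rfl | rfl | rfl <;>
        simp [mul_assoc, ha, hb, haa, hba, ← hab]
    | inv g _ h =>
      rcases h with rfl | rfl | rfl | rfl <;> simp [ha', hb', hab]
  · have h1 : a ∈ Subgroup.closure {a, b} := Subgroup.subset_closure (by simp)
    have h2 : b ∈ Subgroup.closure {a, b} := Subgroup.subset_closure (by simp)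
    rintro (rfl | rfl | rfl | rfl)
    exacts [one_mem _, h1, h2, mul_mem h1 h2]

theorem isKleinFour_closure_pair (ha : a * a = 1) (hb : b * b = 1) (hab : a * b = b * a)
    (ha1 : a ≠ 1) (hb1 : b ≠ 1) (hne : a ≠ b) : IsKleinFour (Subgroup.closure {a, b}) := by
  classical
  have hmem := Subgroup.mem_closure_pair_of_mul_self ha hb hab
  have hset : (Subgroup.closure {a, b} : Set G) = ({1, a, b, a * b} : Finset G) := by
    ext g
    simpa using hmem g
  refine ⟨?_, ?_⟩
  · have : Nat.card (Subgroup.closure {a, b}) = (Subgroup.closure {a, b} : Set G).ncard := rfl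
    rw [this, hset, Set.ncard_coe_finset]
    have h1 : a * b ≠ 1 := fun h => hne (by
      rw [← mul_left_inj b, h, hb])
    rw [Finset.card_insert_of_notMem, Finset.card_insert_of_notMem, Finset.card_insert_of_notMem,
      Finset.card_singleton] <;> simp [ha1, hb1, hne, ha1.symm, hb1.symm, h1.symm]
  · have : Nontrivial (Subgroup.closure {a, b}) :=
      ⟨⟨⟨a, (hmem a).2 (by simp)⟩, 1, fun h => ha1 (congrArg Subtype.val h)⟩⟩
    refine (Monoid.exponent_eq_prime_iff Nat.prime_two).2 fun g hg =>
      orderOf_eq_prime (Subtype.ext ?_) hg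
    have hc : ∀ c, b * (a * c) = a * (b * c) := fun c => by rw [← mul_assoc, ← hab, mul_assoc]
    rw [pow_two]
    rcases (hmem g).1 g.property with h | h | h | h <;> simp [h, mul_assoc, ha, hb, hc]

end KleinFour

namespace CurveC2

open FunSpace Filter

/-- A formula in `(s, t, y)` compatible with the scaling of `ℙ(1, 1, 3)` does not depend on the
chosen triple. -/
theorem exists_map (L : ℂ → ℂ → ℂ → ℂ × ℂ × ℂ)
    (hL : ∀ s t y, s ≠ 0 ∨ t ≠ 0 → y ^ 2 = sexticForm polyC2 s t →
      ((L s t y).1 ≠ 0 ∨ (L s t y).2.1 ≠ 0) ∧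
        (L s t y).2.2 ^ 2 = sexticForm polyC2 (L s t y).1 (L s t y).2.1)
    (hsmul : ∀ c s t y, L (c * s) (c * t) (c ^ 3 * y) =
      (c * (L s t y).1, c * (L s t y).2.1, c ^ 3 * (L s t y).2.2))
    (hinv : ∀ s t y, L (L s t y).1 (L s t y).2.1 (L s t y).2.2 = (s, t, y)) :
    ∃ σ : Equiv.Perm curveC2.carrier, σ * σ = 1 ∧ ∀ s t y h hy, ∃ h' hy',
      σ (sexticPoint polyC2 s t y h hy) =
        sexticPoint polyC2 (L s t y).1 (L s t y).2.1 (L s t y).2.2 h' hy' := by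
  choose s t y h hy hp using fun p : curveC2.carrier => exists_eq_sexticPoint (f := polyC2) p
  let σ : curveC2.carrier → curveC2.carrier := fun p =>
    sexticPoint polyC2 (L (s p) (t p) (y p)).1 (L (s p) (t p) (y p)).2.1
      (L (s p) (t p) (y p)).2.2 (hL _ _ _ (h p) (hy p)).1 (hL _ _ _ (h p) (hy p)).2
  have hσ : ∀ s' t' y' h' hy', σ (sexticPoint polyC2 s' t' y' h' hy') =
      sexticPoint polyC2 (L s' t' y').1 (L s' t' y').2.1 (L s' t' y').2.2 (hL _ _ _ h' hy').1
        (hL _ _ _ h' hy').2 := by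
    intro s' t' y' h' hy'
    obtain ⟨c, hc, h1, h2, h3⟩ := exists_smul_of_sexticPoint_eq
      (hp (sexticPoint polyC2 s' t' y' h' hy')).symm
    have e := hsmul c s' t' y'
    rw [← h1, ← h2, ← h3] at e
    refine sexticPoint_eq_of_smul c ?_ ?_ ?_ <;> rw [e]
  have hinvol : Function.Involutive σ := by
    intro p
    obtain ⟨s', t', y', h', hy', rfl⟩ := exists_eq_sexticPoint p
    refine (congrArg σ (hσ _ _ _ h' hy')).trans ((hσ _ _ _ _ _).trans ?_)
    refine sexticPoint_eq_of_smul 1 ?_ ?_ ?_ <;> rw [hinv] <;> simp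
  exact ⟨hinvol.toPerm, Equiv.ext fun p => hinvol p, fun s' t' y' h' hy' => ⟨_, _, hσ _ _ _ _ _⟩⟩

theorem exists_involutions : ∃ σ ι : Equiv.Perm curveC2.carrier, σ * σ = 1 ∧ ι * ι = 1 ∧
    ∀ (s t y : ℂ) (h : s ≠ 0 ∨ t ≠ 0) (hy : y ^ 2 = sexticForm polyC2 s t),
      (∃ h' hy', σ (sexticPoint polyC2 s t y h hy) = sexticPoint polyC2 (-s - t) t y h' hy') ∧
      (∃ hy', ι (sexticPoint polyC2 s t y h hy) = sexticPoint polyC2 s t (-y) h hy') := by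
  obtain ⟨σ, h1, h2⟩ := exists_map (fun s t y => (-s - t, t, y)) (fun s t y h hy => by
      refine ⟨?_, ?_⟩
      · by_contra! h0
        obtain ⟨h1, h2⟩ := h0
        exact h.elim (fun h => h (by linear_combination -h1 - h2)) fun h => h h2
      · simp only [sexticForm_polyC2] at hy ⊢
        rw [hy]
        ring) (fun c s t y => by simp; ring) (fun s t y => by simp)
  obtain ⟨ι, h3, h4⟩ := exists_map (fun s t y => (s, t, -y)) (fun s t y h hy => by
      simpa using ⟨h, hy⟩) (fun c s t y => by simp) (fun s t y => by simp)
  exact ⟨σ, ι, h1, h3, fun s t y h hy => ⟨h2 s t y h hy, (h4 s t y h hy).2⟩⟩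

theorem isIso_of_mul_self {σ : Equiv.Perm curveC2.carrier} (h : σ * σ = 1) (hc : Continuous σ)
    (hr : ∀ p f, curveC2.RegAt (σ p) f → curveC2.RegAt p (f ∘ σ)) : IsIso σ := by
  have hs : ∀ p, σ (σ p) = p := fun p => Equiv.congr_fun h p
  have hsymm : σ.symm = σ := Equiv.ext fun p => by
    rw [Equiv.symm_apply_eq, hs]
  refine ⟨hc, by rwa [hsymm], fun p f => ⟨hr p f, fun hf => ?_⟩⟩
  have := hr (σ p) (f ∘ σ) (by rwa [hs])
  convert this using 1
  ext q
  simp [hs]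

open MvPolynomial in
/-- A map of `𝓒₂` that is linear in the coordinates of `ℙ⁴`. -/
theorem continuous_and_regAt_of_linear {σ : curveC2.carrier → curveC2.carrier}
    (M : Fin 5 → Fin 5 → ℂ)
    (h : ∀ s t y h hy, ∃ s' t' y' h' hy', σ (sexticPoint polyC2 s t y h hy) =
        sexticPoint polyC2 s' t' y' h' hy' ∧
      ∀ i, ∑ j, M i j * ![s ^ 3, s ^ 2 * t, s * t ^ 2, t ^ 3, y] j =
        ![s' ^ 3, s' ^ 2 * t', s' * t' ^ 2, t' ^ 3, y'] i) :
    Continuous σ ∧ ∀ p f, curveC2.RegAt (σ p) f → curveC2.RegAt p (f ∘ σ) := by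
  refine continuous_and_regAt_comp_of_polynomial (e := 1) (fun i => ∑ j, C (M i j) * X j)
    (fun i => IsHomogeneous.sum _ _ _ fun j _ => (isHomogeneous_X ℂ j).C_mul _) fun p => ?_
  obtain ⟨s, t, y, h1, hy, rfl⟩ := exists_eq_sexticPoint p
  obtain ⟨s', t', y', h', hy', e, hM⟩ := h s t y h1 hy
  obtain ⟨a, ha, hr⟩ := sexticPoint_rep (f := polyC2) (h := h1) (hy := hy)
  have hv : (fun i => eval (sexticPoint polyC2 s t y h1 hy).val.rep (∑ j, C (M i j) * X j)) =
      a • ![s' ^ 3, s' ^ 2 * t', s' * t' ^ 2, t' ^ 3, y'] := by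
    ext i
    rw [Pi.smul_apply, smul_eq_mul, ← hM i, hr]
    simp only [map_sum, map_mul, eval_C, eval_X, Pi.smul_apply, smul_eq_mul, Finset.mul_sum,
      mul_left_comm]
  have hne := smul_ne_zero ha (sextic_ne_zero s' t' y' h')
  rw [← hv] at hne
  refine ⟨hne, ?_⟩
  rw [e]
  exact (Projectivization.mk_eq_mk_of_smul a hv).symm

theorem isIso_involutions {σ ι : Equiv.Perm curveC2.carrier} (h1 : σ * σ = 1) (h2 : ι * ι = 1)
    (h : ∀ (s t y : ℂ) (h : s ≠ 0 ∨ t ≠ 0) (hy : y ^ 2 = sexticForm polyC2 s t),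
      (∃ h' hy', σ (sexticPoint polyC2 s t y h hy) = sexticPoint polyC2 (-s - t) t y h' hy') ∧
      (∃ hy', ι (sexticPoint polyC2 s t y h hy) = sexticPoint polyC2 s t (-y) h hy')) :
    IsIso σ ∧ IsIso ι := by
  have hσ : Continuous σ ∧ ∀ p f, curveC2.RegAt (σ p) f → curveC2.RegAt p (f ∘ σ) := by
    -- The rows expand `(-s-t)³, (-s-t)²t, (-s-t)t², t³, y` in the coordinates of `ℙ⁴`.
    refine continuous_and_regAt_of_linear ![![-1, -3, -3, -1, 0], ![0, 1, 2, 1, 0],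
      ![0, 0, -1, -1, 0], ![0, 0, 0, 1, 0], ![0, 0, 0, 0, 1]] fun s t y h0 hy => ?_
    obtain ⟨h', hy', e⟩ := (h s t y h0 hy).1
    refine ⟨_, _, _, h', hy', e, fun i => ?_⟩
    fin_cases i <;> simp [Fin.sum_univ_five] <;> ring
  have hι : Continuous ι ∧ ∀ p f, curveC2.RegAt (ι p) f → curveC2.RegAt p (f ∘ ι) := by
    refine continuous_and_regAt_of_linear ![![1, 0, 0, 0, 0], ![0, 1, 0, 0, 0],
      ![0, 0, 1, 0, 0], ![0, 0, 0, 1, 0], ![0, 0, 0, 0, -1]] fun s t y h0 hy => ?_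
    obtain ⟨hy', e⟩ := (h s t y h0 hy).2
    refine ⟨_, _, _, h0, hy', e, fun i => ?_⟩
    fin_cases i <;> simp [Fin.sum_univ_five]
  exact ⟨isIso_of_mul_self h1 hσ.1 hσ.2, isIso_of_mul_self h2 hι.1 hι.2⟩

theorem isKleinFour_involutions {σ ι : Equiv.Perm curveC2.carrier} (h1 : σ * σ = 1)
    (h2 : ι * ι = 1)
    (h : ∀ (s t y : ℂ) (h : s ≠ 0 ∨ t ≠ 0) (hy : y ^ 2 = sexticForm polyC2 s t),
      (∃ h' hy', σ (sexticPoint polyC2 s t y h hy) = sexticPoint polyC2 (-s - t) t y h' hy') ∧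
      (∃ hy', ι (sexticPoint polyC2 s t y h hy) = sexticPoint polyC2 s t (-y) h hy')) :
    IsKleinFour (Subgroup.closure {σ, ι}) ∧ σ * ι = ι * σ := by
  have hcomm : σ * ι = ι * σ := by
    refine Equiv.ext fun p => ?_
    obtain ⟨s, t, y, h0, hy, rfl⟩ := exists_eq_sexticPoint p
    obtain ⟨h', hy', e1⟩ := (h s t y h0 hy).1
    obtain ⟨hy'', e2⟩ := (h s t y h0 hy).2
    obtain ⟨_, _, e3⟩ := (h s t (-y) h0 hy'').1
    obtain ⟨_, e4⟩ := (h (-s - t) t y h' hy').2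
    exact (congrArg σ e2).trans (e3.trans (e4.symm.trans (congrArg ι e1).symm))
  -- At a point over `s = t = 1`, where `y ≠ 0`, `σ` changes `x = t/s`, while `ι` keeps `x` and
  -- changes `y`; so `1, σ, ι` are distinct.
  obtain ⟨y, hy⟩ := IsAlgClosed.exists_pow_nat_eq (sexticForm polyC2 1 1) (n := 2) two_pos
  have hy0 : y ≠ 0 := by
    rintro rfl
    rw [sexticForm_polyC2] at hy
    norm_num at hy
  have h0 : (1 : ℂ) ≠ 0 ∨ (1 : ℂ) ≠ 0 := .inl one_ne_zero
  obtain ⟨h', hy', e1⟩ := (h 1 1 y h0 hy).1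
  obtain ⟨hy'', e2⟩ := (h 1 1 y h0 hy).2
  refine ⟨isKleinFour_closure_pair h1 h2 hcomm ?_ ?_ ?_, hcomm⟩
  · rintro rfl
    have := (x_sexticPoint (h := h0) (hw := hy)).symm.trans ((congrArg x e1).trans x_sexticPoint)
    norm_num at this
  · rintro rfl
    have := (y_sexticPoint (h := h0) (hw := hy)).symm.trans ((congrArg CurveC2.y e2).trans y_sexticPoint)
    simp at this
    exact hy0 (self_eq_neg.1 this)
  · rintro rfl
    have := congrArg x (e1.symm.trans e2)
    rw [x_sexticPoint, x_sexticPoint] at this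
    norm_num at this

end CurveC2

namespace bringCurve

open FunSpace

theorem toC2_perm12_smul {σ : Equiv.Perm curveC2.carrier}
    (h : ∀ s t y h hy, ∃ h' hy', σ (sexticPoint polyC2 s t y h hy) =
      sexticPoint polyC2 (-s - t) t y h' hy') (p : bringCurve.carrier) :
    toC2 (perm12 • p) = σ (toC2 p) := by
  obtain ⟨h1, hy1, e⟩ := toC2_smul perm12 p
  obtain ⟨h2, hy2, e'⟩ := h _ _ _ ((isBring_rep p).ne_zero_or p.val.rep_nonzero)
    (isBring_rep p).sq_eq_sexticForm
  refine e.trans (Eq.trans ?_ e'.symm)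
  have h0 : perm12⁻¹ 0 = 1 := by decide
  have h1 : perm12⁻¹ 1 = 0 := by decide
  have h2 : perm12⁻¹ 2 = 2 := by decide
  have h3 : perm12⁻¹ 3 = 3 := by decide
  have h4 : perm12⁻¹ 4 = 4 := by decide
  refine sexticPoint_eq_of_smul 1 ?_ ?_ ?_ <;> simp only [alternating, h0, h1, h2, h3, h4] <;> ring

theorem toC2_perm34_smul {ι : Equiv.Perm curveC2.carrier}
    (h : ∀ s t y h hy, ∃ hy', ι (sexticPoint polyC2 s t y h hy) =
      sexticPoint polyC2 s t (-y) h hy') (p : bringCurve.carrier) :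
    toC2 (perm34 • p) = ι (toC2 p) := by
  obtain ⟨h1, hy1, e⟩ := toC2_smul perm34 p
  obtain ⟨hy2, e'⟩ := h _ _ _ ((isBring_rep p).ne_zero_or p.val.rep_nonzero)
    (isBring_rep p).sq_eq_sexticForm
  refine e.trans (Eq.trans ?_ e'.symm)
  have h0 : perm34⁻¹ 0 = 0 := by decide
  have h1 : perm34⁻¹ 1 = 1 := by decide
  have h2 : perm34⁻¹ 2 = 3 := by decide
  have h3 : perm34⁻¹ 3 = 2 := by decide
  have h4 : perm34⁻¹ 4 = 4 := by decide
  refine sexticPoint_eq_of_smul 1 ?_ ?_ ?_ <;> simp only [alternating, h0, h1, h2, h3, h4] <;> ring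

theorem exists_smul_of_toC2_eq {p q : bringCurve.carrier} (h : toC2 p = toC2 q) :
    ∃ g : Subgroup.closure {perm345}, g • q = p := by
  obtain ⟨n, hn⟩ := exists_pow_smul_of_toC2_eq h
  exact ⟨⟨perm345 ^ n, pow_mem (Subgroup.mem_closure_singleton_self _) n⟩,
    (Subgroup.smul_def _ q).trans hn⟩

theorem exists_isIso_C2 : ∃ Φ : (bringQuotient {perm345}).carrier ≃ curveC2.carrier,
    IsIso Φ ∧ ∀ p, Φ (toBringQuotient {perm345} p) = toC2 p :=
  isQuot_toC2.exists_isIso_quotient (Subgroup.closure {perm345})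
    (fun g p => (congrArg toC2 (Subgroup.smul_def g p)).trans (toC2_smul_of_mem g.property p)) fun _ _ h => exists_smul_of_toC2_eq h

end bringCurve


/-! ### Plane cubics `y² = k(x³ + ax² + bx + c)` -/

/-- The plane cubic `y² z = k (x³ + a x² z + b x z² + c z³)`. -/
def IsCubic (k a b c : ℂ) (v : Fin 3 → ℂ) : Prop :=
  v 1 ^ 2 * v 2 = k * (v 0 ^ 3 + a * v 0 ^ 2 * v 2 + b * v 0 * v 2 ^ 2 + c * v 2 ^ 3)

theorem IsCubic.smul {k a b c : ℂ} {v : Fin 3 → ℂ} (h : IsCubic k a b c v) (l : ℂ) :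
    IsCubic k a b c (l • v) := by
  simp only [IsCubic, Pi.smul_apply, smul_eq_mul] at h ⊢
  linear_combination l ^ 3 * h

/-- The plane cubic curve `y² z = k (x³ + a x² z + b x z² + c z³)`. -/
noncomputable def cubicCurve (k a b c : ℂ) : FunSpace :=
  projectiveSubspace {p | IsCubic k a b c p.rep}

theorem FunSpace.isRational_const_mul {X : FunSpace} {f : X.carrier → ℂ} (c : ℂ)
    (hf : X.IsRational f) : X.IsRational fun q => c * f q :=
  IsCurve.isRational_mul (IsCurve.isRational_const c) hf

namespace cubicCurve

open FunSpace Filter Polynomial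

variable {k a b c : ℂ}

theorem isCubic_mk {v : Fin 3 → ℂ} (hv : v ≠ 0) (h : IsCubic k a b c v) :
    IsCubic k a b c (Projectivization.mk ℂ v hv).rep := by
  obtain ⟨l, -, hr⟩ := Projectivization.exists_rep_eq (v := v) (hv := hv) rfl
  rw [hr]
  exact h.smul l

/-- The point with given homogeneous coordinates. -/
noncomputable def point (v : Fin 3 → ℂ) (hv : v ≠ 0) (h : IsCubic k a b c v) :
    (cubicCurve k a b c).carrier :=
  ⟨Projectivization.mk ℂ v hv, isCubic_mk hv h⟩

theorem point_eq_of_smul {v w : Fin 3 → ℂ} {hv : v ≠ 0} {hw : w ≠ 0} {h : IsCubic k a b c v}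
    {h' : IsCubic k a b c w} (l : ℂ) (e : v = l • w) : point v hv h = point w hw h' :=
  Subtype.ext (Projectivization.mk_eq_mk_of_smul l e)

theorem point_rep {v : Fin 3 → ℂ} {hv : v ≠ 0} {h : IsCubic k a b c v} :
    ∃ l : ℂ, l ≠ 0 ∧ (point v hv h).val.rep = l • v :=
  Projectivization.exists_rep_eq rfl

theorem exists_smul_of_point_eq {v w : Fin 3 → ℂ} {hv : v ≠ 0} {hw : w ≠ 0}
    {h : IsCubic k a b c v} {h' : IsCubic k a b c w} (e : point v hv h = point w hw h') :
    ∃ l : ℂ, l ≠ 0 ∧ v = l • w := by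
  obtain ⟨l, hl⟩ := (Projectivization.mk_eq_mk_iff' _ _ _ _ _).1 (congrArg Subtype.val e)
  refine ⟨l, ?_, hl.symm⟩
  rintro rfl
  exact hv (by rw [← hl, zero_smul])

/-- Every point is affine or the point at infinity. -/
theorem exists_eq_point (hk : k ≠ 0) (p : (cubicCurve k a b c).carrier) :
    ∃ v hv h, p = point v hv h ∧ (v 2 = 1 ∨ v 0 = 0 ∧ v 2 = 0 ∧ v 1 = 1) := by
  have hp : IsCubic k a b c p.val.rep := p.property
  have hne := p.val.rep_nonzero
  have hpt : ∀ l : ℂ, l ≠ 0 → ∃ hv h, p = point (l • p.val.rep) hv h := fun l hl =>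
    ⟨smul_ne_zero hl hne, hp.smul l, Subtype.ext
      (p.val.mk_rep.symm.trans (Projectivization.mk_eq_mk_of_smul l⁻¹ (by
        rw [smul_smul, inv_mul_cancel₀ hl, one_smul])))⟩
  by_cases h2 : p.val.rep 2 = 0
  · have h0 : p.val.rep 0 = 0 := by
      rw [IsCubic, h2] at hp
      simpa [hk] using hp.symm
    have h1 : p.val.rep 1 ≠ 0 := fun h1 => hne (by
      ext i
      fin_cases i
      exacts [h0, h1, h2])
    obtain ⟨hv, h, e⟩ := hpt (p.val.rep 1)⁻¹ (inv_ne_zero h1)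
    exact ⟨_, hv, h, e, .inr (by simp [h0, h1, h2])⟩
  · obtain ⟨hv, h, e⟩ := hpt (p.val.rep 2)⁻¹ (inv_ne_zero h2)
    exact ⟨_, hv, h, e, .inl (by simp [h2])⟩

/-- The affine coordinates. -/
noncomputable def x (p : (cubicCurve k a b c).carrier) : ℂ := p.val.rep 0 / p.val.rep 2

noncomputable def y (p : (cubicCurve k a b c).carrier) : ℂ := p.val.rep 1 / p.val.rep 2

theorem x_point {v : Fin 3 → ℂ} {hv : v ≠ 0} {h : IsCubic k a b c v} :
    x (point v hv h) = v 0 / v 2 := by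
  obtain ⟨l, hl, hr⟩ := point_rep (hv := hv) (h := h)
  change (point v hv h).val.rep 0 / (point v hv h).val.rep 2 = _
  rw [hr]
  exact mul_div_mul_left _ _ hl

theorem y_point {v : Fin 3 → ℂ} {hv : v ≠ 0} {h : IsCubic k a b c v} :
    y (point v hv h) = v 1 / v 2 := by
  obtain ⟨l, hl, hr⟩ := point_rep (hv := hv) (h := h)
  change (point v hv h).val.rep 1 / (point v hv h).val.rep 2 = _
  rw [hr]
  exact mul_div_mul_left _ _ hl

theorem regAt_rep_div {p : (cubicCurve k a b c).carrier} (i j : Fin 3) (h : p.val.rep j ≠ 0) :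
    (cubicCurve k a b c).RegAt p (fun q => q.val.rep i / q.val.rep j) := by
  have := FunSpace.regAt_eval_div (p := p) (MvPolynomial.isHomogeneous_X ℂ i)
    (MvPolynomial.isHomogeneous_X ℂ j) (by simpa using h)
  simp only [MvPolynomial.eval_X] at this
  exact this

theorem regAt_x {p : (cubicCurve k a b c).carrier} (h : p.val.rep 2 ≠ 0) :
    (cubicCurve k a b c).RegAt p x :=
  regAt_rep_div 0 2 h

theorem regAt_y {p : (cubicCurve k a b c).carrier} (h : p.val.rep 2 ≠ 0) :
    (cubicCurve k a b c).RegAt p y :=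
  regAt_rep_div 1 2 h

theorem y_sq {p : (cubicCurve k a b c).carrier} (h : p.val.rep 2 ≠ 0) :
    y p ^ 2 = (C k * (X ^ 3 + C a * X ^ 2 + C b * X + C c)).eval (x p) := by
  have hp : IsCubic k a b c p.val.rep := p.property
  rw [IsCubic] at hp
  simp only [x, y, eval_mul, eval_add, eval_pow, eval_C, eval_X]
  field_simp
  linear_combination hp

theorem exists_x_eq (α : ℂ) : ∃ p : (cubicCurve k a b c).carrier, p.val.rep 2 ≠ 0 ∧ x p = α := by
  obtain ⟨y, hy⟩ := IsAlgClosed.exists_pow_nat_eq (k * (α ^ 3 + a * α ^ 2 + b * α + c))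
    (n := 2) two_pos
  have hv : ![α, y, 1] ≠ 0 := fun h => one_ne_zero (congrFun h 2)
  have h : IsCubic k a b c ![α, y, 1] := by
    simp [IsCubic, hy]
  refine ⟨point _ hv h, ?_, ?_⟩
  · obtain ⟨l, hl, hr⟩ := point_rep (hv := hv) (h := h)
    rw [hr]
    simpa using hl
  · rw [x_point]
    simp

instance : Infinite (cubicCurve k a b c).carrier := by
  choose p hp hpt using exists_x_eq (k := k) (a := a) (b := b) (c := c)
  refine Infinite.of_injective p fun t t' htt => ?_
  rw [← hpt t, ← hpt t', htt]

section Orders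

variable (hc : (cubicCurve k a b c).IsCurve)
include hc

theorem eventually_x_ne (α : ℂ) :
    ∀ᶠ p : (cubicCurve k a b c).carrier in cofinite, x p ≠ α := by
  obtain ⟨p, hp, hx⟩ := exists_x_eq (k := k) (a := a) (b := b) (c := c) (α + 1)
  filter_upwards [hc.eventually_ne (regAt_sub (regAt_x hp)
    ((cubicCurve k a b c).regAt_const p α)) (by simp [hx])] with q hq h
  exact hq (by simp [h])

theorem eventually_rep_two :
    ∀ᶠ p : (cubicCurve k a b c).carrier in cofinite, p.val.rep 2 ≠ 0 := by
  filter_upwards [eventually_x_ne hc 0] with p hp h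
  exact hp (by simp [x, h])

theorem isRational_x : (cubicCurve k a b c).IsRational x :=
  (eventually_rep_two hc).mono fun _ => regAt_x

theorem isRational_y : (cubicCurve k a b c).IsRational y :=
  (eventually_rep_two hc).mono fun _ => regAt_y

/-- In the affine chart the equation has the shape `y² = f(x)`. At infinity `x₁ = z/x` and `y₁ =
yz/x²` satisfy `y₁² = k(x₁ + a x₁² + b x₁³ + c x₁⁴)`, so that `exists_orders` applies to both. -/
theorem hasOrders (hk : k ≠ 0) (hf : (C k * (X ^ 3 + C a * X ^ 2 + C b * X + C c)).Separable)
    (hg : (C k * (X + C a * X ^ 2 + C b * X ^ 3 + C c * X ^ 4)).Separable) :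
    (cubicCurve k a b c).HasOrders := by
  intro q
  have hdeg : (X ^ 3 + C a * X ^ 2 + C b * X + C c).degree = 3 := by
    compute_degree!
  by_cases hq : q.val.rep 2 = 0
  · have hcub : ∀ p : (cubicCurve k a b c).carrier, IsCubic k a b c p.val.rep :=
      fun p => p.property
    have hq0 : q.val.rep 0 = 0 := by
      have := hcub q
      rw [IsCubic, hq] at this
      simpa [hk] using this.symm
    have hq1 : q.val.rep 1 ≠ 0 := fun h1 => q.val.rep_nonzero (by
      ext i
      fin_cases i
      exacts [hq0, h1, hq])
    -- On the curve `D z = k x³`, so `z/x = k x²/D` and `yz/x² = k x y/D`; the right sides are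
    -- defined at the point at infinity.
    set D : MvPolynomial (Fin 3) ℂ := .X 1 ^ 2 - .C k * (.C a * .X 0 ^ 2 + .C b * (.X 0 * .X 2) +
      .C c * .X 2 ^ 2) with hD
    have hX : ∀ i : Fin 3, (MvPolynomial.X i : MvPolynomial (Fin 3) ℂ).IsHomogeneous 1 :=
      MvPolynomial.isHomogeneous_X ℂ
    have hDh : D.IsHomogeneous 2 :=
      ((hX 1).pow 2).sub ((((((hX 0).pow 2).C_mul a).add (((hX 0).mul (hX 2)).C_mul b)).add
        (((hX 2).pow 2).C_mul c)).C_mul k)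
    have hDe : ∀ v : Fin 3 → ℂ, MvPolynomial.eval v D =
        v 1 ^ 2 - k * (a * v 0 ^ 2 + b * (v 0 * v 2) + c * v 2 ^ 2) := fun v => by simp [hD]
    have hDq : MvPolynomial.eval q.val.rep D ≠ 0 := by
      rw [hDe, hq, hq0]
      simpa using hq1
    set x₁ : (cubicCurve k a b c).carrier → ℂ := fun p =>
      MvPolynomial.eval p.val.rep (.C k * .X 0 ^ 2) / MvPolynomial.eval p.val.rep D with hx₁
    set y₁ : (cubicCurve k a b c).carrier → ℂ := fun p =>
      MvPolynomial.eval p.val.rep (.C k * (.X 0 * .X 1)) / MvPolynomial.eval p.val.rep D with hy₁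
    have hxr : (cubicCurve k a b c).RegAt q x₁ :=
      regAt_eval_div (((hX 0).pow 2).C_mul k) hDh hDq
    have hyr : (cubicCurve k a b c).RegAt q y₁ :=
      regAt_eval_div (((hX 0).mul (hX 1)).C_mul k) hDh hDq
    have hne : ∀ᶠ p : (cubicCurve k a b c).carrier in cofinite,
        p.val.rep 0 ≠ 0 ∧ p.val.rep 2 ≠ 0 ∧ x₁ p = p.val.rep 2 / p.val.rep 0 ∧
          y₁ p = p.val.rep 1 * p.val.rep 2 / p.val.rep 0 ^ 2 := by
      filter_upwards [eventually_x_ne hc 0, eventually_rep_two hc] with p h1 h2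
      have h0 : p.val.rep 0 ≠ 0 := fun h0 => h1 (by simp [x, h0])
      have hp := hcub p
      rw [IsCubic] at hp
      have hDp : MvPolynomial.eval p.val.rep D * p.val.rep 2 = k * p.val.rep 0 ^ 3 := by
        rw [hDe]
        linear_combination hp
      have hDp0 : MvPolynomial.eval p.val.rep D ≠ 0 := by
        intro h
        rw [h, zero_mul] at hDp
        exact mul_ne_zero hk (pow_ne_zero 3 h0) hDp.symm
      refine ⟨h0, h2, ?_, ?_⟩
      · simp only [hx₁, map_mul, map_pow, MvPolynomial.eval_C, MvPolynomial.eval_X]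
        rw [div_eq_div_iff hDp0 h0]
        linear_combination -hDp
      · simp only [hy₁, map_mul, MvPolynomial.eval_C, MvPolynomial.eval_X]
        rw [div_eq_div_iff hDp0 (pow_ne_zero 2 h0)]
        linear_combination -p.val.rep 1 * hDp
    have hxy : ∀ᶠ p in cofinite, y₁ p ^ 2 =
        (C k * (X + C a * X ^ 2 + C b * X ^ 3 + C c * X ^ 4)).eval (x₁ p) := by
      filter_upwards [hne] with p ⟨h0, h2, h3, h4⟩
      have hp := hcub p
      rw [IsCubic] at hp
      rw [h3, h4]
      simp only [eval_mul, eval_add, eval_pow, eval_C, eval_X]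
      field_simp
      linear_combination hp
    obtain ⟨u, -, h⟩ := exists_orders hc hxr hyr hxy hg
      -- The constant coefficient is zero, so degree zero would turn this separable polynomial into
      -- the zero polynomial.
      (fun hd => by
        rw [eq_C_of_degree_eq_zero hd] at hg
        have h1 := congrArg (eval 0) (eq_C_of_degree_eq_zero hd)
        have h2 : (C k * (X + C a * X ^ 2 + C b * X ^ 3 + C c * X ^ 4)).coeff 0 = 0 := by simp
        rw [h2, map_zero] at hg
        exact hg.ne_zero rfl)
      (fun α => by
        rcases eq_or_ne α 0 with rfl | hα
        · filter_upwards [hne] with p ⟨h0, h2, h3, h4⟩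
          rw [h3]
          exact div_ne_zero h2 h0
        · filter_upwards [hne, eventually_x_ne hc α⁻¹] with p ⟨h0, h2, h3, h4⟩ h5 h6
          apply h5
          rw [← h6, h3, inv_div, x])
      (fun h hh => by
        obtain ⟨P, Q, h1, h2⟩ := hh.exists_eval hc (fun p => ![x₁ p, y₁ p, x₁ p ^ 2])
          (hne.mono fun p ⟨h0, h2, h3, h4⟩ => ⟨p.val.rep 0 ^ 2 / p.val.rep 2,
            div_ne_zero (pow_ne_zero 2 h0) h2, by
              ext i
              fin_cases i <;> simp [h3, h4] <;> field_simp⟩)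
        refine ⟨_, _, InAB.eval hxy (fun i => ?_) P, InAB.eval hxy (fun i => ?_) Q, h1, h2⟩ <;>
        · fin_cases i
          · exact ⟨X, 0, by simp⟩
          · exact ⟨0, 1, by simp⟩
          · exact ⟨X ^ 2, 0, by simp⟩)
    exact ⟨u, h⟩
  · have hxy := (eventually_rep_two hc).mono fun _ => y_sq (k := k) (a := a) (b := b) (c := c)
    obtain ⟨u, -, h⟩ := exists_orders hc (regAt_x hq) (regAt_y hq) hxy hf
      (by rw [degree_mul, hdeg, degree_C hk]; norm_num) (eventually_x_ne hc) (fun h hh => by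
        obtain ⟨P, Q, h1, h2⟩ := hh.exists_eval hc (fun p => ![x p, y p, 1])
          ((eventually_rep_two hc).mono fun p hp => ⟨_, hp, by
            ext i
            fin_cases i <;> simp [x, y] <;> field_simp⟩)
        refine ⟨_, _, InAB.eval hxy (fun i => ?_) P, InAB.eval hxy (fun i => ?_) Q, h1, h2⟩ <;>
        · fin_cases i
          · exact ⟨X, 0, by simp⟩
          · exact ⟨0, 1, by simp⟩
          · exact ⟨1, 0, by simp⟩)
    exact ⟨u, h⟩

end Orders

end cubicCurve

theorem curveE4_eq : curveE4 = cubicCurve 432 80 125 50 := by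
  refine congrArg projectiveSubspace (Set.ext fun p => ?_)
  simp only [zeroLocus, Set.mem_ofPred_eq, Set.mem_singleton_iff, forall_eq, IsCubic]
  simp [sub_eq_zero]

theorem curveE1_eq : curveE1 = cubicCurve 1 (-5) (-40) (-80) := by
  refine congrArg projectiveSubspace (Set.ext fun p => ?_)
  simp only [zeroLocus, Set.mem_ofPred_eq, Set.mem_singleton_iff, forall_eq, IsCubic,
    WeierstrassCurve.Projective.polynomial]
  simp [sub_eq_zero]


/-! ### The elliptic quotients of `𝓒₂` -/

theorem isHomogeneous_linear_form {n : ℕ} (M : Fin n → ℂ) :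
    (∑ j, .C (M j) * .X j : MvPolynomial (Fin n) ℂ).IsHomogeneous 1 := by
  refine MvPolynomial.IsHomogeneous.sum _ _ _ fun j _ => ?_
  exact (MvPolynomial.isHomogeneous_X ℂ j).C_mul (M j)

namespace CurveC2

open FunSpace Filter Polynomial

variable {k a b c : ℂ}

/-- A map from `𝓒₂` to a plane cubic that is linear in the coordinates of `ℙ⁴`. -/
theorem exists_map_cubicCurve (M : Fin 3 → Fin 5 → ℂ) (v : ℂ → ℂ → ℂ → Fin 3 → ℂ)
    (hM : ∀ s t y i, ∑ j, M i j * ![s ^ 3, s ^ 2 * t, s * t ^ 2, t ^ 3, y] j = v s t y i)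
    (hv : ∀ s t y, s ≠ 0 ∨ t ≠ 0 → y ^ 2 = sexticForm polyC2 s t → v s t y ≠ 0)
    (hcub : ∀ s t y, y ^ 2 = sexticForm polyC2 s t → IsCubic k a b c (v s t y)) :
    ∃ φ : curveC2.carrier → (cubicCurve k a b c).carrier,
      (Continuous φ ∧ ∀ p f, (cubicCurve k a b c).RegAt (φ p) f → curveC2.RegAt p (f ∘ φ)) ∧
      ∀ s t y (h : s ≠ 0 ∨ t ≠ 0) (hy : y ^ 2 = sexticForm polyC2 s t),
        φ (sexticPoint polyC2 s t y h hy) =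
          cubicCurve.point (v s t y) (hv s t y h hy) (hcub s t y hy) := by
  choose s t y h hy hp using fun p : curveC2.carrier => exists_eq_sexticPoint (f := polyC2) p
  obtain ⟨φ, hφ⟩ : ∃ φ : curveC2.carrier → (cubicCurve k a b c).carrier, ∀ p, φ p =
    cubicCurve.point (v (s p) (t p) (y p)) (hv _ _ _ (h p) (hy p)) (hcub _ _ _ (hy p)) :=
    ⟨_, fun _ => rfl⟩
  have hlin : ∀ (l : ℂ) s t y s' t' y',
      ![s ^ 3, s ^ 2 * t, s * t ^ 2, t ^ 3, y] =
        l • ![s' ^ 3, s' ^ 2 * t', s' * t' ^ 2, t' ^ 3, y'] → v s t y = l • v s' t' y' := by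
    intro l s t y s' t' y' e
    ext i
    rw [Pi.smul_apply, smul_eq_mul, ← hM, ← hM, e]
    simp only [Pi.smul_apply, smul_eq_mul, Finset.mul_sum, mul_left_comm]
  refine ⟨φ, ?_, fun s' t' y' h' hy' => ?_⟩
  · have hψ : ∀ i, (∑ j, .C (M i j) * .X j : MvPolynomial (Fin 5) ℂ).IsHomogeneous 1 := fun i =>
      isHomogeneous_linear_form (M i)
    refine continuous_and_regAt_comp_of_polynomial (T := {p | IsCubic k a b c p.rep}) (φ := φ)
      (fun i => ∑ j, MvPolynomial.C (M i j) * MvPolynomial.X j) hψ fun p => ?_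
    obtain ⟨l, hl, hr⟩ := sexticPoint_rep (f := polyC2) (h := h p) (hy := hy p)
    rw [← hp p] at hr
    have e : (fun i => MvPolynomial.eval p.val.rep (∑ j, MvPolynomial.C (M i j) * MvPolynomial.X j)) =
        l • v (s p) (t p) (y p) := by
      ext i
      rw [Pi.smul_apply, smul_eq_mul, ← hM, hr]
      simp only [map_sum, map_mul, MvPolynomial.eval_C, MvPolynomial.eval_X, Pi.smul_apply,
        smul_eq_mul, Finset.mul_sum, mul_left_comm]
    have hne := smul_ne_zero hl (hv _ _ _ (h p) (hy p))
    rw [← e] at hne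
    exact ⟨hne, (congrArg Subtype.val (hφ p)).trans
      (Projectivization.mk_eq_mk_of_smul l e).symm⟩
  · obtain ⟨d, hd, h1, h2, h3⟩ := exists_smul_of_sexticPoint_eq
      (hp (sexticPoint polyC2 s' t' y' h' hy')).symm
    refine (hφ _).trans (cubicCurve.point_eq_of_smul (d ^ 3) (hlin _ _ _ _ _ _ _ ?_))
    rw [h1, h2, h3]
    ext i
    fin_cases i <;> simp <;> ring

/-- The function `z = (2 s + t) / t`. -/
noncomputable def z (p : curveC2.carrier) : ℂ := (2 * p.val.rep 2 + p.val.rep 3) / p.val.rep 3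

theorem z_sexticPoint {s t w : ℂ} {h : s ≠ 0 ∨ t ≠ 0} {hw : w ^ 2 = sexticForm polyC2 s t} :
    z (sexticPoint polyC2 s t w h hw) = (2 * s + t) / t := by
  obtain ⟨a, ha, hr⟩ := sexticPoint_rep (f := polyC2) (h := h) (hy := hw)
  change (2 * (sexticPoint polyC2 s t w h hw).val.rep 2 +
    (sexticPoint polyC2 s t w h hw).val.rep 3) / (sexticPoint polyC2 s t w h hw).val.rep 3 = _
  rw [hr]
  rcases eq_or_ne t 0 with rfl | ht
  · simp
  · simp
    field_simp

theorem z_eq {p : curveC2.carrier} (h : p.val.rep 3 ≠ 0) : z p = 2 * x' p + 1 := by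
  rw [z, x']
  field_simp

theorem eventually_z_ne (α : ℂ) : ∀ᶠ p in cofinite, z p ≠ α := by
  filter_upwards [eventually_x'_ne isCurve_curveC2 ((α - 1) / 2),
    eventually_rep_three isCurve_curveC2] with p hp h3 h
  apply hp
  rw [← h, z_eq h3]
  ring

/-- The quotient of `𝓒₂` by an involution that changes the sign of `z`. -/
theorem isQuot_of_involution {Y : FunSpace} (hY : Y.IsCurve) (hd : Y.HasOrders)
    {φ : curveC2.carrier → Y.carrier} (hφ : Continuous φ) (hs : Function.Surjective φ)
    (hreg : ∀ p f, Y.RegAt (φ p) f → curveC2.RegAt p (f ∘ φ)) {τ : Equiv.Perm curveC2.carrier}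
    (hτ : ∀ p, φ (τ p) = φ p) (hz : ∀ p, z (τ p) = -z p) {g : Y.carrier → ℂ}
    (hg : Y.IsRational g) (hgz : ∀ᶠ p in cofinite, z p ^ 2 = g (φ p))
    {g₀ g₁ : Y.carrier → ℂ} (hg₀ : Y.IsRational g₀) (hg₁ : Y.IsRational g₁)
    (hy : ∀ᶠ p in cofinite, y' p = g₀ (φ p) + g₁ (φ p) * z p) : IsQuot φ := by
  have hX := isCurve_curveC2
  -- The function field of `𝓒₂` is spanned by the even function `1` and the odd function `z` over
  -- that of the quotient.
  set m : Fin 2 → curveC2.carrier → ℂ := fun i p => z p ^ (i : ℕ) with hm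
  have h0 : InSpan φ m 1 := (inSpan_self 0).congr (Eventually.of_forall fun p => by simp [hm])
  have h1 : InSpan φ m z := (inSpan_self 1).congr (Eventually.of_forall fun p => by simp [hm])
  have hmul : ∀ i j, InSpan φ m (m i * m j) := by
    have h2 : InSpan φ m (z * z) := (h0.smul hg).congr (hgz.mono fun p hp => by
      simp [← hp, pow_two])
    intro i j
    fin_cases i <;> fin_cases j
    · exact h0.congr (Eventually.of_forall fun p => by simp [hm])
    · exact h1.congr (Eventually.of_forall fun p => by simp [hm])
    · exact h1.congr (Eventually.of_forall fun p => by simp [hm])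
    · exact h2.congr (Eventually.of_forall fun p => by simp [hm])
  have hx : InSpan φ m x' :=
    (((h1.smul (IsCurve.isRational_const (1 / 2))).add
      (h0.smul (IsCurve.isRational_const (-1 / 2)))).congr
      ((eventually_rep_three hX).mono fun p hp => by
        simp only [Pi.add_apply, z_eq hp, Pi.one_apply]
        ring))
  have hy' : InSpan φ m y' := ((h0.smul hg₀).add (h1.smul hg₁)).congr
    (hy.mono fun p hp => by simp [hp])
  refine hX.isQuot hY hd hφ hs hreg fun f hf => ?_
  refine isRational_of_comp (I := Fin 2) (K := Fin 2) (m := m) hX hY hφ hs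
    (fun k => (τ ^ (k : ℕ) : Equiv.Perm _)) (fun k => Equiv.injective _) (fun k p => ?_)
    (fun k i => ((-1) ^ (k : ℕ)) ^ (i : ℕ)) (fun k i p => ?_)
    (fun i k => ((-1) ^ (k : ℕ)) ^ (i : ℕ) / 2) (fun i j => ?_) (fun i => ?_) (fun h hh => ?_) f hf
  · fin_cases k
    · rfl
    · exact hτ p
  · fin_cases k
    · simp [hm]
    · simp [hm, hz, ← mul_pow]
  · fin_cases i <;> fin_cases j <;> norm_num [Fin.sum_univ_two]
  · exact (eventually_z_ne 0).mono fun p hp => pow_ne_zero _ hp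
  · obtain ⟨P, Q, e1, e2⟩ := hh.exists_eval hX (fun p => ![x' p ^ 3, x' p ^ 2, x' p, 1, y' p])
      ((eventually_rep_three hX).mono fun p hp => ⟨_, hp, rep_eq' hp⟩)
    have hψ : ∀ i, InSpan φ m (fun p => ![x' p ^ 3, x' p ^ 2, x' p, 1, y' p] i) := by
      intro i
      fin_cases i
      · exact (hx.mul hmul (hx.mul hmul hx)).congr
          (Eventually.of_forall fun p => by simp; ring)
      · exact (hx.mul hmul hx).congr (Eventually.of_forall fun p => by simp; ring)
      · exact hx
      · exact h0
      · exact hy'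
    exact ⟨_, _, InSpan.eval hmul h0 hψ P, InSpan.eval hmul h0 hψ Q, e1, e2⟩

theorem exists_mem_zpowers_smul {τ : Equiv.Perm curveC2.carrier} {p q : curveC2.carrier}
    (h : p = q ∨ p = τ q) : ∃ g : Subgroup.zpowers τ, g • q = p := by
  rcases h with rfl | rfl
  · exact ⟨1, one_smul _ _⟩
  · exact ⟨⟨τ, Subgroup.mem_zpowers τ⟩, rfl⟩

theorem apply_zpowers_smul {Y : Type} {τ : Equiv.Perm curveC2.carrier} {φ : curveC2.carrier → Y}
    (hτ : ∀ p, φ (τ p) = φ p) (g : Subgroup.zpowers τ) (p : curveC2.carrier) :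
    φ (g • p) = φ p := by
  have h : ∀ g ∈ Subgroup.zpowers τ, ∀ p, φ (g p) = φ p := by
    intro g hg
    rw [Subgroup.zpowers_eq_closure] at hg
    induction hg using Subgroup.closure_induction with
    | mem g hg => rw [Set.mem_singleton_iff.1 hg]; exact hτ
    | one => exact fun p => rfl
    | mul g g' _ _ h h' => exact fun p => (h _).trans (h' p)
    | inv g _ h => exact fun p => (h (g⁻¹ p)).symm.trans (congrArg φ (Equiv.apply_symm_apply g p))
  exact h g.1 g.2 p

end CurveC2

section E4

open FunSpace Filter Polynomial

/-- In `z = (2s + t)/t`, which `σ` negates, the sextic is a cubic polynomial in `z²`. The map is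
given by the invariants `z²` and `-8y'`, that is `[t(2s + t)² : -8y : t³]`. -/
theorem exists_toE4 {σ : Equiv.Perm curveC2.carrier}
    (h : ∀ s t y h hy, ∃ h' hy', σ (sexticPoint polyC2 s t y h hy) =
      sexticPoint polyC2 (-s - t) t y h' hy') :
    ∃ φ : curveC2.carrier → curveE4.carrier, IsQuot φ ∧ (∀ p, φ (σ p) = φ p) ∧
      ∀ p q, φ p = φ q → p = q ∨ p = σ q := by
  have key : ∃ φ : curveC2.carrier → (cubicCurve 432 80 125 50).carrier, IsQuot φ ∧
      (∀ p, φ (σ p) = φ p) ∧ ∀ p q, φ p = φ q → p = q ∨ p = σ q := by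
    have hv : ∀ s t y : ℂ, s ≠ 0 ∨ t ≠ 0 → y ^ 2 = sexticForm polyC2 s t →
        ![4 * s ^ 2 * t + 4 * s * t ^ 2 + t ^ 3, -8 * y, t ^ 3] ≠ 0 := by
      intro s t y h hy h0
      have e1 : -8 * y = 0 := congrFun h0 1
      have e2 : t ^ 3 = 0 := congrFun h0 2
      have ht : t = 0 := by simpa using e2
      have hy0 : y = 0 := by simpa using e1
      rw [sexticForm_polyC2, ht, hy0] at hy
      have hs : s = 0 := by simpa using hy.symm
      exact h.elim (fun h => h hs) fun h => h ht
    have hcub : ∀ s t y : ℂ, y ^ 2 = sexticForm polyC2 s t → IsCubic 432 80 125 50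
        ![4 * s ^ 2 * t + 4 * s * t ^ 2 + t ^ 3, -8 * y, t ^ 3] := by
      intro s t y hy
      rw [sexticForm_polyC2] at hy
      simp [IsCubic]
      linear_combination 64 * t ^ 3 * hy
    obtain ⟨φ, ⟨hc, hr⟩, hφ⟩ := CurveC2.exists_map_cubicCurve
      ![![0, 4, 4, 1, 0], ![0, 0, 0, 0, -8], ![0, 0, 0, 1, 0]] _ (fun s t y i => by
        fin_cases i <;> simp [Fin.sum_univ_five]; ring) hv hcub
    have hs : Function.Surjective φ := by
      intro q
      obtain ⟨v, hv, hq, rfl, h2 | ⟨h0, h2, h1⟩⟩ := cubicCurve.exists_eq_point (by norm_num) q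
      · obtain ⟨z, hz⟩ := IsAlgClosed.exists_pow_nat_eq (v 0) (n := 2) two_pos
        have hy : (-v 1 / 8) ^ 2 = sexticForm polyC2 ((z - 1) / 2) 1 := by
          rw [IsCubic, h2, ← hz] at hq
          rw [sexticForm_polyC2]
          linear_combination hq / 64
        refine ⟨sexticPoint polyC2 _ _ _ (.inr one_ne_zero) hy, (hφ _ _ _ _ _).trans
          (cubicCurve.point_eq_of_smul 1 ?_)⟩
        ext i
        fin_cases i
        · simp [← hz]
          ring
        · simp
          ring
        · simp [h2]
      · obtain ⟨y, hy⟩ := IsAlgClosed.exists_pow_nat_eq (sexticForm polyC2 1 0) (n := 2) two_pos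
        refine ⟨sexticPoint polyC2 _ _ _ (.inl one_ne_zero) hy, (hφ _ _ _ _ _).trans
          (cubicCurve.point_eq_of_smul (-8 * y) ?_)⟩
        ext i
        fin_cases i <;> simp [h0, h1, h2]
    have hcurve : (cubicCurve 432 80 125 50).IsCurve := isCurve_curveC2.of_surjective hc hs
      isClosed_singleton_projectiveSubspace inferInstance
    have hord : (cubicCurve 432 80 125 50).HasOrders := by
      refine cubicCurve.hasOrders hcurve (by norm_num) ?_ ?_
      · refine ⟨C (1 / 432) * (C (37987 / 25600) + C (723 / 25600) * X),
          C (1 / 432) * (C (-1499 / 2560) + C (-19089 / 25600) * X + C (-241 / 25600) * X ^ 2), ?_⟩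
        refine funext fun z => ?_
        simp
        ring
      · refine ⟨C (1 / 432) * (C (-329385 / 1024) + C (-780825 / 1024) * X +
            C (-52175 / 128) * X ^ 2),
          C (1 / 432) * (1 + C (165545 / 1024) * X + C (260425 / 1024) * X ^ 2 +
            C (52175 / 512) * X ^ 3), ?_⟩
        refine funext fun z => ?_
        simp
        ring
    have hx : ∀ p : curveC2.carrier, p.val.rep 3 ≠ 0 →
        cubicCurve.x (φ p) = CurveC2.z p ^ 2 ∧ cubicCurve.y (φ p) = -8 * CurveC2.y' p := by
      intro p hp
      obtain ⟨s, t, y, h0, hy, rfl⟩ := exists_eq_sexticPoint p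
      have ht : t ≠ 0 := CurveC2.rep_three_ne_zero_iff.1 hp
      refine ⟨(congrArg cubicCurve.x (hφ _ _ _ _ _)).trans ?_,
        (congrArg cubicCurve.y (hφ _ _ _ _ _)).trans ?_⟩
      · rw [cubicCurve.x_point, CurveC2.z_sexticPoint]
        simp
        field_simp
        ring
      · rw [cubicCurve.y_point, CurveC2.y'_sexticPoint]
        simp
        ring
    have hσ : ∀ p, φ (σ p) = φ p := by
      intro p
      obtain ⟨s, t, y, h0, hy, rfl⟩ := exists_eq_sexticPoint p
      obtain ⟨h', hy', e⟩ := h s t y h0 hy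
      refine (congrArg φ e).trans ((hφ _ _ _ _ _).trans ((cubicCurve.point_eq_of_smul 1 ?_).trans
        (hφ _ _ _ _ _).symm))
      ext i
      fin_cases i <;> simp
      ring
    refine ⟨φ, CurveC2.isQuot_of_involution hcurve hord hc hs hr hσ (fun p => ?_)
      (cubicCurve.isRational_x hcurve)
      ((CurveC2.eventually_rep_three isCurve_curveC2).mono fun p hp => (hx p hp).1.symm)
      (isRational_const_mul (-1 / 8) (cubicCurve.isRational_y hcurve))
      (IsCurve.isRational_const 0)
      ((CurveC2.eventually_rep_three isCurve_curveC2).mono fun p hp => ?_), hσ, fun p q hpq => ?_⟩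
    · obtain ⟨s, t, y, h0, hy, rfl⟩ := exists_eq_sexticPoint p
      obtain ⟨h', hy', e⟩ := h s t y h0 hy
      refine (congrArg CurveC2.z e).trans (CurveC2.z_sexticPoint.trans
        (Eq.trans ?_ (congrArg Neg.neg CurveC2.z_sexticPoint).symm))
      ring
    · simp only [(hx p hp).2]
      ring
    · obtain ⟨s, t, y, h0, hy, rfl⟩ := exists_eq_sexticPoint p
      obtain ⟨s', t', y', h0', hy', rfl⟩ := exists_eq_sexticPoint q
      obtain ⟨h1, hy1, e⟩ := h s' t' y' h0' hy'
      obtain ⟨l, hl, hlv⟩ := cubicCurve.exists_smul_of_point_eq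
        ((hφ _ _ _ _ _).symm.trans (hpq.trans (hφ _ _ _ _ _)))
      have e0 : 4 * s ^ 2 * t + 4 * s * t ^ 2 + t ^ 3 =
        l * (4 * s' ^ 2 * t' + 4 * s' * t' ^ 2 + t' ^ 3) := congrFun hlv 0
      have e1 : -8 * y = l * (-8 * y') := congrFun hlv 1
      have e2 : t ^ 3 = l * t' ^ 3 := congrFun hlv 2
      rw [e]
      -- Over the point at infinity lie the two points `[s : 0 : ±y]`, which `σ` exchanges.
      rcases eq_or_ne t' 0 with rfl | ht'
      · have ht : t = 0 := by simpa using e2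
        subst ht
        have hs0 : s ≠ 0 := h0.resolve_right (by simp)
        have hs0' : s' ≠ 0 := h0'.resolve_right (by simp)
        rw [sexticForm_polyC2] at hy hy'
        have hy1 : y ^ 2 = (s / s') ^ 6 * y' ^ 2 := by
          rw [hy, hy']
          field_simp
          ring
        have : (y - (s / s') ^ 3 * y') * (y + (s / s') ^ 3 * y') = 0 := by
          linear_combination hy1
        rcases mul_eq_zero.1 this with h2 | h2
        · left
          exact sexticPoint_eq_of_smul (s / s') (by field_simp) (by simp)
            (by linear_combination h2)
        · right
          exact sexticPoint_eq_of_smul (-(s / s')) (by field_simp; simp) (by simp)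
            (by linear_combination h2)
      · have hc0 : t / t' ≠ 0 := by
          refine div_ne_zero (fun h => ?_) ht'
          rw [h] at e2
          exact mul_ne_zero hl (pow_ne_zero 3 ht') (by simpa using e2.symm)
        obtain ⟨d, hd⟩ : ∃ d, t = d * t' := ⟨t / t', by field_simp⟩
        have hd0 : d ≠ 0 := by
          rintro rfl
          simp [hd] at hc0
        have hl3 : l = d ^ 3 := by
          have := mul_right_cancel₀ (pow_ne_zero 3 ht')
            (show d ^ 3 * t' ^ 3 = l * t' ^ 3 by rw [← e2, hd]; ring)
          exact this.symm
        subst hd hl3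
        have hy2 : y = d ^ 3 * y' := by linear_combination -e1 / 8
        -- Equality of the first coordinates factors into the two possibilities `s = d s'` and `s =
        -- d(-s' - t')`.
        have : (d * t') * ((s - d * s') * (s - d * (-s' - t'))) = 0 := by
          linear_combination e0 / 4
        rcases mul_eq_zero.1 ((mul_eq_zero.1 this).resolve_left (mul_ne_zero hd0 ht')) with h2 | h2
        · left
          exact sexticPoint_eq_of_smul d (sub_eq_zero.1 h2) rfl hy2
        · right
          exact sexticPoint_eq_of_smul d (sub_eq_zero.1 h2) rfl hy2
  rwa [← curveE4_eq] at key

end E4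


section E1

open FunSpace Filter Polynomial

theorem curveE1_hasOrders (hc : (cubicCurve 1 (-5) (-40) (-80)).IsCurve) :
    (cubicCurve 1 (-5) (-40) (-80)).HasOrders := by
  refine cubicCurve.hasOrders hc (by norm_num) ?_ ?_
  · refine ⟨C (-283 / 10240) + C (87 / 20480) * X,
      C (31 / 1024) + C (237 / 20480) * X + C (-29 / 20480) * X ^ 2, ?_⟩
    refine funext fun z => ?_
    simp
    ring
  · refine ⟨C (75 / 4) + C (375 / 2) * X + C 460 * X ^ 2,
      1 + C (-35 / 4) * X + C (-245 / 4) * X ^ 2 + C (-115) * X ^ 3, ?_⟩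
    refine funext fun z => ?_
    simp
    ring

/-- Here both `z` and `y'` are negated, so the invariants are `1/z²` and `y'/z³`. Dividing `y'² =
(27/4)(z⁶ + 80z⁴ + 125z² + 50)` by `z⁶` gives a cubic in `1/z²`, and `x = 10/z² + 10`, `y = -8κ
y'/z³` bring it to the equation of `𝓔₁`. -/
theorem exists_toE1 {τ : Equiv.Perm curveC2.carrier}
    (h : ∀ s t y h hy, ∃ h' hy', τ (sexticPoint polyC2 s t y h hy) =
      sexticPoint polyC2 (-s - t) t (-y) h' hy') :
    ∃ φ : curveC2.carrier → curveE1.carrier, IsQuot φ ∧ (∀ p, φ (τ p) = φ p) ∧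
      ∀ p q, φ p = φ q → p = q ∨ p = τ q := by
  have key : ∃ φ : curveC2.carrier → (cubicCurve 1 (-5) (-40) (-80)).carrier, IsQuot φ ∧
      (∀ p, φ (τ p) = φ p) ∧ ∀ p q, φ p = φ q → p = q ∨ p = τ q := by
    -- With `κ² = 5/108` one has `64 κ² · 27/4 = 20`, and `20 · 50 = 10³` makes the cubic monic in
    -- `x`.
    obtain ⟨κ, hκ⟩ := IsAlgClosed.exists_pow_nat_eq (5 / 108 : ℂ) (n := 2) two_pos
    have hκ0 : κ ≠ 0 := by
      rintro rfl
      norm_num at hκ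
    have hv : ∀ s t y : ℂ, s ≠ 0 ∨ t ≠ 0 → y ^ 2 = sexticForm polyC2 s t →
        ![10 * t ^ 2 * (2 * s + t) + 10 * (2 * s + t) ^ 3, -8 * κ * y, (2 * s + t) ^ 3] ≠ 0 := by
      intro s t y h hy h0
      have e1 : -8 * κ * y = 0 := congrFun h0 1
      have e2 : (2 * s + t) ^ 3 = 0 := congrFun h0 2
      have ht : t = -2 * s := by
        linear_combination (pow_eq_zero_iff (n := 3) (by norm_num)).1 e2
      have hy0 : y = 0 := by simpa [hκ0] using e1
      rw [sexticForm_polyC2, ht, hy0] at hy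
      have hs : s ^ 6 = 0 := by linear_combination -hy / 21600
      have hs : s = 0 := by simpa using hs
      exact h.elim (fun h => h hs) fun h => h (by rw [ht, hs, mul_zero])
    have hcub : ∀ s t y : ℂ, y ^ 2 = sexticForm polyC2 s t → IsCubic 1 (-5) (-40) (-80)
        ![10 * t ^ 2 * (2 * s + t) + 10 * (2 * s + t) ^ 3, -8 * κ * y, (2 * s + t) ^ 3] := by
      intro s t y hy
      rw [sexticForm_polyC2] at hy
      simp [IsCubic]
      linear_combination 64 * κ ^ 2 * (2 * s + t) ^ 3 * hy + 64 * (2 * s + t) ^ 3 *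
        (108 * (4 * s ^ 6 + 12 * s ^ 5 * t + 95 * s ^ 4 * t ^ 2 + 170 * s ^ 3 * t ^ 3 +
        155 * s ^ 2 * t ^ 4 + 72 * s * t ^ 5 + 16 * t ^ 6)) * hκ
    obtain ⟨φ, ⟨hc, hr⟩, hφ⟩ := CurveC2.exists_map_cubicCurve
      ![![80, 120, 80, 20, 0], ![0, 0, 0, 0, -8 * κ], ![8, 12, 6, 1, 0]] _ (fun s t y i => by
        fin_cases i <;> simp [Fin.sum_univ_five] <;> ring) hv hcub
    have hs : Function.Surjective φ := by
      intro q
      obtain ⟨v, hv, hq, rfl, h2 | ⟨h0, h2, h1⟩⟩ := cubicCurve.exists_eq_point (by norm_num) q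
      · obtain ⟨t, ht⟩ := IsAlgClosed.exists_pow_nat_eq ((v 0 - 10) / 10) (n := 2) two_pos
        have hv0 : v 0 = 10 * t ^ 2 + 10 := by linear_combination -10 * ht
        have hy : (-v 1 / (8 * κ)) ^ 2 = sexticForm polyC2 ((1 - t) / 2) t := by
          rw [IsCubic, h2, hv0] at hq
          rw [sexticForm_polyC2, div_pow, mul_pow, hκ]
          linear_combination (27 / 80) * hq
        have hne : (1 - t) / 2 ≠ 0 ∨ t ≠ 0 := by
          by_contra! h0
          rw [h0.2] at h0
          norm_num at h0
        refine ⟨sexticPoint polyC2 _ _ _ hne hy, (hφ _ _ _ _ _).trans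
          (cubicCurve.point_eq_of_smul 1 ?_)⟩
        ext i
        fin_cases i
        · simp [hv0]
          ring
        · simp
          field_simp
        · simp [h2]
          ring
      · obtain ⟨y, hy⟩ := IsAlgClosed.exists_pow_nat_eq (sexticForm polyC2 1 (-2)) (n := 2) two_pos
        refine ⟨sexticPoint polyC2 _ _ _ (.inl one_ne_zero) hy, (hφ _ _ _ _ _).trans
          (cubicCurve.point_eq_of_smul (-8 * κ * y) ?_)⟩
        ext i
        fin_cases i <;> simp [h0, h1, h2]
    have hcurve : (cubicCurve 1 (-5) (-40) (-80)).IsCurve := isCurve_curveC2.of_surjective hc hs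
      isClosed_singleton_projectiveSubspace inferInstance
    have hx : ∀ p : curveC2.carrier, p.val.rep 3 ≠ 0 → CurveC2.z p ≠ 0 →
        cubicCurve.x (φ p) = 10 / CurveC2.z p ^ 2 + 10 ∧
          cubicCurve.y (φ p) = -8 * κ * CurveC2.y' p / CurveC2.z p ^ 3 := by
      intro p hp hz
      obtain ⟨s, t, y, h0, hy, rfl⟩ := exists_eq_sexticPoint p
      have ht : t ≠ 0 := CurveC2.rep_three_ne_zero_iff.1 hp
      have hz' : 2 * s + t ≠ 0 := fun h => hz (CurveC2.z_sexticPoint.trans (by rw [h, zero_div]))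
      refine ⟨(congrArg cubicCurve.x (hφ _ _ _ _ _)).trans ?_,
        (congrArg cubicCurve.y (hφ _ _ _ _ _)).trans ?_⟩
      · rw [cubicCurve.x_point, CurveC2.z_sexticPoint]
        simp
        field_simp
      · rw [cubicCurve.y_point, CurveC2.y'_sexticPoint, CurveC2.z_sexticPoint]
        simp
        field_simp
    have hσ : ∀ p, φ (τ p) = φ p := by
      intro p
      obtain ⟨s, t, y, h0, hy, rfl⟩ := exists_eq_sexticPoint p
      obtain ⟨h', hy', e⟩ := h s t y h0 hy
      refine (congrArg φ e).trans ((hφ _ _ _ _ _).trans ((cubicCurve.point_eq_of_smul (-1) ?_).trans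
        (hφ _ _ _ _ _).symm))
      ext i
      fin_cases i <;> simp <;> ring
    have hxr := cubicCurve.isRational_x hcurve
    have hg : (cubicCurve 1 (-5) (-40) (-80)).IsRational
        ((fun _ => 10) / (cubicCurve.x + fun _ => -10)) :=
      hcurve.isRational_div (IsCurve.isRational_const 10)
        (IsCurve.isRational_add hxr (IsCurve.isRational_const (-10)))
    have hgz : ∀ p : curveC2.carrier, p.val.rep 3 ≠ 0 → CurveC2.z p ≠ 0 → CurveC2.z p ^ 2 =
        10 / (cubicCurve.x (φ p) + -10) := by
      intro p hp hz
      rw [(hx p hp hz).1]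
      field_simp
      ring
    have hev := (CurveC2.eventually_rep_three isCurve_curveC2).and (CurveC2.eventually_z_ne 0)
    refine ⟨φ, CurveC2.isQuot_of_involution hcurve (curveE1_hasOrders hcurve) hc hs hr hσ
      (fun p => ?_) hg (hev.mono fun p hp => hgz p hp.1 hp.2) (IsCurve.isRational_const 0)
      (isRational_const_mul (-1 / (8 * κ)) (IsCurve.isRational_mul (cubicCurve.isRational_y hcurve)
        hg)) (hev.mono fun p hp => ?_), hσ, fun p q hpq => ?_⟩
    · obtain ⟨s, t, y, h0, hy, rfl⟩ := exists_eq_sexticPoint p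
      obtain ⟨h', hy', e⟩ := h s t y h0 hy
      refine (congrArg CurveC2.z e).trans (CurveC2.z_sexticPoint.trans
        (Eq.trans ?_ (congrArg Neg.neg CurveC2.z_sexticPoint).symm))
      ring
    · simp only [Pi.mul_apply, Pi.div_apply, Pi.add_apply, ← hgz p hp.1 hp.2, (hx p hp.1 hp.2).2]
      have := hp.2
      field_simp
      ring
    · obtain ⟨s, t, y, h0, hy, rfl⟩ := exists_eq_sexticPoint p
      obtain ⟨s', t', y', h0', hy', rfl⟩ := exists_eq_sexticPoint q
      obtain ⟨h1, hy1, e⟩ := h s' t' y' h0' hy'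
      obtain ⟨l, hl, hlv⟩ := cubicCurve.exists_smul_of_point_eq
        ((hφ _ _ _ _ _).symm.trans (hpq.trans (hφ _ _ _ _ _)))
      have e0 : 10 * t ^ 2 * (2 * s + t) + 10 * (2 * s + t) ^ 3 =
        l * (10 * t' ^ 2 * (2 * s' + t') + 10 * (2 * s' + t') ^ 3) := congrFun hlv 0
      have e1 : -8 * κ * y = l * (-8 * κ * y') := congrFun hlv 1
      have e2 : (2 * s + t) ^ 3 = l * (2 * s' + t') ^ 3 := congrFun hlv 2
      have hy2 : y = l * y' := by
        refine mul_left_cancel₀ (mul_ne_zero (by norm_num : (-8 : ℂ) ≠ 0) hκ0) ?_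
        linear_combination e1
      rw [e]
      -- The points with `z = 0` lie over infinity and are exchanged by `τ`.
      rcases eq_or_ne (2 * s' + t') 0 with hw' | hw'
      · have hw : 2 * s + t = 0 := by
          rw [hw'] at e2
          simpa using e2
        have ht : t = -2 * s := by linear_combination hw
        have ht' : t' = -2 * s' := by linear_combination hw'
        subst ht ht'
        have hs0 : s ≠ 0 := fun h => h0.elim (fun h' => h' h) fun h' => h' (by rw [h, mul_zero])
        have hs0' : s' ≠ 0 := fun h => h0'.elim (fun h' => h' h) fun h' => h' (by rw [h, mul_zero])
        rw [sexticForm_polyC2] at hy hy'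
        have hy1 : y ^ 2 = (s / s') ^ 6 * y' ^ 2 := by
          rw [hy, hy']
          field_simp
        have : (y - (s / s') ^ 3 * y') * (y + (s / s') ^ 3 * y') = 0 := by
          linear_combination hy1
        rcases mul_eq_zero.1 this with h2 | h2
        · left
          exact sexticPoint_eq_of_smul (s / s') (by field_simp) (by field_simp)
            (by linear_combination h2)
        · right
          exact sexticPoint_eq_of_smul (s / s') (by field_simp; ring) (by field_simp)
            (by linear_combination h2)
      · have hw : 2 * s + t ≠ 0 := by
          intro h
          rw [h] at e2
          exact mul_ne_zero hl (pow_ne_zero 3 hw') (by simpa using e2.symm)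
        obtain ⟨d, hd⟩ : ∃ d, 2 * s + t = d * (2 * s' + t') :=
          ⟨(2 * s + t) / (2 * s' + t'), by field_simp⟩
        have hd0 : d ≠ 0 := by
          rintro rfl
          exact hw (by rw [hd, zero_mul])
        have hl3 : l = d ^ 3 := by
          have := mul_right_cancel₀ (pow_ne_zero 3 hw')
            (show d ^ 3 * (2 * s' + t') ^ 3 = l * (2 * s' + t') ^ 3 by rw [← e2, hd]; ring)
          exact this.symm
        subst hl3
        have : d * (2 * s' + t') * ((t - d * t') * (t + d * t')) = 0 := by
          rw [hd] at e0
          linear_combination e0 / 10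
        rcases mul_eq_zero.1 ((mul_eq_zero.1 this).resolve_left (mul_ne_zero hd0 hw')) with h2 | h2
        · left
          exact sexticPoint_eq_of_smul d (by linear_combination hd / 2 - h2 / 2)
            (sub_eq_zero.1 h2) hy2
        · right
          exact sexticPoint_eq_of_smul (-d) (by linear_combination hd / 2 - h2 / 2)
            (by linear_combination h2) (by linear_combination hy2)
  rwa [← curveE1_eq] at key

end E1

section Quotients

open FunSpace

theorem CurveC2.quotient_isomorphic {Y : FunSpace} {τ : Equiv.Perm curveC2.carrier}
    {φ : curveC2.carrier → Y.carrier} (hφ : IsQuot φ) (h1 : ∀ p, φ (τ p) = φ p)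
    (h2 : ∀ p q, φ p = φ q → p = q ∨ p = τ q) :
    (curveC2.quotient (Subgroup.zpowers τ)).Isomorphic Y := by
  obtain ⟨e, he, -⟩ := hφ.exists_isIso_quotient (Subgroup.zpowers τ)
    (CurveC2.apply_zpowers_smul h1) fun p q h => CurveC2.exists_mem_zpowers_smul (h2 p q h)
  exact ⟨e, he⟩

/-- The quotient is taken in two stages: `φ ∘ toC2` is a quotient map, and since `π` lifts `τ` its
fibres are the orbits of the group generated by `π` and the rotation. -/
theorem bringCurve.quotient_isomorphic {Y : FunSpace} {τ : Equiv.Perm curveC2.carrier}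
    {φ : curveC2.carrier → Y.carrier} (hφ : IsQuot φ) (h1 : ∀ p, φ (τ p) = φ p)
    (h2 : ∀ p q, φ p = φ q → p = q ∨ p = τ q) {π : Equiv.Perm (Fin 5)}
    (hπ : ∀ p, toC2 (π • p) = τ (toC2 p)) : (bringQuotient {π, perm345}).Isomorphic Y := by
  have hinv : ∀ g ∈ Subgroup.closure {π, perm345}, ∀ p : bringCurve.carrier,
      φ (toC2 (g • p)) = φ (toC2 p) := by
    intro g hg
    induction hg using Subgroup.closure_induction with
    | mem g hg =>
      rcases hg with rfl | rfl
      · exact fun p => (congrArg φ (hπ p)).trans (h1 _)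
      · exact fun p => congrArg φ (toC2_perm345_smul p)
    | one => exact fun p => by rw [one_smul]
    | mul g g' _ _ h h' => exact fun p => by rw [mul_smul, h, h']
    | inv g _ h => exact fun p => by rw [← h (g⁻¹ • p), smul_inv_smul]
  have hle : Subgroup.closure {perm345} ≤ Subgroup.closure {π, perm345} :=
    Subgroup.closure_mono (by simp)
  have hπm : π ∈ Subgroup.closure {π, perm345} := Subgroup.subset_closure (by simp)
  obtain ⟨e, he, -⟩ := (hφ.comp isQuot_toC2).exists_isIso_quotient
    (Subgroup.closure {π, perm345})
    (fun g p => (congrArg (φ ∘ toC2) (Subgroup.smul_def g p)).trans (hinv g g.property p))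
    fun p q h => by
      rcases h2 _ _ h with h | h
      · obtain ⟨g, hg⟩ := exists_smul_of_toC2_eq h
        exact ⟨⟨g, hle g.property⟩, hg⟩
      · obtain ⟨g, hg⟩ := exists_smul_of_toC2_eq (h.trans (hπ q).symm)
        refine ⟨⟨g * π, mul_mem (hle g.property) hπm⟩, (Subgroup.smul_def _ q).trans ?_⟩
        exact (mul_smul _ _ _).trans ((Subgroup.smul_def g _).symm.trans hg)
  exact ⟨e, he⟩

end Quotients


/-! ### The quotient of `𝓑` by a Klein four-group -/

/-- The coordinates in which the Klein four-group acts by changes of sign. -/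
def kleinCoord (v : Fin 5 → ℂ) : Fin 3 → ℂ :=
  ![v 0 + v 1 - v 2 - v 3, v 0 - v 1 + v 2 - v 3, v 0 - v 1 - v 2 + v 3]

/-- The vector with given Klein coordinates and given last coordinate. -/
noncomputable def ofKleinCoord (a b c w : ℂ) : Fin 5 → ℂ :=
  ![(-w + a + b + c) / 4, (-w + a - b - c) / 4, (-w - a + b - c) / 4, (-w - a - b + c) / 4, w]

theorem kleinCoord_ofKleinCoord (a b c w : ℂ) :
    kleinCoord (ofKleinCoord a b c w) = ![a, b, c] := by
  ext i
  fin_cases i <;> simp [kleinCoord, ofKleinCoord] <;> ring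

theorem IsBring.eq_ofKleinCoord {v : Fin 5 → ℂ} (h : IsBring v) :
    v = ofKleinCoord (kleinCoord v 0) (kleinCoord v 1) (kleinCoord v 2) (v 4) := by
  have h1 := h.1
  simp only [Fin.sum_univ_five] at h1
  ext i
  fin_cases i <;> simp [kleinCoord, ofKleinCoord] <;> linear_combination h1 / 4

theorem isBring_ofKleinCoord {a b c w : ℂ} (h2 : a ^ 2 + b ^ 2 + c ^ 2 = -5 * w ^ 2)
    (h3 : a * b * c = -5 * w ^ 3) : IsBring (ofKleinCoord a b c w) := by
  refine ⟨?_, ?_, ?_⟩ <;> simp [ofKleinCoord, Fin.sum_univ_five]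
  · ring
  · linear_combination h2 / 4
  · linear_combination (-3 / 16 * w) * h2 + (3 / 8) * h3

theorem kleinCoord_smul (l : ℂ) (v : Fin 5 → ℂ) : kleinCoord (l • v) = l • kleinCoord v := by
  ext i
  fin_cases i <;> simp [kleinCoord] <;> ring

/-- The sign changes that preserve the product are the four even ones. An odd number of changes
forces the product to be zero, and the sign of a vanishing coordinate is free. -/
theorem eq_or_neg_of_mul_eq {a b c a' b' c' : ℂ} (h : a * b * c = a' * b' * c')
    (ha : a = a' ∨ a = -a') (hb : b = b' ∨ b = -b') (hc : c = c' ∨ c = -c') :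
    (a = a' ∧ b = b' ∧ c = c') ∨ (a = a' ∧ b = -b' ∧ c = -c') ∨
      (a = -a' ∧ b = b' ∧ c = -c') ∨ (a = -a' ∧ b = -b' ∧ c = c') := by
  have key : a * b * c = -(a' * b' * c') → a' = 0 ∨ b' = 0 ∨ c' = 0 := by
    intro h'
    have : a' * b' * c' = 0 := by linear_combination (h' - h) / 2
    simpa [or_assoc] using this
  rcases ha with ha | ha <;> rcases hb with hb | hb <;> rcases hc with hc | hc
  · simp [ha, hb, hc]
  · rcases key (by rw [ha, hb, hc]; ring) with h0 | h0 | h0 <;> simp [ha, hb, hc, h0]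
  · rcases key (by rw [ha, hb, hc]; ring) with h0 | h0 | h0 <;> simp [ha, hb, hc, h0]
  · simp [ha, hb, hc]
  · rcases key (by rw [ha, hb, hc]; ring) with h0 | h0 | h0 <;> simp [ha, hb, hc, h0]
  · simp [ha, hb, hc]
  · simp [ha, hb, hc]
  · rcases key (by rw [ha, hb, hc]; ring) with h0 | h0 | h0 <;> simp [ha, hb, hc, h0]

namespace bringCurve

open FunSpace Filter

/-- A square root of `-5`. -/
noncomputable def sqrtNegFive : ℂ := Real.sqrt 5 * Complex.I

theorem sqrtNegFive_sq : sqrtNegFive ^ 2 = -5 := by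
  rw [sqrtNegFive, mul_pow, ← Complex.ofReal_pow, Real.sq_sqrt (by norm_num), Complex.I_sq]
  norm_num

theorem sqrtNegFive_ne_zero : sqrtNegFive ≠ 0 := fun h => by
  have := sqrtNegFive_sq
  rw [h] at this
  norm_num at this

/-- The map to `𝓔₁` in coordinates. -/
noncomputable def kleinMap (v : Fin 5 → ℂ) : Fin 3 → ℂ :=
  ![20 * v 4 ^ 2, 4 * sqrtNegFive * (kleinCoord v 0 ^ 2 - kleinCoord v 2 ^ 2), kleinCoord v 1 ^ 2]

theorem kleinMap_smul (l : ℂ) (v : Fin 5 → ℂ) : kleinMap (l • v) = l ^ 2 • kleinMap v := by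
  ext i
  fin_cases i <;> simp [kleinMap, kleinCoord_smul] <;> ring

theorem sum_kleinCoord_sq {v : Fin 5 → ℂ} (h : IsBring v) :
    kleinCoord v 0 ^ 2 + kleinCoord v 1 ^ 2 + kleinCoord v 2 ^ 2 = -5 * v 4 ^ 2 :=
  h.sum_sq_eq

theorem prod_kleinCoord {v : Fin 5 → ℂ} (h : IsBring v) :
    kleinCoord v 0 * kleinCoord v 1 * kleinCoord v 2 = -5 * v 4 ^ 3 :=
  h.prod_eq

/-- Let `A, B, C` be the squares of the Klein coordinates and `W` that of the last coordinate. From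
`A + B + C = -5W` and `ABC = 25W³` follows `B(A - C)² = B(5W + B)² - 100W³`, which is the cubic for
`x = 20W`, `y² = -80(A - C)²`, `z = B`. -/
theorem isCubic_kleinMap {v : Fin 5 → ℂ} (h : IsBring v) :
    IsCubic 1 (-5) (-40) (-80) (kleinMap v) := by
  have h1 := sum_kleinCoord_sq h
  have h2 := prod_kleinCoord h
  have h3 : kleinCoord v 0 ^ 2 = -5 * v 4 ^ 2 - kleinCoord v 1 ^ 2 - kleinCoord v 2 ^ 2 := by
    linear_combination h1
  have h4 : kleinCoord v 0 ^ 2 * kleinCoord v 1 ^ 2 * kleinCoord v 2 ^ 2 = 25 * v 4 ^ 6 := by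
    rw [← mul_pow, ← mul_pow, h2]
    ring
  have h5 : (4 * sqrtNegFive * (kleinCoord v 0 ^ 2 - kleinCoord v 2 ^ 2)) ^ 2 =
      -80 * (kleinCoord v 0 ^ 2 - kleinCoord v 2 ^ 2) ^ 2 := by
    rw [mul_pow, mul_pow, sqrtNegFive_sq]
    ring
  simp only [IsCubic, kleinMap, Matrix.cons_val, h5]
  rw [h3] at h4 ⊢
  linear_combination 320 * h4

theorem kleinMap_ne_zero {v : Fin 5 → ℂ} (h : IsBring v) (hv : v ≠ 0) : kleinMap v ≠ 0 := by
  intro h0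
  have e0 : 20 * v 4 ^ 2 = 0 := congrFun h0 0
  have e1 : 4 * sqrtNegFive * (kleinCoord v 0 ^ 2 - kleinCoord v 2 ^ 2) = 0 := congrFun h0 1
  have e2 : kleinCoord v 1 ^ 2 = 0 := congrFun h0 2
  have h1 := sum_kleinCoord_sq h
  have h4 : v 4 = 0 := by simpa using e0
  have hk1 : kleinCoord v 1 = 0 := by simpa using e2
  have e3 := (mul_eq_zero.1 e1).resolve_left (mul_ne_zero (by norm_num) sqrtNegFive_ne_zero)
  rw [h4, hk1] at h1
  have hk0 : kleinCoord v 0 = 0 := by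
    refine (pow_eq_zero_iff (n := 2) two_ne_zero).1 ?_
    linear_combination h1 / 2 + e3 / 2
  have hk2 : kleinCoord v 2 = 0 := by
    refine (pow_eq_zero_iff (n := 2) two_ne_zero).1 ?_
    linear_combination h1 / 2 - e3 / 2
  apply hv
  rw [h.eq_ofKleinCoord, h4, hk0, hk1, hk2]
  ext i
  fin_cases i <;> simp [ofKleinCoord]

/-- The map `𝓑 → 𝓔₁` given by the invariants of the Klein four-group. -/
noncomputable def toE1 (p : bringCurve.carrier) : (cubicCurve 1 (-5) (-40) (-80)).carrier :=
  cubicCurve.point (kleinMap p.val.rep) (kleinMap_ne_zero (isBring_rep p) p.val.rep_nonzero)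
    (isCubic_kleinMap (isBring_rep p))

theorem toE1_eq_point {p : bringCurve.carrier} {v : Fin 5 → ℂ} {w : Fin 3 → ℂ} {a l : ℂ}
    (hr : p.val.rep = a • v) (hw : kleinMap v = l • w) (hw0 : w ≠ 0)
    (hwc : IsCubic 1 (-5) (-40) (-80) w) : toE1 p = cubicCurve.point w hw0 hwc := by
  refine cubicCurve.point_eq_of_smul (a ^ 2 * l) ?_
  rw [hr, kleinMap_smul, hw, smul_smul]

theorem exists_toE1_eq {v : Fin 5 → ℂ} (h : IsBring v) (hv : v ≠ 0) {w : Fin 3 → ℂ} {l : ℂ}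
    (hw : kleinMap v = l • w) (hw0 : w ≠ 0) (hwc : IsCubic 1 (-5) (-40) (-80) w) :
    ∃ p, toE1 p = cubicCurve.point w hw0 hwc := by
  obtain ⟨a, ha, hr⟩ := Projectivization.exists_rep_eq (v := v) (hv := hv) rfl
  exact ⟨⟨Projectivization.mk ℂ v hv, (mk_mem_bringSet hv).2 h⟩, toE1_eq_point hr hw hw0 hwc⟩

/-- With `z = B = 1` the coordinates `x, y` give `w²`, `A + C` and `A - C`. After extracting square
roots, the sign of `b = ±1` is chosen so that `abc = -5w³`. The point at infinity comes from `(1, 0,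
i)` with `w = 0`. -/
theorem toE1_surjective : Function.Surjective toE1 := by
  intro q
  obtain ⟨v, hv, hq, rfl, h2 | ⟨h0, h2, h1⟩⟩ := cubicCurve.exists_eq_point (by norm_num) q
  · obtain ⟨w, hw⟩ := IsAlgClosed.exists_pow_nat_eq (v 0 / 20) (n := 2) two_pos
    obtain ⟨a, ha⟩ := IsAlgClosed.exists_pow_nat_eq
      ((-5 * w ^ 2 - 1 + v 1 / (4 * sqrtNegFive)) / 2) (n := 2) two_pos
    obtain ⟨c, hc⟩ := IsAlgClosed.exists_pow_nat_eq
      ((-5 * w ^ 2 - 1 - v 1 / (4 * sqrtNegFive)) / 2) (n := 2) two_pos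
    have hw' : v 0 = 20 * w ^ 2 := by linear_combination -20 * hw
    have hac : (a * c) ^ 2 = (5 * w ^ 3) ^ 2 := by
      have h5 : (v 1 / (4 * sqrtNegFive)) ^ 2 = -v 1 ^ 2 / 80 := by
        rw [div_pow, mul_pow, sqrtNegFive_sq]
        ring
      rw [IsCubic, h2, hw'] at hq
      rw [mul_pow, ha, hc]
      linear_combination -h5 / 4 + hq / 320
    obtain ⟨b, hb, hb2⟩ : ∃ b : ℂ, a * b * c = -5 * w ^ 3 ∧ b ^ 2 = 1 := by
      rcases sq_eq_sq_iff_eq_or_eq_neg.1 hac with h | h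
      · exact ⟨-1, by linear_combination -h, by norm_num⟩
      · exact ⟨1, by linear_combination h, by norm_num⟩
    have hB : IsBring (ofKleinCoord a b c w) :=
      isBring_ofKleinCoord (by linear_combination ha + hb2 + hc) hb
    refine exists_toE1_eq hB ?_ (l := 1) ?_ hv hq
    · intro h0
      have := congrArg (fun v => kleinCoord v 1) h0
      simp only [kleinCoord_ofKleinCoord] at this
      have hb0 : b = 0 := by simpa [kleinCoord] using this
      rw [hb0] at hb2
      norm_num at hb2
    · have hne := sqrtNegFive_ne_zero
      ext i
      fin_cases i
      · simp [kleinMap, ofKleinCoord, hw']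
      · simp [kleinMap, kleinCoord_ofKleinCoord, ha, hc]
        field_simp
        ring
      · simp [kleinMap, kleinCoord_ofKleinCoord, hb2, h2]
  · have hB : IsBring (ofKleinCoord 1 0 Complex.I 0) :=
      isBring_ofKleinCoord (by simp) (by simp)
    refine exists_toE1_eq hB ?_ (l := 8 * sqrtNegFive) ?_ hv hq
    · intro h0
      have := congrArg (fun v => kleinCoord v 0) h0
      simp only [kleinCoord_ofKleinCoord] at this
      simp [kleinCoord] at this
    · ext i
      fin_cases i
      · simp [kleinMap, ofKleinCoord, h0]
      · simp [kleinMap, kleinCoord_ofKleinCoord, h1]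
        ring
      · simp [kleinMap, kleinCoord_ofKleinCoord, h2]

open MvPolynomial in
theorem toE1_continuous_and_regAt : Continuous toE1 ∧
    ∀ p f, (cubicCurve 1 (-5) (-40) (-80)).RegAt (toE1 p) f → bringCurve.RegAt p (f ∘ toE1) := by
  refine continuous_and_regAt_comp_of_polynomial (e := 2)
    ![C 20 * X 4 ^ 2, C (4 * sqrtNegFive) * ((X 0 + X 1 - X 2 - X 3) ^ 2 -
      (X 0 - X 1 - X 2 + X 3) ^ 2), (X 0 - X 1 + X 2 - X 3) ^ 2] ?_ ?_
  · have hX : ∀ i : Fin 5, (X i : MvPolynomial (Fin 5) ℂ).IsHomogeneous 1 := isHomogeneous_X ℂ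
    intro i
    fin_cases i
    · exact ((hX 4).pow 2).C_mul _
    · exact ((((((hX 0).add (hX 1)).sub (hX 2)).sub (hX 3)).pow 2).sub
        (((((hX 0).sub (hX 1)).sub (hX 2)).add (hX 3)).pow 2)).C_mul _
    · exact ((((hX 0).sub (hX 1)).add (hX 2)).sub (hX 3)).pow 2
  · intro p
    have e : (fun i => eval p.val.rep ((![C 20 * X 4 ^ 2, C (4 * sqrtNegFive) *
        ((X 0 + X 1 - X 2 - X 3) ^ 2 - (X 0 - X 1 - X 2 + X 3) ^ 2),
        (X 0 - X 1 + X 2 - X 3) ^ 2] : Fin 3 → MvPolynomial (Fin 5) ℂ) i)) =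
        kleinMap p.val.rep := by
      ext i
      fin_cases i <;> simp [kleinMap, kleinCoord]
    simp only [e]
    exact ⟨kleinMap_ne_zero (isBring_rep p) p.val.rep_nonzero, rfl⟩

theorem isCurve_E1 : (cubicCurve 1 (-5) (-40) (-80)).IsCurve :=
  isCurve_bringCurve.of_surjective toE1_continuous_and_regAt.1 toE1_surjective
    isClosed_singleton_projectiveSubspace inferInstance

/-- The action of the Klein four-group on the Klein coordinates. -/
theorem rep_smul_klein (p : bringCurve.carrier) :
    (∃ a : ℂ, a ≠ 0 ∧ ((perm12 * perm34) • p).val.rep =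
      a • ofKleinCoord (kleinCoord p.val.rep 0) (-kleinCoord p.val.rep 1)
        (-kleinCoord p.val.rep 2) (p.val.rep 4)) ∧
    ∃ a : ℂ, a ≠ 0 ∧ (perm13_24 • p).val.rep =
      a • ofKleinCoord (-kleinCoord p.val.rep 0) (kleinCoord p.val.rep 1)
        (-kleinCoord p.val.rep 2) (p.val.rep 4) := by
  have h1 := (isBring_rep p).1
  simp only [Fin.sum_univ_five] at h1
  refine ⟨?_, ?_⟩
  · obtain ⟨a, ha, hr⟩ := exists_rep_smul (perm12 * perm34) p
    refine ⟨a, ha, hr.trans (congrArg (a • ·) ?_)⟩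
    have h0 : (perm12 * perm34)⁻¹ 0 = 1 := by decide
    have h2 : (perm12 * perm34)⁻¹ 1 = 0 := by decide
    have h3 : (perm12 * perm34)⁻¹ 2 = 3 := by decide
    have h4 : (perm12 * perm34)⁻¹ 3 = 2 := by decide
    have h5 : (perm12 * perm34)⁻¹ 4 = 4 := by decide
    ext i
    fin_cases i <;> simp only [Fin.reduceFinMk, Fin.zero_eta, Fin.mk_one, h0, h2, h3, h4, h5] <;>
      simp [ofKleinCoord, kleinCoord] <;> linear_combination h1 / 4
  · obtain ⟨a, ha, hr⟩ := exists_rep_smul perm13_24 p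
    refine ⟨a, ha, hr.trans (congrArg (a • ·) ?_)⟩
    have h0 : perm13_24⁻¹ 0 = 2 := by decide
    have h2 : perm13_24⁻¹ 1 = 3 := by decide
    have h3 : perm13_24⁻¹ 2 = 0 := by decide
    have h4 : perm13_24⁻¹ 3 = 1 := by decide
    have h5 : perm13_24⁻¹ 4 = 4 := by decide
    ext i
    fin_cases i <;> simp only [Fin.reduceFinMk, Fin.zero_eta, Fin.mk_one, h0, h2, h3, h4, h5] <;>
      simp [ofKleinCoord, kleinCoord] <;> linear_combination h1 / 4

theorem toE1_smul (p : bringCurve.carrier) :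
    toE1 ((perm12 * perm34) • p) = toE1 p ∧ toE1 (perm13_24 • p) = toE1 p := by
  obtain ⟨⟨a, ha, hr⟩, b, hb, hs⟩ := rep_smul_klein p
  constructor
  · refine toE1_eq_point hr (l := 1) ?_ _ _
    ext i
    fin_cases i <;> simp [kleinMap, kleinCoord_ofKleinCoord]; simp [ofKleinCoord]
  · refine toE1_eq_point hs (l := 1) ?_ _ _
    ext i
    fin_cases i <;> simp [kleinMap, kleinCoord_ofKleinCoord]; simp [ofKleinCoord]

theorem toE1_smul_of_mem {g : Equiv.Perm (Fin 5)}
    (hg : g ∈ Subgroup.closure {perm12 * perm34, perm13_24}) (p : bringCurve.carrier) :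
    toE1 (g • p) = toE1 p := by
  induction hg using Subgroup.closure_induction generalizing p with
  | mem g hg =>
    rcases hg with rfl | rfl
    exacts [(toE1_smul p).1, (toE1_smul p).2]
  | one => rw [one_smul]
  | mul g g' _ _ h h' => rw [mul_smul, h, h']
  | inv g _ h => rw [← h (g⁻¹ • p), smul_inv_smul]

theorem eq_of_rep_eq_smul {p q : bringCurve.carrier} (l : ℂ) (h : p.val.rep = l • q.val.rep) :
    p = q := by
  rw [← one_smul (Equiv.Perm (Fin 5)) q]
  exact (eq_smul_of_rep (σ := 1) l fun i => congrFun h i).symm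

/-- Equal images mean that `W, A, B, C` agree up to a factor `l`. With `d² = l`, the sign of `d`
matching the last coordinates, the Klein coordinates agree up to `d` and signs of product one, and
such sign changes are the action of the four-group. -/
theorem exists_smul_of_toE1_eq {p q : bringCurve.carrier} (h : toE1 p = toE1 q) :
    ∃ g : Subgroup.closure {perm12 * perm34, perm13_24}, g • q = p := by
  have ha : perm12 * perm34 ∈ Subgroup.closure {perm12 * perm34, perm13_24} :=
    Subgroup.subset_closure (by simp)
  have hb : perm13_24 ∈ Subgroup.closure {perm12 * perm34, perm13_24} :=
    Subgroup.subset_closure (by simp)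
  obtain ⟨l, hl, e⟩ := cubicCurve.exists_smul_of_point_eq h
  have hp := isBring_rep p
  have hq := isBring_rep q
  set v := p.val.rep with hv
  set w := q.val.rep with hw
  have e0 : 20 * v 4 ^ 2 = l * (20 * w 4 ^ 2) := congrFun e 0
  have e1 : 4 * sqrtNegFive * (kleinCoord v 0 ^ 2 - kleinCoord v 2 ^ 2) =
    l * (4 * sqrtNegFive * (kleinCoord w 0 ^ 2 - kleinCoord w 2 ^ 2)) := congrFun e 1
  have e2 : kleinCoord v 1 ^ 2 = l * kleinCoord w 1 ^ 2 := congrFun e 2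
  have e3 : kleinCoord v 0 ^ 2 - kleinCoord v 2 ^ 2 =
      l * (kleinCoord w 0 ^ 2 - kleinCoord w 2 ^ 2) := by
    refine mul_left_cancel₀ (mul_ne_zero (by norm_num : (4 : ℂ) ≠ 0) sqrtNegFive_ne_zero) ?_
    rw [e1]
    ring
  have f1 := sum_kleinCoord_sq hp
  have f2 := sum_kleinCoord_sq hq
  obtain ⟨d, hd, hdw⟩ : ∃ d : ℂ, d ^ 2 = l ∧ v 4 = d * w 4 := by
    obtain ⟨d, hd⟩ := IsAlgClosed.exists_pow_nat_eq l (n := 2) two_pos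
    have : v 4 ^ 2 = (d * w 4) ^ 2 := by
      rw [mul_pow, hd]
      linear_combination e0 / 20
    rcases sq_eq_sq_iff_eq_or_eq_neg.1 this with h | h
    · exact ⟨d, hd, h⟩
    · exact ⟨-d, by rw [neg_sq, hd], by rw [h, neg_mul]⟩
  have hsq : ∀ i, kleinCoord v i ^ 2 = (d * kleinCoord w i) ^ 2 := by
    intro i
    rw [mul_pow, hd]
    fin_cases i
    · change kleinCoord v 0 ^ 2 = l * kleinCoord w 0 ^ 2
      linear_combination (f1 - l * f2 - e0 / 4 - e2 + e3) / 2
    · exact e2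
    · change kleinCoord v 2 ^ 2 = l * kleinCoord w 2 ^ 2
      linear_combination (f1 - l * f2 - e0 / 4 - e2 - e3) / 2
  have hor := fun i => sq_eq_sq_iff_eq_or_eq_neg.1 (hsq i)
  have hprod : kleinCoord v 0 * kleinCoord v 1 * kleinCoord v 2 =
      d * kleinCoord w 0 * (d * kleinCoord w 1) * (d * kleinCoord w 2) := by
    rw [prod_kleinCoord hp, hdw]
    linear_combination -d ^ 3 * prod_kleinCoord hq
  have hvK := hp.eq_ofKleinCoord
  obtain ⟨⟨a, ha0, hra⟩, b, hb0, hrb⟩ := rep_smul_klein q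
  rw [← hw] at hra hrb
  rcases eq_or_neg_of_mul_eq hprod (hor 0) (hor 1) (hor 2) with
    ⟨g0, g1, g2⟩ | ⟨g0, g1, g2⟩ | ⟨g0, g1, g2⟩ | ⟨g0, g1, g2⟩ <;>
    rw [g0, g1, g2, hdw] at hvK
  · refine ⟨1, (one_smul _ q).trans (eq_of_rep_eq_smul d ?_).symm⟩
    refine hvK.trans ((?_ : _ = _).trans (congrArg (d • ·) hq.eq_ofKleinCoord.symm))
    ext i
    fin_cases i <;> simp [ofKleinCoord] <;> ring
  · refine ⟨⟨_, ha⟩, (Subgroup.smul_def _ q).trans (eq_of_rep_eq_smul (d * a⁻¹) ?_).symm⟩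
    refine hvK.trans ((?_ : _ = _).trans (congrArg ((d * a⁻¹) • ·) hra.symm))
    ext i
    fin_cases i <;> simp [ofKleinCoord] <;> field_simp
  · refine ⟨⟨_, hb⟩, (Subgroup.smul_def _ q).trans (eq_of_rep_eq_smul (d * b⁻¹) ?_).symm⟩
    refine hvK.trans ((?_ : _ = _).trans (congrArg ((d * b⁻¹) • ·) hrb.symm))
    ext i
    fin_cases i <;> simp [ofKleinCoord] <;> field_simp
  · obtain ⟨⟨c, hc0, hrc⟩, -⟩ := rep_smul_klein (perm13_24 • q)
    refine ⟨⟨_, mul_mem ha hb⟩, (Subgroup.smul_def _ q).trans ((mul_smul _ _ _).trans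
      (eq_of_rep_eq_smul (d * (c * b)⁻¹) ?_).symm)⟩
    refine hvK.trans ((?_ : _ = _).trans (congrArg ((d * (c * b)⁻¹) • ·) hrc.symm))
    rw [hrb, kleinCoord_smul, kleinCoord_ofKleinCoord]
    ext i
    fin_cases i <;> simp [ofKleinCoord] <;> field_simp

/-- The affine Klein coordinates. -/
noncomputable def kleinRatio (i : Fin 3) (p : bringCurve.carrier) : ℂ :=
  kleinCoord p.val.rep i / p.val.rep 4

theorem kleinRatio_smul (p : bringCurve.carrier) (i : Fin 3) :
    kleinRatio i ((perm12 * perm34) • p) = ![1, -1, -1] i * kleinRatio i p ∧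
      kleinRatio i (perm13_24 • p) = ![-1, 1, -1] i * kleinRatio i p := by
  obtain ⟨⟨a, ha, hr⟩, b, hb, hs⟩ := rep_smul_klein p
  simp only [kleinRatio]
  rw [hr, hs, kleinCoord_smul, kleinCoord_smul, kleinCoord_ofKleinCoord, kleinCoord_ofKleinCoord]
  constructor <;>
  · simp only [Pi.smul_apply, smul_eq_mul]
    rw [mul_div_mul_left _ _ (by assumption)]
    fin_cases i <;> simp [ofKleinCoord, neg_div]

theorem tendsto_toE1 : Tendsto toE1 cofinite cofinite :=
  isCurve_bringCurve.tendsto_cofinite isCurve_E1 toE1_continuous_and_regAt.1 toE1_surjective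

theorem x_toE1 (p : bringCurve.carrier) :
    cubicCurve.x (toE1 p) = 20 * p.val.rep 4 ^ 2 / kleinCoord p.val.rep 1 ^ 2 :=
  cubicCurve.x_point

theorem y_toE1 (p : bringCurve.carrier) :
    cubicCurve.y (toE1 p) = 4 * sqrtNegFive * (kleinCoord p.val.rep 0 ^ 2 -
      kleinCoord p.val.rep 2 ^ 2) / kleinCoord p.val.rep 1 ^ 2 :=
  cubicCurve.y_point

theorem eventually_rep_four : ∀ᶠ p : bringCurve.carrier in cofinite, p.val.rep 4 ≠ 0 := by
  filter_upwards [tendsto_toE1.eventually (cubicCurve.eventually_x_ne isCurve_E1 0)] with p hp h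
  exact hp ((x_toE1 p).trans (by simp [h]))

theorem kleinRatio_relations {p : bringCurve.carrier} (h : p.val.rep 4 ≠ 0) :
    kleinRatio 0 p ^ 2 + kleinRatio 1 p ^ 2 + kleinRatio 2 p ^ 2 = -5 ∧
      kleinRatio 0 p * kleinRatio 1 p * kleinRatio 2 p = -5 := by
  have h1 := sum_kleinCoord_sq (isBring_rep p)
  have h2 := prod_kleinCoord (isBring_rep p)
  simp only [kleinRatio]
  constructor
  · field_simp
    linear_combination h1
  · field_simp
    linear_combination h2

/-- One has `B/W = 20/x` and `(A - C)/W = (20y/x)/(4√-5)`; together with the sum `-5` these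
determine all three squares. -/
theorem exists_kleinRatio_sq (i : Fin 3) : ∃ g : (cubicCurve 1 (-5) (-40) (-80)).carrier → ℂ,
    (cubicCurve 1 (-5) (-40) (-80)).IsRational g ∧
      ∀ᶠ p in cofinite, kleinRatio i p ^ 2 = g (toE1 p) := by
  have hx := cubicCurve.isRational_x isCurve_E1
  have hy := cubicCurve.isRational_y isCurve_E1
  have hU : (cubicCurve 1 (-5) (-40) (-80)).IsRational ((fun _ => 20) / cubicCurve.x) :=
    isCurve_E1.isRational_div (IsCurve.isRational_const 20) hx
  have hyU := IsCurve.isRational_mul hy hU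
  have h1 : ∀ p : bringCurve.carrier, p.val.rep 4 ≠ 0 →
      kleinRatio 1 p ^ 2 = 20 / cubicCurve.x (toE1 p) := by
    intro p hp
    have := (kleinRatio_relations hp).2
    have hne : kleinCoord p.val.rep 1 ≠ 0 := fun h0 => by
      simp [kleinRatio, h0] at this
    rw [x_toE1, kleinRatio]
    field_simp
  have h2 : ∀ p : bringCurve.carrier, p.val.rep 4 ≠ 0 → kleinRatio 0 p ^ 2 - kleinRatio 2 p ^ 2 =
      cubicCurve.y (toE1 p) * (20 / cubicCurve.x (toE1 p)) / (4 * sqrtNegFive) := by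
    intro p hp
    have := (kleinRatio_relations hp).2
    have hne : kleinCoord p.val.rep 1 ≠ 0 := fun h0 => by
      simp [kleinRatio, h0] at this
    have hs := sqrtNegFive_ne_zero
    rw [← h1 p hp, y_toE1, kleinRatio, kleinRatio, kleinRatio]
    field_simp
  have hc := fun c : ℂ => IsCurve.isRational_const (X := cubicCurve 1 (-5) (-40) (-80)) c
  fin_cases i
  · refine ⟨_, IsCurve.isRational_add (hc (-5 / 2)) (IsCurve.isRational_add
      (isRational_const_mul (-1 / 2) hU) (isRational_const_mul (1 / (8 * sqrtNegFive)) hyU)),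
      eventually_rep_four.mono fun p hp => ?_⟩
    have hs := sqrtNegFive_ne_zero
    have e2 := h2 p hp
    have e3 := (kleinRatio_relations hp).1
    simp only [Pi.add_apply, Pi.mul_apply, Pi.div_apply]
    rw [← h1 p hp] at e2 ⊢
    have e4 : kleinRatio 0 p ^ 2 = -5 / 2 - kleinRatio 1 p ^ 2 / 2 +
        (kleinRatio 0 p ^ 2 - kleinRatio 2 p ^ 2) / 2 := by linear_combination e3 / 2
    refine e4.trans ?_
    rw [e2]
    field_simp
    ring
  · exact ⟨_, hU, eventually_rep_four.mono h1⟩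
  · refine ⟨_, IsCurve.isRational_add (hc (-5 / 2)) (IsCurve.isRational_add
      (isRational_const_mul (-1 / 2) hU) (isRational_const_mul (-1 / (8 * sqrtNegFive)) hyU)),
      eventually_rep_four.mono fun p hp => ?_⟩
    have hs := sqrtNegFive_ne_zero
    have e2 := h2 p hp
    have e3 := (kleinRatio_relations hp).1
    simp only [Pi.add_apply, Pi.mul_apply, Pi.div_apply]
    rw [← h1 p hp] at e2 ⊢
    have e4 : kleinRatio 2 p ^ 2 = -5 / 2 - kleinRatio 1 p ^ 2 / 2 -
        (kleinRatio 0 p ^ 2 - kleinRatio 2 p ^ 2) / 2 := by linear_combination e3 / 2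
    refine e4.trans ?_
    rw [e2]
    field_simp
    ring

/-- Over the function field of `𝓔₁` that of `𝓑` is spanned by `1, r₀, r₁, r₂`, eigenfunctions for
the four characters of the group: each `rᵢ²` descends, and `rᵢrⱼ = -5rₖ/rₖ²`. -/
theorem isQuot_toE1 : IsQuot toE1 := by
  set m : Fin 4 → bringCurve.carrier → ℂ := fun i p =>
    ![1, kleinRatio 0 p, kleinRatio 1 p, kleinRatio 2 p] i with hm
  have hX := isCurve_bringCurve
  have hY := isCurve_E1
  have h0 : InSpan toE1 m 1 := inSpan_self 0
  have hr0 : InSpan toE1 m (kleinRatio 0) := inSpan_self 1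
  have hr1 : InSpan toE1 m (kleinRatio 1) := inSpan_self 2
  have hr2 : InSpan toE1 m (kleinRatio 2) := inSpan_self 3
  have hne : ∀ᶠ p in cofinite, kleinRatio 0 p * kleinRatio 1 p * kleinRatio 2 p = -5 :=
    eventually_rep_four.mono fun p hp => (kleinRatio_relations hp).2
  choose g hg hgr using exists_kleinRatio_sq
  have hmul3 : ∀ i j k : Fin 3, InSpan toE1 m (kleinRatio k) →
      (∀ᶠ p in cofinite, kleinRatio i p * kleinRatio j p * kleinRatio k p = -5) →
      InSpan toE1 m (kleinRatio i * kleinRatio j) := by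
    intro i j k hk hp
    refine (hk.smul (hY.isRational_div (IsCurve.isRational_const (-5)) (hg k))).congr ?_
    filter_upwards [hp, hgr k] with p h1 h2
    have hk0 : kleinRatio k p ≠ 0 := fun h => by
      rw [h] at h1
      norm_num at h1
    simp only [Pi.div_apply, Pi.mul_apply, ← h2, ← h1]
    field_simp
  have hsq : ∀ i, InSpan toE1 m (kleinRatio i * kleinRatio i) := fun i =>
    (h0.smul (hg i)).congr ((hgr i).mono fun p hp => by
      simp only [Pi.one_apply, mul_one, Pi.mul_apply, ← hp, pow_two])
  have hmul : ∀ i j, InSpan toE1 m (m i * m j) := by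
    have h01 := hmul3 0 1 2 hr2 hne
    have h02 := hmul3 0 2 1 hr1 (hne.mono fun p hp => by linear_combination hp)
    have h12 := hmul3 1 2 0 hr0 (hne.mono fun p hp => by linear_combination hp)
    intro i j
    fin_cases i <;> fin_cases j
    · exact h0.congr (Eventually.of_forall fun p => by simp [hm])
    · exact hr0.congr (Eventually.of_forall fun p => by simp [hm])
    · exact hr1.congr (Eventually.of_forall fun p => by simp [hm])
    · exact hr2.congr (Eventually.of_forall fun p => by simp [hm])
    · exact hr0.congr (Eventually.of_forall fun p => by simp [hm])
    · exact hsq 0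
    · exact h01
    · exact h02
    · exact hr1.congr (Eventually.of_forall fun p => by simp [hm])
    · exact h01.congr (Eventually.of_forall fun p => mul_comm _ _)
    · exact hsq 1
    · exact h12
    · exact hr2.congr (Eventually.of_forall fun p => by simp [hm])
    · exact h02.congr (Eventually.of_forall fun p => mul_comm _ _)
    · exact h12.congr (Eventually.of_forall fun p => mul_comm _ _)
    · exact hsq 2
  have hψ : ∀ i, InSpan toE1 m (fun p => p.val.rep i / p.val.rep 4) := by
    have hc : ∀ (c : ℂ) {h}, InSpan toE1 m h → InSpan toE1 m (fun p => c * h p) := fun c _ hh =>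
      hh.smul (IsCurve.isRational_const c)
    have hlin : ∀ a b c : ℂ, InSpan toE1 m (fun p => (-1 + a * kleinRatio 0 p +
        b * kleinRatio 1 p + c * kleinRatio 2 p) / 4) := fun a b c =>
      ((hc (-1 / 4) h0).add ((hc (a / 4) hr0).add ((hc (b / 4) hr1).add (hc (c / 4) hr2)))).congr
        (Eventually.of_forall fun p => by simp; ring)
    intro i
    have hp : ∀ p : bringCurve.carrier, p.val.rep i = ofKleinCoord (kleinCoord p.val.rep 0)
      (kleinCoord p.val.rep 1) (kleinCoord p.val.rep 2) (p.val.rep 4) i := fun p =>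
      congrFun (isBring_rep p).eq_ofKleinCoord i
    simp only [hp]
    fin_cases i
    · refine (hlin 1 1 1).congr (eventually_rep_four.mono fun p h4 => ?_)
      simp [ofKleinCoord, kleinRatio]
      field_simp
    · refine (hlin 1 (-1) (-1)).congr (eventually_rep_four.mono fun p h4 => ?_)
      simp [ofKleinCoord, kleinRatio]
      field_simp
      ring
    · refine (hlin (-1) 1 (-1)).congr (eventually_rep_four.mono fun p h4 => ?_)
      simp [ofKleinCoord, kleinRatio]
      field_simp
      ring
    · refine (hlin (-1) (-1) 1).congr (eventually_rep_four.mono fun p h4 => ?_)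
      simp [ofKleinCoord, kleinRatio]
      field_simp
      ring
    · refine h0.congr (eventually_rep_four.mono fun p h4 => ?_)
      simp [ofKleinCoord, h4]
  refine hX.isQuot hY (curveE1_hasOrders hY) toE1_continuous_and_regAt.1 toE1_surjective
    toE1_continuous_and_regAt.2 fun f hf => ?_
  let γ : Fin 4 → Equiv.Perm (Fin 5) :=
    ![1, perm12 * perm34, perm13_24, perm12 * perm34 * perm13_24]
  -- The character table of the four-group is symmetric with square `4`, which explains the weights.
  let χ : Fin 4 → Fin 4 → ℂ :=
    ![![1, 1, 1, 1], ![1, 1, -1, -1], ![1, -1, 1, -1], ![1, -1, -1, 1]]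
  refine isRational_of_comp (I := Fin 4) (K := Fin 4) (m := m) hX hY toE1_continuous_and_regAt.1
    toE1_surjective (fun k p => γ k • p) (fun k => MulAction.injective _) (fun k p => ?_) χ
    (fun k i p => ?_) (fun i k => χ k i / 4) (fun i j => ?_) (fun i => ?_) (fun h hh => ?_) f hf
  · refine toE1_smul_of_mem ?_ p
    have ha : perm12 * perm34 ∈ Subgroup.closure {perm12 * perm34, perm13_24} :=
      Subgroup.subset_closure (by simp)
    have hb : perm13_24 ∈ Subgroup.closure {perm12 * perm34, perm13_24} :=
      Subgroup.subset_closure (by simp)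
    fin_cases k
    exacts [one_mem _, ha, hb, mul_mem ha hb]
  · have hs := kleinRatio_smul
    have hγ3 : (perm12 * perm34 * perm13_24) • p = (perm12 * perm34) • perm13_24 • p :=
      mul_smul _ _ _
    fin_cases k
    · fin_cases i <;> simp [γ, χ, hm]
    · fin_cases i
      · simp [γ, χ, hm]
      · exact (hs p 0).1
      · exact (hs p 1).1
      · exact (hs p 2).1
    · fin_cases i
      · simp [γ, χ, hm]
      · exact (hs p 0).2
      · exact (hs p 1).2
      · exact (hs p 2).2
    · fin_cases i
      · simp [γ, χ, hm]
      · refine (congrArg (kleinRatio 0) hγ3).trans ((hs _ 0).1.trans ?_)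
        rw [(hs p 0).2]
        simp [χ, hm]
      · refine (congrArg (kleinRatio 1) hγ3).trans ((hs _ 1).1.trans ?_)
        rw [(hs p 1).2]
        simp [χ, hm]
      · refine (congrArg (kleinRatio 2) hγ3).trans ((hs _ 2).1.trans ?_)
        rw [(hs p 2).2]
        simp [χ, hm]
  · rw [Fin.sum_univ_four, show χ 0 = ![1, 1, 1, 1] from rfl, show χ 1 = ![1, 1, -1, -1] from rfl,
      show χ 2 = ![1, -1, 1, -1] from rfl, show χ 3 = ![1, -1, -1, 1] from rfl]
    fin_cases i <;> fin_cases j <;> norm_num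
  · filter_upwards [hne] with p hp
    have hz : kleinRatio 0 p ≠ 0 ∧ kleinRatio 1 p ≠ 0 ∧ kleinRatio 2 p ≠ 0 := by
      refine ⟨?_, ?_, ?_⟩ <;> intro h <;> rw [h] at hp <;> norm_num at hp
    fin_cases i
    exacts [one_ne_zero, hz.1, hz.2.1, hz.2.2]
  · obtain ⟨P, Q, e1, e2⟩ := hh.exists_eval hX (fun p i => p.val.rep i / p.val.rep 4)
      (eventually_rep_four.mono fun p hp => ⟨_, hp, rep_eq_smul_div hp⟩)
    exact ⟨_, _, InSpan.eval hmul h0 hψ P, InSpan.eval hmul h0 hψ Q, e1, e2⟩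

theorem kleinQuotient_isomorphic :
    (bringQuotient {perm12 * perm34, perm13_24}).Isomorphic curveE1 := by
  rw [curveE1_eq]
  obtain ⟨e, he, -⟩ := isQuot_toE1.exists_isIso_quotient
    (Subgroup.closure {perm12 * perm34, perm13_24})
    (fun g p => (congrArg toE1 (Subgroup.smul_def g p)).trans (toE1_smul_of_mem g.property p))
    fun _ _ h => exists_smul_of_toE1_eq h
  exact ⟨e, he⟩

end bringCurve


/-! ### Weierstrass equations and `j`-invariants -/

open FunSpace in
theorem cubicCurve_one_eq (a b c : ℂ) :
    cubicCurve 1 a b c = weierstrassPlaneCurve ⟨0, a, 0, b, c⟩ := by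
  refine congrArg projectiveSubspace (Set.ext fun p => ?_)
  simp only [zeroLocus, Set.mem_ofPred_eq, Set.mem_singleton_iff, forall_eq, IsCubic,
    WeierstrassCurve.Projective.polynomial]
  simp [sub_eq_zero]

namespace cubicCurve

open FunSpace

/-- The coordinates `x` and `y` can be rescaled. -/
theorem isomorphic_of_scale {k a b c k' a' b' c' : ℂ} (l : Fin 3 → ℂ) (hl : ∀ i, l i ≠ 0)
    (h : ∀ v : Fin 3 → ℂ, IsCubic k a b c v → IsCubic k' a' b' c' fun i => l i * v i)
    (h' : ∀ v : Fin 3 → ℂ, IsCubic k' a' b' c' v → IsCubic k a b c fun i => (l i)⁻¹ * v i) :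
    (cubicCurve k a b c).Isomorphic (cubicCurve k' a' b' c') := by
  have hne : ∀ m : Fin 3 → ℂ, (∀ i, m i ≠ 0) → ∀ v : Fin 3 → ℂ, v ≠ 0 → (fun i => m i * v i) ≠ 0 :=
    fun m hm v hv h0 => hv (funext fun i => (mul_eq_zero.1 (congrFun h0 i)).resolve_left (hm i))
  have key : ∀ {k a b c k' a' b' c' : ℂ} (m : Fin 3 → ℂ), (∀ i, m i ≠ 0) →
      (∀ v : Fin 3 → ℂ, IsCubic k a b c v → IsCubic k' a' b' c' fun i => m i * v i) →
      ∃ φ : (cubicCurve k a b c).carrier → (cubicCurve k' a' b' c').carrier,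
        (∀ v hv hq, ∃ hv' hq', φ (point v hv hq) = point (fun i => m i * v i) hv' hq') ∧
        Continuous φ ∧ ∀ p f, (cubicCurve k' a' b' c').RegAt (φ p) f →
          (cubicCurve k a b c).RegAt p (f ∘ φ) := by
    intro k a b c k' a' b' c' m hm hq
    refine ⟨fun p => point _ (hne m hm _ p.val.rep_nonzero) (hq p.val.rep p.property), ?_, ?_⟩
    · intro v hv hc
      refine ⟨hne m hm v hv, hq v hc, ?_⟩
      obtain ⟨l, -, hr⟩ := point_rep (hv := hv) (h := hc)
      refine point_eq_of_smul l (funext fun i => ?_)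
      rw [hr]
      simp only [Pi.smul_apply, smul_eq_mul]
      ring
    · refine continuous_and_regAt_comp_of_polynomial (e := 1)
        (fun i => MvPolynomial.C (m i) * MvPolynomial.X i)
        (fun i => (MvPolynomial.isHomogeneous_X ℂ i).C_mul _) fun p => ?_
      simp only [map_mul, MvPolynomial.eval_C, MvPolynomial.eval_X]
      exact ⟨hne m hm _ p.val.rep_nonzero, rfl⟩
  have hpt : ∀ {k a b c : ℂ} (p : (cubicCurve k a b c).carrier),
      ∃ v hv hq, p = point v hv hq := fun p =>
    ⟨p.val.rep, p.val.rep_nonzero, p.property, Subtype.ext p.val.mk_rep.symm⟩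
  obtain ⟨φ, hφ, hφc, hφr⟩ := key l hl h
  obtain ⟨ψ, hψ, hψc, hψr⟩ := key (fun i => (l i)⁻¹) (fun i => inv_ne_zero (hl i)) h'
  have hψφ : ∀ p, ψ (φ p) = p := by
    intro p
    obtain ⟨v, hv, hq, rfl⟩ := hpt p
    obtain ⟨hv', hq', e⟩ := hφ v hv hq
    obtain ⟨_, _, e'⟩ := hψ _ hv' hq'
    rw [e, e']
    refine point_eq_of_smul 1 (funext fun i => ?_)
    rw [inv_mul_cancel_left₀ (hl i), one_smul]
  have hφψ : ∀ p, φ (ψ p) = p := by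
    intro p
    obtain ⟨v, hv, hq, rfl⟩ := hpt p
    obtain ⟨hv', hq', e⟩ := hψ v hv hq
    obtain ⟨_, _, e'⟩ := hφ _ hv' hq'
    rw [e, e']
    refine point_eq_of_smul 1 (funext fun i => ?_)
    rw [mul_inv_cancel_left₀ (hl i), one_smul]
  refine ⟨⟨φ, ψ, hψφ, hφψ⟩, hφc, hψc, fun p f => ⟨hφr p f, fun hf => ?_⟩⟩
  have h1 := hψr (φ p) (f ∘ φ) (by rw [hψφ]; exact hf)
  have h2 : (f ∘ φ) ∘ ψ = f := funext fun q => congrArg f (hφψ q)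
  rwa [h2] at h1

end cubicCurve

theorem curveE1_hasJInvariant : HasJInvariant curveE1 (-(5 * 29 ^ 3) / 2 ^ 5) := by
  have hΔ : (⟨0, -5, 0, -40, -80⟩ : WeierstrassCurve ℂ).Δ = -3276800 := by
    simp only [WeierstrassCurve.Δ, WeierstrassCurve.b₂, WeierstrassCurve.b₄, WeierstrassCurve.b₆,
      WeierstrassCurve.b₈]
    norm_num
  have hW : (⟨0, -5, 0, -40, -80⟩ : WeierstrassCurve ℂ).IsElliptic :=
    ⟨by rw [hΔ]; exact isUnit_iff_ne_zero.2 (by norm_num)⟩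
  refine ⟨_, hW, ⟨_, FunSpace.isIso_refl _⟩, ?_⟩
  rw [WeierstrassCurve.j, Units.val_inv_eq_inv_val, WeierstrassCurve.coe_Δ', hΔ]
  simp only [WeierstrassCurve.c₄, WeierstrassCurve.b₂, WeierstrassCurve.b₄]
  norm_num

/-- Multiplying `x` by `3` and dividing `y` by `4` absorbs the factor `432 = 16 · 27` and makes the
equation monic. -/
theorem curveE4_hasJInvariant : HasJInvariant curveE4 (-(5 ^ 2 * 241 ^ 3) / 2 ^ 3) := by
  have hΔ : (⟨0, 240, 0, 1125, 1350⟩ : WeierstrassCurve ℂ).Δ = -(2 ^ 15) * 3 ^ 6 * 5 ^ 4 := by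
    simp only [WeierstrassCurve.Δ, WeierstrassCurve.b₂, WeierstrassCurve.b₄, WeierstrassCurve.b₆,
      WeierstrassCurve.b₈]
    norm_num
  have hW : (⟨0, 240, 0, 1125, 1350⟩ : WeierstrassCurve ℂ).IsElliptic :=
    ⟨by rw [hΔ]; exact isUnit_iff_ne_zero.2 (by norm_num)⟩
  refine ⟨_, hW, ?_, ?_⟩
  · rw [curveE4_eq, ← cubicCurve_one_eq]
    refine cubicCurve.isomorphic_of_scale ![3, 1 / 4, 1] (by intro i; fin_cases i <;> norm_num)
      (fun v hv => ?_) fun v hv => ?_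
    · simp only [IsCubic, Matrix.cons_val] at hv ⊢
      linear_combination hv / 16
    · simp only [IsCubic, Matrix.cons_val] at hv ⊢
      linear_combination 16 * hv
  · rw [WeierstrassCurve.j, Units.val_inv_eq_inv_val, WeierstrassCurve.coe_Δ', hΔ]
    simp only [WeierstrassCurve.c₄, WeierstrassCurve.b₂, WeierstrassCurve.b₄]
    norm_num

open FunSpace in
theorem curveC2_quotients : (∃ (Φ : (bringQuotient {perm345}).carrier ≃ curveC2.carrier)
        (σ ι : Equiv.Perm curveC2.carrier),
      FunSpace.IsIso Φ ∧ FunSpace.IsIso σ ∧ FunSpace.IsIso ι ∧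
      IsKleinFour (Subgroup.closure {σ, ι}) ∧
      (∀ (s t y : ℂ) (h : s ≠ 0 ∨ t ≠ 0) (hy : y ^ 2 = sexticForm polyC2 s t),
        (∃ h' hy', σ (sexticPoint polyC2 s t y h hy) = sexticPoint polyC2 (-s - t) t y h' hy') ∧
        (∃ hy', ι (sexticPoint polyC2 s t y h hy) = sexticPoint polyC2 s t (-y) h hy')) ∧
      (∀ p : bringCurve.carrier,
        Φ (toBringQuotient {perm345} (perm12 • p)) = σ (Φ (toBringQuotient {perm345} p)) ∧
        Φ (toBringQuotient {perm345} (perm34 • p)) = ι (Φ (toBringQuotient {perm345} p))) ∧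
      (curveC2.quotient (Subgroup.zpowers σ)).Isomorphic curveE4 ∧
      (curveC2.quotient (Subgroup.zpowers (σ * ι))).Isomorphic curveE1) ∧
    (bringQuotient {perm12, perm345}).Isomorphic curveE4 ∧
    (bringQuotient {perm12 * perm34, perm345}).Isomorphic curveE1 := by
  obtain ⟨σ, ι, h1, h2, h⟩ := CurveC2.exists_involutions
  obtain ⟨Φ, hΦ, hp⟩ := bringCurve.exists_isIso_C2
  have hσ := fun s t y h0 hy => (h s t y h0 hy).1
  have hι := fun s t y h0 hy => (h s t y h0 hy).2
  have hσι : ∀ s t y h0 hy, ∃ h' hy', (σ * ι) (sexticPoint polyC2 s t y h0 hy) =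
      sexticPoint polyC2 (-s - t) t (-y) h' hy' := by
    intro s t y h0 hy
    obtain ⟨hy', e⟩ := hι s t y h0 hy
    obtain ⟨h'', hy'', e'⟩ := hσ s t (-y) h0 hy'
    exact ⟨h'', hy'', (congrArg σ e).trans e'⟩
  have h12 := bringCurve.toC2_perm12_smul hσ
  have h34 := bringCurve.toC2_perm34_smul hι
  obtain ⟨φ, hφ, hφ1, hφ2⟩ := exists_toE4 hσ
  obtain ⟨ψ, hψ, hψ1, hψ2⟩ := exists_toE1 hσι
  refine ⟨⟨Φ, σ, ι, hΦ, (CurveC2.isIso_involutions h1 h2 h).1, (CurveC2.isIso_involutions h1 h2 h).2,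
    (CurveC2.isKleinFour_involutions h1 h2 h).1, h, fun p => ⟨?_, ?_⟩,
    CurveC2.quotient_isomorphic hφ hφ1 hφ2, CurveC2.quotient_isomorphic hψ hψ1 hψ2⟩,
    bringCurve.quotient_isomorphic hφ hφ1 hφ2 h12,
    bringCurve.quotient_isomorphic hψ hψ1 hψ2 fun p => ?_⟩
  · rw [hp, hp, h12]
  · rw [hp, hp, h34]
  · rw [mul_smul, h12, h34]
    rfl


/-! ### Differentials on curves `y² = F(x)` -/

namespace FunSpace

open Filter Polynomial

variable {X : FunSpace} {p q : X.carrier} {f g : X.carrier → ℂ}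

theorem diff_eq_of_sub_mem {hf : X.RegAt p f} {hg : X.RegAt p g}
    (h : ∃ hk : X.RegAt p (fun r => f r - f p - (g r - g p)),
      (⟨_, hk⟩ : X.localRing p) ∈ X.maxIdeal p ^ 2) : X.diff p f hf = X.diff p g hg := by
  obtain ⟨hk, h⟩ := h
  exact (Ideal.toCotangent_eq _).2 h

theorem mem_maxIdeal {h : X.localRing p} : h ∈ X.maxIdeal p ↔ h.val p = 0 := Iff.rfl

/-- Elements of `localRing` are functions on the whole space, not germs. If `f = g` near `p`, the
difference equals itself times the indicator of `f ≠ g`; both factors lie in `𝔪_p`, so the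
difference lies in the square. -/
theorem diff_congr {hf : X.RegAt p f} {hg : X.RegAt p g} (h : ∀ᶠ r in 𝓝 p, f r = g r) :
    X.diff p f hf = X.diff p g hg := by
  classical
  have hk : X.RegAt p (f - g) := regAt_sub hf hg
  have he : X.RegAt p (fun r => if f r = g r then 0 else 1) :=
    X.regAt_congr p (fun _ => 0) _ (h.mono fun r hr => by simp [hr]) (X.regAt_const p 0)
  have hp := h.self_of_nhds
  have e : (fun r => f r - f p - (g r - g p)) = (f - g) * fun r => if f r = g r then 0 else 1 := by
    ext r
    simp only [Pi.mul_apply, Pi.sub_apply, hp]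
    split_ifs with h <;> simp [h]
  refine diff_eq_of_sub_mem ⟨e ▸ X.regAt_mul _ _ _ hk he, ?_⟩
  have := Ideal.mul_mem_mul (I := X.maxIdeal p) (J := X.maxIdeal p) (r := ⟨_, hk⟩) (s := ⟨_, he⟩)
    (by rw [mem_maxIdeal]; simp [hp]) (by rw [mem_maxIdeal]; simp [hp])
  rw [← pow_two] at this
  convert this using 1
  exact Subtype.ext e

theorem diff_const (c : ℂ) : X.diff p (fun _ => c) (X.regAt_const p c) = 0 := by
  refine (Ideal.toCotangent_eq_zero _ _).2 ?_
  convert Ideal.zero_mem (X.maxIdeal p ^ 2)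
  exact Subtype.ext (funext fun r => sub_self c)

theorem diff_add (hf : X.RegAt p f) (hg : X.RegAt p g) :
    X.diff p (f + g) (X.regAt_add _ _ _ hf hg) = X.diff p f hf + X.diff p g hg := by
  rw [diff, diff, diff, ← map_add]
  congr 1
  refine Subtype.ext (Subtype.ext (funext fun r => ?_))
  change f r + g r - (f p + g p) = (f r - f p) + (g r - g p)
  ring

set_option synthInstance.maxHeartbeats 400000 in
theorem smul_toCotangent (c : ℂ) (m : X.maxIdeal p) : c • (X.maxIdeal p).toCotangent m =
    (X.maxIdeal p).toCotangent (algebraMap ℂ (X.localRing p) c • m) := by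
  rw [LinearMap.map_smul, algebraMap_smul]

theorem diff_mul (hf : X.RegAt p f) (hg : X.RegAt p g) :
    X.diff p (f * g) (X.regAt_mul _ _ _ hf hg) = g p • X.diff p f hf + f p • X.diff p g hg := by
  rw [diff, diff, diff, smul_toCotangent, smul_toCotangent, ← map_add]
  refine (Ideal.toCotangent_eq _).2 ?_
  have hf' : X.RegAt p (fun r => f r - f p) := regAt_sub hf (X.regAt_const p _)
  have hg' : X.RegAt p (fun r => g r - g p) := regAt_sub hg (X.regAt_const p _)
  have := Ideal.mul_mem_mul (I := X.maxIdeal p) (J := X.maxIdeal p) (r := ⟨_, hf'⟩) (s := ⟨_, hg'⟩)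
    (mem_maxIdeal.2 (sub_self _)) (mem_maxIdeal.2 (sub_self _))
  rw [← pow_two] at this
  convert this using 1
  refine Subtype.ext (funext fun r => ?_)
  change f r * g r - f p * g p - (g p * (f r - f p) + f p * (g r - g p)) =
    (f r - f p) * (g r - g p)
  ring

theorem diff_inv (hf : X.RegAt p f) (h0 : f p ≠ 0) :
    X.diff p f⁻¹ (X.regAt_inv _ _ hf h0) = -(f p ^ 2)⁻¹ • X.diff p f hf := by
  have h1 := diff_mul hf (X.regAt_inv _ _ hf h0)
  have h2 : X.diff p (f * f⁻¹) (X.regAt_mul _ _ _ hf (X.regAt_inv _ _ hf h0)) = 0 := by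
    rw [← diff_const 1]
    exact diff_congr ((X.eventually_ne _ _ hf h0).mono fun r hr => mul_inv_cancel₀ hr)
  have h3 := h1.symm.trans h2
  have h4 : f p • X.diff p f⁻¹ (X.regAt_inv _ _ hf h0) = -((f p)⁻¹ • X.diff p f hf) :=
    eq_neg_of_add_eq_zero_right h3
  have h5 := congrArg ((f p)⁻¹ • ·) h4
  simp only [smul_smul, inv_mul_cancel₀ h0, one_smul, smul_neg] at h5
  refine h5.trans ?_
  rw [neg_smul, pow_two, mul_inv]

theorem diff_eval (hf : X.RegAt p f) (A : ℂ[X]) :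
    X.diff p (fun r => A.eval (f r)) (regAt_eval hf A) =
      A.derivative.eval (f p) • X.diff p f hf := by
  induction A using Polynomial.induction_on with
  | C a =>
    rw [derivative_C, eval_zero, zero_smul, ← diff_const (p := p) a]
    exact diff_congr (Eventually.of_forall fun r => eval_C)
  | add A B hA hB =>
    rw [derivative_add, eval_add, add_smul, ← hA, ← hB, ← diff_add]
    exact diff_congr (Eventually.of_forall fun r => eval_add)
  | monomial n a h =>
    have h1 := diff_mul (regAt_eval hf (C a * Polynomial.X ^ n)) hf
    rw [h, smul_smul, ← add_smul] at h1
    refine Eq.trans (diff_congr (Eventually.of_forall fun r => ?_)) (h1.trans ?_)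
    · simp [pow_succ, mul_assoc]
    · congr 1
      rw [derivative_C_mul_X_pow, derivative_C_mul_X_pow]
      cases n
      · simp
      · simp [pow_succ]
        ring

/-- A function that vanishes at `q` is divisible by a uniformizer. -/
theorem exists_eq_mul_uniformizer (hX : X.IsCurve) {u : X.carrier → ℂ}
    (hu : X.RegAt q u) (hord : ∀ h, X.IsRational h → h =ᶠ[cofinite] 0 ∨
      ∃ (n : ℕ) (v : X.carrier → ℂ), X.RegAt q v ∧ v q ≠ 0 ∧
        (h =ᶠ[cofinite] u ^ n * v ∨ h * u ^ n =ᶠ[cofinite] v)) (hf : X.RegAt q f) (hf0 : f q = 0) :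
    ∃ g, X.RegAt q g ∧ f =ᶠ[cofinite] u * g := by
  rcases hord f (hX.isRational_of_regAt hf) with h | ⟨n, v, hv, hv0, h | h⟩
  · exact ⟨fun _ => 0, X.regAt_const q 0, h.mono fun r hr => by simpa using hr⟩
  · cases n with
    | zero =>
      rw [pow_zero, one_mul] at h
      exact absurd (hX.eq_of_eventuallyEq hf hv h) (by rw [hf0]; exact hv0.symm)
    | succ n =>
      exact ⟨u ^ n * v, X.regAt_mul _ _ _ (regAt_pow hu n) hv, by rwa [pow_succ', mul_assoc] at h⟩
  · have := hX.eq_of_eventuallyEq (X.regAt_mul _ _ _ hf (regAt_pow hu n)) hv h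
    rw [Pi.mul_apply, hf0, zero_mul] at this
    exact absurd this.symm hv0

/-- The differential of a uniformizer is a basis of the cotangent space. -/
theorem diff_uniformizer (hX : X.IsCurve) {u : X.carrier → ℂ} (hu0 : u q = 0)
    (hu : X.RegAt q u) (hune : ∀ᶠ r in cofinite, u r ≠ 0)
    (hord : ∀ h, X.IsRational h → h =ᶠ[cofinite] 0 ∨
      ∃ (n : ℕ) (v : X.carrier → ℂ), X.RegAt q v ∧ v q ≠ 0 ∧
        (h =ᶠ[cofinite] u ^ n * v ∨ h * u ^ n =ᶠ[cofinite] v)) :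
    X.diff q u hu ≠ 0 ∧ ∀ v : X.CotangentSpace q, ∃ c : ℂ, c • X.diff q u hu = v := by
  have hdiv := fun {f} hf hf0 => exists_eq_mul_uniformizer (f := f) hX hu hord hf hf0
  constructor
  · intro h
    -- Elements of `𝔪²` are divisible by `u²`. If `du = 0`, then `u = u² g`, and cancelling gives `1
    -- = u g`, which is false at `q`.
    have hmem : ∀ h : X.localRing q, h ∈ X.maxIdeal q ^ 2 →
        ∃ g, X.RegAt q g ∧ h.val =ᶠ[cofinite] u ^ 2 * g := by
      intro h hh
      rw [pow_two] at hh
      refine Submodule.mul_induction_on hh (fun a ha b hb => ?_) fun a b ha hb => ?_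
      · obtain ⟨g, hg, e⟩ := hdiv a.property ha
        obtain ⟨g', hg', e'⟩ := hdiv b.property hb
        refine ⟨g * g', X.regAt_mul _ _ _ hg hg', (e.mul e').trans (Eventually.of_forall fun r => ?_)⟩
        simp only [Pi.mul_apply, Pi.pow_apply]
        ring
      · obtain ⟨g, hg, e⟩ := ha
        obtain ⟨g', hg', e'⟩ := hb
        refine ⟨g + g', X.regAt_add _ _ _ hg hg', (e.add e').trans (Eventually.of_forall fun r => ?_)⟩
        simp only [Pi.mul_apply, Pi.pow_apply, Pi.add_apply]
        ring
    obtain ⟨g, hg, e⟩ := hmem _ ((Ideal.toCotangent_eq_zero _ _).1 h)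
    have h1 := hX.eq_of_eventuallyEq (f := u * g) (X.regAt_mul _ _ _ hu hg) (X.regAt_const q 1)
      (by
        filter_upwards [e, hune] with r h1 h2
        have h3 : u r - u q = u r ^ 2 * g r := h1
        rw [hu0] at h3
        refine mul_left_cancel₀ h2 ?_
        rw [Pi.mul_apply]
        linear_combination -h3)
    rw [Pi.mul_apply, hu0, zero_mul] at h1
    exact zero_ne_one h1
  · intro v
    obtain ⟨⟨⟨f, hf⟩, hf0⟩, rfl⟩ := Ideal.toCotangent_surjective _ v
    have hf0' : f q = 0 := hf0
    obtain ⟨g, hg, e⟩ := hdiv hf hf0'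
    refine ⟨g q, ?_⟩
    have h1 : X.diff q (u * g) (X.regAt_mul _ _ _ hu hg) = g q • X.diff q u hu := by
      rw [diff_mul hu hg, hu0, zero_smul, add_zero]
    rw [← h1]
    have h2 : X.diff q f hf = (X.maxIdeal q).toCotangent ⟨⟨f, hf⟩, hf0⟩ := by
      refine congrArg (X.maxIdeal q).toCotangent (Subtype.ext (Subtype.ext (funext fun r => ?_)))
      change f r - f q = f r
      rw [hf0', sub_zero]
    rw [← h2]
    exact diff_congr (hX.eventually_nhds.2 ⟨by rw [hf0', Pi.mul_apply, hu0, zero_mul], e.symm⟩)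

/-- On the curve `y² = f(x)` the form `dx / y = 2 dy / f'(x)` is a basis of the cotangent space. -/
theorem exists_cotangent_basis (hX : X.IsCurve) {x y u : X.carrier → ℂ} {F : ℂ[X]}
    (hx : X.RegAt q x) (hy : X.RegAt q y) (hxy : ∀ᶠ r in 𝓝 q, y r ^ 2 = F.eval (x r))
    (hF : F.Separable) (hu : u = (fun r => x r - x q) ∧ y q ≠ 0 ∨ u = y ∧ y q = 0)
    (hu0 : u q = 0) (hur : X.RegAt q u) (hune : ∀ᶠ r in cofinite, u r ≠ 0)
    (hord : ∀ h, X.IsRational h → h =ᶠ[cofinite] 0 ∨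
      ∃ (n : ℕ) (v : X.carrier → ℂ), X.RegAt q v ∧ v q ≠ 0 ∧
        (h =ᶠ[cofinite] u ^ n * v ∨ h * u ^ n =ᶠ[cofinite] v)) :
    ∃ w : X.CotangentSpace q, w ≠ 0 ∧ (∀ v : X.CotangentSpace q, ∃ c : ℂ, c • w = v) ∧
      X.diff q x hx = y q • w ∧ X.diff q y hy = (F.derivative.eval (x q) / 2) • w := by
  -- The differential of `y² = F(x)`. As `y q` and `F'(x q)` are not both zero, one of `dx`, `dy` is
  -- a multiple of the other.
  have hyF : (2 * y q) • X.diff q y hy = F.derivative.eval (x q) • X.diff q x hx := by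
    rw [← diff_eval hx, two_mul, add_smul, ← diff_mul hy hy]
    exact diff_congr (hxy.mono fun r hr => by rw [Pi.mul_apply, ← pow_two, hr])
  obtain ⟨h0, h1⟩ := diff_uniformizer hX hu0 hur hune hord
  rcases hu with ⟨rfl, hyq⟩ | ⟨rfl, hyq⟩
  · have e : X.diff q _ hur = X.diff q x hx := by
      rw [diff, diff]
      congr 1
      refine Subtype.ext (Subtype.ext (funext fun r => ?_))
      change x r - x q - (x q - x q) = x r - x q
      ring
    rw [e] at h0 h1
    refine ⟨(y q)⁻¹ • X.diff q x hx, smul_ne_zero (inv_ne_zero hyq) h0, fun v => ?_, ?_, ?_⟩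
    · obtain ⟨c, rfl⟩ := h1 v
      exact ⟨c * y q, by rw [smul_smul, mul_inv_cancel_right₀ hyq]⟩
    · rw [smul_smul, mul_inv_cancel₀ hyq, one_smul]
    · have := congrArg ((2 * y q)⁻¹ • ·) hyF
      simp only [smul_smul] at this
      rw [inv_mul_cancel₀ (mul_ne_zero two_ne_zero hyq), one_smul] at this
      rw [this, smul_smul]
      congr 1
      field_simp
  · have hd : F.derivative.eval (x q) ≠ 0 := by
      intro h
      obtain ⟨a, b, hab⟩ := hF
      have h2 := congrArg (eval (x q)) hab
      rw [eval_add, eval_mul, eval_mul, h, ← hxy.self_of_nhds, hyq, eval_one] at h2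
      simp at h2
    refine ⟨(2 / F.derivative.eval (x q)) • X.diff q u hy, smul_ne_zero (div_ne_zero two_ne_zero hd) h0,
      fun v => ?_, ?_, ?_⟩
    · obtain ⟨c, rfl⟩ := h1 v
      refine ⟨c * (F.derivative.eval (x q) / 2), ?_⟩
      rw [smul_smul]
      congr 1
      field_simp
    · rw [hyq, zero_smul]
      rw [hyq, mul_zero, zero_smul] at hyF
      exact (smul_eq_zero.1 hyF.symm).resolve_left hd
    · rw [smul_smul]
      convert (one_smul ℂ _).symm using 2
      field_simp

/-- The condition for a differential form to be regular at `p`. -/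
def FormRegAt (X : FunSpace) (ω : ∀ p : X.carrier, X.CotangentSpace p) (p : X.carrier) : Prop :=
  ∃ U : Set X.carrier, IsOpen U ∧ p ∈ U ∧
    ∃ (n : ℕ) (a b : Fin n → X.carrier → ℂ),
      (∀ i, ∀ q ∈ U, X.RegAt q (a i)) ∧ ∃ hb : ∀ i, ∀ q ∈ U, X.RegAt q (b i),
        ∀ q (hq : q ∈ U), ω q = ∑ i, a i q • X.diff q (b i) (hb i q hq)

/-- `df = g ω` near `q`, with `g` regular at `q`. -/
def HasQuotient (ω : ∀ p : X.carrier, X.CotangentSpace p) (q : X.carrier)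
    (f g : X.carrier → ℂ) : Prop :=
  X.RegAt q g ∧ ∀ᶠ r in 𝓝 q, ∃ hf : X.RegAt r f, X.diff r f hf = g r • ω r

variable {ω : ∀ p : X.carrier, X.CotangentSpace p} {f' g' : X.carrier → ℂ}

theorem hasQuotient_const (c : ℂ) : HasQuotient ω q (fun _ => c) fun _ => 0 :=
  ⟨X.regAt_const q 0, Eventually.of_forall fun r => ⟨X.regAt_const r c, by
    rw [diff_const, zero_smul]⟩⟩

theorem HasQuotient.add (hf : HasQuotient ω q f f') (hg : HasQuotient ω q g g') :
    HasQuotient ω q (f + g) (f' + g') := by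
  refine ⟨X.regAt_add _ _ _ hf.1 hg.1, ?_⟩
  filter_upwards [hf.2, hg.2] with r ⟨h1, e1⟩ ⟨h2, e2⟩
  exact ⟨X.regAt_add _ _ _ h1 h2, by rw [diff_add h1 h2, e1, e2, Pi.add_apply, add_smul]⟩

theorem HasQuotient.regAt (hf : HasQuotient ω q f f') : X.RegAt q f :=
  hf.2.self_of_nhds.1

theorem HasQuotient.mul (hf : HasQuotient ω q f f') (hg : HasQuotient ω q g g') :
    HasQuotient ω q (f * g) (f' * g + f * g') := by
  refine ⟨X.regAt_add _ _ _ (X.regAt_mul _ _ _ hf.1 hg.regAt) (X.regAt_mul _ _ _ hf.regAt hg.1), ?_⟩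
  filter_upwards [hf.2, hg.2] with r ⟨h1, e1⟩ ⟨h2, e2⟩
  refine ⟨X.regAt_mul _ _ _ h1 h2, ?_⟩
  rw [diff_mul h1 h2, e1, e2, Pi.add_apply, add_smul, smul_smul, smul_smul, Pi.mul_apply,
    Pi.mul_apply, mul_comm (f' r)]

theorem HasQuotient.inv (hf : HasQuotient ω q f f') (h0 : f q ≠ 0) :
    HasQuotient ω q f⁻¹ (-(f⁻¹ ^ 2) * f') := by
  have h1 : X.RegAt q f⁻¹ := X.regAt_inv _ _ hf.regAt h0
  refine ⟨X.regAt_mul _ _ _ ?_ hf.1, ?_⟩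
  · convert regAt_const_mul (-1) (regAt_pow h1 2) using 1
    ext r
    simp
  · filter_upwards [hf.2, X.eventually_ne _ _ hf.regAt h0] with r ⟨h1, e1⟩ h2
    refine ⟨X.regAt_inv _ _ h1 h2, ?_⟩
    rw [diff_inv h1 h2, e1, smul_smul]
    simp

theorem HasQuotient.congr (hf : HasQuotient ω q f f') (h : ∀ᶠ r in 𝓝 q, f r = g r) :
    HasQuotient ω q g f' := by
  refine ⟨hf.1, ?_⟩
  filter_upwards [hf.2, eventually_eventually_nhds.2 h] with r ⟨h1, e1⟩ h2
  exact ⟨X.regAt_congr _ _ _ h2 h1, (diff_congr (h2.mono fun _ => Eq.symm)).trans e1⟩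

theorem exists_hasQuotient_eval {n : ℕ} {ψ : X.carrier → Fin n → ℂ}
    (hψ : ∀ k, ∃ g, HasQuotient ω q (fun r => ψ r k) g) (P : MvPolynomial (Fin n) ℂ) :
    ∃ g, HasQuotient ω q (fun r => MvPolynomial.eval (ψ r) P) g := by
  induction P using MvPolynomial.induction_on with
  | C a => exact ⟨_, by simpa using hasQuotient_const a⟩
  | add P Q hP hQ =>
    obtain ⟨g, hg⟩ := hP
    obtain ⟨g', hg'⟩ := hQ
    exact ⟨_, by simpa using! hg.add hg'⟩
  | mul_X P k hP =>
    obtain ⟨g, hg⟩ := hP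
    obtain ⟨g', hg'⟩ := hψ k
    exact ⟨_, by simpa using! hg.mul hg'⟩

/-- A regular form is a multiple of `ω` by a regular function if all differentials are. -/
theorem FormRegAt.exists_eq_smul (h : ∀ f, X.RegAt q f → ∃ g, HasQuotient ω q f g)
    {η : ∀ p : X.carrier, X.CotangentSpace p} (hη : X.FormRegAt η q) :
    ∃ g, X.RegAt q g ∧ ∀ᶠ r in 𝓝 q, η r = g r • ω r := by
  obtain ⟨U, hU, hq, n, a, b, ha, hb, e⟩ := hη
  choose g hg using fun i => h (b i) (hb i q hq)
  refine ⟨∑ i, a i * g i, ?_, ?_⟩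
  · refine Finset.sum_induction _ (X.RegAt q) (fun _ _ => X.regAt_add _ _ _) (X.regAt_const q 0)
      fun i _ => X.regAt_mul _ _ _ (ha i q hq) (hg i).1
  · filter_upwards [eventually_all.2 fun i => (hg i).2, hU.mem_nhds hq] with r h1 h2
    rw [e r h2, Finset.sum_apply, Finset.sum_smul]
    refine Finset.sum_congr rfl fun i _ => ?_
    rw [(h1 i).2, smul_smul, Pi.mul_apply]

end FunSpace


namespace FunSpace

open Filter Polynomial

variable {X : FunSpace}

/-- On `U` the form `ω` is regular without zeros, and differentials are multiples of `ω`. -/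
structure IsFormBasis (X : FunSpace) (ω : ∀ p : X.carrier, X.CotangentSpace p)
    (U : Set X.carrier) : Prop where
  isOpen : IsOpen U
  ne_zero : ∀ q ∈ U, ω q ≠ 0
  span : ∀ q ∈ U, ∀ v : X.CotangentSpace q, ∃ c : ℂ, c • ω q = v
  formRegAt : ∀ q ∈ U, X.FormRegAt ω q
  hasQuotient : ∀ q ∈ U, ∀ f, X.RegAt q f → ∃ g, HasQuotient ω q f g

theorem IsFormBasis.finrank {ω : ∀ p : X.carrier, X.CotangentSpace p} {U : Set X.carrier}
    (h : X.IsFormBasis ω U) {q : X.carrier} (hq : q ∈ U) :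
    Module.finrank ℂ (X.CotangentSpace q) = 1 :=
  (finrank_eq_one_iff_of_nonzero' (ω q) (h.ne_zero q hq)).2 (h.span q hq)

/-- The coefficient with respect to `ω` is unique because `ω` has no zeros, so near `q` it is the
regular function provided by `FormRegAt.exists_eq_smul`. -/
theorem IsFormBasis.exists_eq_smul {ω : ∀ p : X.carrier, X.CotangentSpace p} {U : Set X.carrier}
    (h : X.IsFormBasis ω U) (η : ∀ p : X.carrier, X.CotangentSpace p) :
    ∃ H : X.carrier → ℂ, ∀ q ∈ U, η q = H q • ω q ∧ (X.FormRegAt η q → X.RegAt q H) := by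
  have : ∀ q, ∃ c : ℂ, q ∈ U → η q = c • ω q := by
    intro q
    by_cases hq : q ∈ U
    · obtain ⟨c, hc⟩ := h.span q hq (η q)
      exact ⟨c, fun _ => hc.symm⟩
    · exact ⟨0, fun h => absurd h hq⟩
  choose H hH using this
  refine ⟨H, fun q hq => ⟨hH q hq, fun hη => ?_⟩⟩
  obtain ⟨g, hg, e⟩ := hη.exists_eq_smul (h.hasQuotient q hq)
  refine X.regAt_congr q g H ?_ hg
  filter_upwards [e, h.isOpen.mem_nhds hq] with r h1 h2
  exact smul_left_injective ℂ (h.ne_zero r h2) (h1.symm.trans (hH r h2))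

theorem formRegAt_smul_diff {ω : ∀ p : X.carrier, X.CotangentSpace p} {q : X.carrier}
    {a b : X.carrier → ℂ} (ha : X.RegAt q a)
    (h : ∀ᶠ r in 𝓝 q, ∃ hb : X.RegAt r b, ω r = a r • X.diff r b hb) : X.FormRegAt ω q := by
  obtain ⟨U, hU, hUo, hq⟩ := eventually_nhds_iff.1 ((X.eventually_regAt _ _ ha).and h)
  refine ⟨U, hUo, hq, 1, fun _ => a, fun _ => b, fun _ r hr => (hU r hr).1,
    fun _ r hr => (hU r hr).2.1, fun r hr => ?_⟩
  rw [Fin.sum_univ_one]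
  exact (hU r hr).2.2

theorem FormRegAt.smul {ω : ∀ p : X.carrier, X.CotangentSpace p} {q : X.carrier}
    (hω : X.FormRegAt ω q) {a : X.carrier → ℂ} (ha : X.RegAt q a) :
    X.FormRegAt (fun r => a r • ω r) q := by
  obtain ⟨U, hU, hq, n, c, b, hc, hb, e⟩ := hω
  obtain ⟨V, hV, hVo, hqV⟩ := eventually_nhds_iff.1 (X.eventually_regAt _ _ ha)
  refine ⟨U ∩ V, hU.inter hVo, ⟨hq, hqV⟩, n, fun i => a * c i, b,
    fun i r hr => X.regAt_mul _ _ _ (hV r hr.2) (hc i r hr.1), fun i r hr => hb i r hr.1,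
    fun r hr => ?_⟩
  refine (congrArg (a r • ·) (e r hr.1)).trans (Finset.smul_sum.trans ?_)
  exact Finset.sum_congr rfl fun i _ => smul_smul _ _ _

theorem FormRegAt.congr {ω η : ∀ p : X.carrier, X.CotangentSpace p} {q : X.carrier}
    (hω : X.FormRegAt ω q) (h : ∀ᶠ r in 𝓝 q, ω r = η r) : X.FormRegAt η q := by
  obtain ⟨U, hU, hq, n, c, b, hc, hb, e⟩ := hω
  obtain ⟨V, hV, hVo, hqV⟩ := eventually_nhds_iff.1 h
  exact ⟨U ∩ V, hU.inter hVo, ⟨hq, hqV⟩, n, c, b, fun i r hr => hc i r hr.1,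
    fun i r hr => hb i r hr.1, fun r hr => (hV r hr.2).symm.trans (e r hr.1)⟩

/-- The form `dx / y` on an affine curve `y² = F(x)`. -/
theorem exists_isFormBasis {m n : ℕ} {S : Set (ℙ ℂ (Fin n → ℂ))}
    (hX : (projectiveSubspace S).IsCurve) {U : Set (projectiveSubspace S).carrier} (hU : IsOpen U)
    {x y : (projectiveSubspace S).carrier → ℂ} {F : ℂ[X]}
    (hx : ∀ q ∈ U, (projectiveSubspace S).RegAt q x)
    (hy : ∀ q ∈ U, (projectiveSubspace S).RegAt q y) (hxy : ∀ q ∈ U, y q ^ 2 = F.eval (x q))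
    (hF : F.Separable) (hxne : ∀ α, ∀ᶠ p in cofinite, x p ≠ α)
    (hu : ∀ q ∈ U, ∃ u : (projectiveSubspace S).carrier → ℂ,
      (u = (fun p => x p - x q) ∧ y q ≠ 0 ∨ u = y ∧ y q = 0) ∧
      (projectiveSubspace S).RegAt q u ∧ u q = 0 ∧
      ∀ h, (projectiveSubspace S).IsRational h → h =ᶠ[cofinite] 0 ∨
      ∃ (n : ℕ) (v : (projectiveSubspace S).carrier → ℂ), (projectiveSubspace S).RegAt q v ∧
        v q ≠ 0 ∧ (h =ᶠ[cofinite] u ^ n * v ∨ h * u ^ n =ᶠ[cofinite] v))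
    (ψ : Fin n → MvPolynomial (Fin m) ℂ) (c : (projectiveSubspace S).carrier → Fin m → ℂ)
    (hc : ∀ i, (fun r => c r i) = x ∨ (fun r => c r i) = y)
    (hrep : ∀ q ∈ U, ∃ l : ℂ, l ≠ 0 ∧ q.val.rep = l • fun i => MvPolynomial.eval (c q) (ψ i)) :
    ∃ ω, (projectiveSubspace S).IsFormBasis ω U ∧ ∀ q ∈ U, HasQuotient ω q x y := by
  have hxyn : ∀ q ∈ U, ∀ᶠ r in 𝓝 q, y r ^ 2 = F.eval (x r) := fun q hq =>
   Filter.eventually_of_mem (hU.mem_nhds hq) hxy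
  -- `ω` is chosen pointwise, with value `0` outside `U`. It equals `dx/y` where `y ≠ 0` and `2
  -- dy/F'(x)` where `F'(x) ≠ 0`, which makes it regular.
  have key : ∀ q, ∃ w : (projectiveSubspace S).CotangentSpace q, q ∈ U → w ≠ 0 ∧
      (∀ v : (projectiveSubspace S).CotangentSpace q, ∃ c : ℂ, c • w = v) ∧
      ∃ (h1 : (projectiveSubspace S).RegAt q x) (h2 : (projectiveSubspace S).RegAt q y),
      (projectiveSubspace S).diff q x h1 = y q • w ∧
      (projectiveSubspace S).diff q y h2 = (F.derivative.eval (x q) / 2) • w := by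
    intro q
    by_cases hq : q ∈ U
    swap
    · exact ⟨0, fun h => absurd h hq⟩
    obtain ⟨u, hu, hur, hu0, hord⟩ := hu q hq
    have hune : ∀ᶠ p in cofinite, u p ≠ 0 := by
      rcases hu with ⟨rfl, -⟩ | ⟨rfl, -⟩
      · exact (hxne (x q)).mono fun p hp => sub_ne_zero.2 hp
      · filter_upwards [(hX.eventually_nhds.1 (hxyn q hq)).2,
          eventually_eval_ne_zero hxne hF.ne_zero] with p h1 h2 h3
        rw [← h1, h3] at h2
        simp at h2
    obtain ⟨w, h1, h2, h3, h4⟩ := exists_cotangent_basis hX (hx q hq) (hy q hq) (hxyn q hq) hF hu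
      hu0 hur hune hord
    exact ⟨w, fun _ => ⟨h1, h2, hx q hq, hy q hq, h3, h4⟩⟩
  choose ω hω using key
  have hF' : ∀ q ∈ U, y q = 0 → F.derivative.eval (x q) ≠ 0 := by
    intro q hq h0 h
    obtain ⟨a, b, hab⟩ := hF
    have h2 := congrArg (eval (x q)) hab
    rw [eval_add, eval_mul, eval_mul, h, ← hxy q hq, h0, eval_one] at h2
    simp at h2
  have hFr : ∀ q ∈ U, (projectiveSubspace S).RegAt q fun r => F.derivative.eval (x r) / 2 := by
    intro q hq
    convert regAt_const_mul (1 / 2) (regAt_eval (hx q hq) F.derivative) using 2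
    ring
  have hxQ : ∀ q ∈ U, HasQuotient ω q x y := by
    intro q hq
    refine ⟨hy q hq, ?_⟩
    filter_upwards [hU.mem_nhds hq] with r hr
    obtain ⟨-, -, h3, h4, h5, h6⟩ := hω r hr
    exact ⟨h3, h5⟩
  refine ⟨ω, ⟨hU, fun q hq => (hω q hq).1, fun q hq => (hω q hq).2.1, fun q hq => ?_,
    fun q hq f hf => ?_⟩, hxQ⟩
  · by_cases h0 : y q = 0
    · have h1 : F.derivative.eval (x q) / 2 ≠ 0 := div_ne_zero (hF' q hq h0) two_ne_zero
      refine formRegAt_smul_diff (b := y) (FunSpace.regAt_inv _ _ _ (hFr q hq) h1) ?_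
      filter_upwards [hU.mem_nhds hq, FunSpace.eventually_ne _ _ _ (hFr q hq) h1] with r hr h2
      obtain ⟨-, -, h3, h4, h5, h6⟩ := hω r hr
      exact ⟨h4, by rw [h6, smul_smul, inv_mul_cancel₀ h2, one_smul]⟩
    · refine formRegAt_smul_diff (b := x) (FunSpace.regAt_inv _ _ _ (hy q hq) h0) ?_
      filter_upwards [hU.mem_nhds hq, FunSpace.eventually_ne _ _ _ (hy q hq) h0] with r hr h2
      obtain ⟨-, -, h3, h4, h5, h6⟩ := hω r hr
      exact ⟨h3, by rw [h5, smul_smul, inv_mul_cancel₀ h2, one_smul]⟩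
  · have hyQ : HasQuotient ω q y fun r => F.derivative.eval (x r) / 2 := by
      refine ⟨hFr q hq, ?_⟩
      filter_upwards [hU.mem_nhds hq] with r hr
      obtain ⟨-, -, h3, h4, h5, h6⟩ := hω r hr
      exact ⟨h4, h6⟩
    have hcQ : ∀ k, ∃ g, HasQuotient ω q (fun r => c r k) g := by
      intro k
      rcases hc k with h | h
      · exact ⟨_, h ▸ hxQ q hq⟩
      · exact ⟨_, h ▸ hyQ⟩
    -- Every function regular at `q` is near `q` a quotient of polynomials in `x` and `y`, so its
    -- differential is a regular multiple of `ω`.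
    have hψQ : ∀ k, ∃ g, HasQuotient ω q (fun r => MvPolynomial.eval (c r) (ψ k)) g := fun k =>
      exists_hasQuotient_eval hcQ (ψ k)
    obtain ⟨d, P, Q, hP, hQ, hQ0, e⟩ := hf
    obtain ⟨g, hg⟩ := exists_hasQuotient_eval
      (ψ := fun r k => MvPolynomial.eval (c r) (ψ k)) hψQ P
    obtain ⟨g', hg'⟩ := exists_hasQuotient_eval
      (ψ := fun r k => MvPolynomial.eval (c r) (ψ k)) hψQ Q
    have hne : MvPolynomial.eval (fun k => MvPolynomial.eval (c q) (ψ k)) Q ≠ 0 := by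
      obtain ⟨l, hl, hr⟩ := hrep q hq
      rw [hr, hQ.eval_smul_eq] at hQ0
      exact right_ne_zero_of_mul hQ0
    refine ⟨_, (hg.mul (hg'.inv hne)).congr ?_⟩
    filter_upwards [e, hU.mem_nhds hq] with r h1 h2
    obtain ⟨l, hl, hr⟩ := hrep r h2
    refine Eq.trans ?_ h1.symm
    rw [hr, hP.eval_smul_eq, hQ.eval_smul_eq, mul_div_mul_left _ _ (pow_ne_zero _ hl)]
    rfl

end FunSpace


/-! ### The regular differentials of `𝓒₂` -/

namespace CurveC2

open Filter Polynomial FunSpace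

theorem isOpen_of_eventually {U : Set curveC2.carrier} (h : ∀ᶠ q in cofinite, q ∈ U) : IsOpen U :=
  (isCurve_curveC2.isOpen_iff U).2 (.inr h)

/-- The form `dx / y` on the chart `s ≠ 0`. -/
theorem exists_isFormBasis_zero : ∃ ω, curveC2.IsFormBasis ω {q | q.val.rep 0 ≠ 0} ∧
    ∀ q ∈ {q : curveC2.carrier | q.val.rep 0 ≠ 0}, HasQuotient ω q x y := by
  refine exists_isFormBasis (m := 2) isCurve_curveC2
    (isOpen_of_eventually (eventually_rep_zero isCurve_curveC2)) (fun q hq => regAt_x hq)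
    (fun q hq => regAt_y hq) (fun q hq => y_sq hq) polyC2_separable
    (eventually_x_ne isCurve_curveC2) (fun q hq => exists_uniformizer isCurve_curveC2 hq)
    ![1, MvPolynomial.X 0, MvPolynomial.X 0 ^ 2, MvPolynomial.X 0 ^ 3, MvPolynomial.X 1]
    (fun r => ![x r, y r]) (fun i => ?_) fun q hq => ⟨_, hq, (rep_eq hq).trans ?_⟩
  · fin_cases i
    exacts [.inl rfl, .inr rfl]
  · congr 1
    ext i
    fin_cases i <;> simp

/-- The form `dx' / y'` on the chart `t ≠ 0`. -/
theorem exists_isFormBasis_three : ∃ ω, curveC2.IsFormBasis ω {q | q.val.rep 3 ≠ 0} ∧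
    ∀ q ∈ {q : curveC2.carrier | q.val.rep 3 ≠ 0}, HasQuotient ω q x' y' := by
  refine exists_isFormBasis (m := 2) isCurve_curveC2
    (isOpen_of_eventually (eventually_rep_three isCurve_curveC2)) (fun q hq => regAt_x' hq)
    (fun q hq => regAt_y' hq) (fun q hq => y'_sq hq) polyC2Rev_separable
    (eventually_x'_ne isCurve_curveC2) (fun q hq => exists_uniformizer' isCurve_curveC2 hq)
    ![MvPolynomial.X 0 ^ 3, MvPolynomial.X 0 ^ 2, MvPolynomial.X 0, 1, MvPolynomial.X 1]
    (fun r => ![x' r, y' r]) (fun i => ?_) fun q hq => ⟨_, hq, (rep_eq' hq).trans ?_⟩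
  · fin_cases i
    exacts [.inl rfl, .inr rfl]
  · congr 1
    ext i
    fin_cases i <;> simp

theorem x'_mul_x {q : curveC2.carrier} (h0 : q.val.rep 0 ≠ 0) (h3 : q.val.rep 3 ≠ 0) :
    x' q * x q = 1 ∧ y q = y' q * x q ^ 3 := by
  obtain ⟨s, t, w, h, hw, rfl⟩ := exists_eq_sexticPoint q
  have hs := rep_zero_ne_zero_iff.1 h0
  have ht := rep_three_ne_zero_iff.1 h3
  rw [x'_sexticPoint, x_sexticPoint, y'_sexticPoint, y_sexticPoint]
  constructor <;> field_simp

theorem eventually_y_ne : ∀ᶠ q in cofinite, y q ≠ 0 := by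
  filter_upwards [eventually_y_sq isCurve_curveC2, eventually_eval_ne_zero
    (eventually_x_ne isCurve_curveC2) polyC2_separable.ne_zero] with q h1 h2 h3
  rw [← h1, h3] at h2
  simp at h2

/-- The transition between the two charts. -/
theorem formBasis_transition {ω ω' : ∀ q : curveC2.carrier, curveC2.CotangentSpace q}
    (hω : curveC2.IsFormBasis ω {q | q.val.rep 0 ≠ 0})
    (hx : ∀ q ∈ {q : curveC2.carrier | q.val.rep 0 ≠ 0}, HasQuotient ω q x y)
    (hω' : curveC2.IsFormBasis ω' {q | q.val.rep 3 ≠ 0})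
    (hx' : ∀ q ∈ {q : curveC2.carrier | q.val.rep 3 ≠ 0}, HasQuotient ω' q x' y')
    {q : curveC2.carrier} (h0 : q.val.rep 0 ≠ 0) (h3 : q.val.rep 3 ≠ 0) :
    ω' q = -x q • ω q := by
  obtain ⟨c, hc⟩ := hω.exists_eq_smul ω'
  -- Almost everywhere `x' = 1/x` gives `dx' = -x⁻² dx`, while `dx = yω`, `dx' = y'ω'` and `y =
  -- y'x³`; the coefficient is therefore `-x`, and regularity extends this to the remaining points.
  have hcx : c =ᶠ[cofinite] fun q => -x q := by
    filter_upwards [eventually_rep_zero isCurve_curveC2, eventually_rep_three isCurve_curveC2,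
      eventually_y_ne] with r hr0 hr3 hry
    obtain ⟨h1, h2⟩ := x'_mul_x hr0 hr3
    have hxr : x r ≠ 0 := right_ne_zero_of_mul_eq_one h1
    have e1 := ((hx r hr0).inv hxr).congr (g := x') (by
      filter_upwards [hω.isOpen.mem_nhds hr0, hω'.isOpen.mem_nhds hr3] with s hs0 hs3
      exact (eq_inv_of_mul_eq_one_left (x'_mul_x hs0 hs3).1).symm)
    obtain ⟨_, e1⟩ := e1.2.self_of_nhds
    obtain ⟨_, e2⟩ := (hx' r hr3).2.self_of_nhds
    rw [(hc r hr0).1, smul_smul] at e2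
    have e3 := smul_left_injective ℂ (hω.ne_zero r hr0) (e1.symm.trans e2)
    simp only [Pi.mul_apply, Pi.neg_apply, Pi.pow_apply, Pi.inv_apply] at e3
    have hy' : y' r ≠ 0 := fun h => hry (by rw [h2, h, zero_mul])
    rw [h2] at e3
    refine mul_left_cancel₀ hy' (e3.symm.trans ?_)
    field_simp
  rw [(hc q h0).1, isCurve_curveC2.eq_of_eventuallyEq ((hc q h0).2 (hω'.formRegAt q h3))
    (g := fun q => -x q) (by simpa using! regAt_const_mul (-1) (regAt_x h0)) hcx]

theorem exists_x_eq_y_eq {α β : ℂ} (h : β ^ 2 = polyC2.eval α) :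
    ∃ q : curveC2.carrier, q.val.rep 0 ≠ 0 ∧ x q = α ∧ y q = β := by
  have hy : β ^ 2 = sexticForm polyC2 1 α := by
    rw [h, sexticForm_polyC2, polyC2_eval]
    ring
  exact ⟨sexticPoint polyC2 1 α β (.inl one_ne_zero) hy, rep_zero_ne_zero_iff.2 one_ne_zero,
    by rw [x_sexticPoint, div_one], by rw [y_sexticPoint, one_pow, div_one]⟩

theorem exists_x'_eq_y'_eq {α β : ℂ} (h : β ^ 2 = polyC2Rev.eval α) :
    ∃ q : curveC2.carrier, q.val.rep 3 ≠ 0 ∧ x' q = α ∧ y' q = β := by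
  have hy : β ^ 2 = sexticForm polyC2 α 1 := by
    rw [h, sexticForm_polyC2, polyC2Rev_eval]
    ring
  exact ⟨sexticPoint polyC2 α 1 β (.inr one_ne_zero) hy, rep_three_ne_zero_iff.2 one_ne_zero,
    by rw [x'_sexticPoint, div_one], by rw [y'_sexticPoint, one_pow, div_one]⟩

/-- A regular function on the affine curve is `A(x) + B(x) y` with polynomials `A` and `B`. -/
theorem exists_polynomials {H : curveC2.carrier → ℂ}
    (hH : ∀ q : curveC2.carrier, q.val.rep 0 ≠ 0 → curveC2.RegAt q H) :
    ∃ A B : ℂ[X], ∀ᶠ q in cofinite, H q = A.eval (x q) + B.eval (x q) * y q := by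
  have hc := isCurve_curveC2
  have hxy := eventually_y_sq hc
  -- Multiplying numerator and denominator by the conjugate of the denominator gives a denominator
  -- in `x` alone; among all such `D` one of least degree is then taken.
  have hD : ∃ D : ℂ[X], D ≠ 0 ∧ ∃ A B : ℂ[X], ∀ᶠ q in cofinite,
      D.eval (x q) * H q = A.eval (x q) + B.eval (x q) * y q := by
    obtain ⟨q, hq, -⟩ := exists_x_eq 0
    obtain ⟨P, Q, ⟨A, B, hP⟩, ⟨A', B', hQ⟩, hQ0, hPQ⟩ :=
      exists_inAB hc (hc.isRational_of_regAt (hH q hq))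
    have h0 : ¬ (A' = 0 ∧ B' = 0) := by
      rintro ⟨rfl, rfl⟩
      obtain ⟨p, h1, h2⟩ := hc.eventually_exists (hQ.and hQ0)
      exact h2 (by simpa using h1)
    set d := EuclideanDomain.gcd A' B'
    have hd : d ≠ 0 := fun h => h0 (EuclideanDomain.gcd_eq_zero_iff.1 h)
    obtain ⟨A₁, hA⟩ := EuclideanDomain.gcd_dvd_left A' B'
    obtain ⟨B₁, hB⟩ := EuclideanDomain.gcd_dvd_right A' B'
    have hcop : IsCoprime A₁ B₁ := by
      refine ⟨EuclideanDomain.gcdA A' B', EuclideanDomain.gcdB A' B', mul_left_cancel₀ hd ?_⟩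
      have := EuclideanDomain.gcd_eq_gcd_ab A' B'
      calc d * _ = d * A₁ * EuclideanDomain.gcdA A' B' + d * B₁ * EuclideanDomain.gcdB A' B' := by
            ring
        _ = d * 1 := by rw [← hA, ← hB, ← this, mul_one]
    refine ⟨d * (A₁ ^ 2 - B₁ ^ 2 * polyC2), mul_ne_zero hd
      (sq_sub_mul_sq_ne_zero polyC2_separable polyC2_degree_ne_zero hcop),
      A * A₁ - B * B₁ * polyC2, B * A₁ - A * B₁, ?_⟩
    filter_upwards [hP, hQ, hPQ, hxy] with p h1 h2 h3 h4
    have e1 : A'.eval (x p) = d.eval (x p) * A₁.eval (x p) := by rw [← eval_mul, ← hA]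
    have e2 : B'.eval (x p) = d.eval (x p) * B₁.eval (x p) := by rw [← eval_mul, ← hB]
    rw [Pi.mul_apply, h1, h2, e1, e2] at h3
    simp only [eval_mul, eval_sub, eval_pow, ← h4]
    linear_combination (A₁.eval (x p) - B₁.eval (x p) * y p) * h3
  classical
  obtain ⟨D, ⟨hD0, A, B, hAB⟩, hmin⟩ := exists_minimalFor_of_wellFoundedLT
    (fun D : ℂ[X] => D ≠ 0 ∧ ∃ A B : ℂ[X], ∀ᶠ q in cofinite,
      D.eval (x q) * H q = A.eval (x q) + B.eval (x q) * y q) natDegree hD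
  by_cases hdeg : D.degree = 0
  · rw [eq_C_of_degree_eq_zero hdeg] at hAB hD0
    have h0 : D.coeff 0 ≠ 0 := fun h => hD0 (by rw [h, map_zero])
    refine ⟨C (D.coeff 0)⁻¹ * A, C (D.coeff 0)⁻¹ * B, hAB.mono fun q hq => ?_⟩
    simp only [eval_C, eval_mul] at hq ⊢
    field_simp
    linear_combination hq
  exfalso
  -- At every point over a root `α` of `D` the numerator `A + B y` vanishes; this makes `A` and `B`
  -- divisible by `X - α`, against minimality.
  obtain ⟨α, hα⟩ := IsAlgClosed.exists_root D hdeg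
  obtain ⟨D₁, hD₁⟩ := dvd_iff_isRoot.2 hα
  have hD₁0 : D₁ ≠ 0 := by
    rintro rfl
    exact hD0 (by rw [hD₁, mul_zero])
  have hreg : ∀ (A B : ℂ[X]) {q : curveC2.carrier}, q.val.rep 0 ≠ 0 →
      curveC2.RegAt q fun q => A.eval (x q) + B.eval (x q) * y q := fun A B q hq =>
    curveC2.regAt_add _ _ _ (regAt_eval (regAt_x hq) A)
      (curveC2.regAt_mul _ _ _ (regAt_eval (regAt_x hq) B) (regAt_y hq))
  have hval : ∀ β : ℂ, β ^ 2 = polyC2.eval α → A.eval α + B.eval α * β = 0 := by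
    intro β hβ
    obtain ⟨q, hq, rfl, rfl⟩ := exists_x_eq_y_eq hβ
    have := hc.eq_of_eventuallyEq (curveC2.regAt_mul _ _ _ (regAt_eval (regAt_x hq) D) (hH q hq))
      (hreg A B hq) hAB
    rw [← this, Pi.mul_apply, show D.eval (x q) = 0 from hα, zero_mul]
  obtain ⟨β, hβ⟩ := IsAlgClosed.exists_pow_nat_eq (polyC2.eval α) (n := 2) two_pos
  have hv1 := hval β hβ
  have hv2 := hval (-β) (by rw [neg_sq, hβ])
  have hA0 : A.eval α = 0 := by linear_combination (hv1 + hv2) / 2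
  obtain ⟨A₁, hA₁⟩ := dvd_iff_isRoot.2 (show A.IsRoot α from hA0)
  have hB0 : B.eval α = 0 := by
    -- Only one point lies over a branch value. There the relation is multiplied by `y` and `x - α`
    -- is cancelled, which gives `B g = 0` with `g(α) ≠ 0`.
    rcases eq_or_ne β 0 with rfl | hβ0
    · obtain ⟨g, hg⟩ := dvd_iff_isRoot.2 (show polyC2.IsRoot α by
        rw [IsRoot.def, ← hβ]
        simp)
      have hgq : g.eval α ≠ 0 := by
        intro h0
        obtain ⟨a, b, hab⟩ := polyC2_separable
        have := congrArg (eval α) hab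
        rw [hg] at this
        simp [h0] at this
      obtain ⟨q, hq, rfl, hyq⟩ := exists_x_eq_y_eq hβ
      have e := hc.eq_of_eventuallyEq (curveC2.regAt_mul _ _ _ (curveC2.regAt_mul _ _ _
        (regAt_eval (regAt_x hq) D₁) (hH q hq)) (regAt_y hq)) (hreg (B * g) A₁ hq) (by
          filter_upwards [hAB, hxy, eventually_x_ne hc (x q)] with p h1 h2 h3
          refine mul_left_cancel₀ (sub_ne_zero.2 h3) ?_
          rw [hg] at h2
          rw [hD₁, hA₁] at h1
          simp only [eval_mul, eval_sub, eval_X, eval_C, Pi.mul_apply] at h1 h2 ⊢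
          linear_combination y p * h1 + B.eval (x p) * h2)
      simp only [Pi.mul_apply, hyq, mul_zero, add_zero, eval_mul] at e
      exact (mul_eq_zero.1 e.symm).resolve_right hgq
    · exact (mul_eq_zero.1 (show B.eval α * β = 0 by linear_combination (hv1 - hv2) / 2)).resolve_right
        hβ0
  obtain ⟨B₁, hB₁⟩ := dvd_iff_isRoot.2 (show B.IsRoot α from hB0)
  have hlt : D₁.natDegree < D.natDegree := by
    rw [hD₁, natDegree_mul (X_sub_C_ne_zero α) hD₁0, natDegree_X_sub_C]
    omega
  refine absurd (hmin (j := D₁) ⟨hD₁0, A₁, B₁, ?_⟩ hlt.le) (not_le.2 hlt)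
  filter_upwards [hAB, eventually_x_ne hc α] with p h1 h3
  refine mul_left_cancel₀ (sub_ne_zero.2 h3) ?_
  rw [hD₁, hA₁, hB₁] at h1
  simp only [eval_mul, eval_sub, eval_X, eval_C] at h1
  linear_combination h1

end CurveC2


namespace CurveC2

open Filter Polynomial FunSpace

theorem eval_eq_eval_reflect {a b : ℂ} (h : b * a = 1) {n : ℕ} {A : ℂ[X]} (hA : A.natDegree ≤ n) :
    A.eval a = (A.reflect n).eval b * a ^ n := by
  let _ : Invertible a := ⟨b, h, by rw [mul_comm, h]⟩
  exact (eval₂_reflect_mul_pow (RingHom.id ℂ) a n A hA).symm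

theorem eval_zero_reflect (n : ℕ) (A : ℂ[X]) : (A.reflect n).eval 0 = A.coeff n := by
  rw [← coeff_zero_eq_eval_zero, coeff_reflect, revAt_le n.zero_le, Nat.sub_zero]

/-- The relation says `H' x'^(k+1) = -(A + B y')`. The left side vanishes at the two points with `x'
= 0`, which have distinct values `y' = ±β`. -/
theorem eval_zero_of_regAt {H' : curveC2.carrier → ℂ}
    (hH' : ∀ q : curveC2.carrier, q.val.rep 3 ≠ 0 → curveC2.RegAt q H') {A B : ℂ[X]} {k : ℕ}
    (h : ∀ᶠ q in cofinite,
      -x q * H' q = (A.eval (x' q) + B.eval (x' q) * y' q) * x q ^ (k + 2)) :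
    A.eval 0 = 0 ∧ B.eval 0 = 0 := by
  have hc := isCurve_curveC2
  have hval : ∀ β : ℂ, β ^ 2 = polyC2Rev.eval 0 → A.eval 0 + B.eval 0 * β = 0 := by
    intro β hβ
    obtain ⟨q, hq, hx, rfl⟩ := exists_x'_eq_y'_eq hβ
    have e := hc.eq_of_eventuallyEq (curveC2.regAt_mul _ _ _ (regAt_pow (regAt_x' hq) (k + 1))
      (hH' q hq)) (g := fun q => -1 * (A.eval (x' q) + B.eval (x' q) * y' q))
      (regAt_const_mul _ (curveC2.regAt_add _ _ _ (regAt_eval (regAt_x' hq) A)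
        (curveC2.regAt_mul _ _ _ (regAt_eval (regAt_x' hq) B) (regAt_y' hq)))) (by
        filter_upwards [h, eventually_rep_zero hc, eventually_rep_three hc] with p h1 h2 h3
        have h4 := (x'_mul_x h2 h3).1
        have hx0 : x p ≠ 0 := right_ne_zero_of_mul_eq_one h4
        have h5 : x' p ^ (k + 1) * x p ^ (k + 1) = 1 := by rw [← mul_pow, h4, one_pow]
        refine mul_left_cancel₀ (pow_ne_zero (k + 2) hx0) ?_
        simp only [Pi.mul_apply, Pi.pow_apply]
        linear_combination x p * H' p * h5 - h1)
    simp only [Pi.mul_apply, Pi.pow_apply, hx] at e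
    rw [zero_pow k.succ_ne_zero, zero_mul] at e
    linear_combination e
  obtain ⟨β, hβ⟩ := IsAlgClosed.exists_pow_nat_eq (polyC2Rev.eval 0) (n := 2) two_pos
  have hβ0 : β ≠ 0 := by
    rintro rfl
    rw [polyC2Rev_eval] at hβ
    norm_num at hβ
  have h1 := hval β hβ
  have h2 := hval (-β) (by rw [neg_sq, hβ])
  exact ⟨by linear_combination (h1 + h2) / 2, (mul_eq_zero.1
    (show B.eval 0 * β = 0 by linear_combination (h1 - h2) / 2)).resolve_right hβ0⟩

/-- The coefficient of a regular form with respect to `dx / y` is linear in `x`. -/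
theorem exists_linear {H H' : curveC2.carrier → ℂ}
    (hH : ∀ q : curveC2.carrier, q.val.rep 0 ≠ 0 → curveC2.RegAt q H)
    (hH' : ∀ q : curveC2.carrier, q.val.rep 3 ≠ 0 → curveC2.RegAt q H')
    (h : ∀ᶠ q in cofinite, H q = -x q * H' q) :
    ∃ a b : ℂ, ∀ᶠ q in cofinite, H q = a + b * x q := by
  have hc := isCurve_curveC2
  obtain ⟨A, B, hAB⟩ := exists_polynomials hH
  have hB : B = 0 := by
    by_contra hB
    -- As `y = y'x³`, the terms `A(x)` and `B(x) y` have degrees `deg A` and `deg B + 3` at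
    -- infinity. The larger is `n + 3`, so one of the two reflected polynomials has a nonzero
    -- constant term.
    obtain ⟨n, hA, hBn, hn⟩ : ∃ n, A.natDegree ≤ n + 3 ∧ B.natDegree ≤ n ∧
        (B.natDegree = n ∨ A.natDegree = n + 3) := by
      rcases le_total A.natDegree (B.natDegree + 3) with h | h
      · exact ⟨_, h, le_rfl, .inl rfl⟩
      · exact ⟨A.natDegree - 3, by omega, by omega, .inr (by omega)⟩
    obtain ⟨h1, h2⟩ := eval_zero_of_regAt hH' (A := A.reflect (n + 3)) (B := B.reflect n)
      (k := n + 1) (by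
        filter_upwards [h, hAB, eventually_rep_zero hc, eventually_rep_three hc] with q h1 h2 h3 h4
        obtain ⟨h5, h6⟩ := x'_mul_x h3 h4
        rw [← h1, h2, h6, eval_eq_eval_reflect h5 hA, eval_eq_eval_reflect h5 hBn]
        ring)
    rw [eval_zero_reflect] at h1 h2
    rcases hn with hn | hn
    · rw [← hn] at h2
      exact hB (leadingCoeff_eq_zero.1 h2)
    · rw [← hn] at h1
      rw [leadingCoeff_eq_zero.1 h1, natDegree_zero] at hn
      omega
  have hA : A.natDegree ≤ 1 := by
    by_contra! hA
    obtain ⟨k, hk⟩ := Nat.exists_eq_add_of_le hA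
    obtain ⟨h1, -⟩ := eval_zero_of_regAt hH' (A := A.reflect A.natDegree) (B := 0) (k := k) (by
        filter_upwards [h, hAB, eventually_rep_zero hc, eventually_rep_three hc] with q h1 h2 h3 h4
        rw [← h1, h2, hB, eval_eq_eval_reflect (x'_mul_x h3 h4).1 le_rfl, eval_zero, zero_mul,
          add_zero, eval_zero, zero_mul, add_zero]
        congr 2
        omega)
    rw [eval_zero_reflect] at h1
    rw [leadingCoeff_eq_zero.1 h1, natDegree_zero] at hA
    omega
  obtain ⟨b, a, rfl⟩ := exists_eq_X_add_C_of_natDegree_le_one hA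
  refine ⟨a, b, hAB.mono fun q hq => ?_⟩
  rw [hq, hB]
  simp
  ring

/-- The curve `𝓒₂` has genus `2`: the forms `dx / y` and `x dx / y` are a basis. -/
theorem isSmoothCurveOfGenus : curveC2.IsSmoothCurveOfGenus 2 := by
  have hc := isCurve_curveC2
  obtain ⟨ω, hω, hx⟩ := exists_isFormBasis_zero
  obtain ⟨ω', hω', hx'⟩ := exists_isFormBasis_three
  have htr : ∀ q : curveC2.carrier, q.val.rep 0 ≠ 0 → q.val.rep 3 ≠ 0 → ω' q = -x q • ω q :=
    fun q => formBasis_transition hω hx hω' hx'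
  refine ⟨hc.irreducibleSpace, fun q => ?_, ?_⟩
  · rcases rep_zero_or_three q with h | h
    exacts [hω.finrank h, hω'.finrank h]
  classical
  -- Since `ω' = -xω` and `x x' = 1`, `(c₁ + c₂x) ω = -(c₁x' + c₂) ω'` on the overlap, and the two
  -- expressions are regular on their charts.
  let θ : ℂ × ℂ → ∀ q : curveC2.carrier, curveC2.CotangentSpace q := fun c q =>
    if q.val.rep 0 ≠ 0 then (c.1 + c.2 * x q) • ω q else -(c.1 * x' q + c.2) • ω' q
  have hθ0 : ∀ c (q : curveC2.carrier), q.val.rep 0 ≠ 0 → θ c q = (c.1 + c.2 * x q) • ω q :=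
    fun c q hq => if_pos hq
  have hθ3 : ∀ c (q : curveC2.carrier), q.val.rep 3 ≠ 0 → θ c q = -(c.1 * x' q + c.2) • ω' q := by
    intro c q h3
    by_cases h0 : q.val.rep 0 ≠ 0
    · rw [hθ0 c q h0, htr q h0 h3, smul_smul]
      congr 1
      linear_combination -c.1 * (x'_mul_x h0 h3).1
    · exact if_neg h0
  have hreg : ∀ (c : ℂ × ℂ) {q : curveC2.carrier}, q.val.rep 0 ≠ 0 →
      curveC2.RegAt q fun q => c.1 + c.2 * x q := fun c q hq =>
    curveC2.regAt_add _ _ _ (curveC2.regAt_const _ _) (regAt_const_mul _ (regAt_x hq))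
  have hreg' : ∀ (c : ℂ × ℂ) {q : curveC2.carrier}, q.val.rep 3 ≠ 0 →
      curveC2.RegAt q fun q => -(c.1 * x' q + c.2) := fun c q hq => by
    simpa using! regAt_const_mul (-1) (curveC2.regAt_add _ _ _
      (regAt_const_mul c.1 (regAt_x' hq)) (curveC2.regAt_const _ c.2))
  have hmem : ∀ c, θ c ∈ curveC2.forms := by
    intro c q
    rcases rep_zero_or_three q with h | h
    · refine ((hω.formRegAt q h).smul (hreg c h)).congr ?_
      filter_upwards [hω.isOpen.mem_nhds h] with r hr using (hθ0 c r hr).symm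
    · refine ((hω'.formRegAt q h).smul (hreg' c h)).congr ?_
      filter_upwards [hω'.isOpen.mem_nhds h] with r hr using (hθ3 c r hr).symm
  let T : ℂ × ℂ →ₗ[ℂ] curveC2.forms :=
    { toFun := fun c => ⟨θ c, hmem c⟩
      map_add' := fun c d => Subtype.ext (funext fun q => by
        change θ (c + d) q = θ c q + θ d q
        by_cases h0 : q.val.rep 0 ≠ 0
        · rw [hθ0 _ q h0, hθ0 _ q h0, hθ0 _ q h0, ← add_smul]
          congr 1
          simp only [Prod.fst_add, Prod.snd_add]
          ring
        · have h3 := (rep_zero_or_three q).resolve_left h0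
          rw [hθ3 _ q h3, hθ3 _ q h3, hθ3 _ q h3, ← add_smul]
          congr 1
          simp only [Prod.fst_add, Prod.snd_add]
          ring)
      map_smul' := fun a c => Subtype.ext (funext fun q => by
        change θ (a • c) q = a • θ c q
        by_cases h0 : q.val.rep 0 ≠ 0
        · rw [hθ0 _ q h0, hθ0 _ q h0, smul_smul]
          congr 1
          simp only [Prod.smul_fst, Prod.smul_snd, smul_eq_mul]
          ring
        · have h3 := (rep_zero_or_three q).resolve_left h0
          rw [hθ3 _ q h3, hθ3 _ q h3, smul_smul]
          congr 1
          simp only [Prod.smul_fst, Prod.smul_snd, smul_eq_mul]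
          ring) }
  have hT : ∀ c, (T c).val = θ c := fun c => rfl
  have hinj : Function.Injective T := by
    refine (injective_iff_map_eq_zero T).2 fun c h => ?_
    have h0 : ∀ q, θ c q = 0 := fun q => congrFun (congrArg Subtype.val h) q
    have h1 : ∀ α : ℂ, c.1 + c.2 * α = 0 := by
      intro α
      obtain ⟨q, hq, rfl⟩ := exists_x_eq α
      exact (smul_eq_zero.1 ((hθ0 c q hq).symm.trans (h0 q))).resolve_right (hω.ne_zero q hq)
    have h2 := h1 0
    have h3 := h1 1
    rw [mul_zero, add_zero] at h2
    rw [h2, zero_add, mul_one] at h3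
    exact Prod.ext h2 h3
  have hsurj : Function.Surjective T := by
    rintro ⟨η, hη⟩
    obtain ⟨H, hH⟩ := hω.exists_eq_smul η
    obtain ⟨H', hH'⟩ := hω'.exists_eq_smul η
    have hHr := fun q hq => (hH q hq).2 (hη q)
    have hHr' := fun q hq => (hH' q hq).2 (hη q)
    obtain ⟨a, b, hab⟩ := exists_linear hHr hHr' (by
      filter_upwards [eventually_rep_zero hc, eventually_rep_three hc] with q h0 h3
      have e := (hH q h0).1.symm.trans (hH' q h3).1
      rw [htr q h0 h3, smul_smul] at e
      exact (smul_left_injective ℂ (hω.ne_zero q h0) e).trans (mul_comm _ _))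
    refine ⟨(a, b), Subtype.ext (funext fun q => ?_)⟩
    rw [hT]
    change θ (a, b) q = η q
    rcases rep_zero_or_three q with h | h
    · rw [hθ0 _ q h, (hH q h).1, hc.eq_of_eventuallyEq (hHr q h) (hreg (a, b) h) hab]
    · rw [hθ3 _ q h, (hH' q h).1, hc.eq_of_eventuallyEq (hHr' q h) (hreg' (a, b) h)]
      filter_upwards [hab, eventually_rep_zero hc, eventually_rep_three hc] with r h1 h0 h3
      have e := (hH r h0).1.symm.trans (hH' r h3).1
      rw [htr r h0 h3, smul_smul, h1] at e
      have e1 := smul_left_injective ℂ (hω.ne_zero r h0) e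
      have e2 := (x'_mul_x h0 h3).1
      have hx0 : x r ≠ 0 := right_ne_zero_of_mul_eq_one e2
      refine mul_left_cancel₀ hx0 ?_
      linear_combination e1 + a * e2
  rw [← (LinearEquiv.ofBijective T ⟨hinj, hsurj⟩).rank_eq, rank_prod']
  simp
  norm_num

end CurveC2


/-! ### The norm from `Γ₀(p)` to level one -/

section LevelOne

open UpperHalfPlane Filter
open scoped MatrixGroups CongruenceSubgroup ModularForm

/-- A holomorphic function on the upper half-plane that is invariant under `z ↦ z + 1` and
`z ↦ -1 / z` and tends to zero at the cusp vanishes identically. -/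
theorem eq_zero_of_levelOne_invariant {P : ℂ → ℂ}
    (hd : DifferentiableOn ℂ P upperHalfPlaneSet)
    (hT : ∀ z : ℂ, 0 < z.im → P (z + 1) = P z)
    (hS : ∀ z : ℂ, 0 < z.im → P (-1 / z) = P z)
    (h0 : Tendsto P (comap Complex.im atTop) (𝓝 0)) {z : ℂ} (hz : 0 < z.im) : P z = 0 := by
  let F : ℍ → ℂ := fun τ => P τ
  have hFS : F ∣[(0 : ℤ)] ModularGroup.S = F := by
    ext τ
    rw [ModularForm.SL_slash_apply, UpperHalfPlane.modular_S_smul]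
    have := hS τ τ.2
    simpa [F, neg_div, ModularGroup.S] using this
  have hFT : F ∣[(0 : ℤ)] ModularGroup.T = F := by
    ext τ
    rw [ModularForm.SL_slash_apply, UpperHalfPlane.modular_T_smul]
    have := hT τ τ.2
    simpa [F, add_comm] using this
  have hF0 : IsZeroAtImInfty F := h0.comp tendsto_coe_atImInfty
  have hsl : ∀ γ : SL(2, ℤ), F ∣[(0 : ℤ)] γ = F := SlashInvariantForm.slash_action_generators_SL2Z hFS hFT
  let M : ModularForm 𝒮ℒ 0 :=
    { toFun := F
      slash_action_eq' := by
        rintro A ⟨A, rfl⟩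
        exact hsl A
      holo' := by
        rw [UpperHalfPlane.mdifferentiable_iff]
        refine hd.congr fun z hz => ?_
        simp [F, ofComplex_apply_of_im_pos hz]
      bdd_at_cusps' := by
        intro c hc
        rw [Subgroup.IsArithmetic.isCusp_iff_isCusp_SL2Z] at hc
        rw [OnePoint.isBoundedAt_iff_forall_SL2Z hc]
        intro γ _
        rw [hsl]
        exact hF0.isBoundedAtImInfty }
  -- In weight zero and level one a modular form is constant, and the constant is the limit at the
  -- cusp.
  obtain ⟨c, hc⟩ := ModularFormClass.levelOne_weight_zero_const M
  have hFc : ∀ τ : ℍ, F τ = c := fun τ => congrFun hc τ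
  have : Tendsto F atImInfty (𝓝 c) := tendsto_const_nhds.congr fun τ => (hFc τ).symm
  have h := tendsto_nhds_unique this hF0
  simpa [h] using hFc ⟨z, hz⟩

theorem neg_one_div_im_pos {z : ℂ} (hz : 0 < z.im) : 0 < (-1 / z).im := by
  have h : z ≠ 0 := fun h => by simp [h] at hz
  rw [neg_div, one_div, Complex.neg_im, Complex.inv_im, neg_div, neg_neg]
  exact div_pos hz (Complex.normSq_pos.2 h)

/-- Vanishing criterion for the functions at the cusps of `Γ₀(N)`, `N` prime, by way of the norm
to level one. -/
theorem eq_zero_of_norm_levelOne {N : ℕ} {G H : ℂ → ℂ}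
    (hG : DifferentiableOn ℂ G upperHalfPlaneSet) (hH : DifferentiableOn ℂ H upperHalfPlaneSet)
    (hGT : ∀ z : ℂ, 0 < z.im → G (z + 1) = G z)
    (hHT : ∀ z : ℂ, 0 < z.im → H (z + (N + 1 : ℕ)) = H z)
    (hGS : ∀ z : ℂ, 0 < z.im → G (-1 / z) = H z)
    (hR : ∀ z : ℂ, 0 < z.im → ∏ j ∈ Finset.range N, H (-1 / z + (j + 1 : ℕ)) =
      ∏ j ∈ Finset.range N, H (z + (j + 1 : ℕ)))
    (hH0 : Tendsto H (comap Complex.im atTop) (𝓝 0))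
    {C : ℝ} (hGb : ∀ᶠ z in comap Complex.im atTop, ‖G z‖ ≤ C) {z : ℂ} (hz : 0 < z.im) :
    G z = 0 := by
  have hHS : ∀ z : ℂ, 0 < z.im → H (-1 / z) = G z := fun z hz => by
    have h : z ≠ 0 := fun h => by simp [h] at hz
    rw [← hGS _ (neg_one_div_im_pos hz)]
    congr 1
    field_simp
  have him : ∀ (z : ℂ) (j : ℕ), (z + j).im = z.im := fun z j => by simp
  have hsd : ∀ j : ℕ, DifferentiableOn ℂ (fun z => H (z + j)) upperHalfPlaneSet := fun j =>
    hH.comp (by fun_prop) fun z hz => by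
      change 0 < (z + j).im
      rw [him]; exact hz
  have hs0 : ∀ j : ℕ, Tendsto (fun z => H (z + j)) (comap Complex.im atTop) (𝓝 0) := fun j =>
    hH0.comp (by
      rw [tendsto_comap_iff]
      exact tendsto_comap.congr fun z => (him z j).symm)
  -- The level is `N + 1`. `G` and the `N + 1` translates of `H` correspond to the cosets: `z ↦ z +
  -- 1` fixes `G` and rotates the translates, `z ↦ -1/z` exchanges `G` with `H` and by `hR`
  -- preserves the product of the rest.
  let P : ℂ → ℂ := fun z => G z * ∏ j ∈ Finset.range (N + 1), H (z + j)
  have hP : ∀ z : ℂ, 0 < z.im → P z = 0 := fun z hz => by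
    refine eq_zero_of_levelOne_invariant (P := P) ?_ ?_ ?_ ?_ hz
    · exact hG.mul (DifferentiableOn.fun_finsetProd fun j _ => hsd j)
    · intro z hz
      change G (z + 1) * _ = G z * _
      rw [hGT z hz, Finset.prod_range_succ, Finset.prod_range_succ']
      congr 2
      · refine Finset.prod_congr rfl fun j _ => ?_
        congr 1; push_cast; ring
      · rw [Nat.cast_zero, add_zero, ← hHT z hz]
        congr 1; push_cast; ring
    · intro z hz
      change G (-1 / z) * _ = G z * _
      rw [hGS z hz, Finset.prod_range_succ', Finset.prod_range_succ', hR z hz, Nat.cast_zero,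
        add_zero, add_zero, hHS z hz]
      ring
    · have h1 : Tendsto (fun z => ∏ j ∈ Finset.range (N + 1), H (z + j)) (comap Complex.im atTop)
          (𝓝 0) := by
        have := tendsto_finsetProd (Finset.range (N + 1)) fun j _ => hs0 j
        simpa using this
      exact isBoundedUnder_le_mul_tendsto_zero ⟨C, by simpa using hGb⟩ h1
  have han : ∀ {f : ℂ → ℂ}, DifferentiableOn ℂ f upperHalfPlaneSet →
      AnalyticOnNhd ℂ f upperHalfPlaneSet := fun h => h.analyticOnNhd isOpen_upperHalfPlaneSet
  have hpre : IsPreconnected upperHalfPlaneSet := (convex_halfSpace_im_gt 0).isPreconnected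
  -- A vanishing product of analytic functions has a vanishing factor; if this is a translate of
  -- `H`, then `H` and therefore `G` vanish.
  have key : ∀ n : ℕ, (∀ z ∈ upperHalfPlaneSet, ∏ j ∈ Finset.range n, H (z + j) = 0) →
      ∃ j : ℕ, ∀ z ∈ upperHalfPlaneSet, H (z + j) = 0 := by
    intro n
    induction n with
    | zero =>
      intro h
      simpa using h Complex.I (by simp [upperHalfPlaneSet])
    | succ n ih =>
      intro h
      rcases (han (DifferentiableOn.fun_finsetProd (u := Finset.range n)
        fun j _ => hsd j)).eq_zero_or_eq_zero_of_mul_eq_zero (han (hsd n))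
        (fun z hz => by rw [← Finset.prod_range_succ]; exact h z hz) hpre with h | h
      · exact ih h
      · exact ⟨n, h⟩
  rcases (han hG).eq_zero_or_eq_zero_of_mul_eq_zero
    (han (DifferentiableOn.fun_finsetProd (u := Finset.range (N + 1)) fun j _ => hsd j)) hP hpre
    with h | h
  · exact h z hz
  · obtain ⟨j, hj⟩ := key _ h
    rw [← hHS z hz]
    have hw : 0 < (-1 / z - j).im := by simpa using neg_one_div_im_pos hz
    simpa using hj _ hw

end LevelOne


/-! ### Euler's product -/

section EulerProduct

open Filter

theorem multipliable_one_sub_pow_add {R : Type*} [NormedCommRing R] [NormOneClass R]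
    [CompleteSpace R] {q : R} (hq : ‖q‖ < 1) (M : ℕ) :
    Multipliable fun n : ℕ => 1 - q ^ (n + 1 + M) := by
  simp_rw [sub_eq_add_neg]
  refine multipliable_one_add_of_summable ?_
  have h := (summable_nat_add_iff (1 + M)).mpr (summable_geometric_of_lt_one (norm_nonneg q) hq)
  refine h.of_nonneg_of_le (fun _ => norm_nonneg _) fun n => ?_
  rw [norm_neg, ← add_assoc]
  exact norm_pow_le' _ (by omega)

/-- Tail estimate for the Euler product. -/
theorem norm_tprod_one_sub_pow_sub_one_le {R : Type*} [NormedCommRing R] [NormOneClass R]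
    [CompleteSpace R] {q : R} (hq : ‖q‖ < 1) (M : ℕ) :
    ‖(∏' n : ℕ, (1 - q ^ (n + 1 + M))) - 1‖ ≤ Real.exp (‖q‖ ^ (M + 1) / (1 - ‖q‖)) - 1 := by
  have h := ((multipliable_one_sub_pow_add hq M).hasProd.sub_const 1).norm
  refine le_of_tendsto h (Eventually.of_forall fun s => ?_)
  simp_rw [sub_eq_add_neg (1 : R)]
  refine (Finset.norm_prod_one_add_sub_one_le s _).trans ?_
  gcongr
  have hg := summable_geometric_of_lt_one (norm_nonneg q) hq
  have hs : Summable fun n : ℕ => ‖q‖ ^ (n + 1 + M) := by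
    simpa only [add_assoc] using (summable_nat_add_iff (1 + M)).mpr hg
  calc ∑ n ∈ s, ‖-q ^ (n + 1 + M)‖ ≤ ∑ n ∈ s, ‖q‖ ^ (n + 1 + M) :=
        Finset.sum_le_sum fun n _ => by rw [norm_neg]; exact norm_pow_le' _ (by omega)
    _ ≤ ∑' n : ℕ, ‖q‖ ^ (n + 1 + M) := hs.sum_le_tsum s fun _ _ => by positivity
    _ = ‖q‖ ^ (M + 1) / (1 - ‖q‖) := by
        simp_rw [add_assoc, pow_add _ _ (1 + M)]
        rw [tsum_mul_right, tsum_geometric_of_lt_one (norm_nonneg q) hq, add_comm 1 M]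
        field_simp

/-- Euler's function `∏ (1 - qⁿ)`. -/
noncomputable def eulerProd {R : Type*} [CommRing R] [TopologicalSpace R] (q : R) : R :=
  ∏' n : ℕ, (1 - q ^ (n + 1))

theorem eulerProd_eq_prod_mul {R : Type*} [NormedCommRing R] [NormOneClass R]
    [CompleteSpace R] {q : R} (hq : ‖q‖ < 1) (M : ℕ) :
    eulerProd q = (∏ n ∈ Finset.range M, (1 - q ^ (n + 1))) * ∏' n : ℕ, (1 - q ^ (n + 1 + M)) := by
  rw [eulerProd, ← Multipliable.prod_mul_tprod_nat_mul' (k := M)]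
  · simp_rw [add_right_comm _ M 1]
  · simp_rw [add_right_comm _ M 1]
    exact multipliable_one_sub_pow_add hq M

theorem eulerProd_zero : eulerProd (0 : ℂ) = 1 := by simp [eulerProd]

theorem differentiableOn_eulerProd :
    DifferentiableOn ℂ (eulerProd : ℂ → ℂ) (Metric.ball 0 1) :=
  ModularForm.differentiableOn_tprod_one_sub_pow

theorem eulerProd_ne_zero {q : ℂ} (hq : ‖q‖ < 1) : eulerProd q ≠ 0 := by
  unfold eulerProd
  simp_rw [sub_eq_add_neg]
  refine tprod_one_add_ne_zero_of_summable (fun n h => ?_) ?_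
  · have h1 : q ^ (n + 1) = 1 := by linear_combination -h
    have h2 := pow_lt_one₀ (norm_nonneg q) hq n.succ_ne_zero
    rw [← norm_pow, h1, norm_one] at h2
    exact lt_irrefl _ h2
  · simpa using (summable_nat_add_iff 1).mpr (summable_geometric_of_lt_one (norm_nonneg q) hq)

/-- Splitting off the first factor, the product is `(1 - q) T` with `T - 1 = O(q²)`. -/
theorem hasDerivAt_eulerProd_zero : HasDerivAt (eulerProd : ℂ → ℂ) (-1) 0 := by
  rw [hasDerivAt_iff_isLittleO]
  have hO : (fun q : ℂ => eulerProd q - eulerProd 0 - (q - 0) • (-1 : ℂ)) =O[𝓝 0]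
      fun q : ℂ => q ^ 2 := by
    refine Asymptotics.IsBigO.of_bound 8 ?_
    filter_upwards [Metric.ball_mem_nhds (0 : ℂ) (show (0 : ℝ) < 1 / 2 by norm_num)] with q hq
    rw [mem_ball_zero_iff] at hq
    have hn := norm_nonneg q
    have h1 := norm_tprod_one_sub_pow_sub_one_le (show ‖q‖ < 1 by linarith) 1
    set T := ∏' n : ℕ, (1 - q ^ (n + 1 + 1)) with hT
    have hE : eulerProd q = (1 - q) * T := by
      simpa using eulerProd_eq_prod_mul (show ‖q‖ < 1 by linarith) 1
    have hx : ‖q‖ ^ (1 + 1) / (1 - ‖q‖) ≤ 2 * ‖q‖ ^ 2 := by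
      rw [div_le_iff₀ (by linarith)]
      have h9 := mul_nonneg (sq_nonneg ‖q‖) (show 0 ≤ 1 - 2 * ‖q‖ by linarith)
      norm_num only
      linarith
    have hx0 : 0 ≤ ‖q‖ ^ (1 + 1) / (1 - ‖q‖) := div_nonneg (by positivity) (by linarith)
    have hx1 : 2 * ‖q‖ ^ 2 ≤ 1 := by nlinarith
    have h2 := Real.abs_exp_sub_one_le (abs_le.2 ⟨by linarith, hx.trans hx1⟩)
    rw [abs_of_nonneg hx0] at h2
    have h3 : ‖T - 1‖ ≤ 4 * ‖q‖ ^ 2 := (h1.trans (le_abs_self _)).trans (by linarith)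
    have h4 : ‖1 - q‖ ≤ 2 := (norm_sub_le _ _).trans (by rw [norm_one]; linarith)
    rw [hE, eulerProd_zero, show (1 - q) * T - 1 - (q - 0) • (-1 : ℂ) = (1 - q) * (T - 1) by
      rw [smul_eq_mul]; ring, norm_mul, norm_pow]
    calc ‖1 - q‖ * ‖T - 1‖ ≤ 2 * (4 * ‖q‖ ^ 2) := by gcongr
      _ = _ := by ring
  refine hO.trans_isLittleO ?_
  simpa using Asymptotics.isLittleO_pow_id (𝕜 := ℂ) one_lt_two

theorem hasDerivAt_eulerProd_pow_zero {N : ℕ} (hN : 2 ≤ N) :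
    HasDerivAt (fun q : ℂ => eulerProd (q ^ N)) 0 0 := by
  have h0 : (0 : ℂ) ^ N = 0 := zero_pow (by omega)
  have := HasDerivAt.comp (0 : ℂ) (h₂ := eulerProd) (by rw [h0]; exact hasDerivAt_eulerProd_zero)
    (hasDerivAt_pow N 0)
  refine this.congr_deriv ?_
  simp [show N - 1 ≠ 0 by omega]

theorem analyticAt_eulerProd_zero : AnalyticAt ℂ (eulerProd : ℂ → ℂ) 0 :=
  differentiableOn_eulerProd.analyticAt (Metric.ball_mem_nhds _ one_pos)

theorem analyticAt_eulerProd_pow_zero {N : ℕ} (hN : N ≠ 0) :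
    AnalyticAt ℂ (fun q : ℂ => eulerProd (q ^ N)) 0 :=
  AnalyticAt.fun_comp (by rw [zero_pow hN]; exact analyticAt_eulerProd_zero) (analyticAt_id.pow N)

end EulerProduct


/-! ### Transformation laws of `η²` and of forms of level one -/

section EtaSquared

open Filter UpperHalfPlane Function

local notation "𝕢" => Periodic.qParam

/-- The square of the Dedekind eta function. -/
noncomputable def etaSq (z : ℂ) : ℂ := ModularForm.eta z ^ 2

/-- The primitive twelfth root of unity `exp (2πi / 12)`. -/
noncomputable def zeta12 : ℂ := 𝕢 12 1

theorem qParam_add (h : ℝ) (z w : ℂ) : 𝕢 h (z + w) = 𝕢 h z * 𝕢 h w := by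
  simp only [Periodic.qParam, ← Complex.exp_add]
  congr 1; ring

theorem qParam_pow (h : ℝ) (z : ℂ) (n : ℕ) : 𝕢 h z ^ n = 𝕢 h (n * z) := by
  simp only [Periodic.qParam, ← Complex.exp_nat_mul]
  congr 1; ring

theorem qParam_natCast_mul {h : ℝ} (hh : h ≠ 0) {n : ℕ} (hn : n ≠ 0) (z : ℂ) :
    𝕢 (n * h) (n * z) = 𝕢 h z := by
  have h1 : (h : ℂ) ≠ 0 := by exact_mod_cast hh
  have h2 : (n : ℂ) ≠ 0 := by exact_mod_cast hn
  simp only [Periodic.qParam]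
  congr 1; push_cast; field_simp

theorem qParam_self {h : ℝ} (hh : h ≠ 0) : 𝕢 h h = 1 := by
  have h1 : (h : ℂ) ≠ 0 := by exact_mod_cast hh
  simp [Periodic.qParam, mul_div_assoc, div_self h1]

theorem zeta12_pow_three : zeta12 ^ 3 = Complex.I := by
  rw [zeta12, Periodic.qParam, ← Complex.exp_nat_mul,
    show ((3 : ℕ) : ℂ) * (2 * Real.pi * Complex.I * 1 / (12 : ℝ)) = Real.pi / 2 * Complex.I by
      push_cast; ring, Complex.exp_pi_div_two_mul_I]

theorem zeta12_pow_six : zeta12 ^ 6 = -1 := by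
  rw [show 6 = 3 * 2 from rfl, pow_mul, zeta12_pow_three, Complex.I_sq]

theorem zeta12_pow_twelve : zeta12 ^ 12 = 1 := by
  rw [show 12 = 6 * 2 from rfl, pow_mul, zeta12_pow_six]; norm_num

theorem zeta12_ne_zero : zeta12 ≠ 0 := fun h => by
  simpa [h] using zeta12_pow_six

theorem norm_qParam_one_lt_one {z : ℂ} (hz : 0 < z.im) : ‖𝕢 1 z‖ < 1 := by
  simpa using UpperHalfPlane.norm_qParam_lt_one 1 ⟨z, hz⟩

theorem etaSq_eq (z : ℂ) : etaSq z = 𝕢 12 z * eulerProd (𝕢 1 z) ^ 2 := by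
  rw [etaSq, ModularForm.eta, mul_pow, qParam_pow]
  congr 1
  have := qParam_natCast_mul (h := 12) (by norm_num) (two_ne_zero) z
  rw [← this]; norm_num

theorem etaSq_add_one (z : ℂ) : etaSq (z + 1) = zeta12 * etaSq z := by
  have h1 : 𝕢 1 1 = 1 := by simpa using qParam_self one_ne_zero
  rw [etaSq_eq, etaSq_eq, qParam_add, qParam_add, h1, mul_one, zeta12]
  ring

theorem etaSq_neg_one_div {z : ℂ} (hz : 0 < z.im) :
    etaSq (-1 / z) = -Complex.I * z * etaSq z := by
  have h := ModularForm.eta_comp_eq_csqrt_I_inv hz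
  have hsq : ∀ w : ℂ, Complex.sqrt w ^ 2 = w := fun w => by
    rw [Complex.sqrt, ← Complex.cpow_nat_mul]; norm_num
  simp only [comp_apply, Pi.smul_apply, Pi.mul_apply, smul_eq_mul] at h
  rw [etaSq, h, mul_pow, mul_pow, inv_pow, hsq, hsq, Complex.inv_I, etaSq]
  ring

theorem etaSq_ne_zero {z : ℂ} (hz : 0 < z.im) : etaSq z ≠ 0 :=
  pow_ne_zero 2 (ModularForm.eta_ne_zero hz)

theorem differentiableOn_etaSq : DifferentiableOn ℂ etaSq upperHalfPlaneSet := fun _ hz =>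
  ((ModularForm.differentiableAt_eta_of_mem_upperHalfPlaneSet hz).pow 2).differentiableWithinAt

theorem etaSq_add_nat (z : ℂ) (n : ℕ) : etaSq (z + n) = zeta12 ^ n * etaSq z := by
  induction n with
  | zero => simp
  | succ n ih => rw [Nat.cast_succ, ← add_assoc, etaSq_add_one, ih]; ring

theorem etaSq_sub_nat (z : ℂ) (n : ℕ) : zeta12 ^ n * etaSq (z - n) = etaSq z := by
  rw [← etaSq_add_nat, sub_add_cancel]

theorem ne_zero_of_im_pos {z : ℂ} (hz : 0 < z.im) : z ≠ 0 := fun h => by simp [h] at hz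

/-- `w ↦ w / (N w + 1)`. -/
theorem etaSq_div_mul_add_one {w : ℂ} (hw : 0 < w.im) (N : ℕ) :
    zeta12 ^ N * etaSq (w / (N * w + 1)) = (N * w + 1) * etaSq w := by
  have hw0 := ne_zero_of_im_pos hw
  -- The map is the composite of `w ↦ -1/w`, `w ↦ w - N` and `w ↦ -1/w`.
  have h1 := neg_one_div_im_pos hw
  have h2 : 0 < (-1 / w - N).im := by simpa using h1
  have h3 : (N * w + 1 : ℂ) ≠ 0 := by
    have := ne_zero_of_im_pos h2
    intro h
    apply this
    field_simp
    linear_combination -h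
  have h6 : (-1 / w - N) * w = -(N * w + 1) := by field_simp; ring
  have h4 : w / (N * w + 1) = -1 / (-1 / w - N) := by
    rw [div_eq_div_iff h3 (ne_zero_of_im_pos h2)]
    linear_combination h6
  have h5 := etaSq_sub_nat (-1 / w) N
  rw [etaSq_neg_one_div hw] at h5
  rw [h4, etaSq_neg_one_div h2]
  linear_combination (-Complex.I * (-1 / w - N)) * h5 - etaSq w * h6 +
    w * (-1 / w - N) * etaSq w * Complex.I_sq

theorem etaSq_add_int (z : ℂ) (n : ℤ) : etaSq (z + n) = zeta12 ^ n * etaSq z := by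
  obtain ⟨m, rfl | rfl⟩ := n.eq_nat_or_neg
  · simpa using etaSq_add_nat z m
  · rw [zpow_neg, zpow_natCast, eq_inv_mul_iff_mul_eq₀ (pow_ne_zero _ zeta12_ne_zero),
      ← etaSq_sub_nat z m]
    simp [sub_eq_add_neg]

/-- `w ↦ (2 s w - 1) / (5 w - 2 s)`, an elliptic element of order two. -/
theorem etaSq_elliptic {w : ℂ} (hw : 0 < w.im) {s : ℤ} (hs : s ^ 2 = 1) :
    etaSq ((2 * s * w - 1) / (5 * w - 2 * s)) = -Complex.I * (5 * w - 2 * s) * etaSq w := by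
  have hs' : (s : ℂ) ^ 2 = 1 := by exact_mod_cast hs
  have hw0 := ne_zero_of_im_pos hw
  -- The map is composed of three inversions `w ↦ -1/w`, separated by the translations by `2s` and
  -- by `-2s`, whose multipliers cancel.
  have h1 := neg_one_div_im_pos hw
  have h2 : 0 < (-1 / w + (2 * s : ℤ)).im := by simpa using h1
  have h3 := neg_one_div_im_pos h2
  have h4 : 0 < (-1 / (-1 / w + (2 * s : ℤ)) + (-(2 * s) : ℤ)).im := by simpa using h3
  have e1 : (-1 / w + (2 * s : ℤ)) * w = 2 * s * w - 1 := by push_cast; field_simp; ring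
  have n2 := ne_zero_of_im_pos h2
  have n4 := ne_zero_of_im_pos h4
  have t1 := etaSq_neg_one_div hw
  have t2 := etaSq_add_int (-1 / w) (2 * s)
  have t3 := etaSq_neg_one_div h2
  have t4 := etaSq_add_int (-1 / (-1 / w + (2 * s : ℤ))) (-(2 * s))
  have t5 := etaSq_neg_one_div h4
  have e2 : (-1 / (-1 / w + (2 * s : ℤ)) + (-(2 * s) : ℤ)) * (-1 / w + (2 * s : ℤ)) * w =
      -(5 * w - 2 * s) := by
    push_cast at e1 n2 ⊢
    linear_combination w * div_mul_cancel₀ (-1 : ℂ) n2 - 2 * s * e1 - 4 * w * hs'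
  rw [t3, t2, t1] at t4
  set v := -1 / w + (2 * s : ℤ)
  set u := -1 / v + (-(2 * s) : ℤ)
  have n5 : 5 * w - 2 * s ≠ 0 := by
    rw [← neg_ne_zero, ← e2]
    exact mul_ne_zero (mul_ne_zero n4 n2) hw0
  have e3 : (2 * s * w - 1) / (5 * w - 2 * s) = -1 / u := by
    rw [div_eq_div_iff n5 n4, ← e1]
    linear_combination e2
  have hz : zeta12 ^ (-(2 * s)) * zeta12 ^ (2 * s) = 1 := by
    rw [← zpow_add₀ zeta12_ne_zero, neg_add_cancel, zpow_zero]
  rw [e3, t5, t4]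
  linear_combination Complex.I * u * v * w * etaSq w * (-Complex.I ^ 2) * hz -
    Complex.I ^ 3 * etaSq w * e2 + Complex.I * (5 * w - 2 * s) * etaSq w * Complex.I_sq

/-! ### Modular forms of level one as functions on `ℂ` -/

open scoped MatrixGroups ModularForm

theorem modularForm_add_one {k : ℤ} (F : ModularForm 𝒮ℒ k) (z : ℂ) :
    F (ofComplex (z + 1)) = F (ofComplex z) := by
  simpa using SlashInvariantFormClass.periodic_comp_ofComplex F one_mem_strictPeriods_SL z

theorem modularForm_neg_one_div {k : ℕ} (F : ModularForm 𝒮ℒ k) {z : ℂ} (hz : 0 < z.im) :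
    F (ofComplex (-1 / z)) = z ^ k * F (ofComplex z) := by
  have h1 : (⇑F) ∣[(k : ℤ)] ModularGroup.S = F := F.slash_action_eq' _ ⟨ModularGroup.S, rfl⟩
  have h2 := congrFun h1 ⟨z, hz⟩
  rw [ModularForm.SL_slash_apply, ModularGroup.denom_S, UpperHalfPlane.modular_S_smul] at h2
  rw [ofComplex_apply_of_im_pos hz, ← h2, ofComplex_apply_of_im_pos (neg_one_div_im_pos hz)]
  have h3 := ne_zero_of_im_pos hz
  simp only [neg_div, one_div, inv_neg, zpow_neg, zpow_natCast]
  field_simp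

theorem differentiableOn_modularForm {k : ℤ} (F : ModularForm 𝒮ℒ k) :
    DifferentiableOn ℂ (fun z => F (ofComplex z)) upperHalfPlaneSet :=
  UpperHalfPlane.mdifferentiable_iff.1 F.holo'

theorem modularForm_ofComplex_eq {k : ℤ} (F : ModularForm 𝒮ℒ k) {z : ℂ} (hz : 0 < z.im) :
    F (ofComplex z) = cuspFunction 1 F (𝕢 1 z) := by
  rw [ofComplex_apply_of_im_pos hz]
  exact (SlashInvariantFormClass.eq_cuspFunction F ⟨z, hz⟩ one_mem_strictPeriods_SL
    one_ne_zero).symm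

theorem analyticAt_cuspFunction {k : ℤ} (F : ModularForm 𝒮ℒ k) :
    AnalyticAt ℂ (cuspFunction 1 F) 0 :=
  ModularFormClass.analyticAt_cuspFunction_zero F one_pos one_mem_strictPeriods_SL

theorem cuspFunction_eisenstein_zero {k : ℕ} (hk : 3 ≤ k) (hk2 : Even k) :
    cuspFunction 1 (ModularForm.E hk) 0 = 1 := by
  have h := EisensteinSeries.E_qExpansion_coeff_zero hk hk2
  rw [qExpansion_coeff] at h
  simpa using h

theorem hasDerivAt_cuspFunction {k : ℤ} (F : ModularForm 𝒮ℒ k) {c : ℂ}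
    (h : (qExpansion 1 F).coeff 1 = c) : HasDerivAt (cuspFunction 1 F) c 0 := by
  rw [qExpansion_coeff, iteratedDeriv_one, Nat.factorial_one, Nat.cast_one, inv_one, one_mul] at h
  exact h ▸ (analyticAt_cuspFunction F).differentiableAt.hasDerivAt

/-- The quotient of a modular form by the corresponding power of `η²`. -/
noncomputable def divEta {k : ℕ} (F : ModularForm 𝒮ℒ k) (z : ℂ) : ℂ :=
  F (ofComplex z) / etaSq z ^ k

theorem divEta_add_nat {k : ℕ} (F : ModularForm 𝒮ℒ k) (z : ℂ) (n : ℕ) :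
    divEta F z = zeta12 ^ (k * n) * divEta F (z + n) := by
  have h : F (ofComplex (z + n)) = F (ofComplex z) := by
    induction n with
    | zero => simp
    | succ n ih => rw [Nat.cast_succ, ← add_assoc, modularForm_add_one, ih]
  have hz := zeta12_ne_zero
  rw [divEta, divEta, etaSq_add_nat, h, mul_pow, ← pow_mul, mul_comm n k, ← mul_div_assoc,
    mul_div_mul_left _ _ (pow_ne_zero _ hz)]

theorem divEta_add_int {k : ℕ} (F : ModularForm 𝒮ℒ k) (z : ℂ) (n : ℤ) :
    divEta F z = zeta12 ^ (k * n) * divEta F (z + n) := by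
  obtain ⟨m, rfl | rfl⟩ := n.eq_nat_or_neg
  · exact_mod_cast divEta_add_nat F z m
  · rw [divEta_add_nat F (z + (-m : ℤ)) m, ← zpow_natCast, ← mul_assoc,
      ← zpow_add₀ zeta12_ne_zero]
    simp

theorem divEta_neg_one_div {k : ℕ} (F : ModularForm 𝒮ℒ k) {z : ℂ} (hz : 0 < z.im) :
    (-Complex.I) ^ k * divEta F (-1 / z) = divEta F z := by
  have h1 := ne_zero_of_im_pos hz
  have h2 := etaSq_ne_zero hz
  rw [divEta, divEta, etaSq_neg_one_div hz, modularForm_neg_one_div F hz, mul_pow, mul_pow]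
  have h3 : (-Complex.I) ^ k ≠ 0 := pow_ne_zero _ (neg_ne_zero.2 Complex.I_ne_zero)
  field_simp

theorem differentiableOn_divEta {k : ℕ} (F : ModularForm 𝒮ℒ k) :
    DifferentiableOn ℂ (divEta F) upperHalfPlaneSet :=
  (differentiableOn_modularForm F).div (differentiableOn_etaSq.pow k) fun _ hz =>
    pow_ne_zero _ (etaSq_ne_zero hz)

/-- The quotient `η(z)² / η(nz)²`. -/
noncomputable def etaQuot (n : ℂ) (z : ℂ) : ℂ := etaSq z / etaSq (n * z)

theorem differentiableOn_etaQuot {c : ℝ} (hc : 0 < c) :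
    DifferentiableOn ℂ (etaQuot c) upperHalfPlaneSet := by
  have him : ∀ {z : ℂ}, 0 < z.im → 0 < (c * z).im := fun hz => by simpa using mul_pos hc hz
  refine differentiableOn_etaSq.div (differentiableOn_etaSq.comp (by fun_prop) fun z hz => him hz)
    fun z hz => etaSq_ne_zero (him hz)

/-- A double zero of `φ` cancels the pole `q⁻²`, so `G` has a limit at the cusp. -/
theorem exists_bound_of_cusp_expansion {φ D G : ℂ → ℂ} {c : ℂ} (hφ : AnalyticAt ℂ φ 0)
    (h0 : φ 0 = 0) (h1 : HasDerivAt φ 0 0) (hD : ContinuousAt D 0) (hD0 : D 0 ≠ 0)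
    (hG : ∀ z : ℂ, 0 < z.im → G z = φ (𝕢 1 z) / (𝕢 1 z ^ 2 * D (𝕢 1 z)) + c) :
    ∃ C : ℝ, ∀ᶠ z in comap Complex.im atTop, ‖G z‖ ≤ C := by
  have hord : ((2 : ℕ) : ℕ∞) ≤ analyticOrderAt φ 0 := by
    rw [natCast_le_analyticOrderAt_iff_iteratedDeriv_eq_zero hφ]
    intro i hi
    interval_cases i
    · simpa using h0
    · simpa using h1.deriv
  obtain ⟨ψ, hψ, hφψ⟩ := (natCast_le_analyticOrderAt hφ).1 hord
  have hq : Tendsto (𝕢 1) (comap Complex.im atTop) (𝓝 0) :=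
    (Periodic.qParam_tendsto one_pos).mono_right nhdsWithin_le_nhds
  have hlim : Tendsto (fun z => ψ (𝕢 1 z) / D (𝕢 1 z) + c) (comap Complex.im atTop)
      (𝓝 (ψ 0 / D 0 + c)) :=
    ((hψ.continuousAt.div hD hD0).tendsto.comp hq).add_const c
  refine ⟨‖ψ 0 / D 0 + c‖ + 1, ?_⟩
  filter_upwards [hlim.norm.eventually (gt_mem_nhds (lt_add_one _)), hq.eventually hφψ,
    preimage_mem_comap (Ioi_mem_atTop (0 : ℝ))] with z hz hz' hpos
  rw [hG z hpos, hz', sub_zero, smul_eq_mul,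
    mul_div_mul_left _ _ (pow_ne_zero 2 (Periodic.qParam_ne_zero z))]
  exact hz.le

end EtaSquared


/-! ### Eta quotients at the two cusps -/

section EtaQuotient

open Filter UpperHalfPlane Function
open scoped MatrixGroups

local notation "𝕢" => Periodic.qParam

variable {N : ℕ} {z : ℂ}

theorem etaQuot_add_one (N : ℕ) (z : ℂ) :
    etaQuot N (z + 1) = zeta12 / zeta12 ^ N * etaQuot N z := by
  rw [etaQuot, etaQuot, etaSq_add_one, mul_add, mul_one, etaSq_add_nat]
  have := zeta12_ne_zero
  field_simp

theorem etaQuot_inv_add_nat (hN : N ≠ 0) (z : ℂ) :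
    etaQuot (N : ℂ)⁻¹ (z + N) = zeta12 ^ N / zeta12 * etaQuot (N : ℂ)⁻¹ z := by
  have hN' : (N : ℂ) ≠ 0 := by exact_mod_cast hN
  rw [etaQuot, etaQuot, mul_add, inv_mul_cancel₀ hN', etaSq_add_one, etaSq_add_nat]
  have := zeta12_ne_zero
  field_simp

theorem natCast_inv_mul_im_pos (hN : N ≠ 0) (hz : 0 < z.im) : 0 < ((N : ℂ)⁻¹ * z).im := by
  have h : (0 : ℝ) < (N : ℝ)⁻¹ := by positivity
  have := mul_pos h hz
  rwa [← Complex.im_ofReal_mul, Complex.ofReal_inv, Complex.ofReal_natCast] at this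

theorem etaQuot_neg_one_div (hN : N ≠ 0) (hz : 0 < z.im) :
    etaQuot N (-1 / z) = N * etaQuot (N : ℂ)⁻¹ z := by
  have hN' : (N : ℂ) ≠ 0 := by exact_mod_cast hN
  have hz0 := ne_zero_of_im_pos hz
  have h1 := natCast_inv_mul_im_pos hN hz
  have h2 := etaSq_ne_zero h1
  rw [etaQuot, etaQuot, etaSq_neg_one_div hz,
    show (N : ℂ) * (-1 / z) = -1 / ((N : ℂ)⁻¹ * z) by field_simp, etaSq_neg_one_div h1]
  have := Complex.I_ne_zero
  field_simp

/-- With `w = (z - 1)/N` one has `(-1/z + 1)/N = w/(N w + 1)`. -/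
theorem etaQuot_inv_neg_one_div_add_one (hN : N ≠ 0) (hz : 0 < z.im) :
    etaQuot (N : ℂ)⁻¹ (-1 / z + 1) =
      -Complex.I * zeta12 ^ (N + 2) * etaQuot (N : ℂ)⁻¹ (z - 1) := by
  have hN' : (N : ℂ) ≠ 0 := by exact_mod_cast hN
  have hz0 := ne_zero_of_im_pos hz
  have hw := natCast_inv_mul_im_pos hN (show 0 < (z - 1).im by simpa using hz)
  have h1 := etaSq_div_mul_add_one hw N
  rw [show (N : ℂ) * ((N : ℂ)⁻¹ * (z - 1)) + 1 = z by field_simp; ring] at h1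
  have h2 := etaSq_sub_nat z 1
  rw [pow_one, Nat.cast_one] at h2
  rw [etaQuot, etaQuot, etaSq_add_one, etaSq_neg_one_div hz, ← h2,
    show (N : ℂ)⁻¹ * (-1 / z + 1) = (N : ℂ)⁻¹ * (z - 1) / z by field_simp; ring]
  have h3 : etaSq ((N : ℂ)⁻¹ * (z - 1) / z) = z * etaSq ((N : ℂ)⁻¹ * (z - 1)) / zeta12 ^ N := by
    rw [eq_div_iff (pow_ne_zero _ zeta12_ne_zero), mul_comm, h1]
  have := zeta12_ne_zero
  have := etaSq_ne_zero hw
  rw [h3]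
  field_simp
  ring

/-- Since `2² ≡ -1` modulo `5`, the classes `±2` are fixed by `z ↦ -1/z`; in `w = (z + 2s)/5` this
becomes an elliptic map of order two. -/
theorem etaQuot_five_neg_one_div_add (hz : 0 < z.im) {s : ℤ} (hs : s ^ 2 = 1) :
    etaQuot (5 : ℂ)⁻¹ (-1 / z + (2 * s : ℤ)) = etaQuot (5 : ℂ)⁻¹ (z + (2 * s : ℤ)) := by
  have hs' : (s : ℂ) ^ 2 = 1 := by exact_mod_cast hs
  have hz0 := ne_zero_of_im_pos hz
  have hw := natCast_inv_mul_im_pos (N := 5) (by norm_num)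
    (show 0 < (z + (2 * s : ℤ)).im by simpa using hz)
  have h1 := etaSq_elliptic hw hs
  push_cast at h1 hw
  rw [show (5 : ℂ) * ((5 : ℂ)⁻¹ * (z + 2 * s)) - 2 * s = z by field_simp; ring] at h1
  rw [etaQuot, etaQuot, etaSq_add_int, etaSq_add_int, etaSq_neg_one_div hz]
  push_cast
  rw [show (5 : ℂ)⁻¹ * (-1 / z + 2 * s) = (2 * s * (5⁻¹ * (z + 2 * s)) - 1) / z by
    field_simp; linear_combination (-4) * hs', h1]
  have := Complex.I_ne_zero
  have := etaSq_ne_zero hw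
  field_simp

/-- The eta products at the cusp `0` in terms of a common local parameter. -/
theorem etaSq_eq_inv_parameter (hN : N ≠ 0) (z : ℂ) :
    etaSq ((N : ℂ)⁻¹ * z) =
        𝕢 (12 * N) z * eulerProd (𝕢 (12 * N) z ^ 12) ^ 2 ∧
      etaSq z = 𝕢 (12 * N) z ^ N * eulerProd (𝕢 (12 * N) z ^ (12 * N)) ^ 2 ∧
      𝕢 1 z = 𝕢 (12 * N) z ^ (12 * N) := by
  have hN' : (N : ℂ) ≠ 0 := by exact_mod_cast hN
  have h1 : 𝕢 1 z = 𝕢 (12 * N) z ^ (12 * N) := by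
    rw [qParam_pow]; simp only [Periodic.qParam]; congr 1; push_cast; field_simp
  refine ⟨?_, ?_, h1⟩
  · rw [etaSq_eq, qParam_pow]
    congr 1
    · simp only [Periodic.qParam]; congr 1; push_cast; field_simp
    · congr 2; simp only [Periodic.qParam]; congr 1; push_cast; field_simp
  · rw [etaSq_eq, ← h1, qParam_pow]
    congr 1
    simp only [Periodic.qParam]; congr 1; push_cast; field_simp

/-- The eta products at the cusp `∞` in terms of a common local parameter. -/
theorem etaSq_eq_parameter (N : ℕ) (z : ℂ) :
    etaSq z = 𝕢 12 z * eulerProd (𝕢 1 z) ^ 2 ∧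
      etaSq (N * z) = 𝕢 12 z ^ N * eulerProd (𝕢 1 z ^ N) ^ 2 ∧ 𝕢 1 z = 𝕢 12 z ^ 12 := by
  refine ⟨etaSq_eq z, ?_, ?_⟩
  · rw [etaSq_eq, qParam_pow, qParam_pow]
  · rw [qParam_pow]; simp only [Periodic.qParam]; congr 1; push_cast; field_simp

theorem continuousAt_eulerProd_pow {n : ℕ} (hn : n ≠ 0) :
    ContinuousAt (fun q : ℂ => eulerProd (q ^ n)) 0 :=
  (analyticAt_eulerProd_pow_zero hn).continuousAt

theorem continuousAt_cuspFunction_pow {k : ℤ} (F : ModularForm 𝒮ℒ k) {n : ℕ} (hn : n ≠ 0) :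
    ContinuousAt (fun q : ℂ => cuspFunction 1 F (q ^ n)) 0 :=
  ContinuousAt.comp' (by rw [zero_pow hn]; exact (analyticAt_cuspFunction F).continuousAt)
    (by fun_prop)

end EtaQuotient

/-! ### The Hauptmodul of level five -/

section LevelFive

open Filter UpperHalfPlane Function ModularForm
open scoped MatrixGroups

local notation "𝕢" => Periodic.qParam

/-- The relation between `E₄` and the Hauptmodul of level five. -/
noncomputable def levelFive (f r : ℂ) : ℂ := f * r ^ 5 - r ^ 6 - 250 * r ^ 3 - 3125

/-- All terms scale by powers of `u³`, so the roots of unity in the transformation laws drop out. -/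
theorem levelFive_congr {f f' r r' u : ℂ} (hr : r' = u * r) (hf : f = u ^ 2 * f')
    (hu : u ^ 3 = 1) : levelFive f' r' = levelFive f r := by
  rw [levelFive, levelFive, hr, hf]
  linear_combination (f' * r ^ 5 * u ^ 2 - r ^ 6 * (u ^ 3 + 1) - 250 * r ^ 3) * hu

theorem divEta_four_neg_one_div {z : ℂ} (hz : 0 < z.im) :
    divEta (k := 4) E₄ (-1 / z) = divEta (k := 4) E₄ z := by
  have := divEta_neg_one_div (k := 4) E₄ hz
  rwa [neg_pow, Complex.I_pow_four, mul_one, show (-1 : ℂ) ^ 4 = 1 by norm_num, one_mul] at this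

/-- The cube root of the classical `j = (t² + 250t + 3125)³/t⁵`, `t = r³ = (η(τ)/η(5τ))⁶`, since the
cube of `E₄/η⁸` is `j`. The difference `G`, cleared of denominators, is bounded at `∞`, its
transform `H` at the cusp `0` tends to zero, and the norm to level one does the rest. -/
theorem levelFive_eq_zero {z : ℂ} (hz : 0 < z.im) :
    levelFive (divEta E₄ z) (etaQuot 5 z) = 0 := by
  have h12 := zeta12_pow_twelve
  have h3 := zeta12_pow_three
  have h6 := zeta12_pow_six
  have hz0 := zeta12_ne_zero
  have hu4 : (zeta12 ^ 4) ^ 3 = 1 := by rw [← pow_mul]; exact h12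
  let G : ℂ → ℂ := fun z => levelFive (divEta E₄ z) (etaQuot 5 z)
  let H : ℂ → ℂ := fun z => levelFive (divEta E₄ z) (5 * etaQuot 5⁻¹ z)
  have hf := differentiableOn_divEta (k := 4) E₄
  have hdG : DifferentiableOn ℂ G upperHalfPlaneSet := by
    have := differentiableOn_etaQuot (c := 5) (by norm_num)
    push_cast at this
    exact (((hf.mul (this.pow 5)).sub (this.pow 6)).sub ((this.pow 3).const_mul _)).sub_const _
  have hdH : DifferentiableOn ℂ H upperHalfPlaneSet := by
    have := (differentiableOn_etaQuot (c := 5⁻¹) (by norm_num)).const_mul 5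
    push_cast at this
    exact (((hf.mul (this.pow 5)).sub (this.pow 6)).sub ((this.pow 3).const_mul _)).sub_const _
  have hHT : ∀ z, H (z + 5) = H z := fun z => by
    have h1 := etaQuot_inv_add_nat (N := 5) (by norm_num) z
    have h2 := divEta_add_nat (k := 4) E₄ z 5
    push_cast at h1 h2
    refine levelFive_congr (u := zeta12 ^ 4) ?_ ?_ hu4
    · rw [h1]; field_simp
    · rw [h2]; linear_combination zeta12 ^ 8 * divEta E₄ (z + 5) * h12
  have hfS : ∀ {z : ℂ}, 0 < z.im → divEta (k := 4) E₄ (-1 / z) = divEta (k := 4) E₄ z :=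
    divEta_four_neg_one_div
  have hHS1 : ∀ {z : ℂ}, 0 < z.im → H (-1 / z + 1) = H (z - 1) := fun {z} hz => by
    have h1 := etaQuot_inv_neg_one_div_add_one (N := 5) (by norm_num) hz
    have h2 := divEta_add_nat (k := 4) E₄ (-1 / z) 1
    have h4 := divEta_add_nat (k := 4) E₄ (z - 1) 1
    push_cast at h1 h2 h4
    rw [sub_add_cancel] at h4
    refine levelFive_congr (u := zeta12 ^ 4) ?_ ?_ hu4
    · rw [h1, ← h3]; linear_combination -5 * zeta12 ^ 4 * etaQuot 5⁻¹ (z - 1) * h6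
    · rw [h4, ← hfS hz, h2]; ring
  have hHS2 : ∀ {z : ℂ} {s : ℤ}, 0 < z.im → s ^ 2 = 1 →
      H (-1 / z + (2 * s : ℤ)) = H (z + (2 * s : ℤ)) := fun {z s} hz hs => by
    have h1 : divEta (k := 4) E₄ (-1 / z + (2 * s : ℤ)) = divEta (k := 4) E₄ (z + (2 * s : ℤ)) := by
      apply mul_left_cancel₀ (zpow_ne_zero ((4 : ℕ) * (2 * s)) hz0)
      rw [← divEta_add_int, ← divEta_add_int, hfS hz]
    change levelFive _ _ = levelFive _ _
    rw [h1, etaQuot_five_neg_one_div_add hz hs]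
  -- At `∞` the poles have order at most two in `q`. They cancel because the numerator vanishes to
  -- order two: its constant term is `1 - 1`, its linear one `240 - 2 + 12 - 250`.
  obtain ⟨C, hC⟩ : ∃ C : ℝ, ∀ᶠ z in comap Complex.im atTop, ‖G z‖ ≤ C := by
    have hA := analyticAt_eulerProd_zero
    have hB := analyticAt_eulerProd_pow_zero (N := 5) (by norm_num)
    have hE := analyticAt_cuspFunction E₄
    have hE0 := cuspFunction_eisenstein_zero (k := 4) (by norm_num) ⟨2, rfl⟩
    refine exists_bound_of_cusp_expansion (c := -3125)
      (φ := fun q => cuspFunction 1 E₄ q * eulerProd q ^ 2 * eulerProd (q ^ 5) ^ 2 -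
        eulerProd q ^ 12 - 250 * q * eulerProd q ^ 6 * eulerProd (q ^ 5) ^ 6)
      (D := fun q => eulerProd (q ^ 5) ^ 12) ?_ ?_ ?_ ?_ ?_ fun z hz => ?_
    · fun_prop
    · simp [eulerProd_zero, hE0]
    · have dA := hasDerivAt_eulerProd_zero
      have dB := hasDerivAt_eulerProd_pow_zero (N := 5) (by norm_num)
      have dE := hasDerivAt_cuspFunction E₄ E₄_qExpansion_coeff_one
      refine ((((dE.mul (dA.pow 2)).mul (dB.pow 2)).sub (dA.pow 12)).sub
        ((((hasDerivAt_id 0).const_mul 250).mul (dA.pow 6)).mul (dB.pow 6))).congr_deriv ?_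
      simp [eulerProd_zero, hE0]
      norm_num
    · exact hB.continuousAt.pow 12
    · simp [eulerProd_zero]
    · obtain ⟨h1, h2, h3⟩ := etaSq_eq_parameter 5 z
      have hq := norm_qParam_one_lt_one hz
      have n1 := eulerProd_ne_zero hq
      have n2 := eulerProd_ne_zero (q := 𝕢 1 z ^ 5) (by
        rw [norm_pow]; exact pow_lt_one₀ (norm_nonneg _) hq (by norm_num))
      have n3 : 𝕢 12 z ≠ 0 := Periodic.qParam_ne_zero z
      change levelFive _ _ = _
      push_cast at h2
      rw [levelFive, divEta, etaQuot, modularForm_ofComplex_eq _ hz, h1, h2]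
      set x := 𝕢 12 z
      set A := eulerProd (𝕢 1 z)
      set B := eulerProd (𝕢 1 z ^ 5)
      set q := 𝕢 1 z
      clear_value A B
      rw [h3]
      field_simp
      ring
  refine eq_zero_of_norm_levelOne (N := 4) (G := G) (H := H) hdG hdH ?_ ?_ ?_ ?_ ?_ hC hz
  · intro z hz
    have h1 := etaQuot_add_one 5 z
    have h2 := divEta_add_nat (k := 4) E₄ z 1
    push_cast at h1 h2
    refine levelFive_congr (u := zeta12 ^ 8) ?_ ?_ (by rw [← pow_mul, show 8 * 3 = 12 * 2 from rfl,
      pow_mul, h12, one_pow])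
    · rw [h1]; field_simp; linear_combination -etaQuot 5 z * h12
    · rw [h2]; linear_combination -zeta12 ^ 4 * divEta E₄ (z + 1) * h12
  · intro z hz
    push_cast
    exact hHT z
  · intro z hz
    have h1 := etaQuot_neg_one_div (N := 5) (by norm_num) hz
    push_cast at h1
    change levelFive _ _ = levelFive _ _
    rw [h1, hfS hz]
  · intro z hz
    -- `z ↦ -1/z` acts on the nonzero classes modulo `5` by `j ↦ -1/j`: it exchanges `1` and `4` and
    -- fixes `2` and `3`.
    have e1 : H (-1 / z + 1) = H (z + 4) := by
      rw [hHS1 hz, ← hHT]; congr 1; ring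
    have e4 : H (-1 / z + 4) = H (z + 1) := by
      have h := hHS1 (neg_one_div_im_pos hz)
      have h0 := ne_zero_of_im_pos hz
      rw [show -1 / (-1 / z) = z by field_simp, ← hHT (-1 / z - 1)] at h
      rw [h]; congr 1; ring
    have e2 : H (-1 / z + 2) = H (z + 2) := by
      simpa using hHS2 (s := 1) hz (by norm_num)
    have e3 : H (-1 / z + 3) = H (z + 3) := by
      have h := hHS2 (s := -1) hz (by norm_num)
      rw [← hHT, ← hHT (z + _)] at h
      convert h using 2 <;> push_cast <;> ring
    simp only [Finset.prod_range_succ, Finset.prod_range_zero, one_mul]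
    norm_num
    rw [e1, e2, e3, e4]
    ring
  · have hp : Tendsto (𝕢 60) (comap Complex.im atTop) (𝓝 0) :=
      (Periodic.qParam_tendsto (by norm_num)).mono_right nhdsWithin_le_nhds
    have hE0 := cuspFunction_eisenstein_zero (k := 4) (by norm_num) ⟨2, rfl⟩
    -- At the cusp `0` the function is continuous in `p = exp(2πiz/60)`, with value `3125 - 3125` at
    -- `p = 0`.
    let Φ : ℂ → ℂ := fun p => 3125 * (cuspFunction 1 E₄ (p ^ 60) * eulerProd (p ^ 60) ^ 2 /
      eulerProd (p ^ 12) ^ 10) - 15625 * (p ^ 4 * (eulerProd (p ^ 60) ^ 2 / eulerProd (p ^ 12) ^ 2)) ^ 6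
      - 250 * 125 * (p ^ 4 * (eulerProd (p ^ 60) ^ 2 / eulerProd (p ^ 12) ^ 2)) ^ 3 - 3125
    have hΦ0 : Φ 0 = 0 := by simp [Φ, eulerProd_zero, hE0]
    have hΦ : ContinuousAt Φ 0 := by
      have hA := continuousAt_eulerProd_pow (n := 60) (by norm_num)
      have hB := continuousAt_eulerProd_pow (n := 12) (by norm_num)
      have hE := continuousAt_cuspFunction_pow E₄ (n := 60) (by norm_num)
      have hB0 : ∀ n, eulerProd ((0 : ℂ) ^ 12) ^ n ≠ 0 := by simp [eulerProd_zero]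
      have hX := (continuousAt_id.pow 4).mul ((hA.pow 2).div (hB.pow 2) (hB0 2))
      exact (((((hE.mul (hA.pow 2)).div (hB.pow 10) (hB0 10)).const_mul _).sub
        ((hX.pow 6).const_mul _)).sub ((hX.pow 3).const_mul _)).sub_const _
    have hlim := hΦ.tendsto.comp hp
    rw [hΦ0] at hlim
    refine hlim.congr' ?_
    filter_upwards [preimage_mem_comap (Ioi_mem_atTop (0 : ℝ))] with z hz
    obtain ⟨h1, h2, h3⟩ := etaSq_eq_inv_parameter (N := 5) (by norm_num) z
    have hq := norm_qParam_one_lt_one hz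
    have n1 := eulerProd_ne_zero hq
    have n3 : 𝕢 60 z ≠ 0 := Periodic.qParam_ne_zero z
    push_cast at h1 h2 h3
    norm_num at h1 h2 h3
    rw [one_div] at h1
    have n2 := etaSq_ne_zero (natCast_inv_mul_im_pos (N := 5) (by norm_num) hz)
    push_cast at n2
    rw [h1] at n2
    have n4 := (pow_ne_zero_iff two_ne_zero).1 (right_ne_zero_of_mul n2)
    change Φ (𝕢 60 z) = levelFive _ _
    rw [levelFive, divEta, etaQuot, modularForm_ofComplex_eq _ hz, h1, h2, h3]
    rw [h3] at n1
    simp only [Φ]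
    field_simp
    ring

end LevelFive


/-! ### The Hauptmodul of level three -/

section LevelThree

open Filter UpperHalfPlane Function ModularForm
open scoped MatrixGroups

local notation "𝕢" => Periodic.qParam

/-- The relation between `E₆` and the Hauptmodul of level three. -/
noncomputable def levelThree (f r : ℂ) : ℂ := f * r ^ 9 - r ^ 12 + 486 * r ^ 6 + 19683

theorem levelThree_congr {f f' r r' u : ℂ} (hr : r' = u * r) (hf : f = u ^ 3 * f')
    (hu : u ^ 6 = 1) : levelThree f' r' = levelThree f r := by
  rw [levelThree, levelThree, hr, hf]
  linear_combination (f' * r ^ 9 * u ^ 3 - r ^ 12 * (u ^ 6 + 1) + 486 * r ^ 6) * hu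

/-- A square root of `j - 1728 = (t² - 486t - 19683)²/t³`, `t = r⁶ = (η(τ)/η(3τ))¹²`. `E₆` replaces
`E₄` because the factor `t + 27` of `j` is not a cube; as `E₆/η¹²` changes sign under `z ↦ -1/z`, a
sign enters `H`. -/
theorem levelThree_eq_zero {z : ℂ} (hz : 0 < z.im) :
    levelThree (divEta E₆ z) (etaQuot 3 z) = 0 := by
  have h12 := zeta12_pow_twelve
  have h3 := zeta12_pow_three
  have h6 := zeta12_pow_six
  have hz0 := zeta12_ne_zero
  have hu2 : (zeta12 ^ 2) ^ 6 = 1 := by rw [← pow_mul]; exact h12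
  let G : ℂ → ℂ := fun z => levelThree (divEta E₆ z) (etaQuot 3 z)
  let H : ℂ → ℂ := fun z => levelThree (-divEta E₆ z) (3 * etaQuot 3⁻¹ z)
  have hf := differentiableOn_divEta (k := 6) E₆
  have hdG : DifferentiableOn ℂ G upperHalfPlaneSet := by
    have := differentiableOn_etaQuot (c := 3) (by norm_num)
    push_cast at this
    exact (((hf.mul (this.pow 9)).sub (this.pow 12)).add ((this.pow 6).const_mul _)).add_const _
  have hdH : DifferentiableOn ℂ H upperHalfPlaneSet := by
    have := (differentiableOn_etaQuot (c := 3⁻¹) (by norm_num)).const_mul 3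
    push_cast at this
    exact (((hf.neg.mul (this.pow 9)).sub (this.pow 12)).add
      ((this.pow 6).const_mul _)).add_const _
  have hHT : ∀ z, H (z + 3) = H z := fun z => by
    have h1 := etaQuot_inv_add_nat (N := 3) (by norm_num) z
    have h2 := divEta_add_nat (k := 6) E₆ z 3
    push_cast at h1 h2
    refine levelThree_congr (u := zeta12 ^ 2) ?_ ?_ hu2
    · rw [h1]; field_simp
    · rw [h2]; linear_combination -zeta12 ^ 6 * divEta E₆ (z + 3) * h12
  have hfS : ∀ {z : ℂ}, 0 < z.im → divEta (k := 6) E₆ (-1 / z) = -divEta (k := 6) E₆ z :=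
    fun hz => by
      have := divEta_neg_one_div (k := 6) E₆ hz
      rw [← this, show (-Complex.I) ^ 6 = (Complex.I ^ 2) ^ 3 by ring, Complex.I_sq]
      ring
  have hHS1 : ∀ {z : ℂ}, 0 < z.im → H (-1 / z + 1) = H (z - 1) := fun {z} hz => by
    have h1 := etaQuot_inv_neg_one_div_add_one (N := 3) (by norm_num) hz
    have h2 := divEta_add_nat (k := 6) E₆ (-1 / z) 1
    have h4 := divEta_add_nat (k := 6) E₆ (z - 1) 1
    push_cast at h1 h2 h4
    rw [sub_add_cancel] at h4
    refine levelThree_congr (u := zeta12 ^ 2) ?_ ?_ hu2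
    · rw [h1, ← h3]; linear_combination -3 * zeta12 ^ 2 * etaQuot 3⁻¹ (z - 1) * h6
    · have h5 := hfS hz
      rw [h2] at h5
      rw [h4]
      linear_combination h5 - divEta (k := 6) E₆ z * h6
  obtain ⟨C, hC⟩ : ∃ C : ℝ, ∀ᶠ z in comap Complex.im atTop, ‖G z‖ ≤ C := by
    have hA := analyticAt_eulerProd_zero
    have hB := analyticAt_eulerProd_pow_zero (N := 3) (by norm_num)
    have hE := analyticAt_cuspFunction E₆
    have hE0 := cuspFunction_eisenstein_zero (k := 6) (by norm_num) ⟨3, rfl⟩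
    refine exists_bound_of_cusp_expansion (c := 19683)
      (φ := fun q => cuspFunction 1 E₆ q * eulerProd q ^ 6 * eulerProd (q ^ 3) ^ 6 -
        eulerProd q ^ 24 + 486 * q * eulerProd q ^ 12 * eulerProd (q ^ 3) ^ 12)
      (D := fun q => eulerProd (q ^ 3) ^ 24) ?_ ?_ ?_ ?_ ?_ fun z hz => ?_
    · fun_prop
    · simp [eulerProd_zero, hE0]
    · have dA := hasDerivAt_eulerProd_zero
      have dB := hasDerivAt_eulerProd_pow_zero (N := 3) (by norm_num)
      have dE := hasDerivAt_cuspFunction E₆ E₆_qExpansion_coeff_one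
      -- The linear terms cancel: `-504 - 6 + 24 + 486 = 0`.
      refine ((((dE.mul (dA.pow 6)).mul (dB.pow 6)).sub (dA.pow 24)).add
        ((((hasDerivAt_id 0).const_mul 486).mul (dA.pow 12)).mul (dB.pow 12))).congr_deriv ?_
      simp [eulerProd_zero, hE0]
      norm_num
    · exact hB.continuousAt.pow 24
    · simp [eulerProd_zero]
    · obtain ⟨h1, h2, h3⟩ := etaSq_eq_parameter 3 z
      have hq := norm_qParam_one_lt_one hz
      have n1 := eulerProd_ne_zero hq
      have n2 := eulerProd_ne_zero (q := 𝕢 1 z ^ 3) (by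
        rw [norm_pow]; exact pow_lt_one₀ (norm_nonneg _) hq (by norm_num))
      have n3 : 𝕢 12 z ≠ 0 := Periodic.qParam_ne_zero z
      change levelThree _ _ = _
      push_cast at h2
      rw [levelThree, divEta, etaQuot, modularForm_ofComplex_eq _ hz, h1, h2]
      set x := 𝕢 12 z
      set A := eulerProd (𝕢 1 z)
      set B := eulerProd (𝕢 1 z ^ 3)
      set q := 𝕢 1 z
      clear_value A B
      rw [h3]
      field_simp
      ring
  refine eq_zero_of_norm_levelOne (N := 2) (G := G) (H := H) hdG hdH ?_ ?_ ?_ ?_ ?_ hC hz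
  · intro z hz
    have h1 := etaQuot_add_one 3 z
    have h2 := divEta_add_nat (k := 6) E₆ z 1
    push_cast at h1 h2
    refine levelThree_congr (u := zeta12 ^ 10) ?_ ?_ (by rw [← pow_mul, show 10 * 6 = 12 * 5 from rfl,
      pow_mul, h12, one_pow])
    · rw [h1]; field_simp; linear_combination -etaQuot 3 z * h12
    · rw [h2]
      linear_combination -(zeta12 ^ 18 + zeta12 ^ 6) * divEta E₆ (z + 1) * h12
  · intro z hz
    push_cast
    exact hHT z
  · intro z hz
    have h1 := etaQuot_neg_one_div (N := 3) (by norm_num) hz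
    push_cast at h1
    change levelThree _ _ = levelThree _ _
    rw [h1, hfS hz]
  · intro z hz
    have e1 : H (-1 / z + 1) = H (z + 2) := by
      rw [hHS1 hz, ← hHT]; congr 1; ring
    have e2 : H (-1 / z + 2) = H (z + 1) := by
      have h := hHS1 (neg_one_div_im_pos hz)
      have h0 := ne_zero_of_im_pos hz
      rw [show -1 / (-1 / z) = z by field_simp, ← hHT (-1 / z - 1)] at h
      rw [h]; congr 1; ring
    simp only [Finset.prod_range_succ, Finset.prod_range_zero, one_mul]
    norm_num
    rw [e1, e2, mul_comm]
  · have hp : Tendsto (𝕢 36) (comap Complex.im atTop) (𝓝 0) :=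
      (Periodic.qParam_tendsto (by norm_num)).mono_right nhdsWithin_le_nhds
    have hE0 := cuspFunction_eisenstein_zero (k := 6) (by norm_num) ⟨3, rfl⟩
    let Φ : ℂ → ℂ := fun p => -19683 * (cuspFunction 1 E₆ (p ^ 36) * eulerProd (p ^ 36) ^ 6 /
      eulerProd (p ^ 12) ^ 18) -
      3 ^ 12 * (p ^ 2 * (eulerProd (p ^ 36) ^ 2 / eulerProd (p ^ 12) ^ 2)) ^ 12 +
      486 * 3 ^ 6 * (p ^ 2 * (eulerProd (p ^ 36) ^ 2 / eulerProd (p ^ 12) ^ 2)) ^ 6 + 19683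
    have hΦ0 : Φ 0 = 0 := by simp [Φ, eulerProd_zero, hE0]
    have hΦ : ContinuousAt Φ 0 := by
      have hA := continuousAt_eulerProd_pow (n := 36) (by norm_num)
      have hB := continuousAt_eulerProd_pow (n := 12) (by norm_num)
      have hE := continuousAt_cuspFunction_pow E₆ (n := 36) (by norm_num)
      have hB0 : ∀ n, eulerProd ((0 : ℂ) ^ 12) ^ n ≠ 0 := by simp [eulerProd_zero]
      have hX := (continuousAt_id.pow 2).mul ((hA.pow 2).div (hB.pow 2) (hB0 2))
      exact (((((hE.mul (hA.pow 6)).div (hB.pow 18) (hB0 18)).const_mul _).sub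
        ((hX.pow 12).const_mul _)).add ((hX.pow 6).const_mul _)).add_const _
    have hlim := hΦ.tendsto.comp hp
    rw [hΦ0] at hlim
    refine hlim.congr' ?_
    filter_upwards [preimage_mem_comap (Ioi_mem_atTop (0 : ℝ))] with z hz
    obtain ⟨h1, h2, h3⟩ := etaSq_eq_inv_parameter (N := 3) (by norm_num) z
    have hq := norm_qParam_one_lt_one hz
    have n1 := eulerProd_ne_zero hq
    have n3 : 𝕢 36 z ≠ 0 := Periodic.qParam_ne_zero z
    push_cast at h1 h2 h3
    norm_num at h1 h2 h3
    rw [one_div] at h1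
    have n2 := etaSq_ne_zero (natCast_inv_mul_im_pos (N := 3) (by norm_num) hz)
    push_cast at n2
    rw [h1] at n2
    have n4 := (pow_ne_zero_iff two_ne_zero).1 (right_ne_zero_of_mul n2)
    change Φ (𝕢 36 z) = levelThree _ _
    rw [levelThree, divEta, etaQuot, modularForm_ofComplex_eq _ hz, h1, h2, h3]
    rw [h3] at n1
    simp only [Φ]
    field_simp
    ring

end LevelThree

/-! ### `j(τ)`, `j(5τ)` and `j(3τ)` through the Hauptmoduln -/

section Isogenies

open Filter UpperHalfPlane Function ModularForm

theorem coe_scaledPoint (n : ℕ) (hn : 0 < n) (τ : ℍ) : (scaledPoint n hn τ : ℂ) = n * τ := rfl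

theorem discriminant_eq_etaSq (τ : ℍ) : discriminant τ = etaSq τ ^ 12 := by
  rw [discriminant, etaSq, ← pow_mul]

theorem modularJ_eq_divEta (τ : ℍ) : modularJ τ = divEta (k := 4) E₄ τ ^ 3 := by
  rw [modularJ, discriminant_eq_etaSq, divEta, ofComplex_apply, div_pow, ← pow_mul]

theorem modularJ_sub_eq_divEta (τ : ℍ) : modularJ τ - 1728 = divEta (k := 6) E₆ τ ^ 2 := by
  have h := discriminant_eq_E₄_cube_sub_E₆_sq τ
  have h0 := etaSq_ne_zero τ.2
  rw [discriminant_eq_etaSq] at h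
  rw [modularJ, discriminant_eq_etaSq, divEta, ofComplex_apply, div_pow, ← pow_mul]
  change _ = E₆ τ ^ 2 / etaSq τ ^ 12
  have h1 : etaSq (τ : ℂ) ^ 12 ≠ 0 := pow_ne_zero _ h0
  rw [sub_eq_iff_eq_add, div_add' _ _ _ h1]
  congr 1
  linear_combination -1728 * h

/-- The Fricke involution on an eta quotient. -/
theorem etaQuot_fricke {N : ℕ} (hN : N ≠ 0) {z : ℂ} (hz : 0 < z.im) :
    etaQuot N z * etaQuot N (-1 / (N * z)) = N := by
  have hN' : (N : ℂ) ≠ 0 := by exact_mod_cast hN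
  have hz' : 0 < ((N : ℂ) * z).im := by
    simpa using mul_pos (Nat.cast_pos.2 hN.bot_lt) hz
  rw [etaQuot_neg_one_div hN hz', etaQuot, etaQuot, inv_mul_cancel_left₀ hN']
  have := etaSq_ne_zero hz
  have := etaSq_ne_zero hz'
  field_simp

theorem etaQuot_ne_zero {N : ℕ} (hN : N ≠ 0) {z : ℂ} (hz : 0 < z.im) : etaQuot N z ≠ 0 :=
  div_ne_zero (etaSq_ne_zero hz) (etaSq_ne_zero (by
    simpa using mul_pos (Nat.cast_pos.2 hN.bot_lt) hz))

/-- The parametrisation of `(j(τ), j(5τ))` by the Hauptmodul of level five. -/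
theorem modularJ_five_mul (τ : ℍ) :
    modularJ τ * (etaQuot 5 τ ^ 3) ^ 5 =
        ((etaQuot 5 τ ^ 3) ^ 2 + 250 * etaQuot 5 τ ^ 3 + 3125) ^ 3 ∧
      modularJ (scaledPoint 5 (by norm_num) τ) * etaQuot 5 τ ^ 3 =
        ((etaQuot 5 τ ^ 3) ^ 2 + 10 * etaQuot 5 τ ^ 3 + 5) ^ 3 := by
  have h1 := levelFive_eq_zero τ.2
  -- The second formula is the first at `-1/(5τ)`, where `j` has its value at `5τ` and the Fricke
  -- involution replaces `r` by `5/r`.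
  have h2 := levelFive_eq_zero (neg_one_div_im_pos (scaledPoint 5 (by norm_num) τ).2)
  have h3 := etaQuot_fricke (N := 5) (by norm_num) τ.2
  have h4 := etaQuot_ne_zero (N := 5) (by norm_num) τ.2
  rw [modularJ_eq_divEta, modularJ_eq_divEta]
  rw [divEta_four_neg_one_div (scaledPoint 5 (by norm_num) τ).2] at h2
  generalize divEta (k := 4) E₄ (scaledPoint 5 (by norm_num) τ) = f' at *
  rw [coe_scaledPoint] at h2
  push_cast at h2 h3 h4
  have h5 : etaQuot 5 (-1 / (5 * (τ : ℂ))) = 5 / etaQuot 5 τ := by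
    rw [eq_div_iff h4, mul_comm]; exact h3
  rw [h5] at h2
  generalize etaQuot 5 τ = s at *
  generalize divEta (k := 4) E₄ τ = f at *
  rw [levelFive] at h1 h2
  have h6 : f * s ^ 5 = s ^ 6 + 250 * s ^ 3 + 3125 := by linear_combination h1
  have h7 : f' * s = s ^ 6 + 10 * s ^ 3 + 5 := by
    field_simp at h2
    linear_combination (1 / 3125) * h2
  constructor
  · calc f ^ 3 * (s ^ 3) ^ 5 = (f * s ^ 5) ^ 3 := by ring
      _ = _ := by rw [h6]; ring
  · calc f' ^ 3 * s ^ 3 = (f' * s) ^ 3 := by ring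
      _ = _ := by rw [h7]; ring

/-- The parametrisation of `(j(τ), j(3τ))` by the Hauptmodul of level three. -/
theorem modularJ_three_mul (τ : ℍ) :
    modularJ τ * (etaQuot 3 τ ^ 6) ^ 3 = (etaQuot 3 τ ^ 6 + 27) * (etaQuot 3 τ ^ 6 + 243) ^ 3 ∧
      modularJ (scaledPoint 3 (by norm_num) τ) * etaQuot 3 τ ^ 6 =
        (etaQuot 3 τ ^ 6 + 27) * (etaQuot 3 τ ^ 6 + 3) ^ 3 := by
  have h1 := levelThree_eq_zero τ.2
  have h2 := levelThree_eq_zero (neg_one_div_im_pos (scaledPoint 3 (by norm_num) τ).2)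
  have h3 := etaQuot_fricke (N := 3) (by norm_num) τ.2
  have h4 := etaQuot_ne_zero (N := 3) (by norm_num) τ.2
  have j1 := modularJ_sub_eq_divEta τ
  have j2 := modularJ_sub_eq_divEta (scaledPoint 3 (by norm_num) τ)
  have hS := divEta_neg_one_div (k := 6) E₆ (scaledPoint 3 (by norm_num) τ).2
  rw [← hS] at j2
  rw [coe_scaledPoint] at h2 j2
  push_cast at h2 h3 h4 j2
  have h5 : etaQuot 3 (-1 / (3 * (τ : ℂ))) = 3 / etaQuot 3 τ := by
    rw [eq_div_iff h4, mul_comm]; exact h3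
  rw [h5] at h2
  rw [mul_pow, ← pow_mul, show (-Complex.I) ^ (6 * 2) = (Complex.I ^ 2) ^ 6 by ring,
    Complex.I_sq] at j2
  generalize etaQuot 3 τ = s at *
  generalize divEta (k := 6) E₆ τ = f at *
  generalize divEta (k := 6) E₆ (-1 / (3 * (τ : ℂ))) = f' at *
  rw [levelThree] at h1 h2
  have h6 : f * s ^ 9 = s ^ 12 - 486 * s ^ 6 - 19683 := by linear_combination h1
  have h7 : f' * s ^ 3 = 27 - 18 * s ^ 6 - s ^ 12 := by
    field_simp at h2
    linear_combination (1 / 19683) * h2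
  constructor
  · linear_combination (s ^ 6) ^ 3 * j1 + (f * s ^ 9 + s ^ 12 - 486 * s ^ 6 - 19683) * h6
  · linear_combination s ^ 6 * j2 + (f' * s ^ 3 + 27 - 18 * s ^ 6 - s ^ 12) * h7

end Isogenies


/-! ### Negative real nomes and the value `j(15τ₀)` -/

section RealNome

open UpperHalfPlane Function ModularForm

local notation "𝕢" => Periodic.qParam

theorem ofReal_eulerProd {r : ℝ} (hr : |r| < 1) :
    ((eulerProd r : ℝ) : ℂ) = eulerProd (r : ℂ) := by
  have h := (multipliable_one_sub_pow_add (q := r) hr 0).map_tprod Complex.ofRealHom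
    Complex.continuous_ofReal
  simpa [eulerProd] using h

theorem eulerProd_real_ne_zero {r : ℝ} (hr : |r| < 1) : eulerProd r ≠ 0 := by
  have h := eulerProd_ne_zero (q := (r : ℂ)) (by rwa [Complex.norm_real])
  rw [← ofReal_eulerProd hr] at h
  exact_mod_cast h

theorem continuousOn_eulerProd_real : ContinuousOn (eulerProd : ℝ → ℝ) (Set.Ioo (-1) 1) := by
  have h : ContinuousOn (fun r : ℝ => (eulerProd (r : ℂ)).re) (Set.Ioo (-1) 1) := by
    refine Complex.continuous_re.comp_continuousOn
      (differentiableOn_eulerProd.continuousOn.comp Complex.continuous_ofReal.continuousOn ?_)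
    intro r hr
    rw [mem_ball_zero_iff, Complex.norm_real]
    exact abs_lt.2 hr
  refine h.congr fun r hr => ?_
  simp only [← ofReal_eulerProd (abs_lt.2 hr), Complex.ofReal_re]

/-- Explicit truncation of the Euler product at a real argument. -/
theorem exists_eulerProd_eq_mul {r ε : ℝ} (hr : |r| < 1) (M : ℕ)
    (h : |r| ^ (M + 1) / (1 - |r|) ≤ ε) (hε : ε ≤ 1) :
    ∃ T, eulerProd r = (∏ n ∈ Finset.range M, (1 - r ^ (n + 1))) * T ∧ 1 - 2 * ε ≤ T ∧
      T ≤ 1 + 2 * ε := by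
  refine ⟨_, eulerProd_eq_prod_mul hr M, ?_⟩
  have h1 := norm_tprod_one_sub_pow_sub_one_le (q := r) hr M
  rw [Real.norm_eq_abs, Real.norm_eq_abs] at h1
  have h0 : 0 ≤ |r| ^ (M + 1) / (1 - |r|) := div_nonneg (by positivity) (by linarith)
  have h2 := Real.abs_exp_sub_one_le (abs_le.2 ⟨by linarith, h.trans hε⟩)
  rw [abs_of_nonneg h0] at h2
  have h3 := abs_le.1 ((h1.trans (le_abs_self _)).trans h2)
  constructor <;> linarith [h3.1, h3.2]

theorem etaQuot_eq_eulerProd (N : ℕ) {z : ℂ} :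
    etaQuot (N + 1 : ℕ) z =
      eulerProd (𝕢 1 z) ^ 2 / (𝕢 12 z ^ N * eulerProd (𝕢 1 z ^ (N + 1)) ^ 2) := by
  obtain ⟨h1, h2, -⟩ := etaSq_eq_parameter (N + 1) z
  rw [etaQuot, h1, h2, pow_succ' (𝕢 12 z), mul_assoc, mul_div_mul_left _ _ (Periodic.qParam_ne_zero z)]

theorem etaQuot_five_pow (z : ℂ) : etaQuot 5 z ^ 3 =
    eulerProd (𝕢 1 z) ^ 6 / (𝕢 1 z * eulerProd (𝕢 1 z ^ 5) ^ 6) := by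
  have h := etaQuot_eq_eulerProd 4 (z := z)
  push_cast at h
  rw [h, div_pow, mul_pow, ← pow_mul, ← pow_mul, ← pow_mul, (etaSq_eq_parameter 5 z).2.2]

theorem etaQuot_three_pow (z : ℂ) : etaQuot 3 z ^ 6 =
    eulerProd (𝕢 1 z) ^ 12 / (𝕢 1 z * eulerProd (𝕢 1 z ^ 3) ^ 12) := by
  have h := etaQuot_eq_eulerProd 2 (z := z)
  push_cast at h
  rw [h, div_pow, mul_pow, ← pow_mul, ← pow_mul, ← pow_mul, (etaSq_eq_parameter 5 z).2.2]

theorem qParam_one_of_re_eq {τ : ℍ} (h : τ.re = -1 / 2) :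
    𝕢 1 τ = ((-Real.exp (-(2 * Real.pi * τ.im)) : ℝ) : ℂ) := by
  have h1 : (τ : ℂ) = -1 / 2 + τ.im * Complex.I := by
    apply Complex.ext
    · simpa using h
    · simp
  rw [Periodic.qParam, h1, Complex.ofReal_one, div_one,
    show 2 * (Real.pi : ℂ) * Complex.I * (-1 / 2 + τ.im * Complex.I) =
      -(Real.pi * Complex.I) + ((-(2 * Real.pi * τ.im) : ℝ) : ℂ) by
        push_cast; linear_combination 2 * (Real.pi : ℂ) * τ.im * Complex.I_sq,
    Complex.exp_add, Complex.exp_neg, Complex.exp_pi_mul_I]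
  push_cast
  norm_num

theorem eulerProd_bounds_small {r : ℝ} (hr : |r| ≤ 1 / 250) :
    1 - 2 / 249 ≤ eulerProd r ∧ eulerProd (r ^ 3) ≤ 1 + 1 / 1000 := by
  have h1 : |r| ^ (0 + 1) / (1 - |r|) ≤ 1 / 249 := by
    rw [div_le_iff₀ (by linarith)]; linarith
  have h3 : |r ^ 3| ≤ 1 / 10000 := by
    rw [abs_pow]
    exact (pow_le_pow_left₀ (abs_nonneg r) hr 3).trans (by norm_num)
  have h2 : |r ^ 3| ^ (0 + 1) / (1 - |r ^ 3|) ≤ 1 / 2000 := by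
    rw [div_le_iff₀ (by linarith)]; linarith
  obtain ⟨T, hT, hT1, -⟩ := exists_eulerProd_eq_mul (by linarith) 0 h1 (by norm_num)
  obtain ⟨U, hU, -, hU1⟩ := exists_eulerProd_eq_mul (r := r ^ 3) (by linarith) 0 h2 (by norm_num)
  rw [Finset.prod_range_zero, one_mul] at hT hU
  constructor <;> linarith

/-- The value of the level-three Hauptmodul is real and very negative. -/
theorem etaQuot_three_pow_eq_ofReal {r : ℝ} (hr0 : r < 0) (hr : -(1 / 250) ≤ r) {z : ℂ}
    (hz : 𝕢 1 z = r) : ∃ T : ℝ, etaQuot 3 z ^ 6 = T ∧ T ≤ -200 := by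
  have hr1 : |r| ≤ 1 / 250 := by rw [abs_of_neg hr0]; linarith
  have hr3 : |r ^ 3| < 1 := by
    rw [abs_pow]; exact pow_lt_one₀ (abs_nonneg r) (by linarith) (by norm_num)
  obtain ⟨h1, h2⟩ := eulerProd_bounds_small hr1
  refine ⟨eulerProd r ^ 12 / (r * eulerProd (r ^ 3) ^ 12), ?_, ?_⟩
  · rw [etaQuot_three_pow, hz]
    push_cast
    rw [ofReal_eulerProd (by linarith), ofReal_eulerProd hr3, Complex.ofReal_pow]
  · have h3 : 0 < eulerProd (r ^ 3) ^ 12 :=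
      (Even.pow_pos ⟨6, rfl⟩ (eulerProd_real_ne_zero hr3))
    have h6 : 0 ≤ eulerProd (r ^ 3) := by
      obtain ⟨U, hU, hU1, -⟩ := exists_eulerProd_eq_mul (r := r ^ 3) (ε := 1 / 2) hr3 0 (by
        have : |r ^ 3| ≤ 1 / 250 := by
          rw [abs_pow]
          exact (pow_le_of_le_one (abs_nonneg r) (by linarith) (by norm_num)).trans hr1
        rw [div_le_iff₀ (by linarith)]; linarith) (by norm_num)
      rw [Finset.prod_range_zero, one_mul] at hU
      linarith
    have h4 : (1 - 2 / 249 : ℝ) ^ 12 ≤ eulerProd r ^ 12 := pow_le_pow_left₀ (by norm_num) h1 12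
    have h5 : eulerProd (r ^ 3) ^ 12 ≤ (1 + 1 / 1000 : ℝ) ^ 12 := pow_le_pow_left₀ h6 h2 12
    rw [div_le_iff_of_neg (mul_neg_of_neg_of_pos hr0 h3)]
    have h7 : -200 * (r * eulerProd (r ^ 3) ^ 12) ≤ 200 * (1 / 250) * (1 + 1 / 1000 : ℝ) ^ 12 := by
      calc -200 * (r * eulerProd (r ^ 3) ^ 12) = 200 * (-r) * eulerProd (r ^ 3) ^ 12 := by ring
        _ ≤ _ := by
          gcongr
          linarith
    refine h7.trans (le_trans ?_ h4)
    norm_num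

theorem scaledPoint_fifteen (τ : ℍ) :
    scaledPoint 15 (by norm_num) τ =
      scaledPoint 3 (by norm_num) (scaledPoint 5 (by norm_num) τ) := by
  apply UpperHalfPlane.ext
  rw [coe_scaledPoint, coe_scaledPoint, coe_scaledPoint]
  push_cast
  ring

/-- By the level-three formulas at `5τ₀`, the value `-25/2` gives a quartic for the Hauptmodul `T`
there, with the rational root `-729/2`. The nome of `5τ₀` is negative real and at most `1/250` in
absolute value; hence `T ≤ -200`, where the cubic cofactor has no root. -/
theorem modularJ_fifteen_mul {τ : ℍ} (h : IsTauZero τ) :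
    modularJ (scaledPoint 15 (by norm_num) τ) = -(5 ^ 2 * 241 ^ 3) / 2 ^ 3 := by
  obtain ⟨hre, him, -, hj⟩ := h
  set y := τ.im
  have hy : 0.186 < y := by
    have := (abs_lt.1 him).1
    norm_num at this ⊢
    linarith
  let r : ℝ := -Real.exp (-(2 * Real.pi * y))
  have hr5 : r ^ 5 = -Real.exp (-(10 * Real.pi * y)) := by
    change (-Real.exp _) ^ 5 = _
    rw [Odd.neg_pow (show Odd 5 from ⟨2, rfl⟩), ← Real.exp_nat_mul]
    congr 2; push_cast; ring
  have hexp : 250 ≤ Real.exp (10 * Real.pi * y) := by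
    have h1 : (5 : ℝ) + 0.84 ≤ 10 * Real.pi * y := by
      nlinarith [Real.pi_gt_d2, mul_pos (sub_pos.2 Real.pi_gt_d2) (sub_pos.2 hy)]
    have h2 : (2.718 : ℝ) ^ 5 ≤ Real.exp 5 := by
      rw [show (5 : ℝ) = (5 : ℕ) * 1 by norm_num, Real.exp_nat_mul]
      exact pow_le_pow_left₀ (by norm_num) (by linarith [Real.exp_one_gt_d9]) 5
    have h3 := Real.add_one_le_exp (0.84 : ℝ)
    calc (250 : ℝ) ≤ 2.718 ^ 5 * (0.84 + 1) := by norm_num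
      _ ≤ Real.exp 5 * Real.exp 0.84 := by gcongr
      _ = Real.exp (5 + 0.84) := (Real.exp_add _ _).symm
      _ ≤ _ := Real.exp_le_exp.2 h1
  have hq : 𝕢 1 (scaledPoint 5 (by norm_num) τ) = ((r ^ 5 : ℝ) : ℂ) := by
    rw [Complex.ofReal_pow, ← qParam_one_of_re_eq hre, qParam_pow]
    rfl
  obtain ⟨T, hT, hT200⟩ := etaQuot_three_pow_eq_ofReal (r := r ^ 5)
    (by rw [hr5]; exact neg_neg_of_pos (Real.exp_pos _))
    (by
      rw [hr5, Real.exp_neg, neg_le_neg_iff, one_div]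
      exact inv_anti₀ (by norm_num) hexp) hq
  obtain ⟨h1, h2⟩ := modularJ_three_mul (scaledPoint 5 (by norm_num) τ)
  rw [hT, hj] at h1
  rw [hT, ← scaledPoint_fifteen] at h2
  have h3 : -25 / 2 * T ^ 3 = (T + 27) * (T + 243) ^ 3 := by exact_mod_cast h1
  have h4 : (2 * T + 729) * (T ^ 3 + 404 * T ^ 2 + 49572 * T + 1062882) = 0 := by
    linear_combination -2 * h3
  have h5 : T ^ 3 + 404 * T ^ 2 + 49572 * T + 1062882 < 0 := by
    nlinarith [mul_nonneg (show 0 ≤ -T by linarith) (sq_nonneg (T + 202))]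
  have h6 : T = -729 / 2 := by
    have := (mul_eq_zero.1 h4).resolve_right h5.ne
    linarith
  rw [h6] at h2
  push_cast at h2
  linear_combination (-2 / 729) * h2

end RealNome


/-! ### Existence of `τ₀` -/

section Existence

open UpperHalfPlane Function ModularForm

local notation "𝕢" => Periodic.qParam

/-- The nome of `τ₀` is close to `-0.30946`. Sixteen factors at this argument and three at its fifth
power leave relative errors of at most `8e-9` and `2e-10`, enough to decide a sign at the ends of
the bracket. -/
theorem eulerProd_bounds_left :
    1.21058405 ≤ eulerProd (-0.3094605 : ℝ) ∧ 0 ≤ eulerProd ((-0.3094605 : ℝ) ^ 5) ∧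
      eulerProd ((-0.3094605 : ℝ) ^ 5) ≤ 1.00283004 := by
  obtain ⟨T, hT, hT1, -⟩ := exists_eulerProd_eq_mul (r := -0.3094605) (ε := 4e-9)
    (by norm_num [abs_lt]) 16 (by norm_num [abs_of_pos]) (by norm_num)
  obtain ⟨U, hU, hU1, hU2⟩ := exists_eulerProd_eq_mul (r := (-0.3094605) ^ 5) (ε := 1e-10)
    (by norm_num [abs_lt]) 3 (by norm_num [abs_of_pos]) (by norm_num)
  have h1 : (1.210584066 : ℝ) ≤ ∏ n ∈ Finset.range 16, (1 - (-0.3094605 : ℝ) ^ (n + 1)) := by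
    norm_num [Finset.prod_range_succ]
  have h2 : ∏ n ∈ Finset.range 3, (1 - ((-0.3094605 : ℝ) ^ 5) ^ (n + 1)) ≤ 1.002830036 := by
    norm_num [Finset.prod_range_succ]
  have h3 : (1 : ℝ) ≤ ∏ n ∈ Finset.range 3, (1 - ((-0.3094605 : ℝ) ^ 5) ^ (n + 1)) := by
    norm_num [Finset.prod_range_succ]
  rw [hT, hU]
  refine ⟨le_trans (by norm_num) (mul_le_mul h1 hT1 (by norm_num) (by linarith)),
    mul_nonneg (by linarith) (by linarith),
    (mul_le_mul h2 hU2 (by linarith) (by norm_num)).trans (by norm_num)⟩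

theorem eulerProd_bounds_right :
    0 ≤ eulerProd (-0.309462 : ℝ) ∧ eulerProd (-0.309462 : ℝ) ≤ 1.21058458 ∧
      1.0028301 ≤ eulerProd ((-0.309462 : ℝ) ^ 5) := by
  obtain ⟨T, hT, hT1, hT2⟩ := exists_eulerProd_eq_mul (r := -0.309462) (ε := 4e-9)
    (by norm_num [abs_lt]) 16 (by norm_num [abs_of_pos]) (by norm_num)
  obtain ⟨U, hU, hU1, -⟩ := exists_eulerProd_eq_mul (r := (-0.309462) ^ 5) (ε := 1e-10)
    (by norm_num [abs_lt]) 3 (by norm_num [abs_of_pos]) (by norm_num)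
  have h1 : ∏ n ∈ Finset.range 16, (1 - (-0.309462 : ℝ) ^ (n + 1)) ≤ 1.210584561 := by
    norm_num [Finset.prod_range_succ]
  have h2 : (1.002830103 : ℝ) ≤ ∏ n ∈ Finset.range 3, (1 - ((-0.309462 : ℝ) ^ 5) ^ (n + 1)) := by
    norm_num [Finset.prod_range_succ]
  have h3 : (1 : ℝ) ≤ ∏ n ∈ Finset.range 16, (1 - (-0.309462 : ℝ) ^ (n + 1)) := by
    norm_num [Finset.prod_range_succ]
  rw [hT, hU]
  refine ⟨mul_nonneg (by linarith) (by linarith),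
    (mul_le_mul h1 hT2 (by linarith) (by norm_num)).trans (by norm_num),
    le_trans (by norm_num) (mul_le_mul h2 hU1 (by norm_num) (by linarith))⟩

/-- A negative real nome at which the level-five Hauptmodul takes the value `-10`. -/
theorem exists_nome_level_five : ∃ ρ : ℝ, 0.3094605 ≤ ρ ∧ ρ ≤ 0.309462 ∧
    eulerProd (-ρ) ^ 6 = 10 * ρ * eulerProd ((-ρ) ^ 5) ^ 6 := by
  -- At nome `-ρ` the Hauptmodul is `-E(-ρ)⁶/(ρ E((-ρ)⁵)⁶)`, with `E` Euler's product; it equals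
  -- `-10` at the zeros of `g`.
  let g : ℝ → ℝ := fun ρ => eulerProd (-ρ) ^ 6 - 10 * ρ * eulerProd ((-ρ) ^ 5) ^ 6
  have hg : ContinuousOn g (Set.Icc 0.3094605 0.309462) := by
    have h1 : ContinuousOn (fun ρ : ℝ => eulerProd (-ρ)) (Set.Icc 0.3094605 0.309462) :=
      continuousOn_eulerProd_real.comp (by fun_prop) fun ρ hρ => by
        norm_num at hρ ⊢
        constructor <;> linarith [hρ.1, hρ.2]
    have h2 : ContinuousOn (fun ρ : ℝ => eulerProd ((-ρ) ^ 5)) (Set.Icc 0.3094605 0.309462) :=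
      continuousOn_eulerProd_real.comp (by fun_prop) fun ρ hρ => by
        norm_num at hρ
        have h : |-ρ| < 1 := by rw [abs_neg, abs_lt]; constructor <;> linarith [hρ.1, hρ.2]
        exact abs_lt.1 (by rw [abs_pow]; exact pow_lt_one₀ (abs_nonneg _) h (by norm_num))
    exact (h1.pow 6).sub ((continuousOn_const.mul continuousOn_id).mul (h2.pow 6))
  have ha : 0 ≤ g 0.3094605 := by
    obtain ⟨h1, h2, h3⟩ := eulerProd_bounds_left
    have h4 := pow_le_pow_left₀ (by norm_num) h1 6
    have h5 := pow_le_pow_left₀ h2 h3 6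
    have h6 : (10 * 0.3094605 * 1.00283004 ^ 6 : ℝ) ≤ 1.21058405 ^ 6 := by norm_num
    change 0 ≤ eulerProd (-0.3094605) ^ 6 - 10 * 0.3094605 * eulerProd ((-0.3094605) ^ 5) ^ 6
    linarith
  have hb : g 0.309462 ≤ 0 := by
    obtain ⟨h1, h2, h3⟩ := eulerProd_bounds_right
    have h4 := pow_le_pow_left₀ h1 h2 6
    have h5 := pow_le_pow_left₀ (by norm_num) h3 6
    have h6 : (1.21058458 ^ 6 : ℝ) ≤ 10 * 0.309462 * 1.0028301 ^ 6 := by norm_num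
    change eulerProd (-0.309462) ^ 6 - 10 * 0.309462 * eulerProd ((-0.309462) ^ 5) ^ 6 ≤ 0
    linarith
  obtain ⟨ρ, hρ, h⟩ := intermediate_value_Icc' (by norm_num) hg ⟨hb, ha⟩
  exact ⟨ρ, hρ.1, hρ.2, sub_eq_zero.1 h⟩

/-- Half of the exponent is below one, where the Taylor bound for the exponential applies; the
result is squared. With `inv_nome_lt_exp` it converts the bracket for the nome into one for `Im τ₀`.
-/
theorem exp_lt_inv_nome : Real.exp (2 * Real.pi * 0.186675) < 1 / 0.309462 := by
  have h1 : Real.pi * 0.186675 ≤ 0.58645681 := by linarith [Real.pi_lt_d20]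
  have h2 : Real.exp 0.58645681 ≤ 1.797613 := by
    refine (Real.exp_bound' (n := 10) (by norm_num) (by norm_num) (by norm_num)).trans ?_
    norm_num [Finset.sum_range_succ, Nat.factorial]
  calc Real.exp (2 * Real.pi * 0.186675) = Real.exp (Real.pi * 0.186675) ^ 2 := by
        rw [← Real.exp_nat_mul]; congr 1; push_cast; ring
    _ ≤ 1.797613 ^ 2 :=
        pow_le_pow_left₀ (Real.exp_pos _).le ((Real.exp_le_exp.2 h1).trans h2) 2
    _ < _ := by norm_num

theorem inv_nome_lt_exp : 1 / 0.3094605 < Real.exp (2 * Real.pi * 0.186677) := by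
  have h1 : 0.58646309 ≤ Real.pi * 0.186677 := by linarith [Real.pi_gt_d20]
  have h2 : 1.797618 ≤ Real.exp 0.58646309 := by
    refine le_trans ?_ (Real.sum_le_exp_of_nonneg (by norm_num) 11)
    norm_num [Finset.sum_range_succ, Nat.factorial]
  calc (1 / 0.3094605 : ℝ) < 1.797618 ^ 2 := by norm_num
    _ ≤ Real.exp (Real.pi * 0.186677) ^ 2 :=
        pow_le_pow_left₀ (by norm_num) (h2.trans (Real.exp_le_exp.2 h1)) 2
    _ = _ := by
        rw [← Real.exp_nat_mul]; congr 1; push_cast; ring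

/-- At `t = -10` the level-five formulas give `725³/(-10⁵) = -5 · 29³/2⁵` and `5³/(-10) = -25/2`,
both prescribed values at once. -/
theorem exists_isTauZero : ∃ τ : ℍ, IsTauZero τ := by
  obtain ⟨ρ, h1, h2, h3⟩ := exists_nome_level_five
  have hρ : 0 < ρ := lt_of_lt_of_le (by norm_num) h1
  let y : ℝ := -Real.log ρ / (2 * Real.pi)
  have hy2 : 2 * Real.pi * y = -Real.log ρ := by
    simp only [y]; field_simp
  have hpi : 0 < 2 * Real.pi := by positivity
  have hexp : Real.exp (2 * Real.pi * y) = 1 / ρ := by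
    rw [hy2, Real.exp_neg, Real.exp_log hρ, one_div]
  have hlo : 0.186675 < y := by
    have : Real.exp (2 * Real.pi * 0.186675) < Real.exp (2 * Real.pi * y) := by
      rw [hexp]
      exact exp_lt_inv_nome.trans_le (one_div_le_one_div_of_le hρ h2)
    exact lt_of_mul_lt_mul_left (Real.exp_lt_exp.1 this) hpi.le
  have hhi : y < 0.186677 := by
    have : Real.exp (2 * Real.pi * y) < Real.exp (2 * Real.pi * 0.186677) := by
      rw [hexp]
      exact (one_div_le_one_div_of_le (by norm_num) h1).trans_lt inv_nome_lt_exp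
    exact lt_of_mul_lt_mul_left (Real.exp_lt_exp.1 this) hpi.le
  let τ : ℍ := ⟨⟨-1 / 2, y⟩, by change 0 < y; linarith⟩
  have hre : τ.re = -1 / 2 := rfl
  have him : τ.im = y := rfl
  have hq : 𝕢 1 τ = ((-ρ : ℝ) : ℂ) := by
    rw [qParam_one_of_re_eq hre, him, hy2, neg_neg, Real.exp_log hρ]
  have hr : |-ρ| < 1 := by rw [abs_neg, abs_of_pos hρ]; linarith
  have hr5 : |(-ρ) ^ 5| < 1 := by
    rw [abs_pow]; exact pow_lt_one₀ (abs_nonneg _) hr (by norm_num)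
  have ht : etaQuot 5 τ ^ 3 = -10 := by
    rw [etaQuot_five_pow, hq, ← Complex.ofReal_pow, ← ofReal_eulerProd hr, ← ofReal_eulerProd hr5,
      ← Complex.ofReal_pow, h3]
    have h4 : ((eulerProd ((-ρ) ^ 5) : ℝ) : ℂ) ≠ 0 := by
      exact_mod_cast eulerProd_real_ne_zero hr5
    have h5 : (ρ : ℂ) ≠ 0 := by exact_mod_cast hρ.ne'
    generalize eulerProd ((-ρ) ^ 5) = B at h4 ⊢
    push_cast
    field_simp
  obtain ⟨j1, j5⟩ := modularJ_five_mul τ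
  rw [ht] at j1 j5
  refine ⟨τ, hre, ?_, ?_, ?_⟩
  · rw [him, abs_lt]
    norm_num at hlo hhi ⊢
    constructor <;> linarith
  · linear_combination (-1 / 100000) * j1
  · linear_combination (-1 / 10) * j5

end Existence

theorem mainTheorem7 :
    -- `𝓒₂` is a curve of genus `2`, isomorphic to `𝓑/⟨(345)⟩`, and `(12)`, `(34)` induce on it two
    -- involutions `σ`, `ι` that generate a Klein four-group of automorphisms
    curveC2.IsSmoothCurveOfGenus 2 ∧
    (∃ (Φ : (bringQuotient {perm345}).carrier ≃ curveC2.carrier)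
        (σ ι : Equiv.Perm curveC2.carrier),
      FunSpace.IsIso Φ ∧ FunSpace.IsIso σ ∧ FunSpace.IsIso ι ∧
      IsKleinFour (Subgroup.closure {σ, ι}) ∧
      (∀ (s t y : ℂ) (h : s ≠ 0 ∨ t ≠ 0) (hy : y ^ 2 = sexticForm polyC2 s t),
        (∃ h' hy', σ (sexticPoint polyC2 s t y h hy) = sexticPoint polyC2 (-s - t) t y h' hy') ∧
        (∃ hy', ι (sexticPoint polyC2 s t y h hy) = sexticPoint polyC2 s t (-y) h hy')) ∧
      (∀ p : bringCurve.carrier,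
        Φ (toBringQuotient {perm345} (perm12 • p)) = σ (Φ (toBringQuotient {perm345} p)) ∧
        Φ (toBringQuotient {perm345} (perm34 • p)) = ι (Φ (toBringQuotient {perm345} p))) ∧
      -- the quotients of `𝓒₂` by the two non-hyperelliptic involutions
      (curveC2.quotient (Subgroup.zpowers σ)).Isomorphic curveE4 ∧
      (curveC2.quotient (Subgroup.zpowers (σ * ι))).Isomorphic curveE1) ∧
    -- the elliptic quotient `𝓔₄`
    (bringQuotient {perm12, perm345}).Isomorphic curveE4 ∧
    HasJInvariant curveE4 (-(5 ^ 2 * 241 ^ 3) / 2 ^ 3) ∧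
    -- the curious isomorphism
    (bringQuotient {perm12 * perm34, perm345}).Isomorphic
      (bringQuotient {perm12 * perm34, perm13_24}) ∧
    (bringQuotient {perm12 * perm34, perm13_24}).Isomorphic curveE1 ∧
    HasJInvariant curveE1 (-(5 * 29 ^ 3) / 2 ^ 5) ∧
    -- the modular description of the `j`-invariants
    (∃ τ₀ : ℍ, IsTauZero τ₀) ∧
    (∀ τ₀ : ℍ, IsTauZero τ₀ →
      HasJInvariant curveE1 (modularJ τ₀) ∧
      HasJInvariant curveE4 (modularJ (scaledPoint 15 (by norm_num) τ₀))) := by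
  have hE4 := curveE4_hasJInvariant
  have hE1 := curveE1_hasJInvariant
  obtain ⟨h1, h2, h3⟩ := curveC2_quotients
  exact ⟨CurveC2.isSmoothCurveOfGenus, h1, h2, hE4, h3.trans bringCurve.kleinQuotient_isomorphic.symm,
    bringCurve.kleinQuotient_isomorphic, hE1, exists_isTauZero,
    fun τ₀ h => ⟨h.2.2.1 ▸ hE1, modularJ_fifteen_mul h ▸ hE4⟩⟩
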